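/- Let $M$ be a smooth manifold of dimension $n=m+1\ge 2$ and $L:TM\to\mathbb R$ a regular Lagrangian: continuous, smooth off the zero section, and with $g^L_{ij}=\frac12\,\partial^2L/\partial y^i\partial y^j$ nondegenerate for $y\neq0$. Fix local coordinates $(x,y)$ of $TM$, $y\ne 0$, coming from a chart of $M$. Put $G^i=\frac14 g_L^{ij}\big(\frac{\partial^2L}{\partial y^j\partial x^k}y^k-\frac{\partial L}{\partial x^j}\big)$, $N^a_i=\partial G^a/\partial y^i$, $\mathbf e_i=\partial_{x^i}-N^a_i\partial_{y^a}$, $e_a=\partial_{y^a}$. In this frame a tangent vector $(\dot x,\dot y)$ has horizontal components $\dot x^i$ and vertical components $\dot y^a+N^a_i\dot x^i$. Let $s\in\{1,-1\}$ be an overall sign. (1) *Frames.* Let $u$ be a point of the coordinate domain and $\mathring g$ a constant matrix such that $s\,g^L(u)=A^T\mathring gA$ for some invertible $A$. Then there are smooth invertible frame coefficients $e_i^{\ a}(x,y)$ near $u$ with $s\,\partial^2L/\partial y^i\partial y^j=2\,\mathring g_{ab}\,e_i^{\ a}e_j^{\ b}$. Now let $e$ be any such frame on an open set $V$ of the coordinate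 domain, with $\mathring g$ constant, symmetric and nondegenerate. (2) *Constant curvature.* The metric $s\,g^L$ transformed by $e^{-1}$ has on $V$ the constant coefficients $\mathring g$. With respect to $(\mathbf e_i,e_a)$, the d-curvature coefficients $R^i_{\ hjk},P^i_{\ jka},S^a_{\ bcd}$ of the canonical d-connection $\mathbf D$ of the d-metric $\mathring g_{ij}\,dx^i\otimes dx^j+\mathring g_{ab}\,\mathbf e^a\otimes\mathbf e^b$, $\mathbf e^a=dy^a+N^a_idx^i$, are constant, namely zero. (3) *The hierarchy.* Let $\kappa$ be a nondegenerate Gram matrix of a basis of the $\mathring g$-orthogonal complement of a vector $P_0$ with $\mathring g(P_0,P_0)=1$. For a variable $v(l)\in\mathbb R^{m}$ put $v\cdot w=\kappa_{ab}v^aw^b$, $v\wedge w=v\otimes w-w\otimes v$, $a\rfloor(b\otimes c)=(a\cdot b)c$, $D=d/dl$, and $$\mathcal J=D+D^{-1}(v\cdot)\,v,\qquad \mathcal H=D+v\rfloor D^{-1}(v\wedge).$$ There are unique sequences of differential polynomial vectors, with potentials $p^{(k)}=D^{-1}(v\cdot e^{(k)})$ and $D^{-1}(v\wedge\varpi^{(k)})$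 that are differential polynomials without constant term, such that $$\varpi^{(0)}=v,\qquad e^{(k)}=\mathcal H(\varpi^{(k)}),\qquad \varpi^{(k+1)}=\mathcal J(e^{(k)})\qquad(k\ge0).$$ Here $e^{(0)}=v_l$, $p^{(0)}=\frac12|v|^2$, $e^{(1)}=v_{lll}+\frac32|v|^2v_l$. On differential polynomials, $\mathcal H$, $\mathcal J^{-1}$ and all $\mathcal H+c\mathcal J^{-1}$ ($c\in\mathbb R$) are Hamiltonian: their graphs are skew modulo total derivatives and closed under the Courant–Dorfman bracket (for $\mathcal J$: it is symplectic). There are Hamiltonians $H^{(k)}$, $H^{(0)}=\frac12|v|^2$, with $\varpi^{(k)}=\delta H^{(k)}/\delta v$; they are in involution, and all flows $v_\tau=e^{(k)}$ commute. (4) *The curve flows.* Let $\gamma(\tau,l)$ be smooth on an open rectangle, with values in $V$. Let $X,Y$ be the horizontal components of $\gamma_l,\gamma_\tau$, or else their vertical components, and $\mathbf D_X,\mathbf D_Y$ the covariant derivatives of $\mathbf D$ along $\gamma$ in that component. Assume that $\gamma$ is non-stretching, $\mathring g(X,X)=1$, and that the torsion component $\mathbf D_XY-\mathbf D_YX$ vanishes.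 The latter always holds for horizontal components, and for vertical components if $\gamma$ moves in a fibre. Then: * There are normal frames $F_1,\dots,F_m$ of $X$ along $\gamma$ with Gram matrix $\kappa$ that are parallel in $l$: with $\mathbf D_XX=v^aF_a$, one has $\mathbf D_XF_a=-\kappa_{ab}v^bX$. For every such frame, $Y=h_\parallel X+h_\perp^aF_a$ with $\partial_lh_\parallel=v\cdot h_\perp$, $\mathbf D_YX=\varpi^aF_a$, and the flow has the form $\varpi=\mathcal J(h_\perp)$, $v_\tau=\mathcal H(\varpi)$. * The $0$ flow $Y=X$ gives, in a suitable such frame, $v_\tau=v_l$. * The $+1$ flow is the non-stretching mKdV map $-Y=\mathbf D_X^2X+\frac32|\mathbf D_XX|^2X$; it is the case $k=0$ of the $+(k+1)$ flows $-Y=p^{(k)}X+e^{(k)a}F_a$. If $\gamma$ solves the $+(k+1)$ flow in some such frame, it does so in one for which also $-v_\tau=e^{(k+1)}$, $k=0,1,2,\dots$. * The $-1$ flow is the non-stretching wave map $\mathbf D_YX=0$. It is equivalent to $h_\perp$ lying in the kernel of $\mathcal J$, with $\mathcal J(h_\perp)=\partial_lh_\perp+h_\parallel v$, so that $\mathcal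 H\mathcal J(h_\perp)=0$; in a suitable such frame it gives $v_\tau=0$. Conversely, every smooth solution of $-v_\tau=e^{(k+1)}$ is carried locally, through any point of $V$, by a horizontal and by a vertical curve flow of this kind that solve the $+(k+1)$ map equation. -/

import Mathlib

open scoped ContDiff Manifold

noncomputable section

namespace LagrangeFlow

/-! ### Differential polynomials in the components `v 1, ..., v m` of a vector function

`X (a, j)` stands for the `j`-th derivative of `v a` with respect to `l`. -/

abbrev DiffPoly (m : ℕ) : Type := MvPolynomial (Fin m × ℕ) ℝ

abbrev DVec (m : ℕ) : Type := Fin m → DiffPoly m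

/-- The total derivative with respect to `l`. -/
def totalD (m : ℕ) : Derivation ℝ (DiffPoly m) (DiffPoly m) :=
  MvPolynomial.mkDerivation ℝ fun q => MvPolynomial.X (q.1, q.2 + 1)

/-- The `j`-th derivative of the vector variable `v`. -/
def jet (m j : ℕ) : DVec m := fun a => MvPolynomial.X (a, j)

/-- The product `P · Q` for the constant Gram matrix `κ`. -/
def dot {m : ℕ} (κ : Matrix (Fin m) (Fin m) ℝ) (P Q : DVec m) : DiffPoly m :=
  ∑ a, ∑ b, MvPolynomial.C (κ a b) * P a * Q b

/-- The skew product `P ∧ Q = P ⊗ Q - Q ⊗ P`. -/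
def wedge {m : ℕ} (P Q : DVec m) : Matrix (Fin m) (Fin m) (DiffPoly m) :=
  fun a b => P a * Q b - Q a * P b

/-- The interior product `P ⌋ W`, normalised by `P ⌋ (Q ⊗ S) = (P · Q) S`. -/
def interior {m : ℕ} (κ : Matrix (Fin m) (Fin m) ℝ) (P : DVec m)
    (W : Matrix (Fin m) (Fin m) (DiffPoly m)) : DVec m :=
  fun b => ∑ a, ∑ c, MvPolynomial.C (κ a c) * P a * W c b

/-- `ϖ = J e` for the symplectic operator `J = D + D⁻¹ (v ·) v`; the constant of integration in
`D⁻¹` is arbitrary. -/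
def IsJ {m : ℕ} (κ : Matrix (Fin m) (Fin m) ℝ) (e ϖ : DVec m) : Prop :=
  ∃ p : DiffPoly m, totalD m p = dot κ (jet m 0) e ∧
    ∀ a, ϖ a = totalD m (e a) + p * jet m 0 a

/-- `e = H ϖ` for the cosymplectic (Hamiltonian) operator `H = D + v ⌋ D⁻¹ (v ∧)`; the constant of
integration in `D⁻¹` is an arbitrary skew matrix. -/
def IsH {m : ℕ} (κ : Matrix (Fin m) (Fin m) ℝ) (ϖ e : DVec m) : Prop :=
  ∃ W : Matrix (Fin m) (Fin m) (DiffPoly m), W.transpose = -W ∧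
    (∀ a b, totalD m (W a b) = wedge (jet m 0) ϖ a b) ∧
    ∀ b, e b = totalD m (ϖ b) + interior κ (jet m 0) W b

/-- The derivation of differential polynomials along the evolutionary vector field `v_τ = e`. -/
def evol {m : ℕ} (e : DVec m) : Derivation ℝ (DiffPoly m) (DiffPoly m) :=
  MvPolynomial.mkDerivation ℝ fun q => (totalD m)^[q.2] (e q.1)

/-- The commutator of the evolutionary vector fields `P` and `Q`. -/
def bracket {m : ℕ} (P Q : DVec m) : DVec m :=
  fun a => evol P (Q a) - evol Q (P a)

/-- The Euler operator: the component `a` of the variational derivative of `∫ f dl`. -/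
def eulerOp {m : ℕ} (f : DiffPoly m) (a : Fin m) : DiffPoly m :=
  ∑ᶠ j : ℕ, ((-1 : ℝ) ^ j) • (totalD m)^[j] (MvPolynomial.pderiv (a, j) f)

/-- `ϖ = δ(∫ f dl)/δv`, where covectors and vectors are identified by `κ`. -/
def IsVarDeriv {m : ℕ} (κ : Matrix (Fin m) (Fin m) ℝ) (f : DiffPoly m) (ϖ : DVec m) : Prop :=
  ∀ b, eulerOp f b = ∑ a, MvPolynomial.C (κ a b) * ϖ a

/-- The formal adjoint of the Fréchet derivative of `P`, applied to `Q`. -/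
def adjFrechet {m : ℕ} (P Q : DVec m) : DVec m :=
  fun a => ∑ b, ∑ᶠ j : ℕ,
    ((-1 : ℝ) ^ j) • (totalD m)^[j] (MvPolynomial.pderiv (a, j) (P b) * Q b)

/-- Lie derivative of the variational one-form `∫ α · δv dl` along `e`. -/
def lieForm {m : ℕ} (e α : DVec m) : DVec m :=
  fun a => evol e (α a) + adjFrechet e α a

/-- The contraction of `e` with the exterior derivative of `∫ α · δv dl`. -/
def contrD {m : ℕ} (e α : DVec m) : DVec m :=
  fun a => evol e (α a) - adjFrechet α e a

/-- A relation `R α e` between variational one-forms `α` and evolutionary vector fields `e` is a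
(possibly nonlocal) Hamiltonian structure if it is skew with respect to `∫ α · e dl` (integrands
are taken modulo total derivatives) and is closed under the Courant-Dorfman bracket. For the graph
`e = H α` of an operator this is skew-adjointness with the Jacobi identity of the bracket
`{F, G} = ∫ δF · H δG dl`; for the graph `α = J e` it is skew-adjointness with the closedness of
the two-form `∫ e · J e' dl`. -/
def IsHamiltonianRelation {m : ℕ} (R : DVec m → DVec m → Prop) : Prop :=
  ∀ α₁ e₁ α₂ e₂, R α₁ e₁ → R α₂ e₂ →
    (∃ f : DiffPoly m, totalD m f = ∑ a, (α₁ a * e₂ a + α₂ a * e₁ a)) ∧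
    R (lieForm e₁ α₂ - contrD e₂ α₁) (bracket e₁ e₂)

/-- The one-form `∫ ϖ · δv dl` obtained from `ϖ` by lowering its index. -/
def lower {m : ℕ} (κ : Matrix (Fin m) (Fin m) ℝ) (ϖ : DVec m) : DVec m :=
  fun b => ∑ a, MvPolynomial.C (κ a b) * ϖ a

/-- The graph of `H`. -/
def relH {m : ℕ} (κ : Matrix (Fin m) (Fin m) ℝ) (α e : DVec m) : Prop :=
  ∃ ϖ, α = lower κ ϖ ∧ IsH κ ϖ e

/-- The graph of `J⁻¹`. -/
def relJ {m : ℕ} (κ : Matrix (Fin m) (Fin m) ℝ) (α e : DVec m) : Prop :=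
  ∃ ϖ, α = lower κ ϖ ∧ IsJ κ e ϖ

/-- The graph of `H + c J⁻¹`. -/
def relPencil {m : ℕ} (κ : Matrix (Fin m) (Fin m) ℝ) (c : ℝ) (α e : DVec m) : Prop :=
  ∃ ϖ e₁ e₂, α = lower κ ϖ ∧ IsH κ ϖ e₁ ∧ IsJ κ e₂ ϖ ∧ e = e₁ + c • e₂

/-- Data of a recursion scheme: covector fields `ϖ k`, vector fields `e k`, and the potentials
`p k = D⁻¹ (v · e k)` and `W k = D⁻¹ (v ∧ ϖ k)`. -/
structure HierarchyData (m : ℕ) where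
  ϖ : ℕ → DVec m
  e : ℕ → DVec m
  p : ℕ → DiffPoly m
  W : ℕ → Matrix (Fin m) (Fin m) (DiffPoly m)

/-- The hierarchy generated from `ϖ 0 = v` by `e k = H (ϖ k)` and `ϖ (k + 1) = J (e k)`, hence
`e (k + 1) = H J (e k)`; here `D⁻¹` is taken without constant terms. -/
structure IsHierarchy {m : ℕ} (κ : Matrix (Fin m) (Fin m) ℝ) (h : HierarchyData m) : Prop where
  start : h.ϖ 0 = jet m 0
  W_const : ∀ k a b, MvPolynomial.constantCoeff (h.W k a b) = 0
  W_deriv : ∀ k a b, totalD m (h.W k a b) = wedge (jet m 0) (h.ϖ k) a b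
  e_eq : ∀ k b, h.e k b = totalD m (h.ϖ k b) + interior κ (jet m 0) (h.W k) b
  p_const : ∀ k, MvPolynomial.constantCoeff (h.p k) = 0
  p_deriv : ∀ k, totalD m (h.p k) = dot κ (jet m 0) (h.e k)
  ϖ_succ : ∀ k a, h.ϖ (k + 1) a = totalD m (h.e k a) + h.p k * jet m 0 a

/-- The hierarchy consists of commuting flows that are Hamiltonian for the compatible pair
`H`, `J⁻¹`, with Hamiltonians in involution. -/
structure IsBiHamiltonianHierarchy {m : ℕ} (κ : Matrix (Fin m) (Fin m) ℝ)
    (h : HierarchyData m) : Prop where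
  hierarchy : IsHierarchy κ h
  unique : ∀ h' : HierarchyData m, IsHierarchy κ h' → h' = h
  hamiltonian_H : IsHamiltonianRelation (relH κ)
  symplectic_J : IsHamiltonianRelation (relJ κ)
  compatible : ∀ c : ℝ, IsHamiltonianRelation (relPencil κ c)
  hamiltonians : ∃ F : ℕ → DiffPoly m,
    F 0 = (1 / 2 : ℝ) • dot κ (jet m 0) (jet m 0) ∧ ∀ k, IsVarDeriv κ (F k) (h.ϖ k)
  involution : ∀ i j, ∃ f : DiffPoly m, totalD m f = dot κ (h.ϖ i) (h.e j)
  commute : ∀ i j, bracket (h.e i) (h.e j) = 0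
  first : h.e 0 = jet m 1
  first_potential : h.p 0 = (1 / 2 : ℝ) • dot κ (jet m 0) (jet m 0)
  second : ∀ a, h.e 1 a =
    jet m 3 a + (3 / 2 : ℝ) • (dot κ (jet m 0) (jet m 0) * jet m 1 a)

/-- The value at `(τ, l)` of a differential polynomial on `v`. -/
def evalJet {m : ℕ} (v : ℝ → ℝ → Fin m → ℝ) (f : DiffPoly m) (τ l : ℝ) : ℝ :=
  MvPolynomial.eval (fun q => iteratedDeriv q.2 (fun s => v τ s q.1) l) f

/-! ### Lagrange geometry in local coordinates `u = (x, y)` -/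

abbrev E (n : ℕ) : Type := EuclideanSpace ℝ (Fin n)

def dx {n : ℕ} (f : E n × E n → ℝ) (i : Fin n) (u : E n × E n) : ℝ :=
  fderiv ℝ f u (EuclideanSpace.single i 1, 0)

def dy {n : ℕ} (f : E n × E n → ℝ) (a : Fin n) (u : E n × E n) : ℝ :=
  fderiv ℝ f u (0, EuclideanSpace.single a 1)

/-- `g_{ij} = (1/2) ∂²L/∂y^i∂y^j`. -/
def lagrangeMetric {n : ℕ} (L : E n × E n → ℝ) (u : E n × E n) : Matrix (Fin n) (Fin n) ℝ :=
  fun i j => (1 / 2) * dy (dy L j) i u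

/-- The semispray coefficients
`G^i = (1/4) g^{ij} (∂²L/∂y^j∂x^k y^k - ∂L/∂x^j)`. -/
def semispray {n : ℕ} (L : E n × E n → ℝ) (i : Fin n) (u : E n × E n) : ℝ :=
  (1 / 4) * ∑ j, (lagrangeMetric L u)⁻¹ i j * ((∑ k, dx (dy L j) k u * u.2 k) - dx L j u)

/-- The canonical N-connection `N^a_i = ∂G^a/∂y^i`. -/
def nConnection {n : ℕ} (L : E n × E n → ℝ) (a i : Fin n) (u : E n × E n) : ℝ :=
  dy (semispray L a) i u

/-- The N-elongated derivative `e_k = ∂/∂x^k - N^a_k ∂/∂y^a`. -/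
def elong {n : ℕ} (N : Fin n → Fin n → E n × E n → ℝ) (k : Fin n) (f : E n × E n → ℝ)
    (u : E n × E n) : ℝ :=
  dx f k u - ∑ a, N a k u * dy f a u

/-- The coefficients `L^i_{jk}` of the canonical d-connection of the d-metric
`g_{ij} e^i ⊗ e^j + g_{ij} 𝐞^i ⊗ 𝐞^j`, where `e^i = dx^i`, `𝐞^a = dy^a + N^a_i dx^i`. -/
def connL {n : ℕ} (N : Fin n → Fin n → E n × E n → ℝ)
    (g : E n × E n → Matrix (Fin n) (Fin n) ℝ) (i j k : Fin n) (u : E n × E n) : ℝ :=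
  (1 / 2) * ∑ h, (g u)⁻¹ i h * (elong N k (fun w => g w j h) u + elong N j (fun w => g w k h) u
    - elong N h (fun w => g w j k) u)

/-- The coefficients `C^a_{bc}` of the canonical d-connection. -/
def connC {n : ℕ} (g : E n × E n → Matrix (Fin n) (Fin n) ℝ) (a b c : Fin n)
    (u : E n × E n) : ℝ :=
  (1 / 2) * ∑ h, (g u)⁻¹ a h * (dy (fun w => g w b h) c u + dy (fun w => g w c h) b u
    - dy (fun w => g w b c) h u)

/-- The curvature `Ω^a_{ij}` of the N-connection. -/
def nCurvature {n : ℕ} (N : Fin n → Fin n → E n × E n → ℝ) (a i j : Fin n)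
    (u : E n × E n) : ℝ :=
  elong N j (N a i) u - elong N i (N a j) u

/-- The d-curvature `R^i_{hjk}`. -/
def curvR {n : ℕ} (N : Fin n → Fin n → E n × E n → ℝ)
    (g : E n × E n → Matrix (Fin n) (Fin n) ℝ) (i h j k : Fin n) (u : E n × E n) : ℝ :=
  elong N k (connL N g i h j) u - elong N j (connL N g i h k) u
    + (∑ r, (connL N g r h j u * connL N g i r k u - connL N g r h k u * connL N g i r j u))
    - ∑ a, connC g i h a u * nCurvature N a k j u

/-- The d-curvature
`P^i_{jka} = e_a L^i_{jk} - D_k C^i_{ja} + C^i_{jb} T^b_{ka}`,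
`T^b_{ka} = L^b_{ak} - ∂N^b_k/∂y^a`. -/
def curvP {n : ℕ} (N : Fin n → Fin n → E n × E n → ℝ)
    (g : E n × E n → Matrix (Fin n) (Fin n) ℝ) (i j k a : Fin n) (u : E n × E n) : ℝ :=
  dy (connL N g i j k) a u
    - (elong N k (connC g i j a) u + ∑ r, (connL N g i r k u * connC g r j a u
        - connL N g r j k u * connC g i r a u - connL N g r a k u * connC g i j r u))
    + ∑ b, connC g i j b u * (connL N g b a k u - dy (N b k) a u)

/-- The d-curvature `S^a_{bcd}`. -/
def curvS {n : ℕ} (g : E n × E n → Matrix (Fin n) (Fin n) ℝ) (a b c d : Fin n)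
    (u : E n × E n) : ℝ :=
  dy (connC g a b c) d u - dy (connC g a b d) c u
    + ∑ r, (connC g r b c u * connC g a r d u - connC g r b d u * connC g a r c u)

/-! ### Frames in which the Hessian is constant -/

/-- On `V` the smooth invertible frame coefficients `e` satisfy
`s ∂²L/∂y^i∂y^j = 2 g₀_{ab} e_i^a e_j^b`, with a constant nondegenerate symmetric matrix `g₀` and
an overall sign `s`. -/
structure IsConstantHessianFrame {n : ℕ} (L : E n × E n → ℝ) (s : ℝ)
    (g₀ : Matrix (Fin n) (Fin n) ℝ) (V : Set (E n × E n))
    (e : E n × E n → Matrix (Fin n) (Fin n) ℝ) : Prop where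
  sign : s = 1 ∨ s = -1
  symm : g₀.IsSymm
  nondegenerate : g₀.det ≠ 0
  smooth : ∀ a i, ContDiffOn ℝ ∞ (fun u => e u a i) V
  invertible : ∀ u ∈ V, (e u).det ≠ 0
  hessian : ∀ u ∈ V, s • lagrangeMetric L u = (e u).transpose * g₀ * e u

/-- The frame transform of the Hessian metric by the inverse frame. -/
def deformedMetric {n : ℕ} (L : E n × E n → ℝ) (s : ℝ)
    (e : E n × E n → Matrix (Fin n) (Fin n) ℝ) (u : E n × E n) : Matrix (Fin n) (Fin n) ℝ :=
  (e u)⁻¹.transpose * (s • lagrangeMetric L u) * (e u)⁻¹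

/-! ### Surfaces swept out by curve flows -/

def rect (τ₀ τ₁ l₀ l₁ : ℝ) : Set (ℝ × ℝ) := Set.Ioo τ₀ τ₁ ×ˢ Set.Ioo l₀ l₁

/-- One component (horizontal or vertical) of a curve flow `γ(τ, l)`: the components `X`, `Y` of
`γ_l`, `γ_τ` in the N-adapted frame, the connection matrices `A = X ⌋ Γ`, `B = Y ⌋ Γ` and the
metric along the surface. -/
structure FlowComponent (n : ℕ) where
  X : ℝ → ℝ → Fin n → ℝ
  Y : ℝ → ℝ → Fin n → ℝ
  A : ℝ → ℝ → Matrix (Fin n) (Fin n) ℝ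
  B : ℝ → ℝ → Matrix (Fin n) (Fin n) ℝ
  G : ℝ → ℝ → Matrix (Fin n) (Fin n) ℝ

/-- The velocities `γ_l` and `γ_τ` in coordinates. -/
def velL {n : ℕ} (γ : ℝ → ℝ → E n × E n) (τ l : ℝ) : E n × E n := deriv (fun s => γ τ s) l

def velT {n : ℕ} (γ : ℝ → ℝ → E n × E n) (τ l : ℝ) : E n × E n := deriv (fun s => γ s l) τ

/-- The vertical components `w^a + N^a_i w^i` of a tangent vector `w` at `u`. -/
def vertPart {n : ℕ} (N : Fin n → Fin n → E n × E n → ℝ) (u w : E n × E n) : Fin n → ℝ :=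
  fun a => w.2 a + ∑ i, N a i u * w.1 i

/-- The horizontal component of a curve flow, with the connection matrices `hX ⌋ L`, `hY ⌋ L`. -/
def horizontal {n : ℕ} (N : Fin n → Fin n → E n × E n → ℝ)
    (g : E n × E n → Matrix (Fin n) (Fin n) ℝ) (γ : ℝ → ℝ → E n × E n) : FlowComponent n where
  X τ l := fun i => (velL γ τ l).1 i
  Y τ l := fun i => (velT γ τ l).1 i
  A τ l := fun i j => ∑ k, connL N g i j k (γ τ l) * (velL γ τ l).1 k
  B τ l := fun i j => ∑ k, connL N g i j k (γ τ l) * (velT γ τ l).1 k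
  G τ l := g (γ τ l)

/-- The vertical component of a curve flow, with the connection matrices `vX ⌋ C`, `vY ⌋ C`. -/
def vertical {n : ℕ} (N : Fin n → Fin n → E n × E n → ℝ)
    (g : E n × E n → Matrix (Fin n) (Fin n) ℝ) (γ : ℝ → ℝ → E n × E n) : FlowComponent n where
  X τ l := vertPart N (γ τ l) (velL γ τ l)
  Y τ l := vertPart N (γ τ l) (velT γ τ l)
  A τ l := fun a b => ∑ c, connC g a b c (γ τ l) * vertPart N (γ τ l) (velL γ τ l) c
  B τ l := fun a b => ∑ c, connC g a b c (γ τ l) * vertPart N (γ τ l) (velT γ τ l) c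
  G τ l := g (γ τ l)

namespace FlowComponent

variable {n m : ℕ} (S : FlowComponent n)

/-- The covariant derivative `D_X` of a field along the surface. -/
def covL (Z : ℝ → ℝ → Fin n → ℝ) (τ l : ℝ) : Fin n → ℝ :=
  fun i => deriv (fun s => Z τ s i) l + ∑ j, S.A τ l i j * Z τ l j

/-- The covariant derivative `D_Y` of a field along the surface. -/
def covT (Z : ℝ → ℝ → Fin n → ℝ) (τ l : ℝ) : Fin n → ℝ :=
  fun i => deriv (fun s => Z s l i) τ + ∑ j, S.B τ l i j * Z τ l j

def ip (τ l : ℝ) (z w : Fin n → ℝ) : ℝ := ∑ i, ∑ j, S.G τ l i j * z i * w j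

/-- The curves `l ↦ γ(τ, l)` are non-stretching: `X` is a unit vector. -/
def NonStretching (Q : Set (ℝ × ℝ)) : Prop := ∀ q ∈ Q, S.ip q.1 q.2 (S.X q.1 q.2) (S.X q.1 q.2) = 1

/-- The torsion `T(γ_τ, γ_l) = D_X γ_τ - D_Y γ_l` vanishes. -/
def TorsionFree (Q : Set (ℝ × ℝ)) : Prop := ∀ q ∈ Q, S.covL S.Y q.1 q.2 = S.covT S.X q.1 q.2

/-- `F 1, ..., F m` is a frame of the normal space of `X` with constant Gram matrix `κ`, parallel
along the curves, and `v` are the components of the principal normal `D_X X` in this frame. -/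
structure IsParallelFrame (Q : Set (ℝ × ℝ)) (κ : Matrix (Fin m) (Fin m) ℝ)
    (F : ℝ → ℝ → Fin m → Fin n → ℝ) (v : ℝ → ℝ → Fin m → ℝ) : Prop where
  smooth_F : ∀ a i, ContDiffOn ℝ ∞ (fun q : ℝ × ℝ => F q.1 q.2 a i) Q
  smooth_v : ∀ a, ContDiffOn ℝ ∞ (fun q : ℝ × ℝ => v q.1 q.2 a) Q
  normal : ∀ q ∈ Q, ∀ a, S.ip q.1 q.2 (S.X q.1 q.2) (F q.1 q.2 a) = 0
  gram : ∀ q ∈ Q, ∀ a b, S.ip q.1 q.2 (F q.1 q.2 a) (F q.1 q.2 b) = κ a b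
  principal : ∀ q ∈ Q, S.covL S.X q.1 q.2 = ∑ a, v q.1 q.2 a • F q.1 q.2 a
  parallel : ∀ q ∈ Q, ∀ a, S.covL (fun τ l => F τ l a) q.1 q.2 =
    -(∑ b, κ a b * v q.1 q.2 b) • S.X q.1 q.2

/-- The structure equations of the flow in the variables `v`, `h⊥`, `ϖ`: the flow vector is
`Y = h∥ X + h⊥ F`, with `D_X h∥ = v · h⊥`, and `D_Y X = ϖ F` with
`ϖ = J(h⊥) = D_X h⊥ + D_X⁻¹(v · h⊥) v`, and
`v_τ = H(ϖ) = D_X ϖ + v ⌋ Θ`, `Θ = D_X⁻¹(v ∧ ϖ)`. -/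
structure IsHamiltonianForm (Q : Set (ℝ × ℝ)) (κ : Matrix (Fin m) (Fin m) ℝ)
    (F : ℝ → ℝ → Fin m → Fin n → ℝ) (v : ℝ → ℝ → Fin m → ℝ)
    (hpar : ℝ → ℝ → ℝ) (hperp ϖ : ℝ → ℝ → Fin m → ℝ)
    (Θ : ℝ → ℝ → Matrix (Fin m) (Fin m) ℝ) : Prop where
  smooth_par : ContDiffOn ℝ ∞ (fun q : ℝ × ℝ => hpar q.1 q.2) Q
  smooth_perp : ∀ a, ContDiffOn ℝ ∞ (fun q : ℝ × ℝ => hperp q.1 q.2 a) Q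
  smooth_ϖ : ∀ a, ContDiffOn ℝ ∞ (fun q : ℝ × ℝ => ϖ q.1 q.2 a) Q
  smooth_Θ : ∀ a b, ContDiffOn ℝ ∞ (fun q : ℝ × ℝ => Θ q.1 q.2 a b) Q
  flow : ∀ q ∈ Q, S.Y q.1 q.2 =
    hpar q.1 q.2 • S.X q.1 q.2 + ∑ a, hperp q.1 q.2 a • F q.1 q.2 a
  par_eq : ∀ q ∈ Q, deriv (fun s => hpar q.1 s) q.2 =
    ∑ a, ∑ b, κ a b * v q.1 q.2 a * hperp q.1 q.2 b
  normal_flow : ∀ q ∈ Q, S.covT S.X q.1 q.2 = ∑ a, ϖ q.1 q.2 a • F q.1 q.2 a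
  ϖ_eq : ∀ q ∈ Q, ∀ a, ϖ q.1 q.2 a =
    deriv (fun s => hperp q.1 s a) q.2 + hpar q.1 q.2 * v q.1 q.2 a
  Θ_skew : ∀ q ∈ Q, (Θ q.1 q.2).transpose = -Θ q.1 q.2
  Θ_eq : ∀ q ∈ Q, ∀ a b, deriv (fun s => Θ q.1 s a b) q.2 =
    v q.1 q.2 a * ϖ q.1 q.2 b - ϖ q.1 q.2 a * v q.1 q.2 b
  v_eq : ∀ q ∈ Q, ∀ b, deriv (fun s => v s q.2 b) q.1 =
    deriv (fun s => ϖ q.1 s b) q.2 + ∑ a, ∑ c, κ a c * v q.1 q.2 a * Θ q.1 q.2 c b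

/-- The `0` flow: the convective map equation `γ_τ = γ_X`. -/
def IsConvectiveMap (Q : Set (ℝ × ℝ)) : Prop := ∀ q ∈ Q, S.Y q.1 q.2 = S.X q.1 q.2

/-- The `+1` flow: the non-stretching mKdV map equation
`-γ_τ = D_X² γ_X + (3/2) |D_X γ_X|² γ_X`. -/
def IsMKdVMap (Q : Set (ℝ × ℝ)) : Prop := ∀ q ∈ Q,
  -S.Y q.1 q.2 = S.covL (S.covL S.X) q.1 q.2 +
    ((3 / 2) * S.ip q.1 q.2 (S.covL S.X q.1 q.2) (S.covL S.X q.1 q.2)) • S.X q.1 q.2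

/-- The `-1` flow: the non-stretching wave map equation `D_Y γ_X = 0`. -/
def IsWaveMap (Q : Set (ℝ × ℝ)) : Prop := ∀ q ∈ Q, S.covT S.X q.1 q.2 = 0

/-- The `+(k+1)` flow, expressed in a parallel frame:
`-γ_τ = p⁽ᵏ⁾ γ_X + e⁽ᵏ⁾ F` with `e⁽ᵏ⁾ = (H J)ᵏ (v_l)` and `p⁽ᵏ⁾ = D_X⁻¹ (v · e⁽ᵏ⁾)`. -/
def IsHigherMap (Q : Set (ℝ × ℝ)) (h : HierarchyData m) (k : ℕ)
    (F : ℝ → ℝ → Fin m → Fin n → ℝ) (v : ℝ → ℝ → Fin m → ℝ) : Prop := ∀ q ∈ Q,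
  -S.Y q.1 q.2 = evalJet v (h.p k) q.1 q.2 • S.X q.1 q.2 +
    ∑ a, evalJet v (h.e k a) q.1 q.2 • F q.1 q.2 a

/-- What it means that the component `S` of a curve flow realises the hierarchy `h`. -/
structure RealizesHierarchy (Q : Set (ℝ × ℝ)) (κ : Matrix (Fin m) (Fin m) ℝ)
    (h : HierarchyData m) : Prop where
  frame : ∃ F v, S.IsParallelFrame Q κ F v
  structure_eq : ∀ F v, S.IsParallelFrame Q κ F v →
    ∃ hpar hperp ϖ Θ, S.IsHamiltonianForm Q κ F v hpar hperp ϖ Θ ∧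
      (S.IsWaveMap Q ↔
        ∀ q ∈ Q, ∀ a, deriv (fun s => hperp q.1 s a) q.2 + hpar q.1 q.2 * v q.1 q.2 a = 0)
  convective : S.IsConvectiveMap Q → ∃ F v, S.IsParallelFrame Q κ F v ∧
    ∀ q ∈ Q, ∀ a, deriv (fun s => v s q.2 a) q.1 = deriv (fun s => v q.1 s a) q.2
  mKdV : ∀ F v, S.IsParallelFrame Q κ F v → (S.IsMKdVMap Q ↔ S.IsHigherMap Q h 0 F v)
  higher : ∀ k F v, S.IsParallelFrame Q κ F v → S.IsHigherMap Q h k F v →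
    ∃ F' v', S.IsParallelFrame Q κ F' v' ∧ S.IsHigherMap Q h k F' v' ∧
      ∀ q ∈ Q, ∀ a, -deriv (fun s => v' s q.2 a) q.1 = evalJet v' (h.e (k + 1) a) q.1 q.2
  wave : S.IsWaveMap Q → ∃ F v, S.IsParallelFrame Q κ F v ∧
    ∀ q ∈ Q, ∀ a, deriv (fun s => v s q.2 a) q.1 = 0

end FlowComponent

/-- Every smooth solution `v` of the `k`-th evolution equation `-v_τ = e⁽ᵏ⁺¹⁾` of the hierarchy is,
locally and through every point of `V`, carried by a curve flow solving the `+(k+1)` map equation.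
Here `comp` selects the horizontal or the vertical component of a curve flow. -/
def SolutionsAreCarried {n m : ℕ} (comp : (ℝ → ℝ → E n × E n) → FlowComponent n)
    (V : Set (E n × E n)) (κ : Matrix (Fin m) (Fin m) ℝ) (h : HierarchyData m) : Prop :=
  ∀ (k : ℕ) (v : ℝ → ℝ → Fin m → ℝ) (τ₀ τ₁ l₀ l₁ : ℝ),
    (∀ a, ContDiffOn ℝ ∞ (fun q : ℝ × ℝ => v q.1 q.2 a) (rect τ₀ τ₁ l₀ l₁)) →
    (∀ q ∈ rect τ₀ τ₁ l₀ l₁, ∀ a,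
      -deriv (fun s => v s q.2 a) q.1 = evalJet v (h.e (k + 1) a) q.1 q.2) →
    ∀ q₀ ∈ rect τ₀ τ₁ l₀ l₁, ∀ u ∈ V,
      ∃ τ₂ τ₃ l₂ l₃ : ℝ, q₀ ∈ rect τ₂ τ₃ l₂ l₃ ∧ rect τ₂ τ₃ l₂ l₃ ⊆ rect τ₀ τ₁ l₀ l₁ ∧
        ∃ γ F, ContDiffOn ℝ ∞ (fun q : ℝ × ℝ => γ q.1 q.2) (rect τ₂ τ₃ l₂ l₃) ∧
          (∀ q ∈ rect τ₂ τ₃ l₂ l₃, γ q.1 q.2 ∈ V) ∧ γ q₀.1 q₀.2 = u ∧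
          (comp γ).TorsionFree (rect τ₂ τ₃ l₂ l₃) ∧ (comp γ).NonStretching (rect τ₂ τ₃ l₂ l₃) ∧
          (comp γ).IsParallelFrame (rect τ₂ τ₃ l₂ l₃) κ F v ∧
          (comp γ).IsHigherMap (rect τ₂ τ₃ l₂ l₃) h k F v

/-! ### Regular Lagrangians on a manifold -/

section Manifold

variable {n : ℕ} {M : Type*} [TopologicalSpace M] [ChartedSpace (E n) M]

/-- The coordinate expression `L(x, y)` of a function on `TM` in a chart `φ` of `M`. -/
def localLagrangian (L : TangentBundle 𝓘(ℝ, E n) M → ℝ) (φ : OpenPartialHomeomorph M (E n))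
    (u : E n × E n) : ℝ :=
  L ⟨φ.symm u.1, mfderiv 𝓘(ℝ, E n) 𝓘(ℝ, E n) φ.symm u.1 u.2⟩

/-- The coordinate domain of `TM` without its zero section. -/
def slitDomain (φ : OpenPartialHomeomorph M (E n)) : Set (E n × E n) :=
  {u | u.1 ∈ φ.target ∧ u.2 ≠ 0}

variable [IsManifold 𝓘(ℝ, E n) ∞ M]

/-- A regular Lagrangian: continuous on `TM`, smooth off the zero section, and with nondegenerate
Hessian there, in all coordinates. -/
structure IsRegularLagrangian (L : TangentBundle 𝓘(ℝ, E n) M → ℝ) : Prop where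
  continuous : Continuous L
  smooth : ContMDiffOn 𝓘(ℝ, E n).tangent 𝓘(ℝ, ℝ) ∞ L {z | z.2 ≠ 0}
  regular : ∀ φ ∈ IsManifold.maximalAtlas 𝓘(ℝ, E n) ∞ M, ∀ u ∈ slitDomain φ,
    (lagrangeMetric (localLagrangian L φ) u).det ≠ 0

end Manifold

end LagrangeFlow

end

set_option linter.unusedSectionVars false

noncomputable section

namespace LagrangeFlow

section

/-! ### Vector calculus over a commutative algebra with derivations -/

section VectorCalculus

variable {m : ℕ} {S : Type*} [CommRing S] [Algebra ℝ S]

/-! The geometry becomes flat, and the rest is the differential algebra of one unit vector field in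
a flat space. In a frame that makes the Hessian constant, the d-metric is constant on the open set
`V`. The coefficients of the canonical d-connection are built from first derivatives of the metric,
so they vanish on `V`, and the d-curvatures vanish with them. Such frames exist because, for S = s
g^L, the matrix S(u)⁻¹ S(w) is close to 1 and self-adjoint for S(u) when w is near u. It therefore
has a smooth self-adjoint square root R, and Rᵀ S(u) R = S(w) (`exists_congruence`). Covariant
derivatives along a surface in `V` reduce to partial derivatives, and vanishing torsion says Y_l =
X_τ.

The algebraic half concerns the operators H and J on differential polynomials. Skewness and closure
under the Courant-Dorfman bracket are proved by writing down potentials for everything that D⁻¹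
produces (`isHamiltonianRelation_relH`, `isHamiltonianRelation_relJ`,
`isHamiltonianRelation_relPencil`). That every step of the recursion stays polynomial is seen on
generating functions in a formal parameter z: a Riccati system for vectors α, β has a unique kind of
power series solution by iteration, without integration. With G the Gram determinant formed from α,
β and P = G^(-1/2), the series Pα, Pβ, P and -zP α∧β generate e, ϖ, the potentials p and the
bivectors W (`Generating.isHierarchy`). The variation of the density 1/(P(1 + z² α·α)) is -z δv·(Pβ)
up to a total derivative, which yields the Hamiltonians (`IsRiccati.variation`,
`Generating.exists_hamiltonians`). Involution is the Lenard-Magri argument. Since the ϖ are exact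
and in involution, the bracket of two flows is H(0), that is v contracted with a constant bivector;
as the flows have commuting linear parts, the bracket has no linear term and is zero
(`IsHierarchy.commute`).

The geometric half treats smooth functions on an open set of the plane as a ring with the commuting
derivations ∂_l, ∂_τ. If P is the matrix of a parallel frame with first column X, then P_l = P U and
P_τ = P T, where U contains v, and T contains ϖ and a normal block Θ. The compatibility of U and T,
read block by block, is v_τ = H(ϖ) with ϖ = J(h⊥) (`IsAdaptedFrame.structure_equations`). Parallel
frames come from transporting one frame by infinitesimal rotations (`exists_adaptedFrame`). The
constant of integration hidden in Θ = D⁻¹(v∧ϖ) depends on τ only and is removed by a rotation of the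
normal frame depending on τ only (`exists_rotated_frame`). The rotated frame still solves the same
map equation because the hierarchy is equivariant under isometries of κ, which follows from its
uniqueness (`IsBiHamiltonianHierarchy.equivariant`).

Conversely, a solution v gives matrices U, T with zero curvature. Frobenius' theorem gives the
frame, a closed one-form gives a position vector, and this vector is used as the x-coordinates or as
the y-coordinates of the curve flow (`exists_frame_of_solution`, `solutionsAreCarried`). The
analytic input is smooth dependence of linear differential equations on a parameter
(`exists_smooth_fundamental_pair`). -/

/-- The bilinear form of the constant Gram matrix `κ`. -/
def gdot (κ : Matrix (Fin m) (Fin m) ℝ) (x y : Fin m → S) : S :=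
  x ⬝ᵥ (κ.map (algebraMap ℝ S)).mulVec y

/-- The contraction of a vector with a bivector. -/
def gint (κ : Matrix (Fin m) (Fin m) ℝ) (x : Fin m → S) (W : Matrix (Fin m) (Fin m) S) :
    Fin m → S :=
  Matrix.vecMul (Matrix.vecMul x (κ.map (algebraMap ℝ S))) W

/-- The composition of bivectors. -/
def gcomp (κ : Matrix (Fin m) (Fin m) ℝ) (W W' : Matrix (Fin m) (Fin m) S) :
    Matrix (Fin m) (Fin m) S :=
  W * κ.map (algebraMap ℝ S) * W'

def gwedge (x y : Fin m → S) : Matrix (Fin m) (Fin m) S :=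
  Matrix.vecMulVec x y - Matrix.vecMulVec y x

/-- Componentwise derivative of a vector. -/
def dv (d : Derivation ℝ S S) (x : Fin m → S) : Fin m → S := fun a => d (x a)

/-- Componentwise derivative of a matrix. -/
def dmat (d : Derivation ℝ S S) (W : Matrix (Fin m) (Fin m) S) : Matrix (Fin m) (Fin m) S :=
  fun a b => d (W a b)

variable (κ : Matrix (Fin m) (Fin m) ℝ) (x y z : Fin m → S) (r : S)
  (W W' : Matrix (Fin m) (Fin m) S) (d : Derivation ℝ S S)

variable {κ} in
theorem map_transpose_eq (hκ : κ.IsSymm) :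
    (κ.map (algebraMap ℝ S)).transpose = κ.map (algebraMap ℝ S) := by
  rw [← Matrix.transpose_map, hκ]

theorem gdot_add_left : gdot κ (x + y) z = gdot κ x z + gdot κ y z := by simp [gdot]
theorem gdot_add_right : gdot κ x (y + z) = gdot κ x y + gdot κ x z := by
  simp [gdot, Matrix.mulVec_add]
theorem gdot_sub_left : gdot κ (x - y) z = gdot κ x z - gdot κ y z := by
  simp [gdot]
theorem gdot_sub_right : gdot κ x (y - z) = gdot κ x y - gdot κ x z := by
  simp [gdot, Matrix.mulVec_sub]
theorem gdot_smul_left : gdot κ (r • x) z = r * gdot κ x z := by simp [gdot]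
theorem gdot_smul_right : gdot κ x (r • y) = r * gdot κ x y := by
  simp [gdot, Matrix.mulVec_smul]

variable {κ} in
theorem gdot_comm (hκ : κ.IsSymm) : gdot κ x y = gdot κ y x := by
  unfold gdot
  have h : (κ.map (algebraMap ℝ S)).transpose = κ.map (algebraMap ℝ S) := map_transpose_eq hκ
  rw [Matrix.dotProduct_mulVec, ← Matrix.mulVec_transpose, h, dotProduct_comm]

theorem gint_add_left : gint κ (x + y) W = gint κ x W + gint κ y W := by
  simp [gint, Matrix.add_vecMul]
theorem gint_sub_left : gint κ (x - y) W = gint κ x W - gint κ y W := by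
  simp [gint, Matrix.sub_vecMul]
theorem gint_smul_left : gint κ (r • x) W = r • gint κ x W := by
  simp [gint, Matrix.smul_vecMul]
theorem gint_add_right : gint κ x (W + W') = gint κ x W + gint κ x W' := by
  simp [gint, Matrix.vecMul_add]
theorem gint_sub_right : gint κ x (W - W') = gint κ x W - gint κ x W' := by
  simp [gint, Matrix.vecMul_sub]
theorem gint_smul_right : gint κ x (r • W) = r • gint κ x W := by
  simp [gint, Matrix.vecMul_smul]
theorem gint_zero_right : gint κ x 0 = 0 := by simp [gint]

theorem gint_gcomp : gint κ x (gcomp κ W W') = gint κ (gint κ x W) W' := by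
  simp [gint, gcomp, Matrix.vecMul_vecMul, Matrix.mul_assoc]

theorem vecMul_vecMulVec_eq (u : Fin m → S) :
    Matrix.vecMul u (Matrix.vecMulVec x y) = (u ⬝ᵥ x) • y := by
  ext b
  simp [Matrix.vecMul, dotProduct, Matrix.vecMulVec_apply, Finset.sum_mul, mul_assoc]

theorem gint_gwedge : gint κ x (gwedge y z) = gdot κ x y • z - gdot κ x z • y := by
  simp only [gint, gwedge, gdot, Matrix.vecMul_sub, vecMul_vecMulVec_eq, Matrix.dotProduct_mulVec]

theorem gwedge_apply (a b : Fin m) : gwedge x y a b = x a * y b - y a * x b := by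
  simp [gwedge, Matrix.vecMulVec_apply]

theorem gcomp_gwedge_left (a b : Fin m) :
    gcomp κ (gwedge x y) W a b = x a * gint κ y W b - y a * gint κ x W b := by
  have h : ∀ u w : Fin m → S, Matrix.vecMulVec u w * κ.map (algebraMap ℝ S) * W =
      Matrix.vecMulVec u (gint κ w W) := by
    intro u w
    rw [Matrix.mul_assoc, Matrix.vecMulVec_mul, gint, Matrix.vecMul_vecMul]
  simp only [gcomp, gwedge, Matrix.sub_mul, h, Matrix.sub_apply, Matrix.vecMulVec_apply]

variable {κ W} in
theorem map_mulVec_of_skew (hκ : κ.IsSymm) (hW : W.transpose = -W) :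
    W.mulVec ((κ.map (algebraMap ℝ S)).mulVec x) = -gint κ x W := by
  have h : (κ.map (algebraMap ℝ S)).transpose = κ.map (algebraMap ℝ S) := map_transpose_eq hκ
  have hW' : W = -W.transpose := by rw [hW, neg_neg]
  rw [gint, hW', Matrix.neg_mulVec, Matrix.mulVec_transpose, Matrix.vecMul_neg, neg_neg]
  conv_lhs => rw [← h, Matrix.mulVec_transpose]
  rw [hW]
  simp [Matrix.vecMul_neg]

variable {κ W} in
theorem gcomp_gwedge_right (hκ : κ.IsSymm) (hW : W.transpose = -W) (a b : Fin m) :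
    gcomp κ W (gwedge x y) a b = -(gint κ x W a * y b) + gint κ y W a * x b := by
  have h : ∀ u w : Fin m → S, W * κ.map (algebraMap ℝ S) * Matrix.vecMulVec u w =
      Matrix.vecMulVec (-gint κ u W) w := by
    intro u w
    rw [Matrix.mul_vecMulVec, ← Matrix.mulVec_mulVec, map_mulVec_of_skew u hκ hW]
  simp only [gcomp, gwedge, Matrix.mul_sub, h, Matrix.sub_apply, Matrix.vecMulVec_apply,
    Pi.neg_apply]
  ring

variable {κ W} in
-- A skew bivector acts, through contraction, as an endomorphism that is skew for κ.
theorem gdot_gint (hκ : κ.IsSymm) (hW : W.transpose = -W) :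
    gdot κ (gint κ x W) y = -gdot κ x (gint κ y W) := by
  rw [gdot, gint, ← Matrix.dotProduct_mulVec, map_mulVec_of_skew y hκ hW, gdot,
    Matrix.dotProduct_mulVec]
  simp

theorem dv_add : dv d (x + y) = dv d x + dv d y := by ext a; simp [dv]
theorem dv_sub : dv d (x - y) = dv d x - dv d y := by ext a; simp [dv]
theorem dv_neg : dv d (-x) = -dv d x := by ext a; simp [dv]
theorem dv_smul : dv d (r • x) = d r • x + r • dv d x := by ext a; simp [dv]; ring

theorem deriv_dotProduct : d (x ⬝ᵥ y) = dv d x ⬝ᵥ y + x ⬝ᵥ dv d y := by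
  simp only [dotProduct, map_sum, Derivation.leibniz, ← Finset.sum_add_distrib, dv, smul_eq_mul]
  exact Finset.sum_congr rfl fun i _ => by ring

theorem dv_vecMul : dv d (Matrix.vecMul x W) = Matrix.vecMul (dv d x) W +
    Matrix.vecMul x (dmat d W) := by
  ext b
  exact deriv_dotProduct x (fun a => W a b) d

theorem dmat_algebraMap : dmat d (κ.map (algebraMap ℝ S)) = 0 := by
  ext a b; simp [dmat]

theorem dv_gint : dv d (gint κ x W) = gint κ (dv d x) W + gint κ x (dmat d W) := by
  simp only [gint, dv_vecMul, dmat_algebraMap, Matrix.vecMul_zero, add_zero]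

theorem deriv_gdot : d (gdot κ x y) = gdot κ (dv d x) y + gdot κ x (dv d y) := by
  simp only [gdot, Matrix.dotProduct_mulVec, deriv_dotProduct, dv_vecMul, dmat_algebraMap]
  simp

theorem dmat_add : dmat d (W + W') = dmat d W + dmat d W' := by ext a b; simp [dmat]
theorem dmat_sub : dmat d (W - W') = dmat d W - dmat d W' := by ext a b; simp [dmat]
theorem dmat_smul : dmat d (r • W) = d r • W + r • dmat d W := by
  ext a b; simp [dmat]; ring

theorem dmat_mul : dmat d (W * W') = dmat d W * W' + W * dmat d W' := by
  ext a b
  exact deriv_dotProduct (fun c => W a c) (fun c => W' c b) d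

theorem dmat_gcomp : dmat d (gcomp κ W W') = gcomp κ (dmat d W) W' + gcomp κ W (dmat d W') := by
  simp [gcomp, dmat_mul, dmat_algebraMap]

theorem dmat_gwedge : dmat d (gwedge x y) = gwedge (dv d x) y + gwedge x (dv d y) := by
  ext a b
  simp [dmat, dv, gwedge_apply]; ring

theorem gwedge_transpose : (gwedge x y).transpose = -gwedge x y := by
  ext a b; simp [gwedge_apply]; ring

variable {κ W W'} in
theorem gcomp_transpose (hκ : κ.IsSymm) (hW : W.transpose = -W) (hW' : W'.transpose = -W') :
    (gcomp κ W W').transpose = gcomp κ W' W := by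
  have h : (κ.map (algebraMap ℝ S)).transpose = κ.map (algebraMap ℝ S) := map_transpose_eq hκ
  simp [gcomp, Matrix.transpose_mul, hW, hW', h, Matrix.mul_assoc]

end VectorCalculus

/-! ### The operations on differential polynomials -/

section Bridge

variable {m : ℕ} (κ : Matrix (Fin m) (Fin m) ℝ)

theorem dot_eq_gdot (P Q : DVec m) : dot κ P Q = gdot κ P Q := by
  simp only [dot, gdot, dotProduct, Matrix.mulVec, Finset.mul_sum, Matrix.map_apply,
    MvPolynomial.algebraMap_eq]
  exact Finset.sum_congr rfl fun a _ => Finset.sum_congr rfl fun b _ => by ring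

theorem interior_eq_gint (P : DVec m) (W : Matrix (Fin m) (Fin m) (DiffPoly m)) :
    interior κ P W = gint κ P W := by
  ext1 b
  simp only [interior, gint, dotProduct, Matrix.vecMul, Finset.sum_mul, Matrix.map_apply,
    MvPolynomial.algebraMap_eq]
  rw [Finset.sum_comm]
  exact Finset.sum_congr rfl fun a _ => Finset.sum_congr rfl fun b _ => by ring

theorem wedge_eq_gwedge (P Q : DVec m) : wedge P Q = gwedge P Q := by
  ext a b : 2; rw [gwedge_apply]; rfl

variable {κ} in
theorem lower_eq_mulVec (hκ : κ.IsSymm) (P : DVec m) :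
    lower κ P = (κ.map (algebraMap ℝ (DiffPoly m))).mulVec P := by
  ext1 b
  simp only [lower, Matrix.mulVec, dotProduct, Matrix.map_apply, MvPolynomial.algebraMap_eq]
  exact Finset.sum_congr rfl fun a _ => by rw [hκ.apply]

variable {κ} in
theorem sum_mul_lower (hκ : κ.IsSymm) (P Q : DVec m) : ∑ a, Q a * lower κ P a = gdot κ Q P := by
  rw [lower_eq_mulVec hκ]; rfl

end Bridge

end

section

/-! ### Total derivatives and evolutionary vector fields -/

section DiffPolyBasics

open MvPolynomial

variable {m : ℕ}

@[simp] theorem totalD_X (q : Fin m × ℕ) : totalD m (X q) = X (q.1, q.2 + 1) :=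
  mkDerivation_X _ _ _

@[simp] theorem evol_X (Q : DVec m) (q : Fin m × ℕ) : evol Q (X q) = (totalD m)^[q.2] (Q q.1) :=
  mkDerivation_X _ _ _

/-- The commutator is a derivation and vanishes on the generators, since `evol` is defined on the
j-th derivative by differentiating j times. -/
theorem evol_totalD (Q : DVec m) (f : DiffPoly m) :
    evol Q (totalD m f) = totalD m (evol Q f) := by
  have h : ⁅evol Q, totalD m⁆ = 0 := derivation_ext fun q => by
    simp [Derivation.commutator_apply, Function.iterate_succ_apply']
  have h' := congrArg (fun d => d f) h
  simpa [Derivation.commutator_apply, sub_eq_zero] using h'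

theorem dv_evol_jet (Q : DVec m) : dv (evol Q) (jet m 0) = Q := by
  ext1 a; simp [dv, jet]

theorem dv_totalD_jet (j : ℕ) : dv (totalD m) (jet m j) = jet m (j + 1) := by
  ext1 a; simp [dv, jet]

theorem dv_evol_dv_totalD (Q P : DVec m) :
    dv (evol Q) (dv (totalD m) P) = dv (totalD m) (dv (evol Q) P) := by
  ext1 a; exact evol_totalD _ _

theorem dmat_evol_dmat_totalD (Q : DVec m) (W : Matrix (Fin m) (Fin m) (DiffPoly m)) :
    dmat (evol Q) (dmat (totalD m) W) = dmat (totalD m) (dmat (evol Q) W) := by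
  funext a b; exact evol_totalD _ _

/-- Compare two derivations on generators. This commutation rule is what lets the order of g be read
off from the order of its total derivative. -/
theorem pderiv_succ_totalD (a : Fin m) (j : ℕ) (f : DiffPoly m) :
    pderiv (a, j + 1) (totalD m f) = totalD m (pderiv (a, j + 1) f) + pderiv (a, j) f := by
  have h : ⁅pderiv (R := ℝ) (a, j + 1), totalD m⁆ = pderiv (a, j) := derivation_ext fun q => by
    classical
    obtain ⟨b, i⟩ := q
    rw [Derivation.commutator_apply, totalD_X, pderiv_X, pderiv_X, pderiv_X]
    have h1 : totalD m (Pi.single (M := fun _ => DiffPoly m) (a, j + 1) 1 (b, i)) = 0 := by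
      by_cases hq : (b, i) = (a, j + 1)
      · rw [hq]; simp
      · simp [Pi.single_eq_of_ne hq]
    rw [h1, sub_zero]
    by_cases hq : (b, i) = (a, j)
    · obtain ⟨rfl, rfl⟩ := Prod.ext_iff.1 hq; simp
    · rw [Pi.single_eq_of_ne hq, Pi.single_eq_of_ne]
      simpa [Prod.ext_iff] using hq
  have h' := congrArg (fun d => d f) h
  simp only [Derivation.commutator_apply] at h'
  rw [← h']; ring

/-- `f` involves only derivatives of order less than `N`. -/
def OrderLT (N : ℕ) (f : DiffPoly m) : Prop := ∀ a j, N ≤ j → pderiv (a, j) f = 0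

theorem OrderLT.mono {N N' : ℕ} {f : DiffPoly m} (h : OrderLT N f) (hN : N ≤ N') :
    OrderLT N' f := fun a j hj => h a j (hN.trans hj)

theorem exists_vars_lt (f : DiffPoly m) : ∃ N, ∀ q ∈ f.vars, q.2 < N :=
  ⟨f.vars.sup (fun q => q.2) + 1, fun _ hq =>
    Nat.lt_succ_of_le (Finset.le_sup (f := fun q : Fin m × ℕ => q.2) hq)⟩

theorem exists_orderLT (f : DiffPoly m) : ∃ N, OrderLT N f := by
  obtain ⟨N, hN⟩ := exists_vars_lt f
  exact ⟨N, fun a j hj => pderiv_eq_zero_of_notMem_vars fun h => absurd (hN _ h) (by simpa using hj)⟩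

/-- Descending induction: once the derivative of g by the variable of order j + 1 vanishes, the
commutation rule identifies its derivative by the variable of order j with a derivative of D g. -/
theorem orderLT_of_totalD {N : ℕ} {g : DiffPoly m}
    (h : ∀ a j, N ≤ j → pderiv (a, j + 1) (totalD m g) = 0) : OrderLT N g := by
  obtain ⟨M, hM⟩ := exists_orderLT g
  suffices H : ∀ k, ∀ a j, N ≤ j → M ≤ j + k → pderiv (a, j) g = 0 from
    fun a j hj => H M a j hj (by omega)
  intro k
  induction k with
  | zero => intro a j _ hj; exact hM a j hj
  | succ k ih =>
    intro a j hj hk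
    have h1 := pderiv_succ_totalD a j g
    rw [h a j hj, ih a (j + 1) (by omega) (by omega)] at h1
    simpa using h1.symm

theorem eq_C_of_pderiv_eq_zero {f : DiffPoly m} (h : ∀ q, pderiv q f = 0) :
    f = C (constantCoeff f) := by
  classical
  ext n
  rw [coeff_C]
  split_ifs with hn
  · subst hn; rfl
  · obtain ⟨q, hq⟩ : ∃ q, n q ≠ 0 := by
      by_contra! hc
      exact hn (Finsupp.ext fun q => (hc q).symm)
    have h1 := coeff_pderiv (i := q) f (n - Finsupp.single q 1)
    rw [h q, coeff_zero, tsub_add_cancel_of_le (Finsupp.single_le_iff.2 (by omega))] at h1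
    rcases mul_eq_zero.1 h1.symm with h2 | h2
    · exact h2
    · have : (0 : ℝ) < (((n - Finsupp.single q 1 : Fin m × ℕ →₀ ℕ) q : ℕ) : ℝ) + 1 := by positivity
      exact absurd h2 this.ne'

/-- The order estimate with bound 0. Hence D⁻¹ is determined by its constant term, which underlies
every uniqueness statement on potentials. -/
theorem eq_C_of_totalD_eq_zero {f : DiffPoly m} (h : totalD m f = 0) :
    f = C (constantCoeff f) :=
  eq_C_of_pderiv_eq_zero fun q =>
    orderLT_of_totalD (N := 0) (fun a j _ => by rw [h, map_zero]) q.1 q.2 (Nat.zero_le _)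

theorem eq_of_totalD_eq {f g : DiffPoly m} (h : totalD m f = totalD m g)
    (hc : constantCoeff f = constantCoeff g) : f = g := by
  have h1 := eq_C_of_totalD_eq_zero (f := f - g) (by rw [map_sub, h, sub_self])
  rw [map_sub, hc, sub_self, map_zero] at h1
  exact sub_eq_zero.1 h1

@[simp] theorem constantCoeff_totalD (f : DiffPoly m) : constantCoeff (totalD m f) = 0 := by
  induction f using MvPolynomial.induction_on with
  | C a => simp [derivation_C]
  | add p q hp hq => simp [hp, hq]
  | mul_X p q hp => simp [hp]

/-! ### Differential polynomials modulo total derivatives -/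

variable (m) in
/-- The space of total derivatives. -/
def imD : Submodule ℝ (DiffPoly m) := LinearMap.range (totalD m).toLinearMap

theorem mem_imD {f : DiffPoly m} : f ∈ imD m ↔ ∃ g, totalD m g = f := Iff.rfl

theorem totalD_mem_imD (f : DiffPoly m) : totalD m f ∈ imD m := ⟨f, rfl⟩

theorem evol_mem_imD (Q : DVec m) {f : DiffPoly m} (hf : f ∈ imD m) : evol Q f ∈ imD m := by
  obtain ⟨g, rfl⟩ := hf
  exact ⟨evol Q g, (evol_totalD Q g).symm⟩

/-- Test with the square of a variable y of higher order than f. If y² f = D g, then D g is affine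
in its highest derivative y, so its second derivative in y vanishes; but this second derivative is 2
f. -/
theorem eq_zero_of_forall_mul_mem_imD (a : Fin m) {f : DiffPoly m}
    (h : ∀ P : DiffPoly m, P * f ∈ imD m) : f = 0 := by
  obtain ⟨N, hN⟩ := exists_orderLT f
  obtain ⟨g, hg⟩ := mem_imD.1 (h (X (a, N + 1) ^ 2))
  have hf := hN.mono (Nat.le_succ N)
  have hgN : OrderLT (N + 1) g := orderLT_of_totalD fun b j hj => by
    rw [hg, pderiv_mul, hf b (j + 1) (by omega), pderiv_pow, pderiv_X_of_ne]
    · simp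
    · simp [Prod.ext_iff]; omega
  have h1 : pderiv (a, N + 1) (pderiv (a, N + 1) (totalD m g)) = 0 := by
    rw [pderiv_succ_totalD, hgN a (N + 1) le_rfl, map_zero, zero_add]
    have hc : ⁅pderiv (R := ℝ) (a, N + 1), pderiv (R := ℝ) (a, N)⁆ = 0 := derivation_ext fun q => by
      classical
      rw [Derivation.commutator_apply, pderiv_X, pderiv_X]
      simp only [Pi.single_apply]
      split_ifs <;> simp
    have h' := congrArg (fun d => d g) hc
    simp only [Derivation.commutator_apply, Derivation.coe_zero, Pi.zero_apply] at h'
    rw [sub_eq_zero.1 h', hgN a (N + 1) le_rfl, map_zero]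
  rw [hg] at h1
  simp only [pderiv_mul, pderiv_pow, pderiv_X_self, hf a (N + 1) le_rfl, mul_zero, add_zero,
    mul_one] at h1
  have h2 : pderiv (R := ℝ) (σ := Fin m × ℕ) (a, N + 1) 2 = 0 := by
    rw [show (2 : DiffPoly m) = C 2 from rfl, pderiv_C]
  simpa [pderiv_mul, hf a (N + 1) le_rfl, h2] using h1

/-- The pairing modulo total derivatives is nondegenerate, so identities between one-forms may be
proved by integration by parts against an arbitrary vector field. -/
theorem eq_of_forall_pairing {α β : DVec m}
    (h : ∀ Q : DVec m, ∑ a, Q a * α a - ∑ a, Q a * β a ∈ imD m) : α = β := by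
  ext1 a
  rw [← sub_eq_zero]
  refine eq_zero_of_forall_mul_mem_imD a fun P => ?_
  have := h (Pi.single a P)
  simpa [Pi.single_apply, mul_sub] using this

theorem mul_iterate_totalD_mem (j : ℕ) (f g : DiffPoly m) :
    f * (totalD m)^[j] g - g * ((-1 : ℝ) ^ j • (totalD m)^[j] f) ∈ imD m := by
  induction j generalizing f with
  | zero => simp [mul_comm]
  | succ j ih =>
    have h1 : f * (totalD m)^[j + 1] g + totalD m f * (totalD m)^[j] g ∈ imD m := by
      refine ⟨f * (totalD m)^[j] g, ?_⟩
      simp [Function.iterate_succ_apply', mul_comm]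
    have h2 := (imD m).sub_mem h1 (ih (totalD m f))
    convert h2 using 1
    rw [← Function.iterate_succ_apply, pow_succ]
    simp only [mul_neg, mul_one, neg_smul]
    ring

theorem derivation_sum_apply {ι : Type*} (s : Finset ι)
    (d : ι → Derivation ℝ (DiffPoly m) (DiffPoly m)) (f : DiffPoly m) :
    (∑ i ∈ s, d i) f = ∑ i ∈ s, d i f := by
  classical
  induction s using Finset.induction_on with
  | empty => simp
  | insert i s hi ih => rw [Finset.sum_insert hi, Finset.sum_insert hi, Derivation.add_apply, ih]

/-- Both sides are derivations that agree on the variables of f. The bound N makes the Fréchet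
derivative a finite sum. -/
theorem evol_eq_sum (Q : DVec m) {f : DiffPoly m} {N : ℕ} (hN : ∀ q ∈ f.vars, q.2 < N) :
    evol Q f = ∑ a, ∑ j ∈ Finset.range N, pderiv (a, j) f * (totalD m)^[j] (Q a) := by
  classical
  have h : evol Q f = (∑ a, ∑ j ∈ Finset.range N, (totalD m)^[j] (Q a) • pderiv (R := ℝ) (a, j)) f := by
    refine derivation_eq_of_forall_mem_vars fun q hq => ?_
    simp only [derivation_sum_apply, Derivation.smul_apply, evol_X,
      smul_eq_mul, pderiv_X]
    rw [Finset.sum_eq_single q.1, Finset.sum_eq_single q.2]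
    · simp
    · intro j _ hj; rw [Pi.single_eq_of_ne (fun h => hj (by rw [h])), mul_zero]
    · intro h; exact absurd (Finset.mem_range.2 (hN q hq)) h
    · intro a _ ha
      refine Finset.sum_eq_zero fun j _ => ?_
      rw [Pi.single_eq_of_ne (fun h => ha (by rw [h])), mul_zero]
    · simp
  rw [h]
  simp only [derivation_sum_apply, Derivation.smul_apply, smul_eq_mul,
    mul_comm]

theorem finsum_eq_sum_range {F : ℕ → DiffPoly m} {N : ℕ} (h : ∀ j, N ≤ j → F j = 0) :
    ∑ᶠ j, F j = ∑ j ∈ Finset.range N, F j :=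
  finsum_eq_sum_of_support_subset _ fun j hj => by
    rw [Finset.coe_range, Set.mem_Iio]
    by_contra hc
    exact hj (h j (not_lt.1 hc))

/-- Integration by parts in each term of the Fréchet derivative. With g = 1 it gives the Euler
operator, and in general the formal adjoint. -/
theorem evol_mul_sub_mem (Q : DVec m) (f g : DiffPoly m) :
    evol Q f * g - ∑ a, Q a * ∑ᶠ j : ℕ, ((-1 : ℝ) ^ j) • (totalD m)^[j] (pderiv (a, j) f * g) ∈
      imD m := by
  obtain ⟨N, hN⟩ := exists_vars_lt f
  have hz : ∀ a j, N ≤ j → pderiv (a, j) f = 0 := fun a j hj =>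
    pderiv_eq_zero_of_notMem_vars fun h => absurd (hN _ h) (by simpa using hj)
  have h1 : ∀ a, ∑ᶠ j : ℕ, ((-1 : ℝ) ^ j) • (totalD m)^[j] (pderiv (a, j) f * g) =
      ∑ j ∈ Finset.range N, ((-1 : ℝ) ^ j) • (totalD m)^[j] (pderiv (a, j) f * g) :=
    fun a => finsum_eq_sum_range fun j hj => by
      rw [hz a j hj, zero_mul, iterate_map_zero, smul_zero]
  simp only [h1, evol_eq_sum Q hN, Finset.sum_mul, Finset.mul_sum, ← Finset.sum_sub_distrib]
  refine Submodule.sum_mem _ fun a _ => Submodule.sum_mem _ fun j _ => ?_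
  have := mul_iterate_totalD_mem j (pderiv (a, j) f * g) (Q a)
  convert this using 2
  ring

theorem evol_sub_euler_mem (Q : DVec m) (f : DiffPoly m) :
    evol Q f - ∑ a, Q a * eulerOp f a ∈ imD m := by
  simpa [eulerOp] using evol_mul_sub_mem Q f 1

theorem evol_sum_sub_adjFrechet_mem (Q P A : DVec m) :
    ∑ b, evol Q (P b) * A b - ∑ a, Q a * adjFrechet P A a ∈ imD m := by
  have h : ∑ a, Q a * adjFrechet P A a = ∑ b, ∑ a, Q a * ∑ᶠ j : ℕ,
      ((-1 : ℝ) ^ j) • (totalD m)^[j] (pderiv (a, j) (P b) * A b) := by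
    rw [Finset.sum_comm]
    simp only [adjFrechet, Finset.mul_sum]
  rw [h, ← Finset.sum_sub_distrib]
  exact Submodule.sum_mem _ fun b _ => evol_mul_sub_mem Q (P b) (A b)

end DiffPolyBasics

end

section

/-! ### The invariant pairing of bivectors -/

section BivectorPairing

variable {m : ℕ} {S : Type*} [CommRing S] [Algebra ℝ S] (κ : Matrix (Fin m) (Fin m) ℝ)

/-- The pairing of bivectors. -/
def bpair (W W' : Matrix (Fin m) (Fin m) S) : S :=
  -((1 / 2 : ℝ) • (gcomp κ W W' * κ.map (algebraMap ℝ S)).trace)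

theorem bpair_comm (W W' : Matrix (Fin m) (Fin m) S) : bpair κ W W' = bpair κ W' W := by
  unfold bpair gcomp
  rw [Matrix.mul_assoc, Matrix.trace_mul_comm, ← Matrix.mul_assoc]

theorem deriv_trace (W : Matrix (Fin m) (Fin m) S) (d : Derivation ℝ S S) :
    d W.trace = (dmat d W).trace := by
  simp [Matrix.trace, dmat]

theorem deriv_bpair (W W' : Matrix (Fin m) (Fin m) S) (d : Derivation ℝ S S) :
    d (bpair κ W W') = bpair κ (dmat d W) W' + bpair κ W (dmat d W') := by
  simp only [bpair, map_neg, Derivation.map_smul, deriv_trace, dmat_mul, dmat_gcomp,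
    dmat_algebraMap, Matrix.mul_zero, add_zero, Matrix.add_mul, Matrix.trace_add, smul_add]
  ring

theorem bpair_add_right (W W' W'' : Matrix (Fin m) (Fin m) S) :
    bpair κ W (W' + W'') = bpair κ W W' + bpair κ W W'' := by
  simp only [bpair, gcomp, Matrix.mul_add, Matrix.add_mul, Matrix.trace_add, smul_add]
  ring

variable {κ} in
-- The normalisation -1/2 of the trace is chosen for this formula. Since D W = v ∧ ϖ, it makes the
-- pairing of two such W a primitive of exactly the nonlocal terms (v⌋W₁)·ϖ₂ + (v⌋W₂)·ϖ₁.
theorem bpair_gwedge_right (hκ : κ.IsSymm) (x y : Fin m → S) {W : Matrix (Fin m) (Fin m) S}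
    (hW : W.transpose = -W) : bpair κ W (gwedge x y) = gdot κ (gint κ x W) y := by
  have h : ∀ u w : Fin m → S, (W * κ.map (algebraMap ℝ S) * Matrix.vecMulVec u w *
      κ.map (algebraMap ℝ S)).trace = -gdot κ (gint κ u W) w := by
    intro u w
    rw [Matrix.mul_vecMulVec, ← Matrix.mulVec_mulVec, map_mulVec_of_skew u hκ hW,
      Matrix.vecMulVec_mul, Matrix.trace_vecMulVec, gdot]
    rw [← Matrix.mulVec_transpose, map_transpose_eq hκ, neg_dotProduct]
  rw [bpair, gcomp, gwedge, Matrix.mul_sub, Matrix.sub_mul, Matrix.trace_sub, h, h,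
    gdot_gint y x hκ hW, gdot_comm y _ hκ, ← smul_neg]
  rw [show -(-gdot κ (gint κ x W) y - - -gdot κ (gint κ x W) y) =
    (2 : ℝ) • gdot κ (gint κ x W) y by rw [two_smul]; ring, smul_smul]
  norm_num

variable {κ} in
theorem bpair_gwedge_left (hκ : κ.IsSymm) (x y : Fin m → S) {W : Matrix (Fin m) (Fin m) S}
    (hW : W.transpose = -W) : bpair κ (gwedge x y) W = gdot κ (gint κ x W) y := by
  rw [bpair_comm, bpair_gwedge_right hκ x y hW]

theorem bpair_add_left (W W' W'' : Matrix (Fin m) (Fin m) S) :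
    bpair κ (W + W') W'' = bpair κ W W'' + bpair κ W' W'' := by
  rw [bpair_comm, bpair_add_right, bpair_comm κ W'', bpair_comm κ W'']

end BivectorPairing

/-! ### The Courant-Dorfman bracket and the Hamiltonian structures -/

section Courant

variable {m : ℕ} {κ : Matrix (Fin m) (Fin m) ℝ}

theorem dv_lower (d : Derivation ℝ (DiffPoly m) (DiffPoly m)) (P : DVec m) :
    dv d (lower κ P) = lower κ (dv d P) := by
  ext1 b; simp [dv, lower, mul_comm]

theorem sum_lower_mul (hκ : κ.IsSymm) (P Q : DVec m) :
    ∑ a, lower κ P a * Q a = gdot κ P Q := by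
  rw [gdot_comm _ _ hκ, ← sum_mul_lower hκ]
  exact Finset.sum_congr rfl fun a _ => mul_comm _ _

/-- The Courant-Dorfman bracket of one-forms, computed by integration by parts. -/
theorem courant_eq_lower (hκ : κ.IsSymm) {e₁ e₂ ϖ₁ ϖ₂ η : DVec m}
    (h : ∀ Q : DVec m, gdot κ (dv (evol Q) e₁) ϖ₂ + gdot κ (dv (evol Q) ϖ₁) e₂ - gdot κ Q η ∈
      imD m) :
    lieForm e₁ (lower κ ϖ₂) - contrD e₂ (lower κ ϖ₁) =
      lower κ (dv (evol e₁) ϖ₂ - dv (evol e₂) ϖ₁ + η) := by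
  -- Both adjoint Fréchet derivatives in the bracket are moved back onto Q; what remains beside the
  -- Lie derivatives of the covectors is represented by η.
  refine eq_of_forall_pairing fun Q => ?_
  have h1 := evol_sum_sub_adjFrechet_mem Q e₁ (lower κ ϖ₂)
  have h2 := evol_sum_sub_adjFrechet_mem Q (lower κ ϖ₁) e₂
  have e1 : ∑ b, evol Q (e₁ b) * lower κ ϖ₂ b = gdot κ (dv (evol Q) e₁) ϖ₂ :=
    sum_mul_lower hκ ϖ₂ (dv (evol Q) e₁)
  have e2 : ∑ b, evol Q (lower κ ϖ₁ b) * e₂ b = gdot κ (dv (evol Q) ϖ₁) e₂ := by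
    rw [← sum_lower_mul hκ, ← dv_lower]; rfl
  rw [e1] at h1
  rw [e2] at h2
  have h3 := (imD m).sub_mem (h Q) ((imD m).add_mem h1 h2)
  rw [sum_mul_lower hκ, gdot_add_right, gdot_sub_right, ← sum_mul_lower hκ (dv _ _),
    ← sum_mul_lower hκ (dv _ _), ← dv_lower, ← dv_lower]
  convert h3 using 1
  simp only [lieForm, contrD, Pi.sub_apply, mul_sub, mul_add, Finset.sum_sub_distrib,
    Finset.sum_add_distrib, dv]
  ring

theorem bracket_eq (P Q : DVec m) : bracket P Q = dv (evol P) Q - dv (evol Q) P := rfl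

theorem isJ_iff {e ϖ : DVec m} : IsJ κ e ϖ ↔ ∃ p : DiffPoly m,
    totalD m p = gdot κ (jet m 0) e ∧ ϖ = dv (totalD m) e + p • jet m 0 := by
  simp only [IsJ, dot_eq_gdot, funext_iff]; rfl

theorem isH_iff {e ϖ : DVec m} : IsH κ ϖ e ↔ ∃ W : Matrix (Fin m) (Fin m) (DiffPoly m),
    W.transpose = -W ∧ dmat (totalD m) W = gwedge (jet m 0) ϖ ∧
      e = dv (totalD m) ϖ + gint κ (jet m 0) W := by
  simp only [IsH, interior_eq_gint, wedge_eq_gwedge, funext_iff, ← Matrix.ext_iff, dmat, dv,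
    Pi.add_apply]

theorem dmat_transpose_of_skew (d : Derivation ℝ (DiffPoly m) (DiffPoly m))
    {W : Matrix (Fin m) (Fin m) (DiffPoly m)} (hW : W.transpose = -W) :
    (dmat d W).transpose = -dmat d W := by
  ext1 a b
  have : W b a = -W a b := congrFun (congrFun hW a) b
  simp [dmat, this]

/-! #### The symplectic operator -/

/-- This computes the covector η of the Courant bracket on the graph of J. With δ = `evol Q`, the
primitive is δe₁·e₂ + p₂ δp₁: the second term absorbs the nonlocal part, because D p₂ = v·e₂ and D
δp₁ = δ(v·e₁). -/
theorem isJ_pairing (hκ : κ.IsSymm) {e₁ e₂ ϖ₁ ϖ₂ : DVec m} {p₁ p₂ : DiffPoly m}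
    (hp₁ : totalD m p₁ = gdot κ (jet m 0) e₁) (hϖ₁ : ϖ₁ = dv (totalD m) e₁ + p₁ • jet m 0)
    (hp₂ : totalD m p₂ = gdot κ (jet m 0) e₂) (hϖ₂ : ϖ₂ = dv (totalD m) e₂ + p₂ • jet m 0)
    (Q : DVec m) :
    gdot κ (dv (evol Q) e₁) ϖ₂ + gdot κ (dv (evol Q) ϖ₁) e₂ - gdot κ Q (p₁ • e₂ - p₂ • e₁) ∈
      imD m := by
  refine ⟨gdot κ (dv (evol Q) e₁) e₂ + p₂ * evol Q p₁, ?_⟩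
  have h1 : totalD m (evol Q p₁) = gdot κ Q e₁ + gdot κ (jet m 0) (dv (evol Q) e₁) := by
    rw [← evol_totalD, hp₁, deriv_gdot, dv_evol_jet]
  subst hϖ₁ hϖ₂
  simp only [Derivation.coeFn_coe, map_add, deriv_gdot, Derivation.leibniz, smul_eq_mul, h1, hp₂, dv_add, dv_smul,
    dv_evol_jet, dv_evol_dv_totalD, gdot_add_left, gdot_add_right, gdot_sub_right, gdot_smul_left,
    gdot_smul_right]
  rw [gdot_comm (dv (evol Q) e₁) (jet m 0) hκ]
  ring

/-- Skewness has the primitive e₁·e₂ + p₁ p₂. Closure holds because the bracket of two fields again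
has a polynomial potential, obtained by letting each field act on the potential of the other. -/
theorem isHamiltonianRelation_relJ (hκ : κ.IsSymm) : IsHamiltonianRelation (relJ κ) := by
  rintro _ e₁ _ e₂ ⟨ϖ₁, rfl, h₁⟩ ⟨ϖ₂, rfl, h₂⟩
  obtain ⟨p₁, hp₁, hϖ₁⟩ := isJ_iff.1 h₁
  obtain ⟨p₂, hp₂, hϖ₂⟩ := isJ_iff.1 h₂
  constructor
  · refine ⟨gdot κ e₁ e₂ + p₁ * p₂, ?_⟩
    rw [Finset.sum_add_distrib, sum_lower_mul hκ, sum_lower_mul hκ, hϖ₁, hϖ₂]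
    simp only [map_add, deriv_gdot, Derivation.leibniz, smul_eq_mul, hp₁, hp₂,
      gdot_add_left, gdot_smul_left]
    rw [gdot_comm e₁ _ hκ]
    ring
  · refine ⟨_, courant_eq_lower hκ (isJ_pairing hκ hp₁ hϖ₁ hp₂ hϖ₂), isJ_iff.2
      ⟨evol e₁ p₂ - evol e₂ p₁, ?_, ?_⟩⟩
    · rw [map_sub, ← evol_totalD, ← evol_totalD, hp₁, hp₂, bracket_eq]
      simp only [deriv_gdot, dv_evol_jet, gdot_sub_right]
      rw [gdot_comm e₁ e₂ hκ]
      ring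
    · subst hϖ₁ hϖ₂
      simp only [bracket_eq, dv_add, dv_sub, dv_smul, dv_evol_jet, dv_evol_dv_totalD]
      module

/-! #### The Hamiltonian operator -/

/-- As for J, with δ = `evol Q`: the primitive is δϖ₁·ϖ₂ plus the pairing of δW₁ with W₂, and η
consists of the terms in which δ has fallen on the explicit v. -/
theorem isH_pairing (hκ : κ.IsSymm) {e₁ e₂ ϖ₁ ϖ₂ : DVec m}
    {W₁ W₂ : Matrix (Fin m) (Fin m) (DiffPoly m)}
    (hs₁ : W₁.transpose = -W₁) (hW₁ : dmat (totalD m) W₁ = gwedge (jet m 0) ϖ₁)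
    (he₁ : e₁ = dv (totalD m) ϖ₁ + gint κ (jet m 0) W₁)
    (hs₂ : W₂.transpose = -W₂) (hW₂ : dmat (totalD m) W₂ = gwedge (jet m 0) ϖ₂)
    (he₂ : e₂ = dv (totalD m) ϖ₂ + gint κ (jet m 0) W₂) (Q : DVec m) :
    gdot κ (dv (evol Q) e₁) ϖ₂ + gdot κ (dv (evol Q) ϖ₁) e₂ -
      gdot κ Q (gint κ ϖ₁ W₂ - gint κ ϖ₂ W₁) ∈ imD m := by
  refine ⟨gdot κ (dv (evol Q) ϖ₁) ϖ₂ + bpair κ (dmat (evol Q) W₁) W₂, ?_⟩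
  have hs := dmat_transpose_of_skew (evol Q) hs₁
  have h1 : dmat (totalD m) (dmat (evol Q) W₁) = gwedge Q ϖ₁ +
      gwedge (jet m 0) (dv (evol Q) ϖ₁) := by
    rw [← dmat_evol_dmat_totalD, hW₁, dmat_gwedge, dv_evol_jet]
  subst he₁ he₂
  simp only [Derivation.coeFn_coe, map_add, deriv_gdot, deriv_bpair, h1, hW₂, bpair_gwedge_right hκ _ _ hs,
    bpair_add_left, bpair_gwedge_left hκ _ _ hs₂, dv_add, dv_gint,
    dv_evol_jet, dv_evol_dv_totalD, gdot_add_left, gdot_add_right, gdot_sub_right]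
  rw [gdot_gint Q ϖ₂ hκ hs₁, gdot_gint Q ϖ₁ hκ hs₂,
    gdot_comm (gint κ (jet m 0) W₂) _ hκ]
  ring

theorem isHamiltonianRelation_relH (hκ : κ.IsSymm) : IsHamiltonianRelation (relH κ) := by
  rintro _ e₁ _ e₂ ⟨ϖ₁, rfl, h₁⟩ ⟨ϖ₂, rfl, h₂⟩
  obtain ⟨W₁, hs₁, hW₁, he₁⟩ := isH_iff.1 h₁
  obtain ⟨W₂, hs₂, hW₂, he₂⟩ := isH_iff.1 h₂
  constructor
  · refine ⟨gdot κ ϖ₁ ϖ₂ + bpair κ W₁ W₂, ?_⟩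
    rw [Finset.sum_add_distrib, sum_lower_mul hκ, sum_lower_mul hκ, he₁, he₂]
    simp only [map_add, deriv_gdot, deriv_bpair, hW₁, hW₂, bpair_gwedge_right hκ _ _ hs₁,
      bpair_gwedge_left hκ _ _ hs₂, gdot_add_right]
    rw [gdot_comm ϖ₂ _ hκ, gdot_comm ϖ₂ _ hκ, gdot_comm ϖ₁ (gint κ _ _) hκ]
    ring
  -- The bivector of the bracket is δ₁W₂ - δ₂W₁ - ϖ₁∧ϖ₂ + [W₁, W₂]. In its derivative the wedge
  -- cancels the Dϖ parts of e₁∧ϖ₂ and e₂∧ϖ₁, and the commutator converts their (v⌋W) parts into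
  -- v∧η.
  · refine ⟨_, courant_eq_lower hκ (isH_pairing hκ hs₁ hW₁ he₁ hs₂ hW₂ he₂), isH_iff.2
      ⟨dmat (evol e₁) W₂ - dmat (evol e₂) W₁ - gwedge ϖ₁ ϖ₂ + (gcomp κ W₁ W₂ - gcomp κ W₂ W₁),
        ?_, ?_, ?_⟩⟩
    · simp only [Matrix.transpose_add, Matrix.transpose_sub, dmat_transpose_of_skew _ hs₁,
        dmat_transpose_of_skew _ hs₂, gwedge_transpose, gcomp_transpose hκ hs₁ hs₂,
        gcomp_transpose hκ hs₂ hs₁]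
      abel
    · simp only [dmat_add, dmat_sub, ← dmat_evol_dmat_totalD, hW₁, hW₂, dmat_gwedge, dmat_gcomp,
        dv_evol_jet]
      funext a b
      simp only [Matrix.add_apply, Matrix.sub_apply, gwedge_apply, gcomp_gwedge_left,
        gcomp_gwedge_right _ _ hκ hs₁, gcomp_gwedge_right _ _ hκ hs₂, Pi.add_apply, Pi.sub_apply,
        he₁, he₂]
      ring
    · have hd : ∀ x y : DVec m, gdot κ x y = gdot κ y x := fun x y => gdot_comm x y hκ
      simp only [bracket_eq, he₁, he₂, dv_add, dv_sub, dv_gint, dv_evol_jet, dv_evol_dv_totalD,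
        hW₁, hW₂, gint_gwedge, gint_add_right, gint_sub_right, gint_gcomp, gint_add_left]
      rw [hd ϖ₁ ϖ₂, hd ϖ₂ (jet m 0), hd ϖ₁ (jet m 0)]
      module

/-! #### The pencil -/

/-- Skewness and η add up. The substance is closure: the bracket of two fields a + c b, with a = Hϖ
and ϖ = J b, has mixed terms, and it must be split again into an H part and a J⁻¹ part belonging to
one and the same covector. -/
theorem isHamiltonianRelation_relPencil (hκ : κ.IsSymm) (c : ℝ) :
    IsHamiltonianRelation (relPencil κ c) := by
  rintro _ e₁ _ e₂ ⟨ϖ₁, a₁, b₁, rfl, h₁, k₁, hab₁⟩ ⟨ϖ₂, a₂, b₂, rfl, h₂, k₂, hab₂⟩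
  have hb := (isHamiltonianRelation_relH hκ _ _ _ _ ⟨ϖ₁, rfl, h₁⟩ ⟨ϖ₂, rfl, h₂⟩).1
  have hj := (isHamiltonianRelation_relJ hκ _ _ _ _ ⟨ϖ₁, rfl, k₁⟩ ⟨ϖ₂, rfl, k₂⟩).1
  obtain ⟨W₁, hs₁, hW₁, ha₁⟩ := isH_iff.1 h₁
  obtain ⟨W₂, hs₂, hW₂, ha₂⟩ := isH_iff.1 h₂
  obtain ⟨p₁, hp₁, hϖ₁⟩ := isJ_iff.1 k₁
  obtain ⟨p₂, hp₂, hϖ₂⟩ := isJ_iff.1 k₂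
  have hd : ∀ x y : DVec m, gdot κ x y = gdot κ y x := fun x y => gdot_comm x y hκ
  set r : DiffPoly m := algebraMap ℝ (DiffPoly m) c with hr
  have hrd : ∀ d : Derivation ℝ (DiffPoly m) (DiffPoly m), d r = 0 := fun d =>
    d.map_algebraMap c
  have hc : ∀ x : DVec m, c • x = r • x := fun x => (algebraMap_smul (DiffPoly m) c x).symm
  rw [hc] at hab₁ hab₂
  constructor
  · obtain ⟨f, hf⟩ := hb
    obtain ⟨g, hg⟩ := hj
    refine ⟨f + r * g, ?_⟩
    rw [map_add, Derivation.leibniz, hrd, hf, hg, hab₁, hab₂, smul_eq_mul, Finset.mul_sum]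
    simp only [smul_eq_mul, mul_zero, add_zero, ← Finset.sum_add_distrib, Pi.add_apply,
      Pi.smul_apply]
    exact Finset.sum_congr rfl fun a _ => by ring
  have hpair : ∀ Q : DVec m, gdot κ (dv (evol Q) e₁) ϖ₂ + gdot κ (dv (evol Q) ϖ₁) e₂ -
      gdot κ Q (gint κ ϖ₁ W₂ - gint κ ϖ₂ W₁ + r • (p₁ • b₂ - p₂ • b₁)) ∈ imD m := by
    intro Q
    have h1 := isH_pairing hκ hs₁ hW₁ ha₁ hs₂ hW₂ ha₂ Q
    have h2 := (imD m).smul_mem c (isJ_pairing hκ hp₁ hϖ₁ hp₂ hϖ₂ Q)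
    convert (imD m).add_mem h1 h2 using 1
    rw [Algebra.smul_def c, ← hr, hab₁, hab₂]
    simp only [dv_add, dv_smul, hrd, zero_smul, zero_add, gdot_add_left, gdot_add_right,
      gdot_smul_left, gdot_smul_right]
    ring
  -- The J⁻¹ part is the naive one, with each full field acting on the other b, corrected by p₂ϖ₁ -
  -- b₂⌋W₁ minus its mirror image. Its potential receives b₁·ϖ₂ - b₂·ϖ₁, and the bivector of the H
  -- part receives -c b₁∧b₂. The H part itself is then forced.
  refine ⟨_, _, dv (evol e₁) b₂ - dv (evol e₂) b₁ + (p₂ • ϖ₁ - gint κ b₂ W₁) -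
    (p₁ • ϖ₂ - gint κ b₁ W₂), courant_eq_lower hκ hpair, isH_iff.2
    ⟨dmat (evol e₁) W₂ - dmat (evol e₂) W₁ - gwedge ϖ₁ ϖ₂ + (gcomp κ W₁ W₂ - gcomp κ W₂ W₁) -
      r • gwedge b₁ b₂, ?_, ?_, rfl⟩, isJ_iff.2
    ⟨evol e₁ p₂ - evol e₂ p₁ - gdot κ b₂ ϖ₁ + gdot κ b₁ ϖ₂, ?_, ?_⟩, ?_⟩
  · simp only [Matrix.transpose_add, Matrix.transpose_sub, Matrix.transpose_smul,
      dmat_transpose_of_skew _ hs₁, dmat_transpose_of_skew _ hs₂, gwedge_transpose,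
      gcomp_transpose hκ hs₁ hs₂, gcomp_transpose hκ hs₂ hs₁]
    module
  · simp only [dmat_add, dmat_sub, dmat_smul, ← dmat_evol_dmat_totalD, hW₁, hW₂, dmat_gwedge,
      dmat_gcomp, dv_evol_jet, hrd]
    funext a b
    simp only [Matrix.add_apply, Matrix.sub_apply, Matrix.smul_apply, gwedge_apply,
      gcomp_gwedge_left, gcomp_gwedge_right _ _ hκ hs₁, gcomp_gwedge_right _ _ hκ hs₂,
      Pi.add_apply, Pi.sub_apply, Pi.smul_apply, hab₁, hab₂, ha₁, ha₂, smul_eq_mul]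
    simp only [hϖ₁, hϖ₂, Pi.add_apply, Pi.smul_apply, smul_eq_mul]
    ring
  · simp only [map_sub, map_add, ← evol_totalD, hp₁, hp₂, deriv_gdot, dv_evol_jet, gdot_sub_right,
      gdot_add_right, gdot_smul_right, hab₁, hab₂, ha₁, ha₂, gdot_add_left, gdot_smul_left]
    have e1 : gdot κ (gint κ (jet m 0) W₁) b₂ = -gdot κ (jet m 0) (gint κ b₂ W₁) :=
      gdot_gint _ _ hκ hs₁
    have e2 : gdot κ (gint κ (jet m 0) W₂) b₁ = -gdot κ (jet m 0) (gint κ b₁ W₂) :=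
      gdot_gint _ _ hκ hs₂
    have e3 : dv (totalD m) b₁ = ϖ₁ - p₁ • jet m 0 := by rw [hϖ₁]; module
    have e4 : dv (totalD m) b₂ = ϖ₂ - p₂ • jet m 0 := by rw [hϖ₂]; module
    rw [e1, e2, e3, e4]
    simp only [gdot_sub_left, gdot_smul_left]
    rw [hd b₂ b₁, hd b₂ (dv _ _), hd b₁ (dv _ _), hd ϖ₂ ϖ₁]
    ring
  · simp only [dv_add, dv_sub, dv_smul, dv_gint, ← dv_evol_dv_totalD,
      hp₁, hp₂, hW₁, hW₂, gint_gwedge]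
    have e3 : dv (totalD m) b₁ = ϖ₁ - p₁ • jet m 0 := by rw [hϖ₁]; module
    have e4 : dv (totalD m) b₂ = ϖ₂ - p₂ • jet m 0 := by rw [hϖ₂]; module
    simp only [e3, e4, dv_sub, dv_smul, dv_evol_jet, gint_sub_left, gint_smul_left, hab₁, hab₂,
      ha₁, ha₂]
    rw [hd b₂ (jet m 0), hd b₁ (jet m 0)]
    module
  · rw [hc]
    have e3 : dv (totalD m) b₁ = ϖ₁ - p₁ • jet m 0 := by rw [hϖ₁]; module
    have e4 : dv (totalD m) b₂ = ϖ₂ - p₂ • jet m 0 := by rw [hϖ₂]; module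
    have f₁ : ∀ d, dv d e₁ = dv d (dv (totalD m) ϖ₁) + gint κ (dv d (jet m 0)) W₁ +
        gint κ (jet m 0) (dmat d W₁) + r • dv d b₁ := by
      intro d; rw [hab₁, ha₁]; simp only [dv_add, dv_gint, dv_smul, hrd]; module
    have f₂ : ∀ d, dv d e₂ = dv d (dv (totalD m) ϖ₂) + gint κ (dv d (jet m 0)) W₂ +
        gint κ (jet m 0) (dmat d W₂) + r • dv d b₂ := by
      intro d; rw [hab₂, ha₂]; simp only [dv_add, dv_gint, dv_smul, hrd]; module
    have g₁ : gint κ e₁ W₂ = gint κ (dv (totalD m) ϖ₁) W₂ + gint κ (gint κ (jet m 0) W₁) W₂ +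
        r • gint κ b₁ W₂ := by
      rw [hab₁, ha₁]; simp only [gint_add_left, gint_smul_left]
    have g₂ : gint κ e₂ W₁ = gint κ (dv (totalD m) ϖ₂) W₁ + gint κ (gint κ (jet m 0) W₂) W₁ +
        r • gint κ b₂ W₁ := by
      rw [hab₂, ha₂]; simp only [gint_add_left, gint_smul_left]
    rw [bracket_eq, f₁, f₂]
    simp only [dv_add, dv_sub, dv_smul, dv_gint, dv_evol_dv_totalD, dv_evol_jet, hrd, g₁, g₂,
      hp₁, hp₂, hW₁, hW₂, gint_gwedge, gint_add_right, gint_sub_right, gint_smul_right, gint_gcomp,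
      e3, e4]
    rw [hd ϖ₁ ϖ₂, hd ϖ₂ (jet m 0), hd ϖ₁ (jet m 0)]
    module

end Courant

end

section

/-! ### Solutions of the zero curvature equation from a Riccati system -/

section Riccati

variable {m : ℕ} {S : Type*} [CommRing S] [Algebra ℝ S]

/-- The Riccati system that linearises the recursion, for a spectral parameter `z`. -/
structure IsRiccati (κ : Matrix (Fin m) (Fin m) ℝ) (D : Derivation ℝ S S) (z : S)
    (v α β : Fin m → S) : Prop where
  symm : κ.IsSymm
  const : D z = 0
  beta : z • dv D α = β - v - (z ^ 2 * gdot κ v α) • α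
  alpha : dv D β = α - (z * gdot κ v β) • α

/-- The Gram determinant of the plane spanned by the solutions of a Riccati system. -/
def gramDet (κ : Matrix (Fin m) (Fin m) ℝ) (z : S) (α β : Fin m → S) : S :=
  (1 + z ^ 2 * gdot κ α α) * (1 - z * gdot κ β β) + z ^ 3 * gdot κ α β ^ 2

namespace IsRiccati

variable {κ : Matrix (Fin m) (Fin m) ℝ} {D : Derivation ℝ S S} {z : S} {v α β : Fin m → S}
  (h : IsRiccati κ D z v α β)

include h

theorem gdot_dv_alpha (x : Fin m → S) : z * gdot κ (dv D α) x =
    gdot κ β x - gdot κ v x - z ^ 2 * gdot κ v α * gdot κ α x := by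
  rw [← gdot_smul_left, h.beta]
  simp only [gdot_sub_left, gdot_smul_left]

theorem gdot_dv_beta (x : Fin m → S) : gdot κ (dv D β) x =
    gdot κ α x - z * gdot κ v β * gdot κ α x := by
  rw [h.alpha]
  simp only [gdot_sub_left, gdot_smul_left]

theorem deriv_alpha_beta : z * D (gdot κ α β) = gdot κ β β - gdot κ v β -
    z ^ 2 * gdot κ v α * gdot κ α β + z * (gdot κ α α - z * gdot κ v β * gdot κ α α) := by
  rw [deriv_gdot, gdot_comm α (dv D β) h.symm]
  linear_combination h.gdot_dv_alpha β + z * h.gdot_dv_beta α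

theorem deriv_alpha_alpha : z * D (gdot κ α α) =
    2 * (gdot κ α β - gdot κ v α - z ^ 2 * gdot κ v α * gdot κ α α) := by
  rw [deriv_gdot, gdot_comm α (dv D α) h.symm, gdot_comm α β h.symm]
  linear_combination 2 * h.gdot_dv_alpha α

theorem deriv_beta_beta : D (gdot κ β β) =
    2 * (gdot κ α β - z * gdot κ v β * gdot κ α β) := by
  rw [deriv_gdot, gdot_comm β (dv D β) h.symm]
  linear_combination 2 * h.gdot_dv_beta β

/-- The determinant satisfies a scalar linear equation with logarithmic derivative -2z v·α. Its
inverse square root therefore integrates z v·α without any quadrature; this is why the potentials of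
the hierarchy are local. -/
theorem deriv_gramDet : D (gramDet κ z α β) = -2 * z * gdot κ v α * gramDet κ z α β := by
  have h1 := h.deriv_alpha_beta
  have h2 := h.deriv_alpha_alpha
  have h3 := h.deriv_beta_beta
  have hD : D (gramDet κ z α β) = z ^ 2 * D (gdot κ α α) * (1 - z * gdot κ β β) -
      (1 + z ^ 2 * gdot κ α α) * (z * D (gdot κ β β)) +
      z ^ 3 * (2 * gdot κ α β * D (gdot κ α β)) := by
    simp only [gramDet, map_add, map_sub, Derivation.leibniz, Derivation.leibniz_pow, h.const,
      Derivation.map_one_eq_zero, smul_eq_mul, nsmul_eq_mul]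
    push_cast
    ring
  rw [hD]
  unfold gramDet
  linear_combination z * (1 - z * gdot κ β β) * h2 - (1 + z ^ 2 * gdot κ α α) * z * h3 +
    2 * z ^ 2 * gdot κ α β * h1

variable {P : S} (hP : P ^ 2 * gramDet κ z α β = 1)

include hP

theorem deriv_of_sq_mul : D P = z * gdot κ v α * P := by
  have h1 := congrArg D hP
  rw [Derivation.leibniz, Derivation.leibniz_pow, h.deriv_gramDet, Derivation.map_one_eq_zero] at h1
  simp only [smul_eq_mul, nsmul_eq_mul] at h1
  push_cast at h1
  have h2 : (2 : S) * (D P - z * gdot κ v α * P) = 0 := by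
    linear_combination P * h1 + (2 * P * z * gdot κ v α - 2 * D P) * hP
  -- S need not be a domain, so the factor 2 is removed by scalar multiplication with 1/2.
  have h3 : (1 / 2 : ℝ) • ((2 : S) * (D P - z * gdot κ v α * P)) = D P - z * gdot κ v α * P := by
    rw [two_mul, ← two_smul ℝ, smul_smul]; norm_num
  rw [h2, smul_zero] at h3
  linear_combination -h3

/-- Generating form of D p = v·e: with P = 1 + z q, the coefficient of z^(k+1) is the equation for
the k-th potential. -/
theorem deriv_P : D P = z * gdot κ v (P • α) := by
  rw [h.deriv_of_sq_mul hP, gdot_smul_right]; ring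

/-- Generating form of ϖ^(k+1) = D e^(k) + p^(k) v; the coefficient of z⁰ gives ϖ^(0) = v. -/
theorem smul_dv_e : z • dv D (P • α) + P • v = P • β := by
  rw [dv_smul, h.deriv_of_sq_mul hP, smul_add, smul_comm z P, h.beta]
  module

/-- Generating form of e = Dϖ + v⌋W. -/
theorem dv_w : dv D (P • β) + gint κ v (-(z * P) • gwedge α β) = P • α := by
  rw [dv_smul, h.deriv_of_sq_mul hP, h.alpha, gint_smul_right, gint_gwedge]
  module

/-- Generating form of D W = v∧ϖ. The bivector is decomposable, being the wedge of the two Riccati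
solutions, so it needs no integration either. -/
theorem dmat_W : dmat D (-(z * P) • gwedge α β) = gwedge v (P • β) := by
  have h2 : ∀ a, z * dv D α a = β a - v a - (z ^ 2 * gdot κ v α) * α a := fun a =>
    congrFun h.beta a
  rw [dmat_smul, dmat_gwedge, h.alpha]
  funext a b
  simp only [Matrix.add_apply, Matrix.smul_apply, gwedge_apply, smul_eq_mul, Pi.sub_apply,
    Pi.smul_apply, map_neg, Derivation.leibniz, h.const, h.deriv_of_sq_mul hP]
  linear_combination (-P * β b) * h2 a + P * β a * h2 b

/-- The trace identity: the variation of the conserved density `1 / (P (1 + z² α · α))`. -/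
theorem variation {δ : Derivation ℝ S S} (hδ : δ z = 0) (hδD : ∀ x, δ (D x) = D (δ x))
    {b : S} (hb : (1 + z ^ 2 * gdot κ α α) * b = 1) :
    δ (P * gramDet κ z α β * b) + z * gdot κ (dv δ v) (P • β) =
      -(z ^ 2 * D (P * (gdot κ β (dv δ α) - z ^ 2 * gdot κ α β * gdot κ α (dv δ α) * b))) := by
  have hDP := h.deriv_of_sq_mul hP
  have hcomm : ∀ x y : Fin m → S, gdot κ x y = gdot κ y x := fun x y => gdot_comm x y h.symm
  have hab := h.deriv_alpha_beta
  have haa := h.deriv_alpha_alpha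
  have hδα : z • dv D (dv δ α) = dv δ β - dv δ v -
      (z ^ 2 * (gdot κ (dv δ v) α + gdot κ v (dv δ α))) • α -
      (z ^ 2 * gdot κ v α) • dv δ α := by
    have h1 := congrArg (dv δ) h.beta
    rw [dv_smul, hδ, dv_sub, dv_sub, dv_smul] at h1
    simp only [Derivation.leibniz, Derivation.leibniz_pow, hδ, deriv_gdot, smul_eq_mul, mul_zero,
      smul_zero, add_zero, zero_smul, zero_add] at h1
    have h2 : dv δ (dv D α) = dv D (dv δ α) := by ext1 a; exact hδD _
    rw [h2] at h1
    rw [h1]; module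
  have k1 : z * D (gdot κ β (dv δ α)) = z * (1 - z * gdot κ v β) * gdot κ α (dv δ α) +
      gdot κ β (dv δ β) - gdot κ (dv δ v) β -
      z ^ 2 * (gdot κ (dv δ v) α + gdot κ v (dv δ α)) * gdot κ α β -
      z ^ 2 * gdot κ v α * gdot κ β (dv δ α) := by
    have e1 : z * gdot κ β (dv D (dv δ α)) = gdot κ β (dv δ β) - gdot κ (dv δ v) β -
        z ^ 2 * (gdot κ (dv δ v) α + gdot κ v (dv δ α)) * gdot κ α β -
        z ^ 2 * gdot κ v α * gdot κ β (dv δ α) := by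
      rw [← gdot_smul_right, hδα]
      simp only [gdot_sub_right, gdot_smul_right]
      rw [hcomm β (dv δ v), hcomm β α]
    rw [deriv_gdot, h.gdot_dv_beta]
    linear_combination e1
  have k3 : z * D (gdot κ α (dv δ α)) = gdot κ β (dv δ α) + gdot κ α (dv δ β) -
      (gdot κ v (dv δ α) + gdot κ (dv δ v) α) * (1 + z ^ 2 * gdot κ α α) -
      2 * z ^ 2 * gdot κ v α * gdot κ α (dv δ α) := by
    have e1 : z * gdot κ α (dv D (dv δ α)) = gdot κ α (dv δ β) - gdot κ (dv δ v) α -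
        z ^ 2 * (gdot κ (dv δ v) α + gdot κ v (dv δ α)) * gdot κ α α -
        z ^ 2 * gdot κ v α * gdot κ α (dv δ α) := by
      rw [← gdot_smul_right, hδα]
      simp only [gdot_sub_right, gdot_smul_right]
      rw [hcomm α (dv δ v)]
    rw [deriv_gdot]
    linear_combination e1 + h.gdot_dv_alpha (dv δ α)
  have dinv : ∀ d : Derivation ℝ S S, d z = 0 →
      d b = -(z ^ 2 * b ^ 2 * d (gdot κ α α)) := by
    intro d hd
    have h1 := congrArg d hb
    simp only [Derivation.leibniz, Derivation.leibniz_pow, map_add, hd, smul_eq_mul, smul_zero,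
      mul_zero, add_zero, zero_add, Derivation.map_one_eq_zero] at h1
    linear_combination b * h1 - d b * hb
  have k4 : z * D b = -(2 * z ^ 2 * b ^ 2 *
      (gdot κ α β - gdot κ v α - z ^ 2 * gdot κ v α * gdot κ α α)) := by
    rw [dinv D h.const]
    linear_combination -(z ^ 2 * b ^ 2) * haa
  have hδaa : δ (gdot κ α α) = 2 * gdot κ α (dv δ α) := by
    rw [deriv_gdot, hcomm (dv δ α) α]; ring
  have hδab : δ (gdot κ α β) = gdot κ β (dv δ α) + gdot κ α (dv δ β) := by
    rw [deriv_gdot, hcomm (dv δ α) β]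
  have hδbb : δ (gdot κ β β) = 2 * gdot κ β (dv δ β) := by
    rw [deriv_gdot, hcomm (dv δ β) β]; ring
  have k5 : δ b = -(2 * z ^ 2 * b ^ 2 * gdot κ α (dv δ α)) := by
    rw [dinv δ hδ, hδaa]; ring
  have hG : gramDet κ z α β = (1 + z ^ 2 * gdot κ α α) * (1 - z * gdot κ β β) +
    z ^ 3 * gdot κ α β ^ 2 := rfl
  have hδG : δ (gramDet κ z α β) = 2 * (z ^ 2 * gdot κ α (dv δ α) * (1 - z * gdot κ β β) -
      z * (1 + z ^ 2 * gdot κ α α) * gdot κ β (dv δ β) +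
      z ^ 3 * gdot κ α β * (gdot κ β (dv δ α) + gdot κ α (dv δ β))) := by
    simp only [gramDet, map_add, map_sub, Derivation.leibniz, Derivation.leibniz_pow, hδ,
      Derivation.map_one_eq_zero, smul_eq_mul, nsmul_eq_mul, hδaa, hδab, hδbb]
    push_cast
    ring
  have hδP : δ P * gramDet κ z α β = -P * (z ^ 2 * gdot κ α (dv δ α) * (1 - z * gdot κ β β) -
      z * (1 + z ^ 2 * gdot κ α α) * gdot κ β (dv δ β) +
      z ^ 3 * gdot κ α β * (gdot κ β (dv δ α) + gdot κ α (dv δ β))) := by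
    have h1 := congrArg δ hP
    rw [Derivation.leibniz, Derivation.leibniz_pow, hδG, Derivation.map_one_eq_zero] at h1
    simp only [smul_eq_mul, nsmul_eq_mul] at h1
    push_cast at h1
    set T := z ^ 2 * gdot κ α (dv δ α) * (1 - z * gdot κ β β) -
      z * (1 + z ^ 2 * gdot κ α α) * gdot κ β (dv δ β) +
      z ^ 3 * gdot κ α β * (gdot κ β (dv δ α) + gdot κ α (dv δ β))
    have h2 : (2 : S) * (δ P * gramDet κ z α β + P * T) = 0 := by
      linear_combination P * gramDet κ z α β * h1 -
        (2 * δ P * gramDet κ z α β + 2 * P * T) * hP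
    have h3 : (1 / 2 : ℝ) • ((2 : S) * (δ P * gramDet κ z α β + P * T)) =
        δ P * gramDet κ z α β + P * T := by
      rw [two_mul, ← two_smul ℝ, smul_smul]; norm_num
    rw [h2, smul_zero] at h3
    linear_combination -h3
  -- The Riccati system controls z Dα but not Dα, so the right-hand side is arranged to contain only
  -- z times the derivatives of scalar products involving α.
  have hR : z * D (P * (gdot κ β (dv δ α) - z ^ 2 * gdot κ α β * gdot κ α (dv δ α) * b)) =
      z * (z * gdot κ v α * P) *
        (gdot κ β (dv δ α) - z ^ 2 * gdot κ α β * gdot κ α (dv δ α) * b) +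
      P * (z * D (gdot κ β (dv δ α)) - z ^ 2 * (z * D (gdot κ α β) * gdot κ α (dv δ α) * b +
        gdot κ α β * (z * D (gdot κ α (dv δ α))) * b +
        gdot κ α β * gdot κ α (dv δ α) * (z * D b))) := by
    simp only [map_sub, Derivation.leibniz, Derivation.leibniz_pow, h.const, smul_eq_mul, hDP]
    ring
  rw [k1, hab, k3, k4] at hR
  rw [Derivation.leibniz, Derivation.leibniz, k5, hδG, gdot_smul_right]
  simp only [smul_eq_mul]
  -- All derivatives are now eliminated; what is left is a polynomial identity in which the scalar
  -- products are independent symbols.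
  generalize gramDet κ z α β = G at *
  generalize gdot κ α α = aa at *
  generalize gdot κ α β = ab at *
  generalize gdot κ β β = bb at *
  generalize gdot κ α (dv δ α) = aA at *
  generalize gdot κ β (dv δ β) = bB at *
  generalize gdot κ β (dv δ α) = bA at *
  generalize gdot κ α (dv δ β) = aB at *
  generalize gdot κ v α = va at *
  generalize gdot κ v β = vb at *
  generalize gdot κ v (dv δ α) = vA at *
  generalize gdot κ (dv δ v) α = qa at *
  generalize gdot κ (dv δ v) β = qb at *
  subst hG
  -- Apart from the relations for δP and for the total derivative, the difference of both sides is a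
  -- multiple of (1 + z² α·α) b - 1; the coefficient of `hb` is the quotient.
  linear_combination b * hδP + z * hR + P * (-(z * bB) - z ^ 2 * aA * (1 + 2 * b) +
    2 * z ^ 3 * bb * aA * b + z ^ 3 * ab * (qa + vA) + z ^ 3 * aA * vb -
    2 * z ^ 5 * ab * aA * va * b) * hb

end IsRiccati

end Riccati

end

section

open PowerSeries

/-! ### Formal power series with coefficientwise derivations -/

section PowerSeriesDerivation

variable {R : Type*} [CommRing R] [Algebra ℝ R]

/-- A derivation acting on the coefficients of power series. -/
def psDeriv (d : Derivation ℝ R R) : Derivation ℝ (PowerSeries R) (PowerSeries R) :=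
  Derivation.mk'
    { toFun := fun f => PowerSeries.mk fun n => d (coeff n f)
      map_add' := fun f g => by ext n; simp
      map_smul' := fun c f => by ext n; simp }
    (fun f g => by
      ext n
      simp only [LinearMap.coe_mk, AddHom.coe_mk, coeff_mk, coeff_mul, map_sum, Derivation.leibniz,
        smul_eq_mul, map_add, Finset.sum_add_distrib]
      congr 1
      rw [← Finset.Nat.sum_antidiagonal_swap]
      rfl)

@[simp] theorem coeff_psDeriv (d : Derivation ℝ R R) (n : ℕ) (f : PowerSeries R) :
    coeff n (psDeriv d f) = d (coeff n f) := by simp [psDeriv]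

@[simp] theorem psDeriv_X (d : Derivation ℝ R R) : psDeriv d (X : PowerSeries R) = 0 := by
  ext n
  rw [coeff_psDeriv, coeff_X]
  split_ifs <;> simp

/-- A contraction of the space of tuples of power series has a fixed point. -/
theorem exists_fixedPoint {ι : Type*} (Φ : (ι → PowerSeries R) → ι → PowerSeries R)
    (hΦ : ∀ n A B, (∀ a, X ^ n ∣ A a - B a) → ∀ a, X ^ (n + 1) ∣ Φ A a - Φ B a) :
    ∃ A, Φ A = A := by
  set s : ℕ → ι → PowerSeries R := fun k => Φ^[k] 0 with hs
  have hstep : ∀ k a, X ^ k ∣ s (k + 1) a - s k a := by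
    intro k
    induction k with
    | zero => intro a; simp
    | succ k ih =>
      intro a
      have := hΦ k _ _ ih a
      simpa only [hs, ← Function.iterate_succ_apply' Φ] using this
  have hle : ∀ k j a, X ^ k ∣ s (k + j) a - s k a := by
    intro k j a
    induction j with
    | zero => simp
    | succ j ih =>
      have h1 := (pow_dvd_pow X (Nat.le_add_right k j)).trans (hstep (k + j) a)
      have := dvd_add h1 ih
      rwa [sub_add_sub_cancel] at this
  -- The iterates agree modulo X^k from the k-th on, so the coefficient of X^n is final in the
  -- iterate n + 1.
  set A : ι → PowerSeries R := fun a => PowerSeries.mk fun n => coeff n (s (n + 1) a) with hA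
  have hAs : ∀ k a, X ^ k ∣ A a - s k a := by
    intro k a
    rw [X_pow_dvd_iff]
    intro n hn
    rw [map_sub, hA, coeff_mk]
    obtain ⟨j, rfl⟩ := Nat.exists_eq_add_of_lt hn
    have := X_pow_dvd_iff.1 (hle (n + 1) j a) n (Nat.lt_succ_self n)
    rw [map_sub, sub_eq_zero] at this
    rw [show n + j + 1 = n + 1 + j by ring, this, sub_self]
  refine ⟨A, funext fun a => ?_⟩
  rw [← sub_eq_zero]
  ext n
  have h1 := hΦ n _ _ (hAs n) a
  have h2 := hAs (n + 1) a
  have h3 : s (n + 1) = Φ (s n) := Function.iterate_succ_apply' Φ n 0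
  rw [h3] at h2
  have h4 := dvd_sub h1 h2
  rw [sub_sub_sub_cancel_right] at h4
  simpa using X_pow_dvd_iff.1 h4 n (Nat.lt_succ_self n)

/-- A power series with constant term `1` has the inverse of a square root. -/
theorem exists_sq_mul_eq_one {g : PowerSeries R} (hg : constantCoeff g = 1) :
    ∃ q : PowerSeries R, (1 + X * q) ^ 2 * g = 1 := by
  obtain ⟨k, hk⟩ : X ∣ g - 1 := X_dvd_iff.2 (by simp [hg])
  have hk' : g = 1 + X * k := by linear_combination hk
  -- Expanding (1 + Xq)²(1 + Xk) = 1 and dividing by X gives 2q = -(k + X(2qk + q² + X q² k)), which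
  -- is contracting for the X-adic topology.
  obtain ⟨q, hq⟩ := exists_fixedPoint (ι := Unit)
    (fun q _ => -((1 / 2 : ℝ) • (k + X * (2 * q () * k + q () ^ 2 + X * (q () ^ 2 * k)))))
    (fun n A B h a => by
      obtain ⟨e, he⟩ := h ()
      have hA : A () = B () + X ^ n * e := by linear_combination he
      refine ⟨-((1 / 2 : ℝ) • (2 * e * k + (2 * B () + X ^ n * e) * e +
        X * ((2 * B () + X ^ n * e) * e * k))), ?_⟩
      rw [hA, mul_neg, mul_smul_comm, neg_sub_neg, ← smul_sub, ← smul_neg]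
      congr 1
      ring)
  have h1 := congrFun hq ()
  have h2 : (2 : PowerSeries R) * q () =
      -(k + X * (2 * q () * k + q () ^ 2 + X * (q () ^ 2 * k))) := by
    conv_lhs => rw [← h1]
    rw [mul_neg, two_mul, ← two_smul ℝ, smul_smul]
    norm_num
  refine ⟨q (), ?_⟩
  rw [hk']
  linear_combination X * h2

end PowerSeriesDerivation

/-! ### The generating functions of the hierarchy -/

section Generating

variable {m : ℕ} (κ : Matrix (Fin m) (Fin m) ℝ)

/-- The vector `v` as a constant power series. -/
def psJet : Fin m → PowerSeries (DiffPoly m) := fun a => C (jet m 0 a)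

/-- The right-hand side for `β` in the Riccati system. -/
def riccatiBeta {S : Type*} [CommRing S] [Algebra ℝ S] (D : Derivation ℝ S S) (z : S)
    (v A : Fin m → S) : Fin m → S :=
  v + z • dv D A + (z ^ 2 * gdot κ v A) • A

/-- The fixed-point map whose fixed points solve the Riccati system. -/
def riccatiMap {S : Type*} [CommRing S] [Algebra ℝ S] (D : Derivation ℝ S S) (z : S)
    (v A : Fin m → S) : Fin m → S :=
  dv D (riccatiBeta κ D z v A) + (z * gdot κ v (riccatiBeta κ D z v A)) • A

/-- Contraction property: in β(A) the unknown A occurs only with a factor z, and in the second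
summand of the map a factor z stands in front, so a perturbation divisible by t changes the value by
a multiple of t z. -/
theorem riccatiMap_add_smul {S : Type*} [CommRing S] [Algebra ℝ S] (D : Derivation ℝ S S)
    {z t : S} (hz : D z = 0) (ht : D t = 0) (v B e : Fin m → S) :
    ∃ y, riccatiMap κ D z v (B + t • e) - riccatiMap κ D z v B = (t * z) • y := by
  set η := dv D e + (z * gdot κ v B) • e + (z * gdot κ v e) • B + (z * t * gdot κ v e) • e with hη
  have h1 : riccatiBeta κ D z v (B + t • e) = riccatiBeta κ D z v B + (z * t) • η := by
    simp only [riccatiBeta, hη, dv_add, dv_smul, ht, zero_smul, zero_add, gdot_add_right,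
      gdot_smul_right]
    module
  refine ⟨dv D η + gdot κ v (riccatiBeta κ D z v B) • e + (z * gdot κ v η) • (B + t • e), ?_⟩
  rw [riccatiMap, h1, riccatiMap]
  simp only [dv_add, dv_smul, Derivation.leibniz, hz, ht, smul_zero, add_zero, zero_smul, zero_add,
    gdot_add_right, gdot_smul_right]
  module

theorem isRiccati_of_fixedPoint {S : Type*} [CommRing S] [Algebra ℝ S] {D : Derivation ℝ S S}
    {z : S} (hz : D z = 0) {v A : Fin m → S} (hκ : κ.IsSymm) (hA : riccatiMap κ D z v A = A) :
    IsRiccati κ D z v A (riccatiBeta κ D z v A) where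
  symm := hκ
  const := hz
  beta := by rw [riccatiBeta]; module
  alpha := by
    nth_rewrite 2 [← hA]
    rw [riccatiMap]
    module

variable {κ} in
-- Only derivatives and products enter the iteration, never D⁻¹, so all coefficients are
-- differential polynomials.
theorem exists_riccati (hκ : κ.IsSymm) : ∃ α β : Fin m → PowerSeries (DiffPoly m),
    IsRiccati κ (psDeriv (totalD m)) X psJet α β := by
  have hX : psDeriv (totalD m) X = 0 := psDeriv_X _
  obtain ⟨A, hA⟩ := exists_fixedPoint (riccatiMap κ (psDeriv (totalD m)) X psJet)
    (fun n A B h a => by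
      choose e he using h
      have hAB : A = B + (X ^ n : PowerSeries (DiffPoly m)) • e := by
        ext1 a; simp only [Pi.add_apply, Pi.smul_apply, smul_eq_mul, ← he]; ring
      have ht : psDeriv (totalD m) (X ^ n) = 0 := by rw [Derivation.leibniz_pow, hX]; simp
      obtain ⟨y, hy⟩ := riccatiMap_add_smul κ _ hX ht psJet B e
      rw [pow_succ, hAB]
      exact ⟨y a, congrFun hy a⟩)
  exact ⟨A, _, isRiccati_of_fixedPoint κ hX hκ hA⟩

theorem map_psDeriv_totalD (f : PowerSeries (DiffPoly m)) :
    PowerSeries.map (MvPolynomial.constantCoeff (σ := Fin m × ℕ)) (psDeriv (totalD m) f) = 0 := by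
  ext n; simp

theorem ringHom_gdot {S T : Type*} [CommRing S] [Algebra ℝ S] [CommRing T] (ψ : S →+* T)
    {x : Fin m → S} (y : Fin m → S) (hx : ∀ a, ψ (x a) = 0) : ψ (gdot κ x y) = 0 := by
  simp [gdot, dotProduct, map_sum, hx]

/-- Generating functions for the hierarchy: solutions of the Riccati system with the
normalisation `1 + X q` of the zero curvature equation. -/
structure Generating (κ : Matrix (Fin m) (Fin m) ℝ) where
  α : Fin m → PowerSeries (DiffPoly m)
  β : Fin m → PowerSeries (DiffPoly m)
  q : PowerSeries (DiffPoly m)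
  riccati : IsRiccati κ (psDeriv (totalD m)) X psJet α β
  normal : (1 + X * q) ^ 2 * gramDet κ X α β = 1
  α_const : ∀ a, PowerSeries.map (MvPolynomial.constantCoeff (σ := Fin m × ℕ)) (α a) = 0
  q_const : PowerSeries.map (MvPolynomial.constantCoeff (σ := Fin m × ℕ)) q = 0

variable {κ} in
-- Setting all jet variables to zero kills v and every total derivative. The Riccati system then
-- forces α and β to vanish, and the normalisation becomes (1 + Xq)² = 1, which leaves q = 0 since 2
-- + Xq has a nonzero constant coefficient.
theorem nonempty_generating (hκ : κ.IsSymm) : Nonempty (Generating κ) := by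
  obtain ⟨α, β, h⟩ := exists_riccati hκ
  set ψ := PowerSeries.map (MvPolynomial.constantCoeff (σ := Fin m × ℕ) (R := ℝ)) with hψ
  have hv : ∀ a, ψ (psJet (m := m) a) = 0 := by
    intro a; simp [hψ, psJet, jet]
  have hβ : ∀ a, ψ (β a) = X ^ 2 * ψ (gdot κ psJet α) * ψ (α a) := by
    intro a
    have h1 := congrArg ψ (congrFun h.beta a)
    simp only [Pi.smul_apply, Pi.sub_apply, smul_eq_mul, map_mul, map_sub, map_pow, hv, dv] at h1
    rw [hψ, map_psDeriv_totalD, map_X, mul_zero] at h1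
    linear_combination -h1
  have hα : ∀ a, ψ (α a) = 0 := by
    intro a
    have h1 := congrArg ψ (congrFun h.alpha a)
    simp only [Pi.smul_apply, Pi.sub_apply, smul_eq_mul, map_mul, map_sub, dv, hψ,
      map_psDeriv_totalD] at h1
    have h2 := ringHom_gdot κ ψ β hv
    rw [hψ] at h2
    rw [h2] at h1
    linear_combination -h1
  have hβ' : ∀ a, ψ (β a) = 0 := by intro a; rw [hβ, hα, mul_zero]
  obtain ⟨q, hq⟩ := exists_sq_mul_eq_one (g := gramDet κ X α β) (by simp [gramDet])
  refine ⟨⟨α, β, q, h, hq, hα, ?_⟩⟩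
  have hG : ψ (gramDet κ X α β) = 1 := by
    simp [gramDet, ringHom_gdot κ ψ _ hα, ringHom_gdot κ ψ _ hβ']
  have h1 := congrArg ψ hq
  rw [map_mul, hG, map_pow, map_one, mul_one, map_add, map_one, map_mul, hψ, map_X, ← hψ] at h1
  have h2 : (X : PowerSeries ℝ) * (ψ q * (2 + X * ψ q)) = 0 := by linear_combination h1
  rcases mul_eq_zero.1 h2 with h3 | h3
  · exact absurd h3 X_ne_zero
  rcases mul_eq_zero.1 h3 with h4 | h4
  · exact h4
  · have := congrArg (constantCoeff (R := ℝ)) h4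
    simp only [map_add, map_mul, constantCoeff_X, zero_mul, add_zero, map_ofNat] at this
    exact absurd this two_ne_zero

namespace Generating

variable {κ} (Γ : Generating κ)

/-- The generating function of the potentials `p`. -/
def P : PowerSeries (DiffPoly m) := 1 + X * Γ.q

/-- The hierarchy with the given generating functions. -/
def data : HierarchyData m where
  ϖ k := fun a => coeff k (Γ.P * Γ.β a)
  e k := fun a => coeff k (Γ.P * Γ.α a)
  p k := coeff k Γ.q
  W k := fun a b => coeff k ((-(X * Γ.P) • gwedge Γ.α Γ.β) a b)

theorem gint_apply {S : Type*} [CommRing S] [Algebra ℝ S] (x : Fin m → S)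
    (W : Matrix (Fin m) (Fin m) S) (b : Fin m) :
    gint κ x W b = ∑ c, ∑ a, κ a c • (x a * W c b) := by
  simp only [gint, Matrix.vecMul, dotProduct, Matrix.map_apply, Finset.sum_mul, Algebra.smul_def]
  exact Finset.sum_congr rfl fun c _ => Finset.sum_congr rfl fun a _ => by ring

theorem gdot_apply {S : Type*} [CommRing S] [Algebra ℝ S] (x y : Fin m → S) :
    gdot κ x y = ∑ a, ∑ c, κ a c • (x a * y c) := by
  simp only [gdot, Matrix.mulVec, dotProduct, Matrix.map_apply, Finset.mul_sum, Algebra.smul_def]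
  exact Finset.sum_congr rfl fun c _ => Finset.sum_congr rfl fun a _ => by ring

theorem coeff_gdot_C (k : ℕ) (x : DVec m) (y : Fin m → PowerSeries (DiffPoly m)) :
    coeff k (gdot κ (fun a => C (x a)) y) = gdot κ x (fun a => coeff k (y a)) := by
  simp only [gdot_apply, map_sum, coeff_smul, coeff_C_mul]

theorem coeff_gint_C (k : ℕ) (x : DVec m)
    (W : Matrix (Fin m) (Fin m) (PowerSeries (DiffPoly m))) (b : Fin m) :
    coeff k (gint κ (fun a => C (x a)) W b) =
      gint κ x (Matrix.of fun a b => coeff k (W a b)) b := by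
  rw [gint_apply, gint_apply]
  simp only [map_sum, coeff_smul, coeff_C_mul, Matrix.of_apply]

/-- Comparison of coefficients in the four generating identities; the vanishing of the constant
terms of p and W comes from that of q and α. -/
theorem isHierarchy : IsHierarchy κ Γ.data := by
  have hR := Γ.riccati
  have hN : Γ.P ^ 2 * gramDet κ X Γ.α Γ.β = 1 := Γ.normal
  have hP0 : ∀ f : PowerSeries (DiffPoly m), coeff 0 (Γ.P * f) = coeff 0 f := by
    intro f; simp [P]
  have key : ∀ a, X * psDeriv (totalD m) (Γ.P * Γ.α a) + Γ.P * psJet a = Γ.P * Γ.β a := by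
    intro a
    have h1 := congrFun (hR.smul_dv_e hN) a
    simpa only [Pi.add_apply, Pi.smul_apply, smul_eq_mul, dv] using h1
  constructor
  · ext1 a
    simp only [data]
    rw [← key a]
    simp [P, psJet]
  · intro k a b
    change MvPolynomial.constantCoeff (coeff k ((-(X * Γ.P) • gwedge Γ.α Γ.β) a b)) = 0
    have h1 : PowerSeries.map (MvPolynomial.constantCoeff (σ := Fin m × ℕ))
        ((-(X * Γ.P) • gwedge Γ.α Γ.β) a b) = 0 := by
      rw [Matrix.smul_apply, gwedge_apply, smul_eq_mul, map_mul, map_sub, map_mul, map_mul,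
        Γ.α_const, Γ.α_const]
      ring
    rw [← coeff_map, h1, map_zero]
  · intro k a b
    have h1 := congrArg (coeff k) (congrFun (congrFun (hR.dmat_W hN) a) b)
    rw [wedge_eq_gwedge, gwedge_apply]
    rw [gwedge_apply, dmat, coeff_psDeriv, map_sub] at h1
    simp only [psJet, Pi.smul_apply, smul_eq_mul, coeff_C_mul, coeff_mul_C] at h1
    exact h1
  · intro k b
    have h1 := congrArg (coeff k) (congrFun (hR.dv_w hN) b)
    rw [interior_eq_gint]
    simp only [Pi.add_apply, map_add, dv, coeff_psDeriv] at h1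
    have h2 := coeff_gint_C (κ := κ) k (jet m 0) (-(X * Γ.P) • gwedge Γ.α Γ.β) b
    exact h1.symm.trans (congrArg _ h2)
  · intro k
    change MvPolynomial.constantCoeff (coeff k Γ.q) = 0
    rw [← coeff_map, Γ.q_const, map_zero]
  · intro k
    -- The shift by one reflects P = 1 + X q: the k-th potential is the coefficient of X^(k+1) in P.
    have h1 := congrArg (coeff (k + 1)) (hR.deriv_P hN)
    rw [coeff_psDeriv, coeff_succ_X_mul] at h1
    rw [dot_eq_gdot]
    refine Eq.trans ?_ (h1.trans (coeff_gdot_C k (jet m 0) _))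
    simp [P, data, coeff_one, coeff_succ_X_mul]
  · intro k a
    have h1 := congrArg (coeff (k + 1)) (key a)
    rw [map_add, coeff_succ_X_mul, coeff_psDeriv] at h1
    simp only [psJet, coeff_mul_C] at h1
    simp only [data]
    rw [← h1]
    simp [P, coeff_one, coeff_succ_X_mul]

end Generating

end Generating

end

section

open PowerSeries

variable {m : ℕ} {κ : Matrix (Fin m) (Fin m) ℝ}

/-! ### Uniqueness and the first members of a hierarchy -/

namespace IsHierarchy

variable {h h' : HierarchyData m} (H : IsHierarchy κ h)

include H

theorem dmat_W (k : ℕ) : dmat (totalD m) (h.W k) = gwedge (jet m 0) (h.ϖ k) := by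
  funext a b; rw [← wedge_eq_gwedge]; exact H.W_deriv k a b

theorem e_eq_dv (k : ℕ) : h.e k = dv (totalD m) (h.ϖ k) + gint κ (jet m 0) (h.W k) := by
  ext1 b; rw [← interior_eq_gint]; exact H.e_eq k b

theorem totalD_p (k : ℕ) : totalD m (h.p k) = gdot κ (jet m 0) (h.e k) := by
  rw [← dot_eq_gdot]; exact H.p_deriv k

theorem ϖ_succ_eq (k : ℕ) : h.ϖ (k + 1) = dv (totalD m) (h.e k) + h.p k • jet m 0 := by
  ext1 a; exact H.ϖ_succ k a

theorem W_eq {k : ℕ} {W : Matrix (Fin m) (Fin m) (DiffPoly m)}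
    (hW : dmat (totalD m) W = gwedge (jet m 0) (h.ϖ k))
    (hc : ∀ a b, MvPolynomial.constantCoeff (W a b) = 0) : h.W k = W := by
  funext a b
  refine eq_of_totalD_eq ?_ (by rw [H.W_const, hc])
  exact congrFun (congrFun ((H.dmat_W k).trans hW.symm) a) b

theorem p_eq {k : ℕ} {p : DiffPoly m} (hp : totalD m p = gdot κ (jet m 0) (h.e k))
    (hc : MvPolynomial.constantCoeff p = 0) : h.p k = p :=
  eq_of_totalD_eq ((H.totalD_p k).trans hp.symm) (by rw [H.p_const, hc])

/-- The matrix -Wᵀ is another primitive of the skew matrix v∧ϖ without constant term. -/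
theorem W_skew (k : ℕ) : (h.W k).transpose = -h.W k := by
  have h1 : h.W k = -(h.W k).transpose := H.W_eq (by
    have h2 := congrArg Matrix.transpose (H.dmat_W k)
    rw [gwedge_transpose] at h2
    rw [← neg_neg (gwedge (jet m 0) (h.ϖ k)), ← h2]
    funext a b
    simp [dmat]) (fun a b => by simp [H.W_const])
  rw [eq_comm, neg_eq_iff_eq_neg]; exact h1

theorem isH (k : ℕ) : IsH κ (h.ϖ k) (h.e k) :=
  isH_iff.2 ⟨h.W k, H.W_skew k, H.dmat_W k, H.e_eq_dv k⟩

theorem isJ (k : ℕ) : IsJ κ (h.e k) (h.ϖ (k + 1)) :=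
  isJ_iff.2 ⟨h.p k, H.totalD_p k, H.ϖ_succ_eq k⟩

/-- Each step of the recursion is a function of the preceding data, once D⁻¹ is normalised by
vanishing constant term. -/
theorem ext_of_isHierarchy (H' : IsHierarchy κ h') : h' = h := by
  have step : ∀ k, h'.ϖ k = h.ϖ k → h'.W k = h.W k ∧ h'.e k = h.e k ∧ h'.p k = h.p k := by
    intro k hk
    have hW : h'.W k = h.W k := H'.W_eq (by rw [H.dmat_W, hk]) (H.W_const k)
    have he : h'.e k = h.e k := by rw [H'.e_eq_dv, H.e_eq_dv, hk, hW]
    exact ⟨hW, he, H'.p_eq (by rw [H.totalD_p, he]) (H.p_const k)⟩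
  have hϖ : ∀ k, h'.ϖ k = h.ϖ k := by
    intro k
    induction k with
    | zero => rw [H'.start, H.start]
    | succ k ih => rw [H'.ϖ_succ_eq, H.ϖ_succ_eq, (step k ih).2.1, (step k ih).2.2]
  obtain ⟨ϖ, e, p, W⟩ := h
  obtain ⟨ϖ', e', p', W'⟩ := h'
  simp only [HierarchyData.mk.injEq]
  exact ⟨funext hϖ, funext fun k => (step k (hϖ k)).2.1, funext fun k => (step k (hϖ k)).2.2,
    funext fun k => (step k (hϖ k)).1⟩

theorem W_zero : h.W 0 = 0 :=
  H.W_eq (by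
    rw [H.start]
    funext a b
    simp [dmat, gwedge_apply]) (by simp)

theorem first : h.e 0 = jet m 1 := by
  rw [H.e_eq_dv, H.W_zero, gint_zero_right, add_zero, H.start, dv_totalD_jet]

theorem constantCoeff_gdot_jet (j : ℕ) (P : DVec m) :
    MvPolynomial.constantCoeff (gdot κ (jet m j) P) = 0 :=
  ringHom_gdot κ _ _ (by simp [jet])

theorem first_potential (hκ : κ.IsSymm) :
    h.p 0 = (1 / 2 : ℝ) • gdot κ (jet m 0) (jet m 0) := by
  refine H.p_eq ?_ ?_
  · rw [Derivation.map_smul, deriv_gdot, H.first, dv_totalD_jet, gdot_comm (jet m 1) _ hκ,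
      ← two_smul ℝ, smul_smul]
    norm_num
  · rw [MvPolynomial.smul_eq_C_mul, map_mul, H.constantCoeff_gdot_jet, mul_zero]

theorem W_one : h.W 1 = gwedge (jet m 0) (jet m 1) := by
  refine H.W_eq ?_ (fun a b => by simp [gwedge_apply, jet])
  rw [dmat_gwedge, H.ϖ_succ_eq, H.first, dv_totalD_jet, dv_totalD_jet]
  funext a b
  simp [gwedge_apply]
  ring

theorem second (hκ : κ.IsSymm) : h.e 1 =
    jet m 3 + ((3 / 2 : ℝ) • gdot κ (jet m 0) (jet m 0)) • jet m 1 := by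
  have hd : totalD m ((1 / 2 : ℝ) • gdot κ (jet m 0) (jet m 0)) = gdot κ (jet m 0) (jet m 1) := by
    rw [Derivation.map_smul, deriv_gdot, dv_totalD_jet, gdot_comm (jet m 1) _ hκ,
      ← two_smul ℝ, smul_smul]
    norm_num
  rw [H.e_eq_dv, H.W_one, H.ϖ_succ_eq, H.first, H.first_potential hκ, gint_gwedge]
  simp only [dv_add, dv_smul, dv_totalD_jet, hd]
  have h3 : (3 / 2 : ℝ) • gdot κ (jet m 0) (jet m 0) =
      (1 / 2 : ℝ) • gdot κ (jet m 0) (jet m 0) + gdot κ (jet m 0) (jet m 0) := by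
    module
  rw [h3]
  module

/-- Lenard-Magri: skewness of H and of J together give ϖ^(i+1)·e^(j) ≡ ϖ^(i)·e^(j+1) modulo total
derivatives. Shifting i down to 0 ends with v·e^(i+j), which is the derivative of a potential. -/
theorem gdot_e_mem_imD (hκ : κ.IsSymm) (i j : ℕ) : gdot κ (h.ϖ i) (h.e j) ∈ imD m := by
  have hH : ∀ i j, gdot κ (h.ϖ i) (h.e j) + gdot κ (h.ϖ j) (h.e i) ∈ imD m := by
    intro i j
    obtain ⟨f, hf⟩ := (isHamiltonianRelation_relH hκ _ _ _ _ ⟨_, rfl, H.isH i⟩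
      ⟨_, rfl, H.isH j⟩).1
    rw [Finset.sum_add_distrib, sum_lower_mul hκ, sum_lower_mul hκ] at hf
    exact ⟨f, hf⟩
  have hJ : ∀ i j, gdot κ (h.ϖ (i + 1)) (h.e j) + gdot κ (h.ϖ (j + 1)) (h.e i) ∈ imD m := by
    intro i j
    obtain ⟨f, hf⟩ := (isHamiltonianRelation_relJ hκ _ _ _ _ ⟨_, rfl, H.isJ i⟩
      ⟨_, rfl, H.isJ j⟩).1
    rw [Finset.sum_add_distrib, sum_lower_mul hκ, sum_lower_mul hκ] at hf
    exact ⟨f, hf⟩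
  induction i generalizing j with
  | zero => rw [H.start, ← H.totalD_p]; exact totalD_mem_imD _
  | succ i ih =>
    have h1 := (imD m).sub_mem (hJ i j) (hH i (j + 1))
    have h2 := (imD m).add_mem h1 (ih (j + 1))
    convert h2 using 1
    ring

end IsHierarchy

/-! ### The Hamiltonians -/

theorem isVarDeriv_iff {f : DiffPoly m} {ϖ : DVec m} :
    IsVarDeriv κ f ϖ ↔ eulerOp f = lower κ ϖ := by
  rw [funext_iff]; rfl

theorem isVarDeriv_of_forall (hκ : κ.IsSymm) {f : DiffPoly m} {ϖ : DVec m}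
    (h : ∀ Q : DVec m, evol Q f - gdot κ Q ϖ ∈ imD m) : IsVarDeriv κ f ϖ := by
  rw [isVarDeriv_iff]
  refine eq_of_forall_pairing fun Q => ?_
  rw [sum_mul_lower hκ]
  have := (imD m).sub_mem (h Q) (evol_sub_euler_mem Q f)
  rwa [sub_sub_sub_cancel_left] at this

theorem evol_sub_gdot_mem (hκ : κ.IsSymm) {f : DiffPoly m} {ϖ : DVec m} (h : IsVarDeriv κ f ϖ)
    (Q : DVec m) : evol Q f - gdot κ Q ϖ ∈ imD m := by
  have := evol_sub_euler_mem Q f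
  rwa [isVarDeriv_iff.1 h, sum_mul_lower hκ] at this

namespace Generating

variable (Γ : Generating κ)

/-- Since P²G = 1, the series f = P G (1 + z² α·α)⁻¹ is the density of the trace identity, whose
variation is -z δv·(Pβ) modulo total derivatives. Hence minus its coefficient of z^(k+1) is a
Hamiltonian for ϖ^(k). -/
theorem exists_hamiltonians : ∃ F : ℕ → DiffPoly m,
    F 0 = (1 / 2 : ℝ) • dot κ (jet m 0) (jet m 0) ∧ ∀ k, IsVarDeriv κ (F k) (Γ.data.ϖ k) := by
  have hR := Γ.riccati
  have hκ := hR.symm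
  have hN : Γ.P ^ 2 * gramDet κ X Γ.α Γ.β = 1 := Γ.normal
  set b := invOfUnit (1 + X ^ 2 * gdot κ Γ.α Γ.α) 1 with hbdef
  have hb : (1 + X ^ 2 * gdot κ Γ.α Γ.α) * b = 1 := mul_invOfUnit _ _ (by simp)
  set f := Γ.P * gramDet κ X Γ.α Γ.β * b with hf
  refine ⟨fun k => -coeff (k + 1) f, ?_, ?_⟩
  -- From f P = b and b + X²(α·α)b = 1 the series f(1 + Xq) is 1 modulo X². Thus f has coefficients
  -- 1 and -q₀, and q₀ is the first potential.
  · have h1 : f + X * (f * Γ.q) + X ^ 2 * (gdot κ Γ.α Γ.α * b) = 1 := by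
      have hfP : f * Γ.P = b := by rw [hf]; linear_combination b * hN
      have hP : Γ.P = 1 + X * Γ.q := rfl
      rw [hP] at hfP
      linear_combination hfP + hb
    clear_value f
    have h0 : coeff 0 f = 1 := by simpa using congrArg (coeff 0) h1
    have h2 : coeff 1 f + coeff 0 f * coeff 0 Γ.q = 0 := by
      have h2 := congrArg (coeff (0 + 1)) h1
      rw [pow_two, mul_assoc, map_add, map_add, coeff_succ_X_mul, coeff_succ_X_mul] at h2
      simpa [coeff_one] using h2
    have h3 : coeff 0 Γ.q = (1 / 2 : ℝ) • gdot κ (jet m 0) (jet m 0) :=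
      Γ.isHierarchy.first_potential hκ
    rw [dot_eq_gdot, ← h3]
    rw [h0] at h2
    linear_combination -h2
  · intro k
    refine isVarDeriv_of_forall hκ fun Q => ?_
    have h1 := hR.variation hN (psDeriv_X (evol Q))
      (fun x => by ext n; simp [evol_totalD]) hb
    have hQ : dv (psDeriv (evol Q)) psJet = fun a => (C (Q a) : PowerSeries (DiffPoly m)) := by
      funext a
      refine PowerSeries.ext fun n => ?_
      rw [dv, coeff_psDeriv]
      simp only [psJet, coeff_C]
      split_ifs
      · exact congrFun (dv_evol_jet Q) a
      · simp
    have hX2 : ∀ y : PowerSeries (DiffPoly m),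
        X ^ 2 * psDeriv (totalD m) y = psDeriv (totalD m) (X ^ 2 * y) := by
      intro y
      simp [Derivation.leibniz, Derivation.leibniz_pow]
    have h2 := congrArg (coeff (k + 1)) h1
    rw [hX2, map_add, map_neg, coeff_psDeriv, coeff_psDeriv, coeff_succ_X_mul, hQ,
      coeff_gdot_C, ← hf] at h2
    change evol Q (-coeff (k + 1) f) - gdot κ Q (fun a => coeff k (Γ.P * Γ.β a)) ∈ imD m
    rw [map_neg, ← neg_add', ]
    refine (imD m).neg_mem ?_
    have h3 : (fun a => coeff k (Γ.P * Γ.β a)) = fun a => coeff k ((Γ.P • Γ.β) a) := rfl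
    rw [h3, h2]
    exact (imD m).neg_mem (totalD_mem_imD _)

end Generating

/-! ### Commuting flows -/

theorem evol_bracket (P Q : DVec m) (f : DiffPoly m) :
    evol (bracket P Q) f = evol P (evol Q f) - evol Q (evol P f) := by
  have hit : ∀ (R : DVec m) (j : ℕ) (g : DiffPoly m),
      evol R ((totalD m)^[j] g) = (totalD m)^[j] (evol R g) := by
    intro R j
    induction j with
    | zero => intro g; rw [Function.iterate_zero, id, id]
    | succ j ih =>
      intro g
      rw [Function.iterate_succ_apply, ih, evol_totalD, Function.iterate_succ_apply]
  have h : evol (bracket P Q) = ⁅evol P, evol Q⁆ := MvPolynomial.derivation_ext fun q => by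
    have hb : bracket P Q q.1 = evol P (Q q.1) - evol Q (P q.1) := rfl
    rw [Derivation.commutator_apply, evol_X, evol_X, evol_X, hit, hit, hb, iterate_map_sub]
  rw [h, Derivation.commutator_apply]

/-- An exact variational one-form is closed: apply the Hamiltonian to the commutator of two
evolutionary fields. -/
theorem closed_of_isVarDeriv (hκ : κ.IsSymm) {f : DiffPoly m} {ϖ : DVec m}
    (h : IsVarDeriv κ f ϖ) (P Q : DVec m) :
    gdot κ (dv (evol P) ϖ) Q - gdot κ (dv (evol Q) ϖ) P ∈ imD m := by
  have h1 := evol_mem_imD P (evol_sub_gdot_mem hκ h Q)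
  have h2 := evol_mem_imD Q (evol_sub_gdot_mem hκ h P)
  have h3 := evol_sub_gdot_mem hκ h (bracket P Q)
  have h4 := (imD m).sub_mem h3 ((imD m).sub_mem h1 h2)
  convert h4 using 1
  rw [evol_bracket, bracket_eq, gdot_sub_left]
  simp only [map_sub, deriv_gdot]
  rw [gdot_comm (dv (evol P) ϖ) Q hκ, gdot_comm (dv (evol Q) ϖ) P hκ]
  ring

/-- For exact one-forms the Courant bracket is the differential of the pairing of ϖ₂ with e₁, and
this pairing is a total derivative by hypothesis. -/
theorem courant_eq_zero (hκ : κ.IsSymm) {f₁ f₂ : DiffPoly m} {e₁ e₂ ϖ₁ ϖ₂ : DVec m}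
    (h₁ : IsVarDeriv κ f₁ ϖ₁) (h₂ : IsVarDeriv κ f₂ ϖ₂) (h₁₂ : gdot κ ϖ₂ e₁ ∈ imD m) :
    lieForm e₁ (lower κ ϖ₂) - contrD e₂ (lower κ ϖ₁) = 0 := by
  have h : ∀ Q : DVec m, gdot κ (dv (evol Q) e₁) ϖ₂ + gdot κ (dv (evol Q) ϖ₁) e₂ -
      gdot κ Q (dv (evol e₂) ϖ₁ - dv (evol e₁) ϖ₂) ∈ imD m := by
    intro Q
    have h3 := evol_mem_imD Q h₁₂
    have h4 := (imD m).add_mem h3 ((imD m).sub_mem (closed_of_isVarDeriv hκ h₂ e₁ Q)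
      (closed_of_isVarDeriv hκ h₁ e₂ Q))
    convert h4 using 1
    rw [deriv_gdot, gdot_sub_right, gdot_comm Q _ hκ, gdot_comm Q _ hκ,
      gdot_comm ϖ₂ (dv (evol Q) e₁) hκ]
    ring
  rw [courant_eq_lower hκ h]
  ext1 a
  simp [lower]

variable (m) in
/-- The ideal of differential polynomials without constant term. -/
def augIdeal : Ideal (DiffPoly m) :=
  RingHom.ker (MvPolynomial.constantCoeff (σ := Fin m × ℕ) (R := ℝ))

theorem derivation_mem_sq {I : Ideal (DiffPoly m)} (d : Derivation ℝ (DiffPoly m) (DiffPoly m))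
    (hd : ∀ f ∈ I, d f ∈ I) {f : DiffPoly m} (hf : f ∈ I ^ 2) : d f ∈ I ^ 2 := by
  rw [pow_two] at hf ⊢
  refine Submodule.mul_induction_on hf (fun x hx y hy => ?_) (fun x y hx hy => ?_)
  · rw [Derivation.leibniz]
    exact (I * I).add_mem (Ideal.mul_mem_mul hx (hd y hy))
      (Ideal.mul_mem_mul hy (hd x hx))
  · rw [map_add]; exact (I * I).add_mem hx hy

theorem derivation_mem_of_mem_sq {I : Ideal (DiffPoly m)}
    (d : Derivation ℝ (DiffPoly m) (DiffPoly m)) {f : DiffPoly m} (hf : f ∈ I ^ 2) : d f ∈ I := by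
  rw [pow_two] at hf
  refine Submodule.mul_induction_on hf (fun x hx y hy => ?_) (fun x y hx hy => ?_)
  · rw [Derivation.leibniz]
    exact I.add_mem (I.mul_mem_right _ hx) (I.mul_mem_right _ hy)
  · rw [map_add]; exact I.add_mem hx hy

theorem mem_augIdeal {f : DiffPoly m} :
    f ∈ augIdeal m ↔ MvPolynomial.constantCoeff f = 0 := Iff.rfl

theorem totalD_mem_sq {f : DiffPoly m} (hf : f ∈ augIdeal m ^ 2) :
    totalD m f ∈ augIdeal m ^ 2 :=
  derivation_mem_sq _ (fun g _ => by rw [mem_augIdeal, constantCoeff_totalD]) hf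

theorem evol_mem_augIdeal {Q : DVec m} (hQ : ∀ a, Q a ∈ augIdeal m) (f : DiffPoly m) :
    evol Q f ∈ augIdeal m := by
  obtain ⟨N, hN⟩ := exists_vars_lt f
  rw [evol_eq_sum Q hN]
  refine Ideal.sum_mem _ fun a _ => Ideal.sum_mem _ fun j _ => Ideal.mul_mem_left _ _ ?_
  cases j with
  | zero => exact hQ a
  | succ j => rw [Function.iterate_succ_apply', mem_augIdeal, constantCoeff_totalD]

theorem jet_mem_augIdeal (j : ℕ) (a : Fin m) : jet m j a ∈ augIdeal m := by
  simp [mem_augIdeal, jet]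

theorem totalD_iterate_jet (i j : ℕ) (a : Fin m) :
    (totalD m)^[i] (jet m j a) = jet m (j + i) a := by
  induction i with
  | zero => rfl
  | succ i ih => rw [Function.iterate_succ_apply', ih, ← add_assoc, ← dv_totalD_jet, dv]

theorem gint_mem_sq {x : DVec m} {W : Matrix (Fin m) (Fin m) (DiffPoly m)}
    (hx : ∀ a, x a ∈ augIdeal m) (hW : ∀ a b, W a b ∈ augIdeal m) (b : Fin m) :
    gint κ x W b ∈ augIdeal m ^ 2 := by
  rw [Generating.gint_apply]
  refine Ideal.sum_mem _ fun c _ => Ideal.sum_mem _ fun a _ => ?_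
  rw [MvPolynomial.smul_eq_C_mul, pow_two]
  exact Ideal.mul_mem_left _ _ (Ideal.mul_mem_mul (hx a) (hW c b))

namespace IsHierarchy

variable {h : HierarchyData m} (H : IsHierarchy κ h)

include H

/-- Potentials and bivectors have no constant term, so the nonlocal terms of J and H contribute only
to order two in v. Up to the square of the ideal, each operator acts as D. -/
theorem linear_part (k : ℕ) (a : Fin m) : h.ϖ k a - jet m (2 * k) a ∈ augIdeal m ^ 2 ∧
    h.e k a - jet m (2 * k + 1) a ∈ augIdeal m ^ 2 := by
  have he : ∀ k, (h.ϖ k a - jet m (2 * k) a ∈ augIdeal m ^ 2) →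
      h.e k a - jet m (2 * k + 1) a ∈ augIdeal m ^ 2 := by
    intro k hk
    have h1 := (augIdeal m ^ 2).add_mem (totalD_mem_sq hk)
      (gint_mem_sq (κ := κ) (jet_mem_augIdeal 0) (H.W_const k) a)
    convert h1 using 1
    rw [H.e_eq_dv, map_sub, ← dv_totalD_jet]
    simp only [Pi.add_apply, dv]
    ring
  induction k with
  | zero =>
    have h0 : h.ϖ 0 a - jet m (2 * 0) a ∈ augIdeal m ^ 2 := by
      rw [H.start, mul_zero, sub_self]; exact Ideal.zero_mem _
    exact ⟨h0, he 0 h0⟩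
  | succ k ih =>
    have h0 : h.ϖ (k + 1) a - jet m (2 * (k + 1)) a ∈ augIdeal m ^ 2 := by
      have h1 : h.p k * jet m 0 a ∈ augIdeal m ^ 2 := by
        rw [pow_two]; exact Ideal.mul_mem_mul (H.p_const k) (jet_mem_augIdeal 0 a)
      have h2 := (augIdeal m ^ 2).add_mem (totalD_mem_sq ih.2) h1
      convert h2 using 1
      rw [H.ϖ_succ_eq, map_sub, show 2 * (k + 1) = (2 * k + 1) + 1 by ring, ← dv_totalD_jet (2 * k + 1)]
      simp only [Pi.add_apply, Pi.smul_apply, smul_eq_mul, dv]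
      ring
    exact ⟨h0, he _ h0⟩

theorem e_mem_augIdeal (k : ℕ) (a : Fin m) : h.e k a ∈ augIdeal m := by
  have h1 := Ideal.pow_le_self two_ne_zero (H.linear_part k a).2
  have h2 := (augIdeal m).add_mem h1 (jet_mem_augIdeal (2 * k + 1) a)
  rwa [sub_add_cancel] at h2

theorem evol_e_mem (i j : ℕ) (a : Fin m) :
    evol (h.e i) (h.e j a) - jet m (2 * i + 1 + (2 * j + 1)) a ∈ augIdeal m ^ 2 := by
  have h1 := derivation_mem_sq (evol (h.e i))
    (fun f _ => evol_mem_augIdeal (H.e_mem_augIdeal i) f) (H.linear_part j a).2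
  have hit : ∀ n (f : DiffPoly m), f ∈ augIdeal m ^ 2 →
      (totalD m)^[n] f ∈ augIdeal m ^ 2 := by
    intro n
    induction n with
    | zero => exact fun f hf => hf
    | succ n ih => exact fun f hf => ih _ (totalD_mem_sq hf)
  have h2 := hit (2 * j + 1) _ (H.linear_part i a).2
  have h3 := (augIdeal m ^ 2).add_mem h1 h2
  convert h3 using 1
  rw [map_sub, iterate_map_sub, totalD_iterate_jet]
  rw [show evol (h.e i) (jet m (2 * j + 1) a) = (totalD m)^[2 * j + 1] (h.e i a) from evol_X _ _]
  ring

/-- The bracket of two flows is H applied to the Courant bracket of their one-forms, which is zero.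
So it is v⌋W for some constant W, hence linear in v; but linear parts with constant coefficients
commute, so it lies in the square of the augmentation ideal and must vanish. -/
theorem commute (hκ : κ.IsSymm) (hdet : κ.det ≠ 0) {F : ℕ → DiffPoly m}
    (hF : ∀ k, IsVarDeriv κ (F k) (h.ϖ k)) (i j : ℕ) : bracket (h.e i) (h.e j) = 0 := by
  have h1 := (isHamiltonianRelation_relH hκ _ _ _ _ ⟨_, rfl, H.isH i⟩ ⟨_, rfl, H.isH j⟩).2
  rw [courant_eq_zero hκ (hF i) (hF j) (H.gdot_e_mem_imD hκ j i)] at h1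
  obtain ⟨ϖ, h0, hϖ⟩ := h1
  have hu : IsUnit (κ.map (algebraMap ℝ (DiffPoly m))).det := by
    rw [← RingHom.mapMatrix_apply, ← RingHom.map_det]
    exact (isUnit_iff_ne_zero.2 hdet).map _
  have hϖ0 : ϖ = 0 := by
    rw [lower_eq_mulVec hκ] at h0
    have := congrArg (Matrix.mulVec (κ.map (algebraMap ℝ (DiffPoly m)))⁻¹) h0
    rwa [Matrix.mulVec_zero, Matrix.mulVec_mulVec, Matrix.nonsing_inv_mul _ hu, Matrix.one_mulVec,
      eq_comm] at this
  obtain ⟨W, -, hW, he⟩ := isH_iff.1 hϖ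
  subst hϖ0
  have hdv : dv (totalD m) (0 : DVec m) = 0 := by ext1 a; simp [dv]
  rw [hdv, zero_add] at he
  -- Only the zero covector is left, but D⁻¹(0) is an arbitrary constant skew matrix; the linear
  -- terms it produces have to be excluded separately.
  choose c hc using fun a b => show ∃ c : ℝ, W a b = MvPolynomial.C c from
    ⟨_, eq_C_of_totalD_eq_zero (by
      have := congrFun (congrFun hW a) b
      rw [gwedge_apply, dmat] at this
      simpa using this)⟩
  ext1 b
  -- Either order of composition produces the same jet, of order (2i + 1) + (2j + 1).
  have hlin : bracket (h.e i) (h.e j) b ∈ augIdeal m ^ 2 := by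
    have h2 := (augIdeal m ^ 2).sub_mem (H.evol_e_mem i j b) (H.evol_e_mem j i b)
    convert h2 using 1
    rw [show 2 * j + 1 + (2 * i + 1) = 2 * i + 1 + (2 * j + 1) by ring]
    simp [bracket]
  have hexp : bracket (h.e i) (h.e j) b =
      ∑ a, MvPolynomial.C (∑ d, κ a d * c d b) * MvPolynomial.X (a, 0) := by
    rw [he, Generating.gint_apply, Finset.sum_comm]
    refine Finset.sum_congr rfl fun a _ => ?_
    rw [map_sum, Finset.sum_mul]
    refine Finset.sum_congr rfl fun d _ => ?_
    rw [hc, MvPolynomial.smul_eq_C_mul, map_mul]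
    simp only [jet]
    ring
  rw [hexp] at hlin ⊢
  refine Finset.sum_eq_zero fun a _ => ?_
  have h3 := derivation_mem_of_mem_sq (MvPolynomial.pderiv (a, 0)) hlin
  have h4 : MvPolynomial.pderiv (a, 0) (∑ a, MvPolynomial.C (∑ d, κ a d * c d b) *
      MvPolynomial.X (R := ℝ) ((a, 0) : Fin m × ℕ)) = MvPolynomial.C (∑ d, κ a d * c d b) := by
    rw [map_sum, Finset.sum_eq_single a]
    · simp
    · intro a' _ ha'
      rw [MvPolynomial.pderiv_C_mul, MvPolynomial.pderiv_X_of_ne (by simpa using ha'), mul_zero]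
    · simp
  rw [h4, mem_augIdeal, MvPolynomial.constantCoeff_C] at h3
  rw [h3, map_zero, zero_mul]

end IsHierarchy

/-- The bi-Hamiltonian hierarchy exists. -/
theorem Generating.isBiHamiltonianHierarchy (Γ : Generating κ) (hdet : κ.det ≠ 0) :
    IsBiHamiltonianHierarchy κ Γ.data := by
  have H := Γ.isHierarchy
  have hκ := Γ.riccati.symm
  obtain ⟨F, hF0, hF⟩ := Γ.exists_hamiltonians
  refine ⟨H, fun h' H' => H.ext_of_isHierarchy H', isHamiltonianRelation_relH hκ,
    isHamiltonianRelation_relJ hκ, isHamiltonianRelation_relPencil hκ, ⟨F, hF0, hF⟩,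
    fun i j => ?_, H.commute hκ hdet hF, H.first, ?_, fun a => ?_⟩
  · rw [dot_eq_gdot]; exact H.gdot_e_mem_imD hκ i j
  · rw [dot_eq_gdot]; exact H.first_potential hκ
  · rw [dot_eq_gdot, H.second hκ, Pi.add_apply, Pi.smul_apply, smul_eq_mul, smul_mul_assoc]

end

section

/-! ### Smooth dependence on parameters for linear differential equations -/

section PartialDerivatives

open Filter Topology

variable {F : Type*} [NormedAddCommGroup F] [NormedSpace ℝ F]

/-- A function of two variables with `C^n` partial derivatives is `C^(n+1)`. -/
theorem contDiff_succ_of_partial {n : ℕ} {f f₁ f₂ : ℝ → ℝ → F}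
    (h₁ : ∀ t s, HasDerivAt (fun x => f x s) (f₁ t s) t)
    (h₂ : ∀ t s, HasDerivAt (f t) (f₂ t s) s)
    (c₁ : ContDiff ℝ n ↿f₁) (c₂ : ContDiff ℝ n ↿f₂) : ContDiff ℝ (n + 1 : ℕ) ↿f := by
  set g₁ : ℝ → ℝ → ℝ →L[ℝ] F := fun t s => ContinuousLinearMap.toSpanSingleton ℝ (f₁ t s)
  set g₂ : ℝ → ℝ → ℝ →L[ℝ] F := fun t s => ContinuousLinearMap.toSpanSingleton ℝ (f₂ t s)
  have k₁ : ContDiff ℝ n ↿g₁ :=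
    (ContinuousLinearMap.toSpanSingletonCLE (𝕜 := ℝ) (E := F)).contDiff.comp c₁
  have k₂ : ContDiff ℝ n ↿g₂ :=
    (ContinuousLinearMap.toSpanSingletonCLE (𝕜 := ℝ) (E := F)).contDiff.comp c₂
  have hf : ∀ u : ℝ × ℝ, HasFDerivAt ↿f ((↿g₁ u).coprod (↿g₂ u)) u := fun u =>
    (hasStrictFDerivAt_uncurry_coprod
      (Eventually.of_forall fun v => (h₁ v.1 v.2).hasFDerivAt)
      (Eventually.of_forall fun v => (h₂ v.1 v.2).hasFDerivAt)
      k₁.continuous.continuousAt k₂.continuous.continuousAt).hasFDerivAt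
  rw [show ((n + 1 : ℕ) : WithTop ℕ∞) = (n : WithTop ℕ∞) + 1 by norm_cast,
    contDiff_succ_iff_hasFDerivAt]
  refine ⟨fun u => (↿g₁ u).coprod (↿g₂ u), ?_, hf⟩
  have : (fun u => (↿g₁ u).coprod (↿g₂ u)) = fun u =>
      (↿g₁ u).comp (ContinuousLinearMap.fst ℝ ℝ ℝ) + (↿g₂ u).comp (ContinuousLinearMap.snd ℝ ℝ ℝ) := by
    ext1 u; ext <;> simp
  rw [this]
  exact (k₁.clm_comp contDiff_const).add (k₂.clm_comp contDiff_const)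

/-- Carathéodory's form of differentiability. Combined with Hadamard's lemma it differentiates
integrals in a parameter from continuity alone. -/
theorem hasDerivAt_of_sub_eq_smul {f : ℝ → F} {V : ℝ → F} {t : ℝ}
    (h : ∀ x, f x - f t = (x - t) • V x) (hV : ContinuousAt V t) : HasDerivAt f (V t) t := by
  rw [hasDerivAt_iff_tendsto_slope]
  refine (hV.tendsto.mono_left nhdsWithin_le_nhds).congr' ?_
  filter_upwards [self_mem_nhdsWithin] with x hx
  rw [slope_def_module, h x, smul_smul, inv_mul_cancel₀ (sub_ne_zero.2 hx), one_smul]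

variable [CompleteSpace F]

/-- Hadamard's lemma in the first variable. -/
theorem exists_hadamard {f f₁ : ℝ → ℝ → F} (h : ∀ t s, HasDerivAt (fun x => f x s) (f₁ t s) t)
    (hc : Continuous ↿f₁) : ∃ V : ℝ → ℝ → ℝ → F,
      Continuous (fun p : ℝ × ℝ × ℝ => V p.1 p.2.1 p.2.2) ∧
      (∀ x t s, f x s - f t s = (x - t) • V x t s) ∧ ∀ t s, V t t s = f₁ t s := by
  refine ⟨fun x t s => ∫ θ in (0 : ℝ)..1, f₁ (t + θ * (x - t)) s, ?_, ?_, ?_⟩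
  · apply intervalIntegral.continuous_parametric_intervalIntegral_of_continuous'
    exact hc.comp (f := fun q : (ℝ × ℝ × ℝ) × ℝ => (q.1.2.1 + q.2 * (q.1.1 - q.1.2.1), q.1.2.2))
      (by fun_prop)
  · intro x t s
    have hd : ∀ θ ∈ Set.uIcc (0 : ℝ) 1, HasDerivAt (fun θ => f (t + θ * (x - t)) s)
        ((x - t) • f₁ (t + θ * (x - t)) s) θ := by
      intro θ _
      have h1 : HasDerivAt (fun θ : ℝ => t + θ * (x - t)) (x - t) θ := by
        simpa using ((hasDerivAt_id θ).mul_const (x - t)).const_add t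
      exact (h (t + θ * (x - t)) s).scomp θ h1
    have hi := intervalIntegral.integral_eq_sub_of_hasDerivAt hd (by
      apply Continuous.intervalIntegrable
      exact (hc.comp (f := fun θ : ℝ => (t + θ * (x - t), s)) (by fun_prop)).const_smul _)
    rw [intervalIntegral.integral_smul] at hi
    simpa using hi.symm
  · intro t s
    simp

/-- A parametric primitive of a continuously differentiable function. -/
theorem hasDerivAt_parametric_primitive {g g₁ : ℝ → ℝ → F}
    (h : ∀ t s, HasDerivAt (fun x => g x s) (g₁ t s) t) (hg : Continuous ↿g) (hc : Continuous ↿g₁)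
    (c t l : ℝ) :
    HasDerivAt (fun x => ∫ s in c..l, g x s) (∫ s in c..l, g₁ t s) t := by
  obtain ⟨V, hV, hVeq, hVd⟩ := exists_hadamard h hc
  have hcont : Continuous fun x => ∫ s in c..l, V x t s := by
    apply intervalIntegral.continuous_parametric_intervalIntegral_of_continuous'
    exact hV.comp (f := fun q : ℝ × ℝ => (q.1, t, q.2)) (by fun_prop)
  have hint : ∀ x, IntervalIntegrable (g x) MeasureTheory.volume c l := fun x =>
    (hg.comp (f := fun s : ℝ => (x, s)) (by fun_prop)).intervalIntegrable _ _
  have h1 := hasDerivAt_of_sub_eq_smul (f := fun x => ∫ s in c..l, g x s)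
    (V := fun x => ∫ s in c..l, V x t s) (t := t) (fun x => by
      rw [← intervalIntegral.integral_sub (hint x) (hint t), ← intervalIntegral.integral_smul]
      simp only [hVeq]) hcont.continuousAt
  simpa only [hVd] using h1

theorem hasDerivAt_primitive {g : ℝ → F} (hg : Continuous g) (c l : ℝ) :
    HasDerivAt (fun l => ∫ s in c..l, g s) (g l) l :=
  intervalIntegral.integral_hasDerivAt_right (hg.intervalIntegrable _ _)
    (hg.stronglyMeasurableAtFilter _ _) hg.continuousAt

theorem contDiff_parametric_primitive (n : ℕ) {g : ℝ → ℝ → F} (hg : ContDiff ℝ n ↿g) (c : ℝ) :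
    ContDiff ℝ n ↿(fun t l => ∫ s in c..l, g t s) := by
  induction n generalizing g with
  | zero =>
    rw [Nat.cast_zero, contDiff_zero] at hg ⊢
    exact intervalIntegral.continuous_parametric_primitive_of_continuous hg
  | succ n ih =>
    have hd : Differentiable ℝ ↿g := hg.differentiable (by simp)
    have hf : ContDiff ℝ n (fderiv ℝ ↿g) := by
      rw [show ((n + 1 : ℕ) : WithTop ℕ∞) = (n : WithTop ℕ∞) + 1 by norm_cast] at hg
      exact (contDiff_succ_iff_fderiv.1 hg).2.2
    set g₁ : ℝ → ℝ → F := fun t s => fderiv ℝ ↿g (t, s) (1, 0) with hg₁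
    have hc₁ : ContDiff ℝ n ↿g₁ := hf.clm_apply contDiff_const
    have h1 : ∀ t s, HasDerivAt (fun x => g x s) (g₁ t s) t := by
      intro t s
      have h2 : HasDerivAt (fun x : ℝ => (x, s)) (1, 0) t :=
        (hasDerivAt_id t).prodMk (hasDerivAt_const t s)
      exact (hd (t, s)).hasFDerivAt.comp_hasDerivAt t h2
    exact contDiff_succ_of_partial
      (fun t l => hasDerivAt_parametric_primitive h1 hg.continuous hc₁.continuous c t l)
      (fun t l => hasDerivAt_primitive (hg.continuous.comp (by fun_prop : Continuous fun s => (t, s))) c l)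
      (ih hc₁) (hg.of_le (by exact_mod_cast Nat.le_succ n))

end PartialDerivatives

section LinearODE

variable {𝔸 : Type*} [NormedRing 𝔸] [NormedAlgebra ℝ 𝔸] [CompleteSpace 𝔸]

/-- The iterated integrals of a linear differential equation. -/
def picardTerm (U : ℝ → ℝ → 𝔸) (c : ℝ) : ℕ → ℝ → ℝ → 𝔸
  | 0 => fun _ _ => 1
  | n + 1 => fun t l => ∫ s in c..l, U t s * picardTerm U c n t s

variable {U : ℝ → ℝ → 𝔸} (hU : Continuous ↿U) (c : ℝ)

include hU

theorem continuous_picardTerm (n : ℕ) : Continuous ↿(picardTerm U c n) := by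
  induction n with
  | zero => exact continuous_const
  | succ n ih =>
    exact intervalIntegral.continuous_parametric_primitive_of_continuous
      (f := fun t s => U t s * picardTerm U c n t s) (hU.mul ih)

/-- Each integration turns |s - c|^n / n! into |l - c|^(n+1) / (n+1)!, so the Picard series is
dominated by an exponential series locally uniformly. The factor ‖1‖ appears because the norm of the
unit is not assumed to be 1. -/
theorem norm_picardTerm_le {t R M : ℝ} (hM : ∀ s, |s - c| ≤ R → ‖U t s‖ ≤ M) (n : ℕ) {l : ℝ}
    (hl : |l - c| ≤ R) :
    ‖picardTerm U c n t l‖ ≤ ‖(1 : 𝔸)‖ * (M ^ n * |l - c| ^ n / n.factorial) := by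
  induction n generalizing l with
  | zero => simp [picardTerm]
  | succ n ih =>
    have hM0 : 0 ≤ M := (norm_nonneg _).trans (hM l hl)
    have hmem : ∀ s ∈ Set.uIoc c l, |s - c| ≤ |l - c| := by
      intro s hs
      exact Set.abs_sub_left_of_mem_uIcc (Set.uIoc_subset_uIcc hs)
    have hcont : Continuous fun s => U t s * picardTerm U c n t s :=
      (hU.mul (continuous_picardTerm hU c n)).comp (by fun_prop : Continuous fun s => (t, s))
    calc ‖picardTerm U c (n + 1) t l‖ ≤ ∫ s in Set.uIoc c l, ‖U t s * picardTerm U c n t s‖ :=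
          intervalIntegral.norm_integral_le_integral_norm_uIoc
      _ ≤ ∫ s in Set.uIoc c l, (‖(1 : 𝔸)‖ * (M ^ (n + 1) / n.factorial)) * |s - c| ^ n := by
          refine MeasureTheory.setIntegral_mono_on ?_ ?_ measurableSet_uIoc fun s hs => ?_
          · exact (hcont.norm.integrableOn_uIcc).mono_set Set.uIoc_subset_uIcc
          · have : Continuous fun s => (‖(1 : 𝔸)‖ * (M ^ (n + 1) / n.factorial)) * |s - c| ^ n := by
              fun_prop
            exact this.integrableOn_uIcc.mono_set Set.uIoc_subset_uIcc
          · have hs' := (hmem s hs).trans hl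
            calc ‖U t s * picardTerm U c n t s‖ ≤ ‖U t s‖ * ‖picardTerm U c n t s‖ := norm_mul_le _ _
              _ ≤ M * (‖(1 : 𝔸)‖ * (M ^ n * |s - c| ^ n / n.factorial)) :=
                mul_le_mul (hM s hs') (ih hs') (norm_nonneg _) hM0
              _ = _ := by ring
      _ = _ := by
          rw [MeasureTheory.integral_const_mul, integral_pow_abs_sub_uIoc, Nat.factorial_succ]
          push_cast
          field_simp

theorem exists_bound (t₀ R : ℝ) : ∃ M, ∀ t s, |t - t₀| ≤ R → |s - c| ≤ R → ‖U t s‖ ≤ M := by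
  obtain ⟨M, hM⟩ := ((isCompact_closedBall t₀ R).prod (isCompact_closedBall c R)).exists_bound_of_continuousOn
    hU.continuousOn
  exact ⟨M, fun t s ht hs => hM (t, s) ⟨by simpa [Real.dist_eq] using ht,
    by simpa [Real.dist_eq] using hs⟩⟩

/-- The fundamental solution of `Ψ' = U Ψ`. -/
theorem exists_fundamental : ∃ Ψ : ℝ → ℝ → 𝔸, Continuous ↿Ψ ∧ (∀ t, Ψ t c = 1) ∧
    ∀ t l, HasDerivAt (Ψ t) (U t l * Ψ t l) l := by
  set I := picardTerm U c with hI
  have hIc := continuous_picardTerm hU c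
  have hsum : ∀ M R : ℝ, Summable fun n : ℕ => ‖(1 : 𝔸)‖ * (M ^ n * R ^ n / n.factorial) := by
    intro M R
    simp_rw [← mul_pow]
    exact (Real.summable_pow_div_factorial (M * R)).mul_left _
  have hle : ∀ {t₀ R M : ℝ}, (∀ t s, |t - t₀| ≤ R → |s - c| ≤ R → ‖U t s‖ ≤ M) →
      ∀ n t l, |t - t₀| ≤ R → |l - c| ≤ R →
      ‖I n t l‖ ≤ ‖(1 : 𝔸)‖ * (M ^ n * R ^ n / n.factorial) := by
    intro t₀ R M hM n t l ht hl
    have hM0 : 0 ≤ M := (norm_nonneg _).trans (hM t l ht hl)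
    refine (norm_picardTerm_le hU c (fun s hs => hM t s ht hs) n hl).trans ?_
    gcongr
  refine ⟨fun t l => ∑' n, I n t l, ?_, ?_, ?_⟩
  · rw [continuous_iff_continuousAt]
    rintro ⟨t₀, l₀⟩
    obtain ⟨M, hM⟩ := exists_bound hU c t₀ (|l₀ - c| + 1)
    set B : Set (ℝ × ℝ) := {q | |q.1 - t₀| < |l₀ - c| + 1 ∧ |q.2 - c| < |l₀ - c| + 1} with hB
    have hBo : IsOpen B := by
      have c1 : Continuous fun q : ℝ × ℝ => |q.1 - t₀| := by fun_prop
      have c2 : Continuous fun q : ℝ × ℝ => |q.2 - c| := by fun_prop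
      exact (isOpen_lt c1 continuous_const).inter (isOpen_lt c2 continuous_const)
    have hmem : (t₀, l₀) ∈ B := by
      refine ⟨?_, by simp⟩
      simp only [sub_self, abs_zero]; positivity
    refine ContinuousOn.continuousAt (s := B) ?_ (hBo.mem_nhds hmem)
    exact continuousOn_tsum (fun n => (hIc n).continuousOn) (hsum M (|l₀ - c| + 1))
      (fun n q hq => hle hM n q.1 q.2 hq.1.le hq.2.le)
  · intro t
    have h0 : ∀ n, n ≠ 0 → I n t c = 0 := by
      intro n hn
      obtain ⟨k, rfl⟩ := Nat.exists_eq_succ_of_ne_zero hn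
      simp [hI, picardTerm]
    change ∑' n, I n t c = 1
    rw [tsum_eq_single 0 h0]
    rfl
  · intro t l
    obtain ⟨M, hM⟩ := exists_bound hU c t (|l - c| + 1)
    have hR : (0 : ℝ) ≤ |l - c| + 1 := by positivity
    have htt : |t - t| ≤ |l - c| + 1 := by simpa using hR
    have hball : ∀ s ∈ Metric.ball c (|l - c| + 1), |s - c| ≤ |l - c| + 1 := fun s hs => by
      rw [Metric.mem_ball, Real.dist_eq] at hs; exact hs.le
    have hIsum : ∀ s ∈ Metric.ball c (|l - c| + 1), Summable fun n => I n t s := fun s hs =>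
      Summable.of_norm_bounded (hsum M (|l - c| + 1)) fun n => hle hM n t s htt (hball s hs)
    have hl : l ∈ Metric.ball c (|l - c| + 1) := by simp [Real.dist_eq]
    have hd : ∀ n, ∀ s ∈ Metric.ball c (|l - c| + 1), HasDerivAt (I n t)
        (match n with | 0 => 0 | n + 1 => U t s * I n t s) s := by
      intro n s _
      cases n with
      | zero => exact hasDerivAt_const s 1
      | succ n =>
        exact hasDerivAt_primitive ((hU.mul (hIc n)).comp (by fun_prop : Continuous fun s => (t, s))) c s
    have hM0 : 0 ≤ M := (norm_nonneg _).trans (hM t c htt (by simpa using hR))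
    have hu : Summable fun n : ℕ => (match n with
        | 0 => 0
        | n + 1 => M * (‖(1 : 𝔸)‖ * (M ^ n * (|l - c| + 1) ^ n / n.factorial)) : ℝ) := by
      rw [← summable_nat_add_iff 1]
      exact (hsum M (|l - c| + 1)).mul_left M
    have h1 := hasDerivAt_tsum_of_isPreconnected hu Metric.isOpen_ball
      (convex_ball c (|l - c| + 1)).isPreconnected hd (fun n s hs => by
        cases n with
        | zero => simp
        | succ n =>
          exact (norm_mul_le _ _).trans (mul_le_mul (hM t s htt (hball s hs))
            (hle hM n t s htt (hball s hs)) (norm_nonneg _) hM0)) hl (hIsum l hl) hl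
    refine h1.congr_deriv (HasSum.tsum_eq ((hasSum_nat_add_iff' 1).1 ?_))
    simpa using (hIsum l hl).hasSum.mul_left (U t l)

end LinearODE

section SmoothDependence

variable {𝔸 : Type*} [NormedRing 𝔸] [NormedAlgebra ℝ 𝔸] [CompleteSpace 𝔸]

theorem eq_of_hasDerivAt_zero {f : ℝ → 𝔸} (h : ∀ x, HasDerivAt f 0 x) (x y : ℝ) : f x = f y :=
  is_const_of_deriv_eq_zero (fun x => (h x).differentiableAt) (fun x => (h x).deriv) x y

/-- The fundamental solution of `Ψ' = U Ψ` and its inverse `Φ`. -/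
theorem exists_fundamental_pair [IsDedekindFiniteMonoid 𝔸] {U : ℝ → ℝ → 𝔸} (hU : Continuous ↿U)
    (c : ℝ) : ∃ Ψ Φ : ℝ → ℝ → 𝔸, Continuous ↿Ψ ∧ Continuous ↿Φ ∧ (∀ t, Ψ t c = 1) ∧
      (∀ t, Φ t c = 1) ∧ (∀ t l, HasDerivAt (Ψ t) (U t l * Ψ t l) l) ∧
      (∀ t l, HasDerivAt (Φ t) (-(Φ t l * U t l)) l) ∧ (∀ t l, Φ t l * Ψ t l = 1) ∧
      ∀ t l, Ψ t l * Φ t l = 1 := by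
  obtain ⟨Ψ, hΨ, hΨc, hΨd⟩ := exists_fundamental hU c
  -- The inverse should satisfy Φ' = -ΦU, with the coefficient on the right; in the opposite algebra
  -- this is an equation of the kind already solved. The product ΦΨ then has derivative zero.
  obtain ⟨Φ', hΦ, hΦc, hΦd⟩ := exists_fundamental (U := fun t l => MulOpposite.op (-U t l))
    (MulOpposite.continuous_op.comp hU.neg) c
  have hd : ∀ t l, HasDerivAt (fun l => (Φ' t l).unop) (-((Φ' t l).unop * U t l)) l := by
    intro t l
    have := ((MulOpposite.opContinuousLinearEquiv ℝ (M := 𝔸)).symm.toContinuousLinearMap.hasFDerivAt).comp_hasDerivAt l (hΦd t l)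
    refine this.congr_deriv ?_
    simp
  have h1 : ∀ t l, (Φ' t l).unop * Ψ t l = 1 := by
    intro t l
    have h2 : ∀ l, HasDerivAt (fun l => (Φ' t l).unop * Ψ t l) 0 l := fun l =>
      ((hd t l).mul (hΨd t l)).congr_deriv (by noncomm_ring)
    rw [eq_of_hasDerivAt_zero h2 l c, hΨc, hΦc]
    simp
  exact ⟨Ψ, fun t l => (Φ' t l).unop, hΨ, MulOpposite.continuous_unop.comp hΦ, hΨc,
    fun t => by change (Φ' t c).unop = 1; rw [hΦc]; rfl, hΨd, hd, h1, fun t l => mul_eq_one_symm (h1 t l)⟩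

/-- The fundamental solution of a linear differential equation with smooth coefficients depends
smoothly on parameters. -/
theorem exists_smooth_fundamental_pair [IsDedekindFiniteMonoid 𝔸] {U : ℝ → ℝ → 𝔸}
    (hU : ContDiff ℝ ∞ ↿U) (c : ℝ) : ∃ Ψ Φ : ℝ → ℝ → 𝔸, ContDiff ℝ ∞ ↿Ψ ∧ ContDiff ℝ ∞ ↿Φ ∧
      (∀ t, Ψ t c = 1) ∧ (∀ t, Φ t c = 1) ∧ (∀ t l, HasDerivAt (Ψ t) (U t l * Ψ t l) l) ∧
      (∀ t l, HasDerivAt (Φ t) (-(Φ t l * U t l)) l) ∧ (∀ t l, Φ t l * Ψ t l = 1) ∧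
      ∀ t l, Ψ t l * Φ t l = 1 := by
  obtain ⟨Ψ, Φ, hΨ, hΦ, hΨc, hΦc, hΨd, hΦd, h1, h2⟩ := exists_fundamental_pair hU.continuous c
  set U₁ : ℝ → ℝ → 𝔸 := fun t s => fderiv ℝ ↿U (t, s) (1, 0) with hU₁
  have hc₁ : ContDiff ℝ ∞ ↿U₁ := (hU.fderiv_right (m := ∞) (by simp)).clm_apply contDiff_const
  have hUd : ∀ t s, HasDerivAt (fun x => U x s) (U₁ t s) t := by
    intro t s
    have h2 : HasDerivAt (fun x : ℝ => (x, s)) (1, 0) t :=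
      (hasDerivAt_id t).prodMk (hasDerivAt_const t s)
    exact ((hU.differentiable (by simp)) (t, s)).hasFDerivAt.comp_hasDerivAt t h2
  obtain ⟨V, hV, hVeq, hVd⟩ := exists_hadamard hUd hc₁.continuous
  set K : ℝ → ℝ → ℝ → 𝔸 := fun x t l => ∫ s in c..l, Φ t s * V x t s * Ψ x s with hK
  have hgc : Continuous fun p : ℝ × ℝ × ℝ => Φ p.2.1 p.2.2 * V p.1 p.2.1 p.2.2 * Ψ p.1 p.2.2 :=
    ((hΦ.comp (f := fun p : ℝ × ℝ × ℝ => (p.2.1, p.2.2)) (by fun_prop)).mul hV).mul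
      (hΨ.comp (f := fun p : ℝ × ℝ × ℝ => (p.1, p.2.2)) (by fun_prop))
  -- Variation of constants: Φ(t)Ψ(x) has l-derivative Φ(t)(U(x) - U(t))Ψ(x), and Hadamard's lemma
  -- extracts the factor x - t. The continuous K is thereby the difference quotient of the solution
  -- in the parameter.
  have hkey : ∀ x t l, Φ t l * Ψ x l = 1 + (x - t) • K x t l := by
    intro x t l
    have h3 : ∀ l, HasDerivAt (fun l => Φ t l * Ψ x l - (x - t) • K x t l) 0 l := by
      intro l
      have hk : HasDerivAt (K x t) (Φ t l * V x t l * Ψ x l) l :=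
        hasDerivAt_primitive (hgc.comp (by fun_prop : Continuous fun s : ℝ => (x, t, s))) c l
      refine (((hΦd t l).mul (hΨd x l)).sub (hk.const_smul (x - t))).congr_deriv ?_
      rw [← smul_mul_assoc, ← mul_smul_comm, ← hVeq]
      noncomm_ring
    have h4 := eq_of_hasDerivAt_zero h3 l c
    simp only [hΦc, hΨc, hK, intervalIntegral.integral_same, smul_zero, sub_zero, mul_one] at h4
    rw [← h4]; simp [hK]
  have hKc : ∀ l, Continuous fun p : ℝ × ℝ => K p.1 p.2 l := fun l => by
    apply intervalIntegral.continuous_parametric_intervalIntegral_of_continuous'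
    exact hgc.comp (f := fun q : (ℝ × ℝ) × ℝ => (q.1.1, q.1.2, q.2)) (by fun_prop)
  have hΨt : ∀ t l, HasDerivAt (fun x => Ψ x l) (Ψ t l * ∫ s in c..l, Φ t s * U₁ t s * Ψ t s) t := by
    intro t l
    have := hasDerivAt_of_sub_eq_smul (f := fun x => Ψ x l) (V := fun x => Ψ t l * K x t l) (t := t)
      (fun x => by
        have := congrArg (Ψ t l * ·) (hkey x t l)
        simp only [← mul_assoc, h2, one_mul, mul_add, mul_one, mul_smul_comm] at this
        rw [this]; simp)
      (continuous_const.mul ((hKc l).comp (by fun_prop : Continuous fun x : ℝ => (x, t)))).continuousAt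
    simpa only [hK, hVd] using this
  have hΦt : ∀ t l, HasDerivAt (fun x => Φ x l)
      (-((∫ s in c..l, Φ t s * U₁ t s * Ψ t s) * Φ t l)) t := by
    intro t l
    have := hasDerivAt_of_sub_eq_smul (f := fun x => Φ x l) (V := fun x => -(K t x l * Φ t l)) (t := t)
      (fun x => by
        have := congrArg (· * Φ t l) (hkey t x l)
        simp only [mul_assoc, h2, mul_one, add_mul, one_mul, smul_mul_assoc] at this
        rw [this, smul_neg, ← neg_smul]; simp)
      (((hKc l).comp (by fun_prop : Continuous fun x : ℝ => (t, x))).mul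
        continuous_const).neg.continuousAt
    simpa only [hK, hVd] using this
  -- Bootstrap: both partial derivatives of Ψ and Φ are expressed by Ψ, Φ, U and a parametric
  -- integral of them, so regularity of class n gives class n + 1.
  have hsm : ∀ n : ℕ, ContDiff ℝ n ↿Ψ ∧ ContDiff ℝ n ↿Φ := by
    intro n
    induction n with
    | zero => exact ⟨contDiff_zero.2 hΨ, contDiff_zero.2 hΦ⟩
    | succ n ih =>
      have hUn : ContDiff ℝ n ↿U := hU.of_le (by exact_mod_cast le_top)
      have hint : ContDiff ℝ n ↿(fun t l => ∫ s in c..l, Φ t s * U₁ t s * Ψ t s) :=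
        contDiff_parametric_primitive n (g := fun t s => Φ t s * U₁ t s * Ψ t s)
          ((ih.2.mul (hc₁.of_le (by exact_mod_cast le_top))).mul ih.1) c
      exact ⟨contDiff_succ_of_partial hΨt hΨd (ih.1.mul hint) (hUn.mul ih.1),
        contDiff_succ_of_partial hΦt hΦd (hint.mul ih.2).neg (ih.2.mul hUn).neg⟩
  exact ⟨Ψ, Φ, contDiff_infty.2 fun n => (hsm n).1, contDiff_infty.2 fun n => (hsm n).2, hΨc, hΦc,
    hΨd, hΦd, h1, h2⟩

end SmoothDependence

end

section

/-! ### Transfer of linear systems from the plane to open rectangles -/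

open Filter Topology

/-- A smooth parametrization of an open interval by the real line. -/
theorem exists_interval_chart {a b : ℝ} (hab : a < b) : ∃ φ ψ : ℝ → ℝ, ContDiff ℝ ∞ φ ∧
    ContDiffOn ℝ ∞ ψ (Set.Ioo a b) ∧ (∀ x, φ x ∈ Set.Ioo a b) ∧ (∀ x, ψ (φ x) = x) ∧
    (∀ y ∈ Set.Ioo a b, φ (ψ y) = y) := by
  have hr : 0 < (b - a) / 2 := by linarith
  have hball : Metric.ball ((a + b) / 2) ((b - a) / 2) = Set.Ioo a b := by
    rw [Real.ball_eq_Ioo]; congr 1 <;> ring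
  set e := OpenPartialHomeomorph.univBall ((a + b) / 2 : ℝ) ((b - a) / 2) with he
  have ht : e.target = Set.Ioo a b := by
    rw [he, OpenPartialHomeomorph.univBall_target _ hr, hball]
  have hs : e.source = Set.univ := OpenPartialHomeomorph.univBall_source _ _
  refine ⟨e, e.symm, OpenPartialHomeomorph.contDiff_univBall, ?_, ?_, ?_, ?_⟩
  · rw [← hball]; exact OpenPartialHomeomorph.contDiffOn_univBall_symm
  · intro x; rw [← ht]; exact e.map_source (by rw [hs]; trivial)
  · intro x; exact e.left_inv (by rw [hs]; trivial)
  · intro y hy; exact e.right_inv (by rwa [ht])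

section

variable {𝔸 : Type*} [NormedRing 𝔸] [NormedAlgebra ℝ 𝔸] [CompleteSpace 𝔸]

/-- Both sides of the rectangle are reparametrised by the real line. The coefficient picks up the
factor φ₂' and becomes smooth on the whole plane. -/
theorem exists_fundamental_pair_rect [IsDedekindFiniteMonoid 𝔸] {τ₀ τ₁ l₀ l₁ : ℝ} (hτ : τ₀ < τ₁)
    {U : ℝ → ℝ → 𝔸} (hU : ContDiffOn ℝ ∞ ↿U (rect τ₀ τ₁ l₀ l₁)) {c : ℝ} (hc : c ∈ Set.Ioo l₀ l₁) :
    ∃ Ψ Φ : ℝ → ℝ → 𝔸, ContDiffOn ℝ ∞ ↿Ψ (rect τ₀ τ₁ l₀ l₁) ∧ ContDiffOn ℝ ∞ ↿Φ (rect τ₀ τ₁ l₀ l₁) ∧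
      (∀ t, Ψ t c = 1) ∧ (∀ t, Φ t c = 1) ∧
      (∀ q ∈ rect τ₀ τ₁ l₀ l₁, HasDerivAt (Ψ q.1) (U q.1 q.2 * Ψ q.1 q.2) q.2) ∧
      (∀ q ∈ rect τ₀ τ₁ l₀ l₁, HasDerivAt (Φ q.1) (-(Φ q.1 q.2 * U q.1 q.2)) q.2) ∧
      (∀ t l, Φ t l * Ψ t l = 1) ∧ ∀ t l, Ψ t l * Φ t l = 1 := by
  obtain ⟨φ₁, ψ₁, hφ₁, hψ₁, hm₁, hl₁, hr₁⟩ := exists_interval_chart hτ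
  obtain ⟨φ₂, ψ₂, hφ₂, hψ₂, hm₂, hl₂, hr₂⟩ := exists_interval_chart (hc.1.trans hc.2)
  have hW : ContDiff ℝ ∞ (fun q : ℝ × ℝ => deriv φ₂ q.2 • U (φ₁ q.1) (φ₂ q.2)) := by
    have h1 : ContDiff ℝ ∞ (fun q : ℝ × ℝ => deriv φ₂ q.2) :=
      (contDiff_infty_iff_deriv.1 hφ₂).2.comp contDiff_snd
    have h2 : ContDiff ℝ ∞ (fun q : ℝ × ℝ => (φ₁ q.1, φ₂ q.2)) :=
      (hφ₁.comp contDiff_fst).prodMk (hφ₂.comp contDiff_snd)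
    exact h1.smul (hU.comp_contDiff h2 fun q => ⟨hm₁ _, hm₂ _⟩)
  obtain ⟨Ψ, Φ, hΨ, hΦ, hΨc, hΦc, hΨd, hΦd, h1, h2⟩ := exists_smooth_fundamental_pair
    (U := fun x y => deriv φ₂ y • U (φ₁ x) (φ₂ y)) hW (ψ₂ c)
  have hmap : ContDiffOn ℝ ∞ (fun q : ℝ × ℝ => (ψ₁ q.1, ψ₂ q.2)) (rect τ₀ τ₁ l₀ l₁) :=
    (hψ₁.comp contDiffOn_fst fun q hq => hq.1).prodMk (hψ₂.comp contDiffOn_snd fun q hq => hq.2)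
  have hψd : ∀ l ∈ Set.Ioo l₀ l₁, HasDerivAt ψ₂ (deriv ψ₂ l) l := fun l hl =>
    ((hψ₂.differentiableOn (by simp)).differentiableAt (isOpen_Ioo.mem_nhds hl)).hasDerivAt
  have hprod : ∀ l ∈ Set.Ioo l₀ l₁, deriv ψ₂ l * deriv φ₂ (ψ₂ l) = 1 := by
    intro l hl
    have hφd : HasDerivAt φ₂ (deriv φ₂ (ψ₂ l)) (ψ₂ l) :=
      (hφ₂.differentiable (by simp) _).hasDerivAt
    have h3 := hφd.comp l (hψd l hl)
    have h4 : HasDerivAt (φ₂ ∘ ψ₂) 1 l := (hasDerivAt_id l).congr_of_eventuallyEq <| by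
      filter_upwards [isOpen_Ioo.mem_nhds hl] with y hy using hr₂ y hy
    rw [mul_comm]; exact h3.unique h4
  refine ⟨fun t l => Ψ (ψ₁ t) (ψ₂ l), fun t l => Φ (ψ₁ t) (ψ₂ l), hΨ.comp_contDiffOn hmap,
    hΦ.comp_contDiffOn hmap, fun t => hΨc _, fun t => hΦc _, ?_, ?_, fun t l => h1 _ _,
    fun t l => h2 _ _⟩
  · rintro ⟨t, l⟩ ⟨ht, hl⟩
    refine ((hΨd (ψ₁ t) (ψ₂ l)).scomp l (hψd l hl)).congr_deriv ?_
    rw [smul_mul_assoc, smul_smul, hprod l hl, one_smul, hr₁ t ht, hr₂ l hl]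
  · rintro ⟨t, l⟩ ⟨ht, hl⟩
    refine ((hΦd (ψ₁ t) (ψ₂ l)).scomp l (hψd l hl)).congr_deriv ?_
    rw [mul_smul_comm, smul_neg, smul_smul, hprod l hl, one_smul, hr₁ t ht, hr₂ l hl]

end

open scoped Matrix.Norms.Operator in
/-- The fundamental matrix of a linear system along the second variable, and its inverse. -/
theorem exists_fundamental_matrix_right {ι : Type*} [Fintype ι] [DecidableEq ι]
    {τ₀ τ₁ l₀ l₁ : ℝ} (hτ : τ₀ < τ₁) {U : ℝ → ℝ → Matrix ι ι ℝ}
    (hU : ∀ i j, ContDiffOn ℝ ∞ (fun q : ℝ × ℝ => U q.1 q.2 i j) (rect τ₀ τ₁ l₀ l₁)) {c : ℝ}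
    (hc : c ∈ Set.Ioo l₀ l₁) : ∃ Ψ Φ : ℝ → ℝ → Matrix ι ι ℝ,
      (∀ i j, ContDiffOn ℝ ∞ (fun q : ℝ × ℝ => Ψ q.1 q.2 i j) (rect τ₀ τ₁ l₀ l₁)) ∧
      (∀ i j, ContDiffOn ℝ ∞ (fun q : ℝ × ℝ => Φ q.1 q.2 i j) (rect τ₀ τ₁ l₀ l₁)) ∧
      (∀ t, Ψ t c = 1) ∧ (∀ t, Φ t c = 1) ∧
      (∀ q ∈ rect τ₀ τ₁ l₀ l₁, ∀ i j,
        HasDerivAt (fun s => Ψ q.1 s i j) ((U q.1 q.2 * Ψ q.1 q.2) i j) q.2) ∧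
      (∀ q ∈ rect τ₀ τ₁ l₀ l₁, ∀ i j,
        HasDerivAt (fun s => Φ q.1 s i j) (-(Φ q.1 q.2 * U q.1 q.2) i j) q.2) ∧
      (∀ t l, Φ t l * Ψ t l = 1) ∧ ∀ t l, Ψ t l * Φ t l = 1 := by
  have hU' : ContDiffOn ℝ ∞ ↿U (rect τ₀ τ₁ l₀ l₁) := by
    have : (↿U : ℝ × ℝ → Matrix ι ι ℝ) =
        fun q => ∑ i, ∑ j, U q.1 q.2 i j • Matrix.single i j (1 : ℝ) := by
      ext1 q
      conv_lhs => rw [Matrix.matrix_eq_sum_single (↿U q)]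
      simp [Function.HasUncurry.uncurry, Matrix.smul_single]
    rw [this]
    exact ContDiffOn.sum fun i _ => ContDiffOn.sum fun j _ => (hU i j).smul contDiffOn_const
  let ent : ι → ι → Matrix ι ι ℝ →L[ℝ] ℝ := fun i j =>
    LinearMap.toContinuousLinearMap (Matrix.entryLinearMap ℝ ℝ i j)
  have hent : ∀ i j M, ent i j M = M i j := fun i j M => rfl
  obtain ⟨Ψ, Φ, hΨ, hΦ, hΨc, hΦc, hΨd, hΦd, h1, h2⟩ := exists_fundamental_pair_rect hτ hU' hc
  refine ⟨Ψ, Φ, fun i j => (ent i j).contDiff.comp_contDiffOn hΨ,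
    fun i j => (ent i j).contDiff.comp_contDiffOn hΦ, hΨc, hΦc, ?_, ?_, h1, h2⟩
  · exact fun q hq i j => (ent i j).hasFDerivAt.comp_hasDerivAt q.2 (hΨd q hq)
  · exact fun q hq i j => (ent i j).hasFDerivAt.comp_hasDerivAt q.2 (hΦd q hq)

theorem mem_rect_swap {τ₀ τ₁ l₀ l₁ : ℝ} {q : ℝ × ℝ} (hq : q ∈ rect τ₀ τ₁ l₀ l₁) :
    q.swap ∈ rect l₀ l₁ τ₀ τ₁ := ⟨hq.2, hq.1⟩

theorem contDiffOn_swap {F : Type*} [NormedAddCommGroup F] [NormedSpace ℝ F] {τ₀ τ₁ l₀ l₁ : ℝ}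
    {f : ℝ × ℝ → F} (hf : ContDiffOn ℝ ∞ f (rect τ₀ τ₁ l₀ l₁)) :
    ContDiffOn ℝ ∞ (fun q : ℝ × ℝ => f q.swap) (rect l₀ l₁ τ₀ τ₁) :=
  hf.comp (contDiff_snd.prodMk contDiff_fst).contDiffOn fun _ hq => mem_rect_swap hq

/-- The fundamental matrix of a linear system along the first variable, and its inverse. -/
theorem exists_fundamental_matrix_left {ι : Type*} [Fintype ι] [DecidableEq ι]
    {τ₀ τ₁ l₀ l₁ : ℝ} (hl : l₀ < l₁) {U : ℝ → ℝ → Matrix ι ι ℝ}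
    (hU : ∀ i j, ContDiffOn ℝ ∞ (fun q : ℝ × ℝ => U q.1 q.2 i j) (rect τ₀ τ₁ l₀ l₁)) {c : ℝ}
    (hc : c ∈ Set.Ioo τ₀ τ₁) : ∃ Ψ Φ : ℝ → ℝ → Matrix ι ι ℝ,
      (∀ i j, ContDiffOn ℝ ∞ (fun q : ℝ × ℝ => Ψ q.1 q.2 i j) (rect τ₀ τ₁ l₀ l₁)) ∧
      (∀ i j, ContDiffOn ℝ ∞ (fun q : ℝ × ℝ => Φ q.1 q.2 i j) (rect τ₀ τ₁ l₀ l₁)) ∧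
      (∀ l, Ψ c l = 1) ∧ (∀ l, Φ c l = 1) ∧
      (∀ q ∈ rect τ₀ τ₁ l₀ l₁, ∀ i j,
        HasDerivAt (fun s => Ψ s q.2 i j) ((U q.1 q.2 * Ψ q.1 q.2) i j) q.1) ∧
      (∀ q ∈ rect τ₀ τ₁ l₀ l₁, ∀ i j,
        HasDerivAt (fun s => Φ s q.2 i j) (-(Φ q.1 q.2 * U q.1 q.2) i j) q.1) ∧
      (∀ t l, Φ t l * Ψ t l = 1) ∧ ∀ t l, Ψ t l * Φ t l = 1 := by
  obtain ⟨Ψ, Φ, hΨ, hΦ, hΨc, hΦc, hΨd, hΦd, h1, h2⟩ := exists_fundamental_matrix_right hl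
    (U := fun l t => U t l) (fun i j => contDiffOn_swap (hU i j)) hc
  exact ⟨fun t l => Ψ l t, fun t l => Φ l t, fun i j => contDiffOn_swap (hΨ i j),
    fun i j => contDiffOn_swap (hΦ i j), hΨc, hΦc, fun q hq => hΨd q.swap (mem_rect_swap hq),
    fun q hq => hΦd q.swap (mem_rect_swap hq), fun t l => h1 l t, fun t l => h2 l t⟩

end

section

open Filter Topology TopologicalSpace

/-! ### The differential algebra of smooth functions on an open subset of the plane -/

/-- The subalgebra of smooth functions on `Q`. -/
def smoothSubalgebra (Q : Opens (ℝ × ℝ)) : Subalgebra ℝ (Q → ℝ) where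
  carrier := {f | ∃ F : ℝ × ℝ → ℝ, ContDiffOn ℝ ∞ F Q ∧ ∀ q : Q, F q = f q}
  mul_mem' := by
    rintro f g ⟨F, hF, hFf⟩ ⟨G, hG, hGg⟩
    exact ⟨fun q => F q * G q, hF.mul hG, fun q => by simp [hFf, hGg]⟩
  add_mem' := by
    rintro f g ⟨F, hF, hFf⟩ ⟨G, hG, hGg⟩
    exact ⟨fun q => F q + G q, hF.add hG, fun q => by simp [hFf, hGg]⟩
  algebraMap_mem' := fun r => ⟨fun _ => r, contDiffOn_const, fun _ => rfl⟩

/-- Smooth functions on `Q`. -/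
def smoothFun (Q : Opens (ℝ × ℝ)) : Type := smoothSubalgebra Q

instance (Q : Opens (ℝ × ℝ)) : CommRing (smoothFun Q) :=
  inferInstanceAs (CommRing (smoothSubalgebra Q))

instance (Q : Opens (ℝ × ℝ)) : Algebra ℝ (smoothFun Q) :=
  inferInstanceAs (Algebra ℝ (smoothSubalgebra Q))

variable {Q : Opens (ℝ × ℝ)}

namespace smoothFun

/-- The restriction of a function of two variables to `Q`. -/
def mk (Q : Opens (ℝ × ℝ)) (f : ℝ → ℝ → ℝ)
    (hf : ContDiffOn ℝ ∞ (fun q : ℝ × ℝ => f q.1 q.2) Q) : smoothFun Q :=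
  ⟨fun q => f q.1.1 q.1.2, fun q => f q.1 q.2, hf, fun _ => rfl⟩

/-- The value at a point of `Q`. -/
def ev (q : Q) : smoothFun Q →ₐ[ℝ] ℝ := (Pi.evalAlgHom ℝ (fun _ : Q => ℝ) q).comp (smoothSubalgebra Q).val

theorem ext_ev {f g : smoothFun Q} (h : ∀ q, ev q f = ev q g) : f = g :=
  Subtype.ext (funext h)

open Classical in
/-- The extension by zero. -/
def out (f : smoothFun Q) (τ l : ℝ) : ℝ := if h : (τ, l) ∈ Q then ev ⟨(τ, l), h⟩ f else 0

theorem out_eq (f : smoothFun Q) (q : Q) : out f q.1.1 q.1.2 = ev q f := by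
  rw [out, dif_pos (show (q.1.1, q.1.2) ∈ Q from q.2)]

theorem contDiffOn_out (f : smoothFun Q) : ContDiffOn ℝ ∞ (fun q : ℝ × ℝ => out f q.1 q.2) Q := by
  obtain ⟨F, hF, hFf⟩ := f.2
  refine hF.congr fun q hq => ?_
  rw [out_eq f ⟨q, hq⟩]
  exact (hFf ⟨q, hq⟩).symm

@[simp] theorem ev_mk {f : ℝ → ℝ → ℝ} (hf : ContDiffOn ℝ ∞ (fun q : ℝ × ℝ => f q.1 q.2) Q) (q : Q) :
    ev q (mk Q f hf) = f q.1.1 q.1.2 := rfl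

theorem mk_out (f : smoothFun Q) : mk Q (out f) (contDiffOn_out f) = f :=
  ext_ev fun q => by rw [ev_mk, out_eq]

theorem contDiffOn_fderiv {f : ℝ → ℝ → ℝ} (hf : ContDiffOn ℝ ∞ (fun q : ℝ × ℝ => f q.1 q.2) Q)
    (w : ℝ × ℝ) : ContDiffOn ℝ ∞ (fun q : ℝ × ℝ => fderiv ℝ (fun p : ℝ × ℝ => f p.1 p.2) q w) Q :=
  (hf.fderiv_of_isOpen Q.isOpen (by simp)).clm_apply contDiffOn_const

theorem differentiableAt_out (f : smoothFun Q) (q : Q) :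
    DifferentiableAt ℝ (fun p : ℝ × ℝ => out f p.1 p.2) q.1 :=
  ((contDiffOn_out f).differentiableOn (by simp)).differentiableAt (Q.isOpen.mem_nhds q.2)

/-- The derivative in the direction `w`, as a function. -/
def dirFun (w : ℝ × ℝ) (f : smoothFun Q) : smoothFun Q :=
  mk Q (fun τ l => fderiv ℝ (fun p : ℝ × ℝ => out f p.1 p.2) (τ, l) w)
    (contDiffOn_fderiv (contDiffOn_out f) w)

theorem ev_dirFun (w : ℝ × ℝ) (f : smoothFun Q) (q : Q) :
    ev q (dirFun w f) = fderiv ℝ (fun p : ℝ × ℝ => out f p.1 p.2) q.1 w := rfl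

theorem ev_dirFun_of_eventuallyEq (w : ℝ × ℝ) (f : smoothFun Q) (q : Q) {F : ℝ × ℝ → ℝ}
    (h : ∀ p : Q, F p = ev p f) : ev q (dirFun w f) = fderiv ℝ F q.1 w := by
  have : (fun p : ℝ × ℝ => out f p.1 p.2) =ᶠ[𝓝 q.1] F := by
    filter_upwards [Q.isOpen.mem_nhds q.2] with p hp
    rw [h ⟨p, hp⟩]; exact out_eq f ⟨p, hp⟩
  rw [ev_dirFun, this.fderiv_eq]

/-- The derivation of smooth functions in the direction `w`. -/
def dir (w : ℝ × ℝ) : Derivation ℝ (smoothFun Q) (smoothFun Q) :=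
  Derivation.mk'
    { toFun := dirFun w
      map_add' := fun f g => ext_ev fun q => by
        rw [ev_dirFun_of_eventuallyEq w (f + g) q (F := (fun p : ℝ × ℝ => out f p.1 p.2) +
          fun p : ℝ × ℝ => out g p.1 p.2) (fun p => by simp [out_eq]),
          fderiv_add (differentiableAt_out f q) (differentiableAt_out g q), map_add]
        rfl
      map_smul' := fun r f => ext_ev fun q => by
        rw [ev_dirFun_of_eventuallyEq w (r • f) q (F := r • (fun p : ℝ × ℝ => out f p.1 p.2))
          (fun p => by simp [out_eq]), fderiv_const_smul (differentiableAt_out f q), map_smul]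
        rfl }
    fun f g => ext_ev fun q => by
      change ev q (dirFun w (f * g)) = ev q (f • dirFun w g + g • dirFun w f)
      rw [ev_dirFun_of_eventuallyEq w (f * g) q (F := (fun p : ℝ × ℝ => out f p.1 p.2) *
          fun p : ℝ × ℝ => out g p.1 p.2) (fun p => by simp [out_eq]),
          fderiv_mul (differentiableAt_out f q) (differentiableAt_out g q)]
      simp only [smul_eq_mul, map_add, map_mul, ev_dirFun, out_eq, add_apply,
        smul_apply]

theorem ev_dir_mk (w : ℝ × ℝ) {f : ℝ → ℝ → ℝ}
    (hf : ContDiffOn ℝ ∞ (fun q : ℝ × ℝ => f q.1 q.2) Q) (q : Q) :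
    ev q (dir w (mk Q f hf)) = fderiv ℝ (fun p : ℝ × ℝ => f p.1 p.2) q.1 w :=
  ev_dirFun_of_eventuallyEq w _ q fun _ => rfl

/-- Symmetry of the second derivative. The commuting pair `dl`, `dt` is what makes the structure
equations a matter of pure algebra. -/
theorem dir_comm (w z : ℝ × ℝ) (f : smoothFun Q) : dir w (dir z f) = dir z (dir w f) := by
  refine ext_ev fun q => ?_
  have key : ∀ w z, ev q (dir w (dir z f)) =
      fderiv ℝ (fderiv ℝ (fun p : ℝ × ℝ => out f p.1 p.2)) q.1 w z := by
    intro w z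
    rw [show dir z f = mk Q (fun τ l => fderiv ℝ (fun p : ℝ × ℝ => out f p.1 p.2) (τ, l) z)
      (contDiffOn_fderiv (contDiffOn_out f) z) from rfl, ev_dir_mk]
    have hd : DifferentiableAt ℝ (fderiv ℝ (fun p : ℝ × ℝ => out f p.1 p.2)) q.1 :=
      (((contDiffOn_out f).fderiv_of_isOpen (m := ∞) Q.isOpen (by simp)).differentiableOn
        (by simp)).differentiableAt (Q.isOpen.mem_nhds q.2)
    rw [show (fun p : ℝ × ℝ => fderiv ℝ (fun p : ℝ × ℝ => out f p.1 p.2) (p.1, p.2) z) =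
      fun p => (fderiv ℝ (fun p : ℝ × ℝ => out f p.1 p.2) p) z from rfl,
      fderiv_clm_apply hd (differentiableAt_const _)]
    simp
  rw [key, key]
  have hs : ContDiffAt ℝ ∞ (fun p : ℝ × ℝ => out f p.1 p.2) q.1 :=
    (contDiffOn_out f).contDiffAt (Q.isOpen.mem_nhds q.2)
  exact (hs.isSymmSndFDerivAt (by simpa using WithTop.coe_le_coe.2 (le_top : (2 : ℕ∞) ≤ ⊤))).eq w z

/-- The partial derivative with respect to the second variable. -/
def dl : Derivation ℝ (smoothFun Q) (smoothFun Q) := dir (0, 1)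

/-- The partial derivative with respect to the first variable. -/
def dt : Derivation ℝ (smoothFun Q) (smoothFun Q) := dir (1, 0)

theorem dl_dt (f : smoothFun Q) : dl (dt f) = dt (dl f) := dir_comm _ _ f

theorem hasDerivAt_snd {f : ℝ → ℝ → ℝ} (hf : ContDiffOn ℝ ∞ (fun q : ℝ × ℝ => f q.1 q.2) Q) (q : Q) :
    HasDerivAt (fun s => f q.1.1 s) (ev q (dl (mk Q f hf))) q.1.2 := by
  have h1 : HasDerivAt (fun s : ℝ => (q.1.1, s)) (0, 1) q.1.2 :=
    (hasDerivAt_const _ _).prodMk (hasDerivAt_id _)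
  have h2 := ((hf.differentiableOn (by simp)).differentiableAt (Q.isOpen.mem_nhds q.2)).hasFDerivAt
  rw [dl, ev_dir_mk]
  exact HasFDerivAt.comp_hasDerivAt (f := fun s : ℝ => (q.1.1, s)) q.1.2 h2 h1

theorem hasDerivAt_fst {f : ℝ → ℝ → ℝ} (hf : ContDiffOn ℝ ∞ (fun q : ℝ × ℝ => f q.1 q.2) Q) (q : Q) :
    HasDerivAt (fun s => f s q.1.2) (ev q (dt (mk Q f hf))) q.1.1 := by
  have h1 : HasDerivAt (fun s : ℝ => (s, q.1.2)) (1, 0) q.1.1 :=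
    (hasDerivAt_id _).prodMk (hasDerivAt_const _ _)
  have h2 := ((hf.differentiableOn (by simp)).differentiableAt (Q.isOpen.mem_nhds q.2)).hasFDerivAt
  rw [dt, ev_dir_mk]
  exact HasFDerivAt.comp_hasDerivAt (f := fun s : ℝ => (s, q.1.2)) q.1.1 h2 h1

/-- `f` and `g` agree on `Q`, hence so do their derivatives. -/
theorem deriv_snd_congr {f : ℝ → ℝ → ℝ} (g : smoothFun Q) (h : ∀ q : Q, f q.1.1 q.1.2 = ev q g)
    (q : Q) : deriv (fun s => f q.1.1 s) q.1.2 = ev q (dl g) := by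
  have hf : ContDiffOn ℝ ∞ (fun q : ℝ × ℝ => f q.1 q.2) Q :=
    (contDiffOn_out g).congr fun q hq => (h ⟨q, hq⟩).trans (out_eq g ⟨q, hq⟩).symm
  rw [(hasDerivAt_snd hf q).deriv]
  congr 2
  exact ext_ev fun q => h q

theorem deriv_fst_congr {f : ℝ → ℝ → ℝ} (g : smoothFun Q) (h : ∀ q : Q, f q.1.1 q.1.2 = ev q g)
    (q : Q) : deriv (fun s => f s q.1.2) q.1.1 = ev q (dt g) := by
  have hf : ContDiffOn ℝ ∞ (fun q : ℝ × ℝ => f q.1 q.2) Q :=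
    (contDiffOn_out g).congr fun q hq => (h ⟨q, hq⟩).trans (out_eq g ⟨q, hq⟩).symm
  rw [(hasDerivAt_fst hf q).deriv]
  congr 2
  exact ext_ev fun q => h q

/-! #### Differential polynomials -/

section Jet

variable {m : ℕ}

/-- The substitution of smooth functions in a differential polynomial. -/
def subst (v : Fin m → smoothFun Q) : DiffPoly m →ₐ[ℝ] smoothFun Q :=
  MvPolynomial.aeval fun q => (dl)^[q.2] (v q.1)

/-- Substitution is a homomorphism of differential algebras, so identities of the hierarchy hold
verbatim for smooth functions. -/
theorem subst_totalD (v : Fin m → smoothFun Q) (f : DiffPoly m) :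
    subst v (totalD m f) = dl (subst v f) := by
  induction f using MvPolynomial.induction_on with
  | C r => simp [← MvPolynomial.algebraMap_eq]
  | add p q hp hq => simp only [map_add, hp, hq]
  | mul_X p q hp =>
    rw [Derivation.leibniz, map_mul, Derivation.leibniz, map_add, smul_eq_mul, smul_eq_mul, map_mul,
      map_mul, hp, totalD_X, smul_eq_mul, smul_eq_mul]
    simp only [subst, MvPolynomial.aeval_X, Function.iterate_succ_apply']

theorem iteratedDeriv_eq {f : ℝ → ℝ → ℝ} (g : smoothFun Q) (h : ∀ q : Q, f q.1.1 q.1.2 = ev q g)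
    (j : ℕ) (q : Q) : iteratedDeriv j (fun s => f q.1.1 s) q.1.2 = ev q (dl^[j] g) := by
  induction j generalizing q with
  | zero => simpa using h q
  | succ j ih =>
    rw [iteratedDeriv_succ, Function.iterate_succ_apply']
    exact deriv_snd_congr (f := fun τ l => iteratedDeriv j (fun s => f τ s) l) (dl^[j] g) ih q

theorem evalJet_eq {v : ℝ → ℝ → Fin m → ℝ} {w : Fin m → smoothFun Q}
    (h : ∀ a, ∀ q : Q, v q.1.1 q.1.2 a = ev q (w a)) (f : DiffPoly m) (q : Q) :
    evalJet v f q.1.1 q.1.2 = ev q (subst w f) := by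
  have : (ev q).comp (subst w) =
      MvPolynomial.aeval fun p : Fin m × ℕ => iteratedDeriv p.2 (fun s => v q.1.1 s p.1) q.1.2 := by
    refine MvPolynomial.algHom_ext fun p => ?_
    rw [AlgHom.comp_apply, MvPolynomial.aeval_X, subst, MvPolynomial.aeval_X]
    exact (iteratedDeriv_eq (f := fun τ l => v τ l p.1) (w p.1) (h p.1) p.2 q).symm
  rw [← AlgHom.comp_apply, this, evalJet, MvPolynomial.aeval_eq_eval]

end Jet

end smoothFun

end

section

/-! ### Moving frames adapted to a unit vector field -/

section BlockMatrices

variable {m : ℕ} {R : Type*} [CommRing R]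

/-- The block matrix `diag(1, A)`. -/
def blockOne (A : Matrix (Fin m) (Fin m) R) : Matrix (Fin (m + 1)) (Fin (m + 1)) R :=
  fun i j => Fin.cases (Fin.cases 1 (fun _ => 0) j) (fun a => Fin.cases 0 (fun b => A a b) j) i

variable (A B : Matrix (Fin m) (Fin m) R)

@[simp] theorem blockOne_zero_zero : blockOne A 0 0 = 1 := rfl
@[simp] theorem blockOne_zero_succ (b : Fin m) : blockOne A 0 b.succ = 0 := rfl
@[simp] theorem blockOne_succ_zero (a : Fin m) : blockOne A a.succ 0 = 0 := rfl
@[simp] theorem blockOne_succ_succ (a b : Fin m) : blockOne A a.succ b.succ = A a b := rfl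

theorem matrix_ext_succ {M N : Matrix (Fin (m + 1)) (Fin (m + 1)) R} (h00 : M 0 0 = N 0 0)
    (h01 : ∀ b : Fin m, M 0 b.succ = N 0 b.succ) (h10 : ∀ a : Fin m, M a.succ 0 = N a.succ 0)
    (h11 : ∀ a b : Fin m, M a.succ b.succ = N a.succ b.succ) : M = N := by
  ext i j
  refine Fin.cases ?_ (fun a => ?_) i <;> refine Fin.cases ?_ (fun b => ?_) j
  exacts [h00, h01 b, h10 a, h11 a b]

theorem blockOne_mul : blockOne A * blockOne B = blockOne (A * B) := by
  apply matrix_ext_succ <;> simp [Matrix.mul_apply, Fin.sum_univ_succ]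

theorem blockOne_one : blockOne (1 : Matrix (Fin m) (Fin m) R) = 1 := by
  apply matrix_ext_succ <;> simp [Matrix.one_apply, Fin.succ_ne_zero, (Fin.succ_ne_zero _).symm]

theorem blockOne_transpose : (blockOne A).transpose = blockOne A.transpose := by
  apply matrix_ext_succ <;> simp

variable [Algebra ℝ R]

theorem blockOne_map (κ : Matrix (Fin m) (Fin m) ℝ) :
    (blockOne κ).map (algebraMap ℝ R) = blockOne (κ.map (algebraMap ℝ R)) := by
  apply matrix_ext_succ <;> simp

/-- The connection matrix of an adapted frame, with the normal vector `w` as its first column. -/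
def frameConn (κ : Matrix (Fin m) (Fin m) ℝ) (w : Fin m → R) (Λ : Matrix (Fin m) (Fin m) R) :
    Matrix (Fin (m + 1)) (Fin (m + 1)) R :=
  fun i j => Fin.cases (Fin.cases 0 (fun b => -((κ.map (algebraMap ℝ R)).mulVec w b)) j)
    (fun a => Fin.cases (w a) (fun b => Λ a b) j) i

variable (κ : Matrix (Fin m) (Fin m) ℝ) (w w' : Fin m → R) (Λ Λ' : Matrix (Fin m) (Fin m) R)

@[simp] theorem frameConn_zero_zero : frameConn κ w Λ 0 0 = 0 := rfl
@[simp] theorem frameConn_zero_succ (b : Fin m) :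
    frameConn κ w Λ 0 b.succ = -((κ.map (algebraMap ℝ R)).mulVec w b) := rfl
@[simp] theorem frameConn_succ_zero (a : Fin m) : frameConn κ w Λ a.succ 0 = w a := rfl
@[simp] theorem frameConn_succ_succ (a b : Fin m) : frameConn κ w Λ a.succ b.succ = Λ a b := rfl

variable {κ} in
theorem blockOne_mul_frameConn (hκ : κ.IsSymm)
    (hΛ : κ.map (algebraMap ℝ R) * Λ + Λ.transpose * κ.map (algebraMap ℝ R) = 0) :
    blockOne (κ.map (algebraMap ℝ R)) * frameConn κ w Λ +
      (frameConn κ w Λ).transpose * blockOne (κ.map (algebraMap ℝ R)) = 0 := by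
  have hs : ∀ a b, algebraMap ℝ R (κ a b) = algebraMap ℝ R (κ b a) := fun a b => by rw [hκ.apply]
  apply matrix_ext_succ
  · simp [Matrix.mul_apply, Fin.sum_univ_succ]
  · intro b
    simp [Matrix.mul_apply, Fin.sum_univ_succ, Matrix.mulVec, dotProduct]
    rw [neg_add_eq_zero]
    exact Finset.sum_congr rfl fun a _ => by rw [hs, mul_comm]
  · intro a
    simp [Matrix.mul_apply, Fin.sum_univ_succ, Matrix.mulVec, dotProduct]
  · intro a b
    have := congrFun (congrFun hΛ a) b
    simpa [Matrix.mul_apply, Fin.sum_univ_succ] using this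

variable {κ} in
-- A matrix that is skew for diag(1, κ) has zero corner, as twice the corner vanishes, and its first
-- row is determined by its first column.
theorem eq_frameConn_of_skew (hκ : κ.IsSymm) {T : Matrix (Fin (m + 1)) (Fin (m + 1)) R}
    (hT : blockOne (κ.map (algebraMap ℝ R)) * T +
      T.transpose * blockOne (κ.map (algebraMap ℝ R)) = 0) :
    T = frameConn κ (fun a => T a.succ 0) (T.submatrix Fin.succ Fin.succ) := by
  have hs : ∀ a b, algebraMap ℝ R (κ a b) = algebraMap ℝ R (κ b a) := fun a b => by rw [hκ.apply]
  apply matrix_ext_succ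
  · have := congrFun (congrFun hT 0) 0
    simp [Matrix.mul_apply, Fin.sum_univ_succ] at this
    have h2 : (2 : ℝ) • T 0 0 = 0 := by rw [two_smul]; exact this
    have h3 := congrArg (fun x => (1 / 2 : ℝ) • x) h2
    rw [frameConn_zero_zero]
    simpa [smul_smul] using h3
  · intro b
    have := congrFun (congrFun hT 0) b.succ
    simp [Matrix.mul_apply, Fin.sum_univ_succ] at this
    rw [frameConn_zero_succ, eq_neg_iff_add_eq_zero, ← this]
    simp only [Matrix.mulVec, dotProduct, Matrix.map_apply]
    congr 1
    exact Finset.sum_congr rfl fun a _ => by rw [hs, mul_comm]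
  · intro a; rfl
  · intro a b; rfl

theorem skew_of_blockOne_skew {T : Matrix (Fin (m + 1)) (Fin (m + 1)) R}
    (hT : blockOne (κ.map (algebraMap ℝ R)) * T +
      T.transpose * blockOne (κ.map (algebraMap ℝ R)) = 0) :
    κ.map (algebraMap ℝ R) * T.submatrix Fin.succ Fin.succ +
      (T.submatrix Fin.succ Fin.succ).transpose * κ.map (algebraMap ℝ R) = 0 := by
  ext a b
  have := congrFun (congrFun hT a.succ) b.succ
  simpa [Matrix.mul_apply, Fin.sum_univ_succ] using this

/-- The commutator of infinitesimal isometries is one. -/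
theorem skew_commutator {n : Type*} [Fintype n] {K T U : Matrix n n R}
    (hT : K * T + T.transpose * K = 0) (hU : K * U + U.transpose * K = 0) :
    K * (T * U - U * T) + (T * U - U * T).transpose * K = 0 := by
  have h1 : K * T = -(T.transpose * K) := eq_neg_of_add_eq_zero_left hT
  have h2 : K * U = -(U.transpose * K) := eq_neg_of_add_eq_zero_left hU
  rw [Matrix.transpose_sub, Matrix.transpose_mul, Matrix.transpose_mul, Matrix.mul_sub,
    Matrix.sub_mul, ← Matrix.mul_assoc, ← Matrix.mul_assoc, h1, h2]
  simp only [Matrix.neg_mul, Matrix.mul_assoc, h1, h2, Matrix.mul_neg]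
  abel

end BlockMatrices

section AdaptedFrames

variable {m : ℕ} {R : Type*} [CommRing R] [Algebra ℝ R]

theorem dmat_transpose (d : Derivation ℝ R R) (A : Matrix (Fin m) (Fin m) R) :
    dmat d A.transpose = (dmat d A).transpose := rfl

theorem dmat_blockOne (d : Derivation ℝ R R) (A : Matrix (Fin m) (Fin m) R) :
    dmat d (blockOne A) = blockOne (dmat d A) - blockOne 0 := by
  apply matrix_ext_succ <;> simp [dmat]

theorem dmat_zero (d : Derivation ℝ R R) : dmat d (0 : Matrix (Fin m) (Fin m) R) = 0 := by
  ext a b; simp [dmat]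

theorem dv_mulVec (d : Derivation ℝ R R) (A : Matrix (Fin m) (Fin m) R) (x : Fin m → R) :
    dv d (A.mulVec x) = (dmat d A).mulVec x + A.mulVec (dv d x) := by
  ext a; exact deriv_dotProduct (fun c => A a c) x d

/-- `P` is a frame, with constant Gram matrix `diag(1, κ)` for the constant metric `G`, in which the
derivation `d` has the connection coefficients `frameConn κ v Λ`. -/
structure IsAdaptedFrame (d : Derivation ℝ R R) (G : Matrix (Fin (m + 1)) (Fin (m + 1)) ℝ)
    (κ : Matrix (Fin m) (Fin m) ℝ) (P : Matrix (Fin (m + 1)) (Fin (m + 1)) R) (v : Fin m → R) :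
    Prop where
  gram : P.transpose * G.map (algebraMap ℝ R) * P = blockOne (κ.map (algebraMap ℝ R))
  conn : dmat d P = P * frameConn κ v 0

variable {d e : Derivation ℝ R R} {G : Matrix (Fin (m + 1)) (Fin (m + 1)) ℝ}
  {κ : Matrix (Fin m) (Fin m) ℝ}

theorem map_mul_map_inv (hdet : κ.det ≠ 0) :
    κ.map (algebraMap ℝ R) * κ⁻¹.map (algebraMap ℝ R) = 1 := by
  rw [← Matrix.map_mul, Matrix.mul_nonsing_inv _ (isUnit_iff_ne_zero.2 hdet)]
  simp

theorem map_inv_mul_map (hdet : κ.det ≠ 0) :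
    κ⁻¹.map (algebraMap ℝ R) * κ.map (algebraMap ℝ R) = 1 := by
  rw [← Matrix.map_mul, Matrix.nonsing_inv_mul _ (isUnit_iff_ne_zero.2 hdet)]
  simp

theorem exists_inverse_of_gram (hdet : κ.det ≠ 0) {P : Matrix (Fin (m + 1)) (Fin (m + 1)) R}
    (h : P.transpose * G.map (algebraMap ℝ R) * P = blockOne (κ.map (algebraMap ℝ R))) :
    ∃ P', P' * P = 1 ∧ P * P' = 1 := by
  have h1 : (blockOne (κ⁻¹.map (algebraMap ℝ R)) * (P.transpose * G.map (algebraMap ℝ R))) * P = 1 := by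
    rw [Matrix.mul_assoc, h, blockOne_mul, map_inv_mul_map hdet, blockOne_one]
  exact ⟨_, h1, mul_eq_one_comm.1 h1⟩

/-- The derivative of a frame with constant Gram matrix. -/
theorem skew_of_gram {P T : Matrix (Fin (m + 1)) (Fin (m + 1)) R}
    (h : P.transpose * G.map (algebraMap ℝ R) * P = blockOne (κ.map (algebraMap ℝ R)))
    (hT : dmat e P = P * T) :
    blockOne (κ.map (algebraMap ℝ R)) * T +
      T.transpose * blockOne (κ.map (algebraMap ℝ R)) = 0 := by
  have h1 := congrArg (dmat e) h
  rw [dmat_mul, dmat_mul, dmat_algebraMap, dmat_transpose, hT, ← blockOne_map, dmat_algebraMap,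
    Matrix.mul_zero, add_zero, Matrix.transpose_mul] at h1
  rw [← h1, ← h]
  simp only [Matrix.mul_assoc]
  exact add_comm _ _

/-- The structure equations of the flow of a unit vector field in a parallel frame. -/
theorem IsAdaptedFrame.structure_equations (hde : ∀ f, d (e f) = e (d f))
    (hκ : κ.IsSymm) (hdet : κ.det ≠ 0) {P : Matrix (Fin (m + 1)) (Fin (m + 1)) R} {v : Fin m → R}
    (hP : IsAdaptedFrame d G κ P v) {Y : Fin (m + 1) → R}
    (hY : dv d Y = dv e fun i => P i 0) :
    ∃ (h : R) (hp ϖ : Fin m → R) (Θ : Matrix (Fin m) (Fin m) R),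
      Y = P.mulVec (Fin.cons h hp) ∧ d h = gdot κ v hp ∧
      (dv e fun i => P i 0) = P.mulVec (Fin.cons 0 ϖ) ∧ ϖ = dv d hp + h • v ∧
      Θ.transpose = -Θ ∧ dmat d Θ = gwedge v ϖ ∧ dv e v = dv d ϖ + gint κ v Θ := by
  obtain ⟨P', hP'P, hPP'⟩ := exists_inverse_of_gram hdet hP.gram
  have hcancel : ∀ {x y : Fin (m + 1) → R}, P.mulVec x = P.mulVec y → x = y := fun {x y} h => by
    have := congrArg P'.mulVec h
    simpa [Matrix.mulVec_mulVec, hP'P] using this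
  set K := κ.map (algebraMap ℝ R) with hK
  have hKt : K.transpose = K := map_transpose_eq hκ
  -- T is the connection matrix of the frame in the direction of the flow. Its first column is the
  -- derivative of X in the frame, that is ϖ, and its lower block rotates the normal vectors.
  obtain ⟨T, hTdef⟩ : ∃ T, T = P' * dmat e P := ⟨_, rfl⟩
  have hT : dmat e P = P * T := by rw [hTdef, ← Matrix.mul_assoc, hPP', Matrix.one_mul]
  have hTs := skew_of_gram hP.gram hT
  obtain ⟨ϖ, hϖ⟩ : ∃ ϖ : Fin m → R, ϖ = fun a => T a.succ 0 := ⟨_, rfl⟩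
  obtain ⟨Λ, hΛ⟩ : ∃ Λ, Λ = T.submatrix Fin.succ Fin.succ := ⟨_, rfl⟩
  have hTf : T = frameConn κ ϖ Λ := by rw [hϖ, hΛ]; exact eq_frameConn_of_skew hκ hTs
  have hΛs : K * Λ + Λ.transpose * K = 0 := by rw [hΛ]; exact skew_of_blockOne_skew κ hTs
  -- The normal block is an endomorphism that is skew for κ; raising an index makes it a skew
  -- bivector.
  set Θ := Λ * κ⁻¹.map (algebraMap ℝ R) with hΘ
  have hΘK : Θ * K = Λ := by rw [hΘ, Matrix.mul_assoc, map_inv_mul_map hdet, Matrix.mul_one]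
  have hit : (κ⁻¹.map (algebraMap ℝ R)).transpose = κ⁻¹.map (algebraMap ℝ R) := by
    rw [← Matrix.transpose_map, Matrix.transpose_nonsing_inv, hκ]
  have hΘs : Θ.transpose = -Θ := by
    have h1 : Λ.transpose * K = -(K * Λ) := eq_neg_of_add_eq_zero_right hΛs
    rw [hΘ, Matrix.transpose_mul, hit]
    have h2 := congrArg (fun M => κ⁻¹.map (algebraMap ℝ R) * M * κ⁻¹.map (algebraMap ℝ R)) h1
    simp only [Matrix.mul_neg, Matrix.neg_mul] at h2
    rw [← Matrix.mul_assoc, Matrix.mul_assoc _ K, map_mul_map_inv hdet, Matrix.mul_one,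
      ← Matrix.mul_assoc, map_inv_mul_map hdet, Matrix.one_mul] at h2
    exact h2
  -- compatibility of the two connection matrices
  have hcomp : dmat e (frameConn κ v 0) + T * frameConn κ v 0 =
      dmat d T + frameConn κ v 0 * T := by
    have h1 : dmat d (dmat e P) = dmat e (dmat d P) := by ext i j; exact hde _
    rw [hT, hP.conn, dmat_mul, dmat_mul, hT, hP.conn] at h1
    have h2 := congrArg (P' * ·) h1
    simp only [Matrix.mul_add, ← Matrix.mul_assoc, hP'P, Matrix.one_mul] at h2
    exact (add_comm _ _).trans (h2.symm.trans (add_comm _ _))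
  obtain ⟨y, hy⟩ : ∃ y, y = P'.mulVec Y := ⟨_, rfl⟩
  have hPy : P.mulVec y = Y := by rw [hy, Matrix.mulVec_mulVec, hPP', Matrix.one_mulVec]
  have hX : (dv e fun i => P i 0) = P.mulVec (Fin.cons 0 ϖ) := by
    have h1 : (dv e fun i => P i 0) = fun i => dmat e P i 0 := rfl
    rw [h1, hT, hTf]
    ext i
    simp [Matrix.mul_apply, Matrix.mulVec, dotProduct, Fin.sum_univ_succ]
  -- The torsion equation Y_l = X_τ in the frame: its first entry is the equation for h∥, the others
  -- are ϖ = J(h⊥).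
  have hyd : dv d y + (frameConn κ v 0).mulVec y = Fin.cons 0 ϖ := by
    apply hcancel
    rw [← hX, ← hY, ← hPy, dv_mulVec, hP.conn, Matrix.mulVec_add, Matrix.mulVec_mulVec]
    exact add_comm _ _
  refine ⟨y 0, Fin.tail y, ϖ, Θ, ?_, ?_, hX, ?_, hΘs, ?_, ?_⟩
  · rw [Fin.cons_self_tail, hPy]
  · have := congrFun hyd 0
    simp [dv, Matrix.mulVec, dotProduct, Fin.sum_univ_succ] at this
    rw [gdot_comm _ _ hκ, gdot, dotProduct]
    rw [add_neg_eq_zero] at this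
    rw [this]
    exact Finset.sum_congr rfl fun a _ => by
      simp [Matrix.mulVec, dotProduct, Fin.tail, mul_comm]
  · ext a
    have := congrFun hyd a.succ
    simp [dv, Matrix.mulVec, dotProduct, Fin.sum_univ_succ] at this
    rw [← this]
    simp [dv, Fin.tail, mul_comm]
  -- The normal block of the compatibility equation gives D Θ = v∧ϖ; its first column, treated
  -- afterwards, gives the evolution of v.
  · have h1 : dmat d Λ = gwedge v ϖ * K := by
      ext a b
      have := congrFun (congrFun hcomp a.succ) b.succ
      rw [hTf] at this
      simp [dmat, Matrix.mul_apply, Fin.sum_univ_succ] at this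
      have h2 : d (Λ a b) = v a * K.mulVec ϖ b - ϖ a * K.mulVec v b := by
        linear_combination -this
      have h3 : ∀ u : Fin m → R, K.mulVec u = Matrix.vecMul u K := fun u => by
        conv_lhs => rw [← hKt, Matrix.mulVec_transpose]
      rw [gwedge, Matrix.sub_mul, Matrix.vecMulVec_mul, Matrix.vecMulVec_mul, ← h3, ← h3]
      simpa [Matrix.vecMulVec_apply, dmat] using h2
    rw [hΘ, dmat_mul, dmat_algebraMap, Matrix.mul_zero, add_zero, h1, Matrix.mul_assoc,
      map_mul_map_inv hdet, Matrix.mul_one]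
  · ext a
    have := congrFun (congrFun hcomp a.succ) 0
    rw [hTf] at this
    simp [dmat, Matrix.mul_apply, Fin.sum_univ_succ] at this
    have h3 := congrFun (map_mulVec_of_skew (S := R) (κ := κ) v hκ hΘs) a
    rw [Matrix.mulVec_mulVec, hΘK] at h3
    simp only [dv, Pi.add_apply]
    rw [← this, ← neg_eq_iff_eq_neg.2 h3.symm.symm]
    simp [Matrix.mulVec, dotProduct]

end AdaptedFrames

end

section

open Filter Topology TopologicalSpace

/-! ### Linear systems with smooth coefficients on a rectangle -/

/-- The open rectangle as an open set. -/
def rectOpens (τ₀ τ₁ l₀ l₁ : ℝ) : Opens (ℝ × ℝ) := ⟨rect τ₀ τ₁ l₀ l₁, isOpen_Ioo.prod isOpen_Ioo⟩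

namespace smoothFun

/-- The substitution of a smooth map in smooth functions. -/
def pullback {Q : Opens (ℝ × ℝ)} (σ : ℝ × ℝ → ℝ × ℝ) (hσ : ContDiff ℝ ∞ σ) (hQ : ∀ q ∈ Q, σ q ∈ Q) :
    smoothFun Q →ₐ[ℝ] smoothFun Q where
  toFun f := ⟨fun q => ev ⟨σ q, hQ q q.2⟩ f, by
    obtain ⟨F, hF, hFf⟩ := f.2
    exact ⟨F ∘ σ, hF.comp hσ.contDiffOn hQ, fun q => hFf ⟨σ q, hQ q q.2⟩⟩⟩
  map_one' := rfl
  map_mul' _ _ := rfl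
  map_zero' := rfl
  map_add' _ _ := rfl
  commutes' _ := rfl

variable {τ₀ τ₁ l₀ l₁ : ℝ} (c : rectOpens τ₀ τ₁ l₀ l₁)

/-- The restriction to the line `l = c.2`. -/
def resL : smoothFun (rectOpens τ₀ τ₁ l₀ l₁) →ₐ[ℝ] smoothFun (rectOpens τ₀ τ₁ l₀ l₁) :=
  pullback (fun q => (q.1, c.1.2)) (contDiff_fst.prodMk contDiff_const) fun _ hq => ⟨hq.1, c.2.2⟩

/-- The restriction to the line `τ = c.1`. -/
def resT : smoothFun (rectOpens τ₀ τ₁ l₀ l₁) →ₐ[ℝ] smoothFun (rectOpens τ₀ τ₁ l₀ l₁) :=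
  pullback (fun q => (c.1.1, q.2)) (contDiff_const.prodMk contDiff_snd) fun _ hq => ⟨c.2.1, hq.2⟩

variable (f : smoothFun (rectOpens τ₀ τ₁ l₀ l₁)) (q : rectOpens τ₀ τ₁ l₀ l₁)

theorem ev_resL : ev q (resL c f) =
    ev (⟨(q.1.1, c.1.2), q.2.1, c.2.2⟩ : rectOpens τ₀ τ₁ l₀ l₁) f := rfl
theorem ev_resT : ev q (resT c f) =
    ev (⟨(c.1.1, q.1.2), c.2.1, q.2.2⟩ : rectOpens τ₀ τ₁ l₀ l₁) f := rfl

theorem dl_resL : dl (resL c f) = 0 := by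
  refine ext_ev fun q => ?_
  rw [← deriv_snd_congr (f := fun τ _ => out f τ c.1.2) (resL c f) (fun q => ?_) q]
  · simp
  · exact out_eq f ⟨(q.1.1, c.1.2), q.2.1, c.2.2⟩

theorem dt_resL : dt (resL c f) = resL c (dt f) := by
  refine ext_ev fun q => ?_
  rw [← deriv_fst_congr (f := fun τ _ => out f τ c.1.2) (resL c f) (fun q => ?_) q, ev_resL,
    ← deriv_fst_congr (f := out f) f (out_eq f)]
  exact out_eq f ⟨(q.1.1, c.1.2), q.2.1, c.2.2⟩

variable {f} in
theorem eq_resL (h : dl f = 0) : f = resL c f := by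
  refine ext_ev fun q => ?_
  have hd : ∀ l ∈ Set.Ioo l₀ l₁, HasDerivAt (fun s => out f q.1.1 s) 0 l := by
    intro l hl
    have h1 := hasDerivAt_snd (contDiffOn_out f) ⟨(q.1.1, l), q.2.1, hl⟩
    rwa [mk_out, h, map_zero] at h1
  have h2 := isOpen_Ioo.is_const_of_deriv_eq_zero isPreconnected_Ioo
    (fun l hl => (hd l hl).differentiableAt.differentiableWithinAt) (fun l hl => (hd l hl).deriv)
    q.2.2 c.2.2
  rw [ev_resL, ← out_eq, ← out_eq]
  exact h2

variable {f} in
theorem eq_resT (h : dt f = 0) : f = resT c f := by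
  refine ext_ev fun q => ?_
  have hd : ∀ t ∈ Set.Ioo τ₀ τ₁, HasDerivAt (fun s => out f s q.1.2) 0 t := by
    intro t ht
    have h1 := hasDerivAt_fst (contDiffOn_out f) ⟨(t, q.1.2), ht, q.2.2⟩
    rwa [mk_out, h, map_zero] at h1
  have h2 := isOpen_Ioo.is_const_of_deriv_eq_zero isPreconnected_Ioo
    (fun t ht => (hd t ht).differentiableAt.differentiableWithinAt) (fun t ht => (hd t ht).deriv)
    q.2.1 c.2.1
  rw [ev_resT, ← out_eq, ← out_eq]
  exact h2

variable {f} in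
theorem eq_const (hl : dl f = 0) (ht : dt f = 0) : f = algebraMap ℝ _ (ev c f) := by
  rw [eq_resL c hl]
  refine ext_ev fun q => ?_
  rw [ev_resL, eq_resT c ht]
  rfl

variable {k : ℕ}

theorem matrix_ext_ev {Q : Opens (ℝ × ℝ)} {A B : Matrix (Fin k) (Fin k) (smoothFun Q)}
    (h : ∀ q, A.map (ev q) = B.map (ev q)) : A = B :=
  Matrix.ext fun i j => ext_ev fun q => congrFun (congrFun (h q) i) j

/-- The restriction to `Q` of a matrix of functions of two variables. -/
def mkM (Q : Opens (ℝ × ℝ)) (A : ℝ → ℝ → Matrix (Fin k) (Fin k) ℝ)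
    (hA : ∀ i j, ContDiffOn ℝ ∞ (fun q : ℝ × ℝ => A q.1 q.2 i j) Q) :
    Matrix (Fin k) (Fin k) (smoothFun Q) :=
  Matrix.of fun i j => mk Q (fun τ l => A τ l i j) (hA i j)

theorem mkM_map_ev {Q : Opens (ℝ × ℝ)} {A : ℝ → ℝ → Matrix (Fin k) (Fin k) ℝ}
    (hA : ∀ i j, ContDiffOn ℝ ∞ (fun q : ℝ × ℝ => A q.1 q.2 i j) Q) (q : Q) :
    (mkM Q A hA).map (ev q) = A q.1.1 q.1.2 := rfl

/-- The extension by zero of a matrix of smooth functions. -/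
def outM {Q : Opens (ℝ × ℝ)} (A : Matrix (Fin k) (Fin k) (smoothFun Q)) (τ l : ℝ) :
    Matrix (Fin k) (Fin k) ℝ := Matrix.of fun i j => out (A i j) τ l

theorem outM_eq {Q : Opens (ℝ × ℝ)} (A : Matrix (Fin k) (Fin k) (smoothFun Q)) (q : Q) :
    outM A q.1.1 q.1.2 = A.map (ev q) := Matrix.ext fun i j => out_eq (A i j) q

theorem dmat_dl_mkM {Q : Opens (ℝ × ℝ)} {A B : ℝ → ℝ → Matrix (Fin k) (Fin k) ℝ}
    (hA : ∀ i j, ContDiffOn ℝ ∞ (fun q : ℝ × ℝ => A q.1 q.2 i j) Q) (q : Q)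
    (h : ∀ i j, HasDerivAt (fun s => A q.1.1 s i j) (B q.1.1 q.1.2 i j) q.1.2) :
    (dmat dl (mkM Q A hA)).map (ev q) = B q.1.1 q.1.2 :=
  Matrix.ext fun i j => (hasDerivAt_snd (f := fun τ l => A τ l i j) (hA i j) q).unique (h i j)

theorem dmat_dt_mkM {Q : Opens (ℝ × ℝ)} {A B : ℝ → ℝ → Matrix (Fin k) (Fin k) ℝ}
    (hA : ∀ i j, ContDiffOn ℝ ∞ (fun q : ℝ × ℝ => A q.1 q.2 i j) Q) (q : Q)
    (h : ∀ i j, HasDerivAt (fun s => A s q.1.2 i j) (B q.1.1 q.1.2 i j) q.1.1) :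
    (dmat dt (mkM Q A hA)).map (ev q) = B q.1.1 q.1.2 :=
  Matrix.ext fun i j => (hasDerivAt_fst (f := fun τ l => A τ l i j) (hA i j) q).unique (h i j)

theorem map_ev_one {Q : Opens (ℝ × ℝ)} (q : Q) :
    (1 : Matrix (Fin k) (Fin k) (smoothFun Q)).map (ev q) = 1 :=
  Matrix.map_one _ (map_zero _) (map_one _)

theorem map_neg_algHom {R S : Type*} [CommRing R] [Algebra ℝ R] [CommRing S] [Algebra ℝ S]
    (f : R →ₐ[ℝ] S) (A : Matrix (Fin k) (Fin k) R) : (-A).map f = -A.map f :=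
  Matrix.ext fun i j => map_neg f (A i j)

theorem exists_fundamental_dl
    (U : Matrix (Fin k) (Fin k) (smoothFun (rectOpens τ₀ τ₁ l₀ l₁))) :
    ∃ Ψ Φ : Matrix (Fin k) (Fin k) (smoothFun (rectOpens τ₀ τ₁ l₀ l₁)),
      dmat dl Ψ = U * Ψ ∧ dmat dl Φ = -(Φ * U) ∧ Φ * Ψ = 1 ∧ Ψ * Φ = 1 ∧
      Ψ.map (resL c) = 1 ∧ Φ.map (resL c) = 1 := by
  obtain ⟨Ψ, Φ, hΨ, hΦ, hΨc, hΦc, hΨd, hΦd, h1, h2⟩ := exists_fundamental_matrix_right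
    (c.2.1.1.trans c.2.1.2) (U := outM U) (fun i j => contDiffOn_out (U i j)) c.2.2
  replace hΨ : ∀ i j, ContDiffOn ℝ ∞ (fun q : ℝ × ℝ => Ψ q.1 q.2 i j) (rectOpens τ₀ τ₁ l₀ l₁) := hΨ
  replace hΦ : ∀ i j, ContDiffOn ℝ ∞ (fun q : ℝ × ℝ => Φ q.1 q.2 i j) (rectOpens τ₀ τ₁ l₀ l₁) := hΦ
  refine ⟨mkM _ Ψ hΨ, mkM _ Φ hΦ, ?_, ?_, ?_, ?_, ?_, ?_⟩ <;> refine matrix_ext_ev fun q => ?_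
  · rw [Matrix.map_mul, mkM_map_ev, ← outM_eq U]
    exact dmat_dl_mkM (B := fun τ l => outM U τ l * Ψ τ l) hΨ q (hΨd q q.2)
  · rw [map_neg_algHom, Matrix.map_mul, mkM_map_ev, ← outM_eq U]
    exact dmat_dl_mkM (B := fun τ l => -(Φ τ l * outM U τ l)) hΦ q (hΦd q q.2)
  · rw [Matrix.map_mul, mkM_map_ev, mkM_map_ev, h1, map_ev_one]
  · rw [Matrix.map_mul, mkM_map_ev, mkM_map_ev, h2, map_ev_one]
  · rw [map_ev_one]; exact hΨc q.1.1
  · rw [map_ev_one]; exact hΦc q.1.1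

theorem dmat_map_resL_dt (A : Matrix (Fin k) (Fin k) (smoothFun (rectOpens τ₀ τ₁ l₀ l₁))) :
    dmat dt (A.map (resL c)) = (dmat dt A).map (resL c) :=
  Matrix.ext fun i j => dt_resL c (A i j)

theorem dmat_map_resL_dl (A : Matrix (Fin k) (Fin k) (smoothFun (rectOpens τ₀ τ₁ l₀ l₁))) :
    dmat dl (A.map (resL c)) = 0 :=
  Matrix.ext fun i j => dl_resL c (A i j)

/-- The fundamental solution along the line `l = c.2`. -/
theorem exists_fundamental_dt
    (U : Matrix (Fin k) (Fin k) (smoothFun (rectOpens τ₀ τ₁ l₀ l₁))) :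
    ∃ Ψ Φ : Matrix (Fin k) (Fin k) (smoothFun (rectOpens τ₀ τ₁ l₀ l₁)),
      dmat dl Ψ = 0 ∧ dmat dl Φ = 0 ∧
      dmat dt Ψ = U.map (resL c) * Ψ ∧ dmat dt Φ = -(Φ * U.map (resL c)) ∧ Φ * Ψ = 1 ∧ Ψ * Φ = 1 ∧
      Ψ.map (ev c) = 1 ∧ Φ.map (ev c) = 1 := by
  obtain ⟨Ψ, Φ, hΨ, hΦ, hΨc, hΦc, hΨd, hΦd, h1, -⟩ := exists_fundamental_matrix_left
    (c.2.2.1.trans c.2.2.2) (U := outM U) (fun i j => contDiffOn_out (U i j)) c.2.1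
  replace hΨ : ∀ i j, ContDiffOn ℝ ∞ (fun q : ℝ × ℝ => Ψ q.1 q.2 i j) (rectOpens τ₀ τ₁ l₀ l₁) := hΨ
  replace hΦ : ∀ i j, ContDiffOn ℝ ∞ (fun q : ℝ × ℝ => Φ q.1 q.2 i j) (rectOpens τ₀ τ₁ l₀ l₁) := hΦ
  obtain ⟨A, hA⟩ : ∃ A, A = mkM (rectOpens τ₀ τ₁ l₀ l₁) Ψ hΨ := ⟨_, rfl⟩
  obtain ⟨B, hB⟩ : ∃ B, B = mkM (rectOpens τ₀ τ₁ l₀ l₁) Φ hΦ := ⟨_, rfl⟩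
  have hAd : dmat dt A = U * A := by
    refine matrix_ext_ev fun q => ?_
    rw [Matrix.map_mul, hA, mkM_map_ev, ← outM_eq U]
    exact dmat_dt_mkM (B := fun τ l => outM U τ l * Ψ τ l) hΨ q (hΨd q q.2)
  have hBd : dmat dt B = -(B * U) := by
    refine matrix_ext_ev fun q => ?_
    rw [map_neg_algHom, Matrix.map_mul, hB, mkM_map_ev, ← outM_eq U]
    exact dmat_dt_mkM (B := fun τ l => -(Φ τ l * outM U τ l)) hΦ q (hΦd q q.2)
  have hBA : B * A = 1 := by
    refine matrix_ext_ev fun q => ?_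
    rw [Matrix.map_mul, hA, hB, mkM_map_ev, mkM_map_ev, h1, map_ev_one]
  have h3 : B.map (resL c) * A.map (resL c) = 1 := by
    rw [← Matrix.map_mul, hBA, Matrix.map_one _ (map_zero _) (map_one _)]
  refine ⟨A.map (resL c), B.map (resL c), dmat_map_resL_dl c A, dmat_map_resL_dl c B, ?_, ?_, h3,
    mul_eq_one_comm.1 h3, ?_, ?_⟩
  · rw [dmat_map_resL_dt, hAd, Matrix.map_mul]
  · rw [dmat_map_resL_dt, hBd, map_neg_algHom, Matrix.map_mul]
  · rw [hA]; exact hΨc c.1.2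
  · rw [hB]; exact hΦc c.1.2

theorem map_resL_of_dmat_dl {A : Matrix (Fin k) (Fin k) (smoothFun (rectOpens τ₀ τ₁ l₀ l₁))}
    (h : dmat dl A = 0) : A = A.map (resL c) := by
  refine Matrix.ext fun i j => ?_
  exact eq_resL c (congrFun (congrFun h i) j)

/-- Frobenius' theorem for linear systems. -/
theorem exists_compatible_solution
    {U T : Matrix (Fin k) (Fin k) (smoothFun (rectOpens τ₀ τ₁ l₀ l₁))}
    (h : dmat dt U + T * U = dmat dl T + U * T) (P₀ : Matrix (Fin k) (Fin k) ℝ) :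
    ∃ P : Matrix (Fin k) (Fin k) (smoothFun (rectOpens τ₀ τ₁ l₀ l₁)),
      dmat dl P = P * U ∧ dmat dt P = P * T ∧ P.map (ev c) = P₀ := by
  obtain ⟨-, Φ, -, hΦ, -, -, -, hΦc⟩ := exists_fundamental_dl c (-U)
  obtain ⟨-, A, -, hAl, -, hA, -, -, -, hAc⟩ := exists_fundamental_dt c (-T)
  -- Solve in τ along the line l = c.2, then in l from there. The signs of U and T are reversed so
  -- that the inverse fundamental matrices solve equations with the coefficient on the right.
  obtain ⟨P, hP⟩ : ∃ P, P = P₀.map (algebraMap ℝ (smoothFun (rectOpens τ₀ τ₁ l₀ l₁))) * A * Φ :=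
    ⟨_, rfl⟩
  have hPl : dmat dl P = P * U := by
    rw [hP, dmat_mul, dmat_mul, dmat_algebraMap, hAl, hΦ]
    simp [Matrix.mul_assoc]
  have hres : P.map (resL c) = P₀.map (algebraMap ℝ _) * A := by
    rw [hP, Matrix.map_mul, Matrix.map_mul, hΦc, Matrix.mul_one, ← map_resL_of_dmat_dl c hAl]
    congr 1
  -- Transposition gives an invertible solution of Z_l = -U Z, by which a solution of D_l = D U can
  -- be multiplied to become constant in l.
  obtain ⟨Ψ', Φ', -, hΦ', h1', h2', -, -⟩ := exists_fundamental_dl c U.transpose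
  -- By compatibility the defect of the τ-equation solves the same l-equation as P; it vanishes on
  -- the line l = c.2 and hence everywhere.
  have hDl : dmat dl (dmat dt P - P * T) = (dmat dt P - P * T) * U := by
    have hc : dmat dl (dmat dt P) = dmat dt (dmat dl P) := Matrix.ext fun i j => dl_dt _
    rw [dmat_sub, hc, hPl, dmat_mul, dmat_mul, hPl, Matrix.sub_mul, Matrix.mul_assoc P U T,
      Matrix.mul_assoc P T U]
    have := congrArg (P * ·) h
    simp only [Matrix.mul_add] at this
    rw [sub_eq_sub_iff_add_eq_add, add_assoc, this]
    abel
  have hDr : (dmat dt P - P * T).map (resL c) = 0 := by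
    have h3 : (dmat dt P - P * T).map (resL c) =
        dmat dt (P.map (resL c)) - P.map (resL c) * T.map (resL c) := by
      rw [dmat_map_resL_dt, ← Matrix.map_mul]
      exact Matrix.ext fun i j => map_sub (resL c) _ _
    rw [h3, hres, dmat_mul, dmat_algebraMap, hA, map_neg_algHom]
    simp [Matrix.mul_assoc]
  refine ⟨P, hPl, ?_, ?_⟩
  · rw [← sub_eq_zero]
    obtain ⟨D, hD⟩ : ∃ D, D = dmat dt P - P * T := ⟨_, rfl⟩
    rw [← hD] at hDl hDr ⊢
    have h5 : dmat dl (D * Φ'.transpose) = 0 := by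
      rw [dmat_mul, hDl, dmat_transpose, hΦ']
      simp [Matrix.mul_assoc]
    have h6 : D * Φ'.transpose = 0 := by
      rw [map_resL_of_dmat_dl c h5, Matrix.map_mul, hDr, Matrix.zero_mul]
    have h7 := congrArg (· * Ψ'.transpose) h6
    simpa [Matrix.mul_assoc, ← Matrix.transpose_mul, h2'] using h7
  · have h8 : P.map (ev c) = (P.map (resL c)).map (ev c) := by
      refine Matrix.ext fun i j => ?_; rfl
    rw [h8, hres, Matrix.map_mul, hAc, Matrix.mul_one]
    refine Matrix.ext fun i j => ?_
    simp

/-- A closed one-form has a potential. -/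
theorem exists_potential {f g : smoothFun (rectOpens τ₀ τ₁ l₀ l₁)} (h : dt f = dl g) (x₀ : ℝ) :
    ∃ x, dl x = f ∧ dt x = g ∧ ev c x = x₀ := by
  -- The potential x is the upper right entry of the matrix (1 x; 0 0), for which the system with
  -- nilpotent coefficients is dx = f dl + g dτ.
  obtain ⟨P, hl, ht, hP⟩ := exists_compatible_solution c (k := 2) (U := !![0, f; 0, 0])
    (T := !![0, g; 0, 0]) (by ext i j; fin_cases i <;> fin_cases j <;> simp [dmat, h])
    !![1, x₀; 0, 0]
  have e1 : dl (P 0 0) = 0 := by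
    simpa [dmat, Matrix.mul_apply, Fin.sum_univ_two] using congrFun (congrFun hl 0) 0
  have e2 : dt (P 0 0) = 0 := by
    simpa [dmat, Matrix.mul_apply, Fin.sum_univ_two] using congrFun (congrFun ht 0) 0
  have e3 : P 0 0 = 1 := by
    rw [eq_const c e1 e2, show ev c (P 0 0) = 1 from congrFun (congrFun hP 0) 0, map_one]
  refine ⟨P 0 1, ?_, ?_, congrFun (congrFun hP 0) 1⟩
  · simpa [dmat, Matrix.mul_apply, Fin.sum_univ_two, e3] using congrFun (congrFun hl 0) 1
  · simpa [dmat, Matrix.mul_apply, Fin.sum_univ_two, e3] using congrFun (congrFun ht 0) 1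

end smoothFun

end

section

/-! ### Existence of parallel frames -/

section Isometries

variable {n : ℕ} {G : Matrix (Fin n) (Fin n) ℝ}

/-- The reflection in the hyperplane orthogonal to `w`. -/
def reflectionMatrix (G : Matrix (Fin n) (Fin n) ℝ) (w : Fin n → ℝ) : Matrix (Fin n) (Fin n) ℝ :=
  1 - (2 / (w ⬝ᵥ G.mulVec w)) • Matrix.vecMulVec w (G.mulVec w)

theorem reflectionMatrix_mulVec (w x : Fin n → ℝ) : (reflectionMatrix G w).mulVec x =
    x - (2 / (w ⬝ᵥ G.mulVec w) * (x ⬝ᵥ G.mulVec w)) • w := by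
  rw [reflectionMatrix, Matrix.sub_mulVec, Matrix.one_mulVec, Matrix.smul_mulVec,
    Matrix.vecMulVec_mulVec, dotProduct_comm x]
  simp [smul_smul, mul_comm]

theorem reflectionMatrix_isometry (hG : G.IsSymm) {w : Fin n → ℝ} (hw : w ⬝ᵥ G.mulVec w ≠ 0) :
    (reflectionMatrix G w).transpose * G * reflectionMatrix G w = G := by
  have h1 : G * Matrix.vecMulVec w (G.mulVec w) = Matrix.vecMulVec (G.mulVec w) (G.mulVec w) :=
    Matrix.mul_vecMulVec _ _ _
  have h2 : Matrix.vecMul w G = G.mulVec w := by rw [← Matrix.mulVec_transpose, hG]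
  have h3 : Matrix.vecMulVec (G.mulVec w) w * G = Matrix.vecMulVec (G.mulVec w) (G.mulVec w) := by
    rw [Matrix.vecMulVec_mul, h2]
  have h4 : Matrix.vecMulVec (G.mulVec w) (G.mulVec w) * Matrix.vecMulVec w (G.mulVec w) =
      (w ⬝ᵥ G.mulVec w) • Matrix.vecMulVec (G.mulVec w) (G.mulVec w) := by
    rw [Matrix.vecMulVec_mul_vecMulVec, dotProduct_comm]
    ext i j; simp [Matrix.vecMulVec_apply]; ring
  rw [reflectionMatrix, Matrix.transpose_sub, Matrix.transpose_one, Matrix.transpose_smul,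
    Matrix.transpose_vecMulVec, Matrix.sub_mul, Matrix.one_mul, Matrix.smul_mul, h3,
    Matrix.mul_sub, Matrix.mul_one, Matrix.mul_smul, Matrix.sub_mul, h1, Matrix.smul_mul, h4,
    smul_smul, div_mul_cancel₀ _ hw]
  module

/-- Isometries act transitively on unit vectors. -/
theorem exists_isometry (hG : G.IsSymm) {x y : Fin n → ℝ} (hx : x ⬝ᵥ G.mulVec x = 1)
    (hy : y ⬝ᵥ G.mulVec y = 1) : ∃ O, O.transpose * G * O = G ∧ O.mulVec x = y := by
  have hs : y ⬝ᵥ G.mulVec x = x ⬝ᵥ G.mulVec y := by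
    rw [Matrix.dotProduct_mulVec, ← Matrix.mulVec_transpose, hG, dotProduct_comm]
  -- In an indefinite metric x - y can be null even if x ≠ y, exactly when the product of x and y is
  -- 1. Then x + y has square 4, and minus the reflection in x + y is used.
  by_cases h : x ⬝ᵥ G.mulVec y = 1
  · have hw : (x + y) ⬝ᵥ G.mulVec (x + y) = 4 := by
      simp only [Matrix.mulVec_add, dotProduct_add, add_dotProduct, hs, hx, hy, h]; norm_num
    refine ⟨-reflectionMatrix G (x + y), ?_, ?_⟩
    · rw [Matrix.transpose_neg, Matrix.neg_mul, Matrix.neg_mul, Matrix.mul_neg, neg_neg]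
      exact reflectionMatrix_isometry hG (by rw [hw]; norm_num)
    · rw [Matrix.neg_mulVec, reflectionMatrix_mulVec, hw, Matrix.mulVec_add, dotProduct_add, hx, h]
      norm_num
  · have hw : (x - y) ⬝ᵥ G.mulVec (x - y) = 2 * (1 - x ⬝ᵥ G.mulVec y) := by
      simp only [Matrix.mulVec_sub, dotProduct_sub, sub_dotProduct, hs, hx, hy]; ring
    have h1 : 1 - x ⬝ᵥ G.mulVec y ≠ 0 := fun h2 => h (by linarith)
    have hw0 : (x - y) ⬝ᵥ G.mulVec (x - y) ≠ 0 := by rw [hw]; exact mul_ne_zero two_ne_zero h1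
    refine ⟨reflectionMatrix G (x - y), reflectionMatrix_isometry hG hw0, ?_⟩
    rw [reflectionMatrix_mulVec, hw, Matrix.mulVec_sub, dotProduct_sub, hx]
    rw [show 2 / (2 * (1 - x ⬝ᵥ G.mulVec y)) * (1 - x ⬝ᵥ G.mulVec y) = 1 by field_simp]
    simp

end Isometries

section Transport

variable {m n : ℕ} {R : Type*} [CommRing R] [Algebra ℝ R] {G : Matrix (Fin n) (Fin n) ℝ}

/-- The infinitesimal rotation that carries the unit vector field `X` along. -/
def rotationGenerator (G : Matrix (Fin n) (Fin n) ℝ) (d : Derivation ℝ R R) (X : Fin n → R) :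
    Matrix (Fin n) (Fin n) R :=
  Matrix.vecMulVec (dv d X) ((G.map (algebraMap ℝ R)).mulVec X) -
    Matrix.vecMulVec X ((G.map (algebraMap ℝ R)).mulVec (dv d X))

theorem rotationGenerator_skew (hG : G.IsSymm) (d : Derivation ℝ R R) (X : Fin n → R) :
    G.map (algebraMap ℝ R) * rotationGenerator G d X +
      (rotationGenerator G d X).transpose * G.map (algebraMap ℝ R) = 0 := by
  have h : (G.map (algebraMap ℝ R)).transpose = G.map (algebraMap ℝ R) := map_transpose_eq hG
  have h2 : ∀ w : Fin n → R, Matrix.vecMul w (G.map (algebraMap ℝ R)) =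
      (G.map (algebraMap ℝ R)).mulVec w := fun w => by rw [← Matrix.mulVec_transpose, h]
  simp only [rotationGenerator, Matrix.mul_sub, Matrix.transpose_sub, Matrix.sub_mul,
    Matrix.mul_vecMulVec, Matrix.transpose_vecMulVec, Matrix.vecMulVec_mul, h2]
  abel

/-- Differentiating X·X = 1 shows that the derivative of X is orthogonal to X, so one term of the
generator drops out. -/
theorem rotationGenerator_mulVec (hG : G.IsSymm) (d : Derivation ℝ R R) {X : Fin n → R}
    (hX : gdot G X X = 1) : (rotationGenerator G d X).mulVec X = dv d X := by
  have h1 : (2 : ℝ) • gdot G (dv d X) X = 0 := by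
    have := congrArg d hX
    rw [deriv_gdot, gdot_comm X (dv d X) hG, d.map_one_eq_zero] at this
    rw [two_smul]; exact this
  have h2 : gdot G (dv d X) X = 0 := by
    have := congrArg (fun x => (1 / 2 : ℝ) • x) h1
    simpa [smul_smul] using this
  rw [rotationGenerator, Matrix.sub_mulVec, Matrix.vecMulVec_mulVec, Matrix.vecMulVec_mulVec,
    dotProduct_comm, dotProduct_comm _ X]
  change MulOpposite.op (gdot G X X) • _ - MulOpposite.op (gdot G X (dv d X)) • _ = _
  rw [gdot_comm X (dv d X) hG, h2, hX]
  simp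

/-- A frame that is transported by the rotation generator of its first vector is parallel. -/
theorem isAdaptedFrame_of_transport {d : Derivation ℝ R R}
    {G : Matrix (Fin (m + 1)) (Fin (m + 1)) ℝ} {κ : Matrix (Fin m) (Fin m) ℝ} (hκ : κ.IsSymm)
    (hdet : κ.det ≠ 0) {P : Matrix (Fin (m + 1)) (Fin (m + 1)) R} {X : Fin (m + 1) → R}
    (hG : G.IsSymm) (hPX : ∀ i, P i 0 = X i)
    (hgram : P.transpose * G.map (algebraMap ℝ R) * P = blockOne (κ.map (algebraMap ℝ R)))
    (hP : dmat d P = rotationGenerator G d X * P) : ∃ v, IsAdaptedFrame d G κ P v := by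
  obtain ⟨P', hP'P, hPP'⟩ := exists_inverse_of_gram hdet hgram
  obtain ⟨T, hTd⟩ : ∃ T, T = P' * dmat d P := ⟨_, rfl⟩
  have hT : dmat d P = P * T := by rw [hTd, ← Matrix.mul_assoc, hPP', Matrix.one_mul]
  have hTf := eq_frameConn_of_skew hκ (skew_of_gram hgram hT)
  refine ⟨fun a => T a.succ 0, hgram, ?_⟩
  have hXF : ∀ b : Fin m, ((G.map (algebraMap ℝ R)).mulVec X) ⬝ᵥ (fun i => P i b.succ) = 0 := by
    intro b
    have h1 := congrFun (congrFun hgram 0) b.succ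
    rw [blockOne_zero_succ, Matrix.mul_assoc, Matrix.mul_apply_eq_vecMul] at h1
    have h2 : (P.transpose 0) = X := funext hPX
    have h3 : Matrix.vecMul X (G.map (algebraMap ℝ R)) = (G.map (algebraMap ℝ R)).mulVec X := by
      rw [← Matrix.mulVec_transpose, map_transpose_eq hG]
    rw [h2, ← Matrix.vecMul_vecMul, h3] at h1
    exact h1
  -- The generator maps vectors orthogonal to X to multiples of X, so the derivative of a normal
  -- vector has no normal part.
  have hΛ : T.submatrix Fin.succ Fin.succ = 0 := by
    have h1 : κ.map (algebraMap ℝ R) * T.submatrix Fin.succ Fin.succ = 0 := by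
      have h2 : blockOne (κ.map (algebraMap ℝ R)) * T =
          P.transpose * G.map (algebraMap ℝ R) * (rotationGenerator G d X * P) := by
        rw [← hP, hT, ← Matrix.mul_assoc, hgram]
      ext a b
      have h3 := congrFun (congrFun h2 a.succ) b.succ
      have h4 : (fun i => (rotationGenerator G d X * P) i b.succ) =
          -(((G.map (algebraMap ℝ R)).mulVec (dv d X)) ⬝ᵥ (fun i => P i b.succ)) • X := by
        change (rotationGenerator G d X).mulVec (fun i => P i b.succ) = _
        rw [rotationGenerator, Matrix.sub_mulVec, Matrix.vecMulVec_mulVec, Matrix.vecMulVec_mulVec,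
          hXF]
        ext i; simp [mul_comm]
      have h5 : ((P.transpose * G.map (algebraMap ℝ R)) a.succ) ⬝ᵥ X = 0 := by
        have h6 := congrFun (congrFun hgram a.succ) 0
        rw [blockOne_succ_zero, Matrix.mul_apply'] at h6
        rw [← h6]; congr 1; exact (funext hPX).symm
      have h6 : (P.transpose * G.map (algebraMap ℝ R) * (rotationGenerator G d X * P)) a.succ b.succ =
          ((P.transpose * G.map (algebraMap ℝ R)) a.succ) ⬝ᵥ
            (fun i => (rotationGenerator G d X * P) i b.succ) := rfl
      rw [h6, h4, dotProduct_smul, h5, smul_zero] at h3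
      simpa [Matrix.mul_apply, Fin.sum_univ_succ] using h3
    have h2 := congrArg (κ⁻¹.map (algebraMap ℝ R) * ·) h1
    simpa [← Matrix.mul_assoc, map_inv_mul_map hdet] using h2
  rw [hT]
  rw [hΛ] at hTf
  rw [← hTf]

end Transport

end

section

/-! ### Transport of adapted frames over a rectangle -/

open smoothFun

variable {τ₀ τ₁ l₀ l₁ : ℝ} {m k : ℕ}

section AlgHoms

variable {R S : Type*} [CommRing R] [Algebra ℝ R] [CommRing S] [Algebra ℝ S]

theorem map_map_algebraMap (f : R →ₐ[ℝ] S) (A : Matrix (Fin k) (Fin k) ℝ) :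
    (A.map (algebraMap ℝ R)).map f = A.map (algebraMap ℝ S) :=
  Matrix.ext fun i j => f.commutes (A i j)

theorem comp_mulVec (f : R →ₐ[ℝ] S) (A : Matrix (Fin k) (Fin k) R) (x : Fin k → R) :
    f ∘ A.mulVec x = (A.map f).mulVec (f ∘ x) :=
  funext fun i => RingHom.map_mulVec (f : R →+* S) A x i

theorem map_gdot (f : R →ₐ[ℝ] S) (κ : Matrix (Fin k) (Fin k) ℝ) (x y : Fin k → R) :
    f (gdot κ x y) = gdot κ (f ∘ x) (f ∘ y) := by
  rw [gdot, gdot, ← map_map_algebraMap f, ← comp_mulVec]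
  exact RingHom.map_dotProduct (f : R →+* S) x _

end AlgHoms

namespace smoothFun

theorem eq_resL_vec (c : rectOpens τ₀ τ₁ l₀ l₁) {x : Fin k → smoothFun (rectOpens τ₀ τ₁ l₀ l₁)} (h : dv dl x = 0) :
    x = resL c ∘ x := funext fun i => eq_resL c (congrFun h i)

theorem eq_const_vec (c : rectOpens τ₀ τ₁ l₀ l₁) {x : Fin k → smoothFun (rectOpens τ₀ τ₁ l₀ l₁)} (hl : dv dl x = 0)
    (ht : dv dt x = 0) : x = algebraMap ℝ _ ∘ ev c ∘ x :=
  funext fun i => eq_const c (congrFun hl i) (congrFun ht i)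

theorem eq_const_matrix (c : rectOpens τ₀ τ₁ l₀ l₁)
    {A : Matrix (Fin k) (Fin k) (smoothFun (rectOpens τ₀ τ₁ l₀ l₁))}
    (hl : dmat dl A = 0) (ht : dmat dt A = 0) : A = (A.map (ev c)).map (algebraMap ℝ _) :=
  Matrix.ext fun i j => eq_const c (congrFun (congrFun hl i) j) (congrFun (congrFun ht i) j)

end smoothFun

/-- Unit vector fields on a rectangle have parallel frames. -/
theorem exists_adaptedFrame (c : rectOpens τ₀ τ₁ l₀ l₁)
    {G : Matrix (Fin (m + 1)) (Fin (m + 1)) ℝ} (hG : G.IsSymm)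
    {κ : Matrix (Fin m) (Fin m) ℝ} (hκ : κ.IsSymm) (hdet : κ.det ≠ 0)
    {X : Fin (m + 1) → smoothFun (rectOpens τ₀ τ₁ l₀ l₁)} (hX : gdot G X X = 1)
    {P₀ : Matrix (Fin (m + 1)) (Fin (m + 1)) ℝ} (hP₀ : P₀.transpose * G * P₀ = blockOne κ) :
    ∃ P v, IsAdaptedFrame dl G κ P v ∧ ∀ i, P i 0 = X i := by
  -- the initial value
  have hx₀ : (ev c ∘ X) ⬝ᵥ G.mulVec (ev c ∘ X) = 1 := by
    have := map_gdot (ev c) G X X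
    rw [hX, map_one, gdot] at this
    exact this.symm
  have hp₀ : (fun i => P₀ i 0) ⬝ᵥ G.mulVec (fun i => P₀ i 0) = 1 := by
    have := congrFun (congrFun hP₀ 0) 0
    rw [Matrix.mul_assoc] at this
    exact this
  -- The given constant frame need not start with the value of X at c; an isometry moves its first
  -- vector there.
  obtain ⟨O, hO, hOx⟩ := exists_isometry hG hp₀ hx₀
  obtain ⟨Ψ, Φ, hΨ, hΦ, hΦΨ, hΨΦ, hΨc, hΦc⟩ := exists_fundamental_dl c (rotationGenerator G dl X)
  obtain ⟨A, B, hAl, hBl, hA, hB, hBA, hAB, hAc, hBc⟩ :=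
    exists_fundamental_dt c (rotationGenerator G dt X)
  set g := G.map (algebraMap ℝ (smoothFun (rectOpens τ₀ τ₁ l₀ l₁))) with hg
  -- the transport matrices are isometries
  have hΨg : Ψ.transpose * g * Ψ = g := by
    have h1 : dmat dl (Ψ.transpose * g * Ψ) = 0 := by
      rw [dmat_mul, dmat_mul, dmat_transpose, hg, dmat_algebraMap, hΨ, Matrix.mul_zero, add_zero,
        Matrix.transpose_mul]
      have := congrArg (fun M => Ψ.transpose * M * Ψ) (rotationGenerator_skew hG dl X)
      simp only [Matrix.mul_add, Matrix.add_mul, Matrix.mul_zero, Matrix.zero_mul,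
        Matrix.mul_assoc] at this ⊢
      rw [← this]; abel
    have h2 : Ψ.transpose.map (resL c) = (Ψ.map (resL c)).transpose := rfl
    rw [map_resL_of_dmat_dl c h1, Matrix.map_mul, Matrix.map_mul, h2, hΨc, hg, map_map_algebraMap]
    simp
  have hAg : A.transpose * g * A = g := by
    have h1 : dmat dl (A.transpose * g * A) = 0 := by
      rw [dmat_mul, dmat_mul, dmat_transpose, hg, dmat_algebraMap, hAl]
      simp
    have h2 : dmat dt (A.transpose * g * A) = 0 := by
      rw [dmat_mul, dmat_mul, dmat_transpose, hg, dmat_algebraMap, hA, Matrix.mul_zero, add_zero,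
        Matrix.transpose_mul]
      have h3 := congrArg (fun M => M.map (resL c)) (rotationGenerator_skew hG dt X)
      have h4 : ∀ U V : Matrix (Fin (m + 1)) (Fin (m + 1)) (smoothFun (rectOpens τ₀ τ₁ l₀ l₁)),
          (U + V).map (resL c) = U.map (resL c) + V.map (resL c) := fun U V =>
        Matrix.ext fun i j => map_add (resL c) _ _
      simp only [h4, Matrix.map_mul, map_map_algebraMap] at h3
      have h5 : (rotationGenerator G dt X).transpose.map (resL c) =
        ((rotationGenerator G dt X).map (resL c)).transpose := rfl
      rw [h5, Matrix.map_zero _ (map_zero _)] at h3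
      have := congrArg (fun M => A.transpose * M * A) h3
      simp only [Matrix.mul_add, Matrix.add_mul, Matrix.mul_zero, Matrix.zero_mul,
        Matrix.mul_assoc] at this ⊢
      rw [← this]; abel
    have h3 : A.transpose.map (ev c) = (A.map (ev c)).transpose := rfl
    have h4 : (A.transpose * g * A).map (ev c) = G := by
      rw [Matrix.map_mul, Matrix.map_mul, h3, hAc, hg, map_map_algebraMap, Matrix.transpose_one,
        Matrix.one_mul, Matrix.mul_one]
      rfl
    rw [eq_const_matrix c h1 h2, h4]
  -- `X` is transported to itself
  have hX1 : Ψ.mulVec (resL c ∘ X) = X := by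
    have h1 : dv dl (Φ.mulVec X) = 0 := by
      rw [dv_mulVec, hΦ, Matrix.neg_mulVec, ← Matrix.mulVec_mulVec, rotationGenerator_mulVec hG dl hX]
      exact neg_add_cancel _
    have h2 := eq_resL_vec c h1
    rw [comp_mulVec, hΦc, Matrix.one_mulVec] at h2
    rw [← h2, Matrix.mulVec_mulVec, hΨΦ, Matrix.one_mulVec]
  have hX2 : A.mulVec (algebraMap ℝ _ ∘ ev c ∘ X) = resL c ∘ X := by
    have h1 : dv dl (B.mulVec (resL c ∘ X)) = 0 := by
      have : dv dl (resL c ∘ X) = 0 := funext fun i => dl_resL c (X i)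
      rw [dv_mulVec, hBl, this]; simp
    have h2 : dv dt (B.mulVec (resL c ∘ X)) = 0 := by
      have : dv dt (resL c ∘ X) = resL c ∘ dv dt X := funext fun i => dt_resL c (X i)
      rw [dv_mulVec, hB, this, Matrix.neg_mulVec, ← Matrix.mulVec_mulVec, ← comp_mulVec,
        rotationGenerator_mulVec hG dt hX]
      exact neg_add_cancel _
    have h3 := eq_const_vec c h1 h2
    rw [comp_mulVec, hBc, Matrix.one_mulVec] at h3
    have h4 : ev c ∘ resL c ∘ X = ev c ∘ X := rfl
    rw [h4] at h3
    rw [← h3, Matrix.mulVec_mulVec, hAB, Matrix.one_mulVec]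
  -- The frame at c is carried along the line l = c.2 by A and then in the direction of l by Ψ.
  obtain ⟨P, hP⟩ : ∃ P, P = Ψ * A * (O * P₀).map (algebraMap ℝ _) := ⟨_, rfl⟩
  have hP0 : ∀ i, P i 0 = X i := by
    intro i
    have h1 : (fun j => (O * P₀).map (algebraMap ℝ (smoothFun (rectOpens τ₀ τ₁ l₀ l₁))) j 0) =
        algebraMap ℝ _ ∘ ev c ∘ X := by
      rw [← hOx]; rfl
    have h2 : (fun i => P i 0) = (Ψ * A).mulVec (algebraMap ℝ _ ∘ ev c ∘ X) := by
      rw [hP, ← h1]; rfl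
    rw [← Matrix.mulVec_mulVec, hX2, hX1] at h2
    exact congrFun h2 i
  have hgram : P.transpose * g * P = blockOne (κ.map (algebraMap ℝ _)) := by
    have h1 : P.transpose * g * P = ((O * P₀).map (algebraMap ℝ _)).transpose *
        (A.transpose * (Ψ.transpose * g * Ψ) * A) * (O * P₀).map (algebraMap ℝ _) := by
      rw [hP]
      simp only [Matrix.transpose_mul, Matrix.mul_assoc]
    have h2 : (O * P₀).transpose * G * (O * P₀) = P₀.transpose * (O.transpose * G * O) * P₀ := by
      simp only [Matrix.transpose_mul, Matrix.mul_assoc]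
    rw [h1, hΨg, hAg, hg, ← Matrix.transpose_map, ← Matrix.map_mul, ← Matrix.map_mul, ← blockOne_map,
      h2, hO, hP₀]
  have hPl : dmat dl P = rotationGenerator G dl X * P := by
    rw [hP, dmat_mul, dmat_mul, dmat_algebraMap, hAl, hΨ]
    simp [Matrix.mul_assoc]
  obtain ⟨v, hv⟩ := isAdaptedFrame_of_transport hκ hdet hG hP0 hgram hPl
  exact ⟨P, v, hv, hP0⟩

/-- A rotation of the normal frame that depends on `τ` only. -/
theorem exists_rotation (c : rectOpens τ₀ τ₁ l₀ l₁)
    {κ : Matrix (Fin m) (Fin m) ℝ} (hκ : κ.IsSymm) (hdet : κ.det ≠ 0)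
    {C : Matrix (Fin m) (Fin m) (smoothFun (rectOpens τ₀ τ₁ l₀ l₁))} (hCs : C.transpose = -C)
    (hC : dmat dl C = 0) : ∃ σ ρ : Matrix (Fin m) (Fin m) (smoothFun (rectOpens τ₀ τ₁ l₀ l₁)),
      dmat dl σ = 0 ∧ dmat dl ρ = 0 ∧ σ * ρ = 1 ∧ ρ * σ = 1 ∧
      dmat dt σ = σ * C * κ.map (algebraMap ℝ _) ∧
      σ.transpose * κ.map (algebraMap ℝ _) * σ = κ.map (algebraMap ℝ _) := by
  set K := κ.map (algebraMap ℝ (smoothFun (rectOpens τ₀ τ₁ l₀ l₁))) with hK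
  have hKt : K.transpose = K := map_transpose_eq hκ
  -- The second matrix of the pair solves σ_τ = σCκ, because restricting C to the line l = c.2 does
  -- not change it.
  obtain ⟨ρ, σ, hρl, hσl, -, hσ, hσρ, hρσ, -, hσc⟩ := exists_fundamental_dt c (-(C * K))
  have hσ' : dmat dt σ = σ * C * K := by
    rw [hσ, map_neg_algHom, Matrix.map_mul, ← map_resL_of_dmat_dl c hC, hK, map_map_algebraMap]
    simp [Matrix.mul_assoc]
  have hit : (κ⁻¹.map (algebraMap ℝ (smoothFun (rectOpens τ₀ τ₁ l₀ l₁)))).transpose =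
      κ⁻¹.map (algebraMap ℝ _) := by
    rw [← Matrix.transpose_map, Matrix.transpose_nonsing_inv, hκ]
  -- Skewness of C makes σκ⁻¹σᵀ constant, equal to its value κ⁻¹ at c. Taking inverses gives the
  -- isometry property of σ.
  have h1 : σ * κ⁻¹.map (algebraMap ℝ _) * σ.transpose = κ⁻¹.map (algebraMap ℝ _) := by
    have e1 : dmat dl (σ * κ⁻¹.map (algebraMap ℝ _) * σ.transpose) = 0 := by
      rw [dmat_mul, dmat_mul, dmat_transpose, dmat_algebraMap, hσl]; simp
    have e2 : dmat dt (σ * κ⁻¹.map (algebraMap ℝ _) * σ.transpose) = 0 := by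
      rw [dmat_mul, dmat_mul, dmat_transpose, dmat_algebraMap, hσ', Matrix.transpose_mul,
        Matrix.transpose_mul, hKt, hCs, Matrix.mul_assoc _ K, map_mul_map_inv hdet,
        ← Matrix.mul_assoc (σ * _) K, Matrix.mul_assoc σ _ K, map_inv_mul_map hdet]
      simp [Matrix.mul_assoc]
    have h3 : σ.transpose.map (ev c) = (σ.map (ev c)).transpose := rfl
    have h4 : (σ * κ⁻¹.map (algebraMap ℝ _) * σ.transpose).map (ev c) = κ⁻¹ := by
      rw [Matrix.map_mul, Matrix.map_mul, h3, hσc, map_map_algebraMap, Matrix.transpose_one,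
        Matrix.one_mul, Matrix.mul_one]
      rfl
    rw [eq_const_matrix c e1 e2, h4]
  refine ⟨σ, ρ, hσl, hρl, hσρ, hρσ, hσ', ?_⟩
  have h2 : (K * σ * κ⁻¹.map (algebraMap ℝ _)) * σ.transpose = 1 := by
    rw [Matrix.mul_assoc, Matrix.mul_assoc, ← Matrix.mul_assoc σ, h1, hK, map_mul_map_inv hdet]
  have h3 := congrArg (· * K) (mul_eq_one_comm.1 h2)
  simpa [Matrix.mul_assoc, map_inv_mul_map hdet, hK] using h3

end

section

/-! ### Equivariance of the hierarchy -/

section Equivariance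

variable {m : ℕ} {κ : Matrix (Fin m) (Fin m) ℝ}

/-- The linear substitution `v ↦ s v`. -/
def rotPoly (s : Matrix (Fin m) (Fin m) ℝ) : DiffPoly m →ₐ[ℝ] DiffPoly m :=
  MvPolynomial.aeval fun p => ∑ b, s p.1 b • (MvPolynomial.X (b, p.2) : DiffPoly m)

variable (s : Matrix (Fin m) (Fin m) ℝ)

theorem rotPoly_X (p : Fin m × ℕ) :
    rotPoly s (MvPolynomial.X p) = ∑ b, s p.1 b • (MvPolynomial.X (b, p.2) : DiffPoly m) :=
  MvPolynomial.aeval_X _ _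

theorem rotPoly_totalD (f : DiffPoly m) : rotPoly s (totalD m f) = totalD m (rotPoly s f) := by
  induction f using MvPolynomial.induction_on with
  | C r => simp [← MvPolynomial.algebraMap_eq]
  | add p q hp hq => simp only [map_add, hp, hq]
  | mul_X p q hp =>
    rw [Derivation.leibniz, map_mul, Derivation.leibniz, map_add, smul_eq_mul, smul_eq_mul, map_mul,
      map_mul, hp, totalD_X, smul_eq_mul, smul_eq_mul, rotPoly_X, rotPoly_X, map_sum]
    simp only [Derivation.map_smul, totalD_X]

theorem constantCoeff_rotPoly (f : DiffPoly m) :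
    MvPolynomial.constantCoeff (rotPoly s f) = MvPolynomial.constantCoeff f := by
  induction f using MvPolynomial.induction_on with
  | C r => simp [← MvPolynomial.algebraMap_eq]
  | add p q hp hq => simp only [map_add, hp, hq]
  | mul_X p q hp =>
    rw [map_mul, map_mul, map_mul, rotPoly_X, map_sum]
    simp [MvPolynomial.smul_eq_C_mul]

theorem rotPoly_comp_jet (j : ℕ) :
    rotPoly s ∘ jet m j = (s.map (algebraMap ℝ (DiffPoly m))).mulVec (jet m j) := by
  ext1 a
  change rotPoly s (MvPolynomial.X (a, j)) = _
  rw [rotPoly_X]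
  simp [Matrix.mulVec, dotProduct, jet, MvPolynomial.smul_eq_C_mul, MvPolynomial.algebraMap_eq]

section

variable {R S : Type*} [CommRing R] [Algebra ℝ R] [CommRing S] [Algebra ℝ S]

theorem map_gwedge (f : R →ₐ[ℝ] S) (x y : Fin m → R) :
    (gwedge x y).map f = gwedge (f ∘ x) (f ∘ y) := by
  refine Matrix.ext fun a b => ?_
  rw [Matrix.map_apply, gwedge_apply, gwedge_apply]; simp

theorem comp_gint (f : R →ₐ[ℝ] S) (x : Fin m → R) (W : Matrix (Fin m) (Fin m) R) :
    f ∘ gint κ x W = gint κ (f ∘ x) (W.map f) := by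
  have h : ∀ (y : Fin m → R) (A : Matrix (Fin m) (Fin m) R),
      f ∘ Matrix.vecMul y A = Matrix.vecMul (f ∘ y) (A.map f) := fun y A =>
    funext fun i => RingHom.map_vecMul (f : R →+* S) A y i
  rw [gint, gint, h, h, map_map_algebraMap]

theorem gwedge_mulVec (A : Matrix (Fin m) (Fin m) R) (x y : Fin m → R) :
    gwedge (A.mulVec x) (A.mulVec y) = A * gwedge x y * A.transpose := by
  simp only [gwedge, Matrix.mul_sub, Matrix.sub_mul, Matrix.mul_vecMulVec, Matrix.vecMulVec_mul,
    Matrix.vecMul_transpose]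

theorem mulVec_gint {s t : Matrix (Fin m) (Fin m) R}
    (h : s.transpose * κ.map (algebraMap ℝ R) = κ.map (algebraMap ℝ R) * t) (x : Fin m → R)
    (W : Matrix (Fin m) (Fin m) R) :
    t.mulVec (gint κ (s.mulVec x) W) = gint κ x (t * W * t.transpose) := by
  rw [gint, gint, ← Matrix.vecMul_transpose, ← Matrix.vecMul_transpose s, Matrix.vecMul_vecMul,
    Matrix.vecMul_vecMul, Matrix.vecMul_vecMul, Matrix.vecMul_vecMul,
    ← Matrix.mul_assoc s.transpose, h]
  simp only [Matrix.mul_assoc]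

end

/-- The hierarchy is equivariant under isometries. -/
theorem IsBiHamiltonianHierarchy.equivariant {h : HierarchyData m}
    (H : IsBiHamiltonianHierarchy κ h) (hdet : κ.det ≠ 0)
    (hs : s.transpose * κ * s = κ) (k : ℕ) :
    rotPoly s (h.p k) = h.p k ∧
      rotPoly s ∘ h.e k = (s.map (algebraMap ℝ (DiffPoly m))).mulVec (h.e k) := by
  obtain ⟨t, hts⟩ : ∃ t, t * s = 1 := by
    refine ⟨κ⁻¹ * (s.transpose * κ), ?_⟩
    rw [Matrix.mul_assoc, hs, Matrix.nonsing_inv_mul _ (isUnit_iff_ne_zero.2 hdet)]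
  have hst : s * t = 1 := mul_eq_one_comm.1 hts
  have hsκ : s.transpose * κ = κ * t := by
    have := congrArg (· * t) hs
    simpa [Matrix.mul_assoc, hst] using this
  obtain ⟨s', hs'⟩ : ∃ s', s' = s.map (algebraMap ℝ (DiffPoly m)) := ⟨_, rfl⟩
  obtain ⟨t', ht'⟩ : ∃ t', t' = t.map (algebraMap ℝ (DiffPoly m)) := ⟨_, rfl⟩
  have hts' : t' * s' = 1 := by
    rw [ht', hs', ← Matrix.map_mul, hts, Matrix.map_one _ (map_zero _) (map_one _)]
  have hst' : s' * t' = 1 := mul_eq_one_comm.1 hts'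
  have hsK : s'.transpose * κ.map (algebraMap ℝ (DiffPoly m)) =
      κ.map (algebraMap ℝ (DiffPoly m)) * t' := by
    rw [hs', ht', ← Matrix.transpose_map, ← Matrix.map_mul, hsκ, Matrix.map_mul]
  have hj := rotPoly_comp_jet s 0
  rw [← hs'] at hj ⊢
  have hdot : ∀ x y : DVec m, gdot κ (s'.mulVec x) y = gdot κ x (t'.mulVec y) := fun x y => by
    rw [gdot, gdot, ← Matrix.vecMul_transpose, ← Matrix.dotProduct_mulVec, Matrix.mulVec_mulVec,
      Matrix.mulVec_mulVec, hsK]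
  have hdv : ∀ x : DVec m, dv (totalD m) (t'.mulVec x) = t'.mulVec (dv (totalD m) x) := fun x => by
    rw [dv_mulVec, ht', dmat_algebraMap, Matrix.zero_mulVec, zero_add]
  have hdr : ∀ x : DVec m, dv (totalD m) (rotPoly s ∘ x) = rotPoly s ∘ dv (totalD m) x := fun x =>
    funext fun i => (rotPoly_totalD s (x i)).symm
  have hI := H.hierarchy
  -- Substitute s v for v and undo the rotation on vectors and bivectors. The result satisfies the
  -- same recursion with the same normalisation, so uniqueness identifies it with h.
  let h' : HierarchyData m :=
    { ϖ := fun k => t'.mulVec (rotPoly s ∘ h.ϖ k)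
      e := fun k => t'.mulVec (rotPoly s ∘ h.e k)
      p := fun k => rotPoly s (h.p k)
      W := fun k => t' * (h.W k).map (rotPoly s) * t'.transpose }
  have hh : IsHierarchy κ h' :=
    { start := by
        change t'.mulVec (rotPoly s ∘ h.ϖ 0) = _
        rw [hI.start, hj, Matrix.mulVec_mulVec, hts', Matrix.one_mulVec]
      W_const := fun k a b => by
        change MvPolynomial.constantCoeff ((t' * (h.W k).map (rotPoly s) * t'.transpose) a b) = 0
        simp [Matrix.mul_apply, map_sum, map_mul, constantCoeff_rotPoly, hI.W_const]
      W_deriv := fun k a b => by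
        have h1 : dmat (totalD m) (h.W k) = gwedge (jet m 0) (h.ϖ k) :=
          Matrix.ext fun a b => by rw [← wedge_eq_gwedge]; exact hI.W_deriv k a b
        have h2 : dmat (totalD m) ((h.W k).map (rotPoly s)) =
            gwedge (s'.mulVec (jet m 0)) (rotPoly s ∘ h.ϖ k) := by
          rw [← hj, ← map_gwedge, ← h1]
          exact Matrix.ext fun a b => (rotPoly_totalD s (h.W k a b)).symm
        have h3 : dmat (totalD m) (t' * (h.W k).map (rotPoly s) * t'.transpose) =
            gwedge (jet m 0) (t'.mulVec (rotPoly s ∘ h.ϖ k)) := by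
          rw [dmat_mul, dmat_mul, dmat_transpose, ht', dmat_algebraMap, ← ht', h2]
          simp only [Matrix.zero_mul, Matrix.transpose_zero, Matrix.mul_zero, zero_add, add_zero]
          rw [← gwedge_mulVec, Matrix.mulVec_mulVec, hts', Matrix.one_mulVec]
        rw [wedge_eq_gwedge]
        exact congrFun (congrFun h3 a) b
      e_eq := fun k b => by
        have h1 : h.e k = dv (totalD m) (h.ϖ k) + gint κ (jet m 0) (h.W k) := by
          ext1 b; rw [← interior_eq_gint]; exact hI.e_eq k b
        have h2 : t'.mulVec (rotPoly s ∘ h.e k) = dv (totalD m) (t'.mulVec (rotPoly s ∘ h.ϖ k)) +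
            gint κ (jet m 0) (t' * (h.W k).map (rotPoly s) * t'.transpose) := by
          have h3 : rotPoly s ∘ h.e k = rotPoly s ∘ dv (totalD m) (h.ϖ k) +
              rotPoly s ∘ gint κ (jet m 0) (h.W k) := by
            rw [h1]; ext1 b; exact map_add (rotPoly s) _ _
          rw [h3, Matrix.mulVec_add, hdv, hdr, comp_gint, hj, mulVec_gint hsK]
        rw [interior_eq_gint]
        exact congrFun h2 b
      p_const := fun k => by
        change MvPolynomial.constantCoeff (rotPoly s (h.p k)) = 0
        rw [constantCoeff_rotPoly, hI.p_const]
      p_deriv := fun k => by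
        change totalD m (rotPoly s (h.p k)) = dot κ (jet m 0) (t'.mulVec (rotPoly s ∘ h.e k))
        rw [← rotPoly_totalD, hI.p_deriv, dot_eq_gdot, dot_eq_gdot, map_gdot, hj, hdot]
      ϖ_succ := fun k a => by
        have h1 : h.ϖ (k + 1) = dv (totalD m) (h.e k) + h.p k • jet m 0 :=
          funext fun a => hI.ϖ_succ k a
        have h2 : t'.mulVec (rotPoly s ∘ h.ϖ (k + 1)) =
            dv (totalD m) (t'.mulVec (rotPoly s ∘ h.e k)) + rotPoly s (h.p k) • jet m 0 := by
          have h3 : rotPoly s ∘ h.ϖ (k + 1) = rotPoly s ∘ dv (totalD m) (h.e k) +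
              rotPoly s (h.p k) • (rotPoly s ∘ jet m 0) := by
            rw [h1]; ext1 b; simp
          rw [h3, Matrix.mulVec_add, hdv, hdr, hj, Matrix.mulVec_smul, Matrix.mulVec_mulVec, hts',
            Matrix.one_mulVec]
        exact congrFun h2 a }
  have heq := H.unique h' hh
  have hp : rotPoly s (h.p k) = h.p k := congrArg (fun d : HierarchyData m => d.p k) heq
  have he : t'.mulVec (rotPoly s ∘ h.e k) = h.e k :=
    congrArg (fun d : HierarchyData m => d.e k) heq
  refine ⟨hp, ?_⟩
  conv_rhs => rw [← he, Matrix.mulVec_mulVec, hst', Matrix.one_mulVec]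

end Equivariance

/-! ### Equivariance after substitution of smooth functions -/

namespace smoothFun

variable {m : ℕ} {Q : TopologicalSpace.Opens (ℝ × ℝ)}

theorem iterate_dl_mulVec {σ : Matrix (Fin m) (Fin m) (smoothFun Q)} (hσ : dmat dl σ = 0)
    (v : Fin m → smoothFun Q) (j : ℕ) (a : Fin m) :
    dl^[j] (σ.mulVec v a) = ∑ b, σ a b * dl^[j] (v b) := by
  induction j with
  | zero => rfl
  | succ j ih =>
    rw [Function.iterate_succ_apply', ih, map_sum]
    refine Finset.sum_congr rfl fun b _ => ?_
    have : dl (σ a b) = 0 := congrFun (congrFun hσ a) b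
    rw [Derivation.leibniz, this, smul_zero, add_zero, smul_eq_mul, Function.iterate_succ_apply']

/-- As σ does not depend on l, at a fixed point all jets of σv are rotated by the one real matrix
σ(q). -/
theorem ev_subst_mulVec {σ : Matrix (Fin m) (Fin m) (smoothFun Q)} (hσ : dmat dl σ = 0)
    (v : Fin m → smoothFun Q) (f : DiffPoly m) (q : Q) :
    ev q (subst (σ.mulVec v) f) = ev q (subst v (rotPoly (σ.map (ev q)) f)) := by
  have : (ev q).comp (subst (σ.mulVec v)) =
      ((ev q).comp (subst v)).comp (rotPoly (σ.map (ev q))) := by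
    refine MvPolynomial.algHom_ext fun p => ?_
    simp only [AlgHom.comp_apply, rotPoly_X, map_sum, map_smul]
    simp only [subst, MvPolynomial.aeval_X]
    rw [iterate_dl_mulVec hσ, map_sum]
    simp only [map_mul, Matrix.map_apply, smul_eq_mul]
  exact DFunLike.congr_fun this f

variable {κ : Matrix (Fin m) (Fin m) ℝ} {h : HierarchyData m}

/-- The rotation varies with τ, so the equivariance under constant isometries is applied at each
point separately. -/
theorem subst_equivariant (H : IsBiHamiltonianHierarchy κ h) (hdet : κ.det ≠ 0)
    {σ : Matrix (Fin m) (Fin m) (smoothFun Q)} (hσ : dmat dl σ = 0)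
    (hσκ : σ.transpose * κ.map (algebraMap ℝ _) * σ = κ.map (algebraMap ℝ _))
    (v : Fin m → smoothFun Q) (k : ℕ) :
    subst (σ.mulVec v) (h.p k) = subst v (h.p k) ∧
      subst (σ.mulVec v) ∘ h.e k = σ.mulVec (subst v ∘ h.e k) := by
  have hq : ∀ q : Q, (σ.map (ev q)).transpose * κ * σ.map (ev q) = κ := fun q => by
    have h1 := congrArg (fun M => M.map (ev q)) hσκ
    simp only [Matrix.map_mul, map_map_algebraMap] at h1
    exact h1
  constructor
  · refine ext_ev fun q => ?_
    rw [ev_subst_mulVec hσ, (H.equivariant _ hdet (hq q) k).1]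
  · ext1 a
    refine ext_ev fun q => ?_
    change ev q (subst (σ.mulVec v) (h.e k a)) = _
    rw [ev_subst_mulVec hσ]
    have h1 := congrFun (H.equivariant _ hdet (hq q) k).2 a
    change rotPoly _ (h.e k a) = _ at h1
    rw [h1]
    have h2 : ∀ (A : Matrix (Fin m) (Fin m) ℝ) (x : DVec m),
        (ev q).comp (subst v) ((A.map (algebraMap ℝ (DiffPoly m))).mulVec x a) =
        A.mulVec (fun b => ev q (subst v (x b))) a := fun A x => by
      simp [Matrix.mulVec, dotProduct]
    refine (h2 _ _).trans ?_
    simp [Matrix.mulVec, dotProduct]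

end smoothFun

section Rotation

variable {m : ℕ} {R : Type*} [CommRing R] [Algebra ℝ R] {d e : Derivation ℝ R R}
  {G : Matrix (Fin (m + 1)) (Fin (m + 1)) ℝ} {κ : Matrix (Fin m) (Fin m) ℝ}

/-- Rotating a parallel frame by a matrix that is constant along the curves. -/
theorem IsAdaptedFrame.rotate (hκ : κ.IsSymm) {P : Matrix (Fin (m + 1)) (Fin (m + 1)) R}
    {v : Fin m → R} (hP : IsAdaptedFrame d G κ P v) {σ ρ : Matrix (Fin m) (Fin m) R}
    (hρ : dmat d ρ = 0) (hσρ : σ * ρ = 1) (hρσ : ρ * σ = 1)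
    (hσκ : σ.transpose * κ.map (algebraMap ℝ R) * σ = κ.map (algebraMap ℝ R)) :
    IsAdaptedFrame d G κ (P * blockOne ρ) (σ.mulVec v) := by
  set K := κ.map (algebraMap ℝ R) with hK
  have hKt : K.transpose = K := map_transpose_eq hκ
  have h1 : ρ.transpose * K = K * σ := by
    have h2 : ρ.transpose * σ.transpose = 1 := by rw [← Matrix.transpose_mul, hσρ, Matrix.transpose_one]
    have h3 := congrArg (ρ.transpose * ·) hσκ
    simp only [← Matrix.mul_assoc, h2, Matrix.one_mul] at h3
    exact h3.symm
  refine ⟨?_, ?_⟩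
  · have h2 : (P * blockOne ρ).transpose * G.map (algebraMap ℝ R) * (P * blockOne ρ) =
        blockOne ρ.transpose * (P.transpose * G.map (algebraMap ℝ R) * P) * blockOne ρ := by
      simp only [Matrix.transpose_mul, Matrix.mul_assoc, blockOne_transpose]
    rw [h2, hP.gram, blockOne_mul, blockOne_mul, ← hK, h1, Matrix.mul_assoc, hσρ, Matrix.mul_one]
  · have h2 : frameConn κ v 0 * blockOne ρ = blockOne ρ * frameConn κ (σ.mulVec v) 0 := by
      have h3 : K.mulVec (σ.mulVec v) = Matrix.vecMul (K.mulVec v) ρ := by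
        rw [Matrix.mulVec_mulVec, ← h1, ← Matrix.mulVec_mulVec, Matrix.mulVec_transpose]
      apply matrix_ext_succ
      · simp [Matrix.mul_apply, Fin.sum_univ_succ]
      · intro b
        have := congrFun h3 b
        simp only [Matrix.mul_apply, Fin.sum_univ_succ, frameConn_zero_zero, frameConn_zero_succ,
          blockOne_zero_zero, blockOne_zero_succ, blockOne_succ_succ, ← hK, this]
        simp [Matrix.vecMul, dotProduct]
      · intro a
        have h4 : ρ.mulVec (σ.mulVec v) = v := by
          rw [Matrix.mulVec_mulVec, hρσ, Matrix.one_mulVec]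
        have := congrFun h4 a
        simp only [Matrix.mulVec, dotProduct] at this
        simp [Matrix.mul_apply, Fin.sum_univ_succ, Matrix.mulVec, dotProduct, this]
      · intro a b
        simp [Matrix.mul_apply, Fin.sum_univ_succ]
    rw [dmat_mul, dmat_blockOne, hρ, sub_self, Matrix.mul_zero, add_zero, hP.conn, Matrix.mul_assoc,
      h2, Matrix.mul_assoc]

theorem mul_blockOne_zero (P : Matrix (Fin (m + 1)) (Fin (m + 1)) R) (ρ : Matrix (Fin m) (Fin m) R)
    (i : Fin (m + 1)) : (P * blockOne ρ) i 0 = P i 0 := by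
  simp [Matrix.mul_apply, Fin.sum_univ_succ]

theorem mul_blockOne_mulVec (P : Matrix (Fin (m + 1)) (Fin (m + 1)) R)
    (ρ : Matrix (Fin m) (Fin m) R) (r : R) (x : Fin m → R) :
    (P * blockOne ρ).mulVec (Fin.cons r x) = P.mulVec (Fin.cons r (ρ.mulVec x)) := by
  rw [← Matrix.mulVec_mulVec]
  congr 1
  ext i
  refine Fin.cases ?_ (fun a => ?_) i <;> simp [Matrix.mulVec, dotProduct, Fin.sum_univ_succ]

end Rotation

end

section

open smoothFun

/-! ### The flows of the hierarchy in a suitable parallel frame -/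

section Flows

variable {m : ℕ} {τ₀ τ₁ l₀ l₁ : ℝ} {G : Matrix (Fin (m + 1)) (Fin (m + 1)) ℝ}
  {κ : Matrix (Fin m) (Fin m) ℝ}
  {P : Matrix (Fin (m + 1)) (Fin (m + 1)) (smoothFun (rectOpens τ₀ τ₁ l₀ l₁))}
  {v : Fin m → smoothFun (rectOpens τ₀ τ₁ l₀ l₁)}
  {Y : Fin (m + 1) → smoothFun (rectOpens τ₀ τ₁ l₀ l₁)}

theorem IsAdaptedFrame.mulVec_injective {R : Type*} [CommRing R] [Algebra ℝ R]
    {d : Derivation ℝ R R} {P : Matrix (Fin (m + 1)) (Fin (m + 1)) R} {v : Fin m → R}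
    (hdet : κ.det ≠ 0) (hP : IsAdaptedFrame d G κ P v) : Function.Injective P.mulVec := by
  obtain ⟨P', hP'P, -⟩ := exists_inverse_of_gram hdet hP.gram
  intro x y h
  have := congrArg P'.mulVec h
  simpa [Matrix.mulVec_mulVec, hP'P] using this

/-- A rotation with σ_τ = σCκ adds σCκv to the derivative of σv, and Cκv = -v⌋C. Any term v⌋C with C
independent of l can thus be removed from the evolution of v. -/
theorem exists_rotated_frame (c : rectOpens τ₀ τ₁ l₀ l₁) (hκ : κ.IsSymm) (hdet : κ.det ≠ 0)
    (hP : IsAdaptedFrame dl G κ P v)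
    {C : Matrix (Fin m) (Fin m) (smoothFun (rectOpens τ₀ τ₁ l₀ l₁))} (hCs : C.transpose = -C)
    (hC : dmat dl C = 0) :
    ∃ (P' : Matrix (Fin (m + 1)) (Fin (m + 1)) (smoothFun (rectOpens τ₀ τ₁ l₀ l₁)))
      (σ : Matrix (Fin m) (Fin m) (smoothFun (rectOpens τ₀ τ₁ l₀ l₁))),
      IsAdaptedFrame dl G κ P' (σ.mulVec v) ∧ (∀ i, P' i 0 = P i 0) ∧ dmat dl σ = 0 ∧
      σ.transpose * κ.map (algebraMap ℝ _) * σ = κ.map (algebraMap ℝ _) ∧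
      dv dt (σ.mulVec v) = σ.mulVec (dv dt v - gint κ v C) ∧
      ∀ r x, P'.mulVec (Fin.cons r (σ.mulVec x)) = P.mulVec (Fin.cons r x) := by
  obtain ⟨σ, ρ, hσ, hρ, hσρ, hρσ, hσt, hσκ⟩ := exists_rotation c hκ hdet hCs hC
  refine ⟨P * blockOne ρ, σ, hP.rotate hκ hρ hσρ hρσ hσκ, mul_blockOne_zero P ρ, hσ, hσκ, ?_,
    fun r x => ?_⟩
  · rw [dv_mulVec, hσt, ← Matrix.mulVec_mulVec, ← Matrix.mulVec_mulVec,
      map_mulVec_of_skew v hκ hCs, ← Matrix.mulVec_add]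
    congr 1
    abel
  · rw [mul_blockOne_mulVec, Matrix.mulVec_mulVec, hρσ, Matrix.one_mulVec]

/-- For Y = X the structure equations have h∥ = 1, h⊥ = 0 and ϖ = v. Then v∧ϖ = 0, so Θ is
independent of l and can be rotated away. -/
theorem exists_frame_of_convective (c : rectOpens τ₀ τ₁ l₀ l₁) (hκ : κ.IsSymm) (hdet : κ.det ≠ 0)
    (hP : IsAdaptedFrame dl G κ P v) (h : (dv dl fun i => P i 0) = dv dt fun i => P i 0) :
    ∃ P' v', IsAdaptedFrame dl G κ P' v' ∧ (∀ i, P' i 0 = P i 0) ∧ dv dt v' = dv dl v' := by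
  obtain ⟨r, x, ϖ, Θ, hY, -, -, hϖ, hΘ, hΘd, hv⟩ :=
    hP.structure_equations dl_dt hκ hdet (Y := fun i => P i 0) h
  have h1 : (fun i => P i 0) = P.mulVec (Fin.cons 1 0) := by
    ext1 i; simp [Matrix.mulVec, dotProduct, Fin.sum_univ_succ]
  have h2 := hP.mulVec_injective hdet (h1.symm.trans hY)
  have hr : r = 1 := (congrFun h2 0).symm
  have hx : x = 0 := funext fun a => (congrFun h2 a.succ).symm
  have hϖv : ϖ = v := by
    rw [hϖ, hr, hx, one_smul, show dv dl (0 : Fin m → smoothFun (rectOpens τ₀ τ₁ l₀ l₁)) = 0 from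
      funext fun a => map_zero dl, zero_add]
  have hΘ0 : dmat dl Θ = 0 := by rw [hΘd, hϖv, gwedge, sub_self]
  obtain ⟨P', σ, hP', hP0, hσ, -, hσv, -⟩ := exists_rotated_frame c hκ hdet hP hΘ hΘ0
  refine ⟨P', _, hP', hP0, ?_⟩
  rw [hσv, hv, hϖv, add_sub_cancel_right, dv_mulVec, hσ, Matrix.zero_mulVec, zero_add]

/-- Here ϖ = 0, so v_τ = v⌋Θ with Θ independent of l, and the rotation removes all of it. -/
theorem exists_frame_of_wave (c : rectOpens τ₀ τ₁ l₀ l₁) (hκ : κ.IsSymm) (hdet : κ.det ≠ 0)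
    (hP : IsAdaptedFrame dl G κ P v) (hY : dv dl Y = dv dt fun i => P i 0)
    (h : (dv dt fun i => P i 0) = 0) :
    ∃ P' v', IsAdaptedFrame dl G κ P' v' ∧ (∀ i, P' i 0 = P i 0) ∧ dv dt v' = 0 := by
  obtain ⟨r, x, ϖ, Θ, -, -, hX, hϖ, hΘ, hΘd, hv⟩ := hP.structure_equations dl_dt hκ hdet hY
  have h2 := hP.mulVec_injective hdet ((Matrix.mulVec_zero P).trans (h.symm.trans hX))
  have hϖ0 : ϖ = 0 := funext fun a => (congrFun h2 a.succ).symm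
  have hΘ0 : dmat dl Θ = 0 := by rw [hΘd, hϖ0, gwedge]; simp
  obtain ⟨P', σ, hP', hP0, -, -, hσv, -⟩ := exists_rotated_frame c hκ hdet hP hΘ hΘ0
  refine ⟨P', _, hP', hP0, ?_⟩
  rw [hσv, hv, add_sub_cancel_right, hϖ0, show dv dl (0 : Fin m → smoothFun (rectOpens τ₀ τ₁ l₀ l₁)) = 0
    from funext fun a => map_zero dl, Matrix.mulVec_zero]

section Subst

variable {Q : TopologicalSpace.Opens (ℝ × ℝ)} {h : HierarchyData m}

theorem subst_comp_jet_zero (v : Fin m → smoothFun Q) : subst v ∘ jet m 0 = v := by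
  ext1 a; simp [subst, jet]

theorem dv_subst (v : Fin m → smoothFun Q) (x : DVec m) :
    dv dl (subst v ∘ x) = subst v ∘ dv (totalD m) x :=
  funext fun a => (subst_totalD v (x a)).symm

theorem subst_ϖ_succ (H : IsHierarchy κ h) (v : Fin m → smoothFun Q) (k : ℕ) :
    subst v ∘ h.ϖ (k + 1) = dv dl (subst v ∘ h.e k) + subst v (h.p k) • v := by
  rw [H.ϖ_succ_eq, dv_subst]
  ext1 a
  have hv : subst v (jet m 0 a) = v a := congrFun (subst_comp_jet_zero v) a
  simp [hv]

theorem dmat_subst_W (H : IsHierarchy κ h) (v : Fin m → smoothFun Q) (k : ℕ) :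
    dmat dl ((h.W k).map (subst v)) = gwedge v (subst v ∘ h.ϖ k) := by
  have h1 : gwedge v (subst v ∘ h.ϖ k) = (gwedge (jet m 0) (h.ϖ k)).map (subst v) := by
    rw [map_gwedge, subst_comp_jet_zero]
  rw [h1, ← H.dmat_W]
  exact Matrix.ext fun a b => (subst_totalD v (h.W k a b)).symm

theorem subst_e (H : IsHierarchy κ h) (v : Fin m → smoothFun Q) (k : ℕ) :
    subst v ∘ h.e k = dv dl (subst v ∘ h.ϖ k) + gint κ v ((h.W k).map (subst v)) := by
  have h1 : gint κ v ((h.W k).map (subst v)) = subst v ∘ gint κ (jet m 0) (h.W k) := by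
    rw [comp_gint, subst_comp_jet_zero]
  rw [h1, dv_subst, H.e_eq_dv]
  exact funext fun b => map_add (subst v) _ _

theorem dl_subst_p (H : IsHierarchy κ h) (v : Fin m → smoothFun Q) (k : ℕ) :
    dl (subst v (h.p k)) = gdot κ v (subst v ∘ h.e k) := by
  rw [← subst_totalD, H.p_deriv, dot_eq_gdot, map_gdot, subst_comp_jet_zero]

end Subst

/-- The frame components of the flow give ϖ = -ϖ^(k+1). Hence Θ and -W^(k+1) are primitives of the
same bivector and differ by a matrix independent of l, which a rotation removes. By equivariance the
map equation keeps its form in the rotated frame. -/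
theorem exists_frame_of_higher {h : HierarchyData m} (H : IsBiHamiltonianHierarchy κ h)
    (c : rectOpens τ₀ τ₁ l₀ l₁) (hκ : κ.IsSymm) (hdet : κ.det ≠ 0)
    (hP : IsAdaptedFrame dl G κ P v) (hY : dv dl Y = dv dt fun i => P i 0) (k : ℕ)
    (hflow : -Y = P.mulVec (Fin.cons (subst v (h.p k)) (subst v ∘ h.e k))) :
    ∃ P' v', IsAdaptedFrame dl G κ P' v' ∧ (∀ i, P' i 0 = P i 0) ∧
      -Y = P'.mulVec (Fin.cons (subst v' (h.p k)) (subst v' ∘ h.e k)) ∧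
      -dv dt v' = subst v' ∘ h.e (k + 1) := by
  obtain ⟨r, x, ϖ, Θ, hYx, -, -, hϖ, hΘ, hΘd, hv⟩ := hP.structure_equations dl_dt hκ hdet hY
  have hI := H.hierarchy
  have h2 : -(Fin.cons r x : Fin (m + 1) → smoothFun (rectOpens τ₀ τ₁ l₀ l₁)) =
      Fin.cons (subst v (h.p k)) (subst v ∘ h.e k) := by
    apply hP.mulVec_injective hdet
    rw [← hflow, Matrix.mulVec_neg, ← hYx]
  have hr : r = -subst v (h.p k) := by rw [← neg_eq_iff_eq_neg]; exact congrFun h2 0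
  have hx : x = -(subst v ∘ h.e k) := by
    rw [← neg_eq_iff_eq_neg]; exact funext fun a => congrFun h2 a.succ
  have hϖk : ϖ = -(subst v ∘ h.ϖ (k + 1)) := by
    rw [hϖ, hr, hx, subst_ϖ_succ hI, dv_neg, neg_smul, neg_add]
  obtain ⟨W, hW⟩ : ∃ W, W = (h.W (k + 1)).map (subst v) := ⟨_, rfl⟩
  have hWs : W.transpose = -W := by
    rw [hW, ← Matrix.transpose_map, hI.W_skew, map_neg_algHom]
  have hCs : (Θ + W).transpose = -(Θ + W) := by
    rw [Matrix.transpose_add, hΘ, hWs, neg_add]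
  have hC : dmat dl (Θ + W) = 0 := by
    rw [dmat_add, hΘd, hW, dmat_subst_W hI, hϖk]
    refine Matrix.ext fun a b => ?_
    simp [gwedge_apply]
  obtain ⟨P', σ, hP', hP0, hσ, hσκ, hσv, hcons⟩ := exists_rotated_frame c hκ hdet hP hCs hC
  refine ⟨P', _, hP', hP0, ?_, ?_⟩
  · obtain ⟨e1, e2⟩ := subst_equivariant H hdet hσ hσκ v k
    rw [e1, e2, hcons, hflow]
  · obtain ⟨-, e2⟩ := subst_equivariant H hdet hσ hσκ v (k + 1)
    rw [e2, hσv, ← Matrix.mulVec_neg, hv, subst_e hI, hϖk, ← hW, gint_add_right, dv_neg]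
    congr 1
    abel

end Flows

end

section

open smoothFun TopologicalSpace

/-! ### Curve flows in flat components -/

namespace FlowComponent

/-- The connection vanishes and the metric is constant along the surface. -/
structure IsFlat {n : ℕ} (S : FlowComponent n) (G : Matrix (Fin n) (Fin n) ℝ)
    (Q : Set (ℝ × ℝ)) : Prop where
  smooth_X : ∀ i, ContDiffOn ℝ ∞ (fun q : ℝ × ℝ => S.X q.1 q.2 i) Q
  smooth_Y : ∀ i, ContDiffOn ℝ ∞ (fun q : ℝ × ℝ => S.Y q.1 q.2 i) Q
  A_eq : ∀ q ∈ Q, S.A q.1 q.2 = 0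
  B_eq : ∀ q ∈ Q, S.B q.1 q.2 = 0
  G_eq : ∀ q ∈ Q, S.G q.1 q.2 = G

section Bridge

variable {n m : ℕ} {Q : Opens (ℝ × ℝ)} {S : FlowComponent n} {G : Matrix (Fin n) (Fin n) ℝ}

theorem IsFlat.covL_eq (hS : S.IsFlat G Q) {Z : ℝ → ℝ → Fin n → ℝ} {z : Fin n → smoothFun Q}
    (h : ∀ q : Q, ∀ i, Z q.1.1 q.1.2 i = ev q (z i)) (q : Q) :
    S.covL Z q.1.1 q.1.2 = ev q ∘ dv dl z := by
  ext1 i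
  rw [covL, hS.A_eq q q.2]
  simp only [Matrix.zero_apply, zero_mul, Finset.sum_const_zero, add_zero]
  exact deriv_snd_congr (f := fun τ l => Z τ l i) (z i) (fun q => h q i) q

theorem IsFlat.covT_eq (hS : S.IsFlat G Q) {Z : ℝ → ℝ → Fin n → ℝ} {z : Fin n → smoothFun Q}
    (h : ∀ q : Q, ∀ i, Z q.1.1 q.1.2 i = ev q (z i)) (q : Q) :
    S.covT Z q.1.1 q.1.2 = ev q ∘ dv dt z := by
  ext1 i
  rw [covT, hS.B_eq q q.2]
  simp only [Matrix.zero_apply, zero_mul, Finset.sum_const_zero, add_zero]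
  exact deriv_fst_congr (f := fun τ l => Z τ l i) (z i) (fun q => h q i) q

theorem IsFlat.ip_eq (hS : S.IsFlat G Q) (q : Q) (x y : Fin n → smoothFun Q) :
    S.ip q.1.1 q.1.2 (ev q ∘ x) (ev q ∘ y) = ev q (gdot G x y) := by
  rw [map_gdot, ip, hS.G_eq q q.2, gdot]
  simp only [dotProduct, Matrix.mulVec, Finset.mul_sum]
  exact Finset.sum_congr rfl fun i _ => Finset.sum_congr rfl fun j _ => by
    simp only [Matrix.map_apply, Algebra.algebraMap_self, RingHom.id_apply]; ring

/-- The field `γ_l` as a smooth function. -/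
def fieldX (hS : S.IsFlat G Q) (i : Fin n) : smoothFun Q :=
  smoothFun.mk Q (fun τ l => S.X τ l i) (hS.smooth_X i)

/-- The field `γ_τ` as a smooth function. -/
def fieldY (hS : S.IsFlat G Q) (i : Fin n) : smoothFun Q :=
  smoothFun.mk Q (fun τ l => S.Y τ l i) (hS.smooth_Y i)

theorem ev_comp_fieldY (hS : S.IsFlat G Q) (q : Q) : ev q ∘ fieldY hS = S.Y q.1.1 q.1.2 := rfl

theorem vec_ext_ev {x y : Fin n → smoothFun Q} (h : ∀ q, ev q ∘ x = ev q ∘ y) : x = y :=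
  funext fun i => ext_ev fun q => congrFun (h q) i

theorem nonStretching_iff (hS : S.IsFlat G Q) :
    S.NonStretching Q ↔ gdot G (fieldX hS) (fieldX hS) = 1 := by
  constructor
  · intro h
    refine ext_ev fun q => ?_
    rw [← hS.ip_eq, map_one]; exact h q q.2
  · intro h q hq
    have := hS.ip_eq ⟨q, hq⟩ (fieldX hS) (fieldX hS)
    rw [h, map_one] at this
    exact this

theorem torsionFree_iff (hS : S.IsFlat G Q) :
    S.TorsionFree Q ↔ dv dl (fieldY hS) = dv dt (fieldX hS) := by
  constructor
  · intro h
    refine vec_ext_ev fun q => ?_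
    rw [← hS.covL_eq (Z := S.Y) (fun _ _ => rfl), ← hS.covT_eq (Z := S.X) (fun _ _ => rfl)]
    exact h q q.2
  · intro h q hq
    rw [hS.covL_eq (z := fieldY hS) (fun _ _ => rfl) ⟨q, hq⟩,
      hS.covT_eq (z := fieldX hS) (fun _ _ => rfl) ⟨q, hq⟩, h]

theorem isWaveMap_iff (hS : S.IsFlat G Q) : S.IsWaveMap Q ↔ dv dt (fieldX hS) = 0 := by
  constructor
  · intro h
    refine vec_ext_ev fun q => ?_
    rw [← hS.covT_eq (Z := S.X) (fun _ _ => rfl), h q q.2]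
    ext1 i; simp
  · intro h q hq
    rw [hS.covT_eq (z := fieldX hS) (fun _ _ => rfl) ⟨q, hq⟩, h]
    ext1 i; simp

theorem isConvectiveMap_iff (hS : S.IsFlat G Q) : S.IsConvectiveMap Q ↔ fieldY hS = fieldX hS := by
  constructor
  · intro h
    exact vec_ext_ev fun q => h q q.2
  · intro h q hq
    rw [← ev_comp_fieldY hS ⟨q, hq⟩, h]
    rfl

end Bridge

section Frames

variable {m : ℕ} {Q : Opens (ℝ × ℝ)} {S : FlowComponent (m + 1)}
  {G : Matrix (Fin (m + 1)) (Fin (m + 1)) ℝ} {κ : Matrix (Fin m) (Fin m) ℝ}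
  {F : ℝ → ℝ → Fin m → Fin (m + 1) → ℝ} {v : ℝ → ℝ → Fin m → ℝ}

/-- The frame `X, F` and the functions `v` are represented by smooth functions. -/
structure Represents (hS : S.IsFlat G Q) (F : ℝ → ℝ → Fin m → Fin (m + 1) → ℝ)
    (v : ℝ → ℝ → Fin m → ℝ) (P : Matrix (Fin (m + 1)) (Fin (m + 1)) (smoothFun Q))
    (w : Fin m → smoothFun Q) : Prop where
  tangent : ∀ i, P i 0 = fieldX hS i
  normal : ∀ q : Q, ∀ a i, F q.1.1 q.1.2 a i = ev q (P i a.succ)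
  curvature : ∀ q : Q, ∀ a, v q.1.1 q.1.2 a = ev q (w a)

variable {hS : S.IsFlat G Q} {P : Matrix (Fin (m + 1)) (Fin (m + 1)) (smoothFun Q)}
  {w : Fin m → smoothFun Q}

theorem ev_comp_mulVec_cons (hR : Represents hS F v P w) (r : smoothFun Q) (x : Fin m → smoothFun Q)
    (q : Q) : ev q ∘ P.mulVec (Fin.cons r x) =
      ev q r • S.X q.1.1 q.1.2 + ∑ a, ev q (x a) • F q.1.1 q.1.2 a := by
  ext1 i
  have h : ev q (P i 0) = S.X q.1.1 q.1.2 i := by rw [hR.tangent]; rfl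
  simp [Matrix.mulVec, dotProduct, Fin.sum_univ_succ, h, hR.normal, mul_comm]

theorem eq_mulVec_cons_iff (hR : Represents hS F v P w) {y : Fin (m + 1) → smoothFun Q}
    {r : smoothFun Q} {x : Fin m → smoothFun Q} : y = P.mulVec (Fin.cons r x) ↔
      ∀ q : Q, ev q ∘ y = ev q r • S.X q.1.1 q.1.2 + ∑ a, ev q (x a) • F q.1.1 q.1.2 a := by
  constructor
  · intro h q
    rw [h, ev_comp_mulVec_cons hR]
  · intro h
    exact vec_ext_ev fun q => by rw [h, ev_comp_mulVec_cons hR]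

theorem represents_out (hP : ∀ i, P i 0 = fieldX hS i) :
    Represents hS (fun τ l a i => out (P i a.succ) τ l) (fun τ l a => out (w a) τ l) P w :=
  ⟨hP, fun q _ _ => out_eq _ q, fun q _ => out_eq _ q⟩

/-- Frames of smooth functions are parallel frames. -/
theorem isParallelFrame_iff (hG : G.IsSymm) (hX : gdot G (fieldX hS) (fieldX hS) = 1)
    (hR : Represents hS F v P w) : S.IsParallelFrame Q κ F v ↔ IsAdaptedFrame dl G κ P w := by
  have hcX : ∀ q : Q, S.X q.1.1 q.1.2 = ev q ∘ fun i => P i 0 := fun q => by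
    rw [funext hR.tangent]; rfl
  have hcF : ∀ (q : Q) a, F q.1.1 q.1.2 a = ev q ∘ fun i => P i a.succ := fun q a =>
    funext fun i => hR.normal q a i
  have hent : ∀ i j, (P.transpose * G.map (algebraMap ℝ (smoothFun Q)) * P) i j =
      gdot G (fun r => P r i) (fun r => P r j) := fun i j => by
    rw [Matrix.mul_assoc]; rfl
  have hX' : gdot G (fun r => P r 0) (fun r => P r 0) = 1 := by
    rw [funext hR.tangent]; exact hX
  have hconn0 : ∀ i, (P * frameConn κ w 0) i 0 = ∑ a, P i a.succ * w a := fun i => by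
    simp [Matrix.mul_apply, Fin.sum_univ_succ]
  have hconn : ∀ i b, (P * frameConn κ w 0) i (Fin.succ b) =
      -(κ.map (algebraMap ℝ _)).mulVec w b * P i 0 := fun i b => by
    simp [Matrix.mul_apply, Fin.sum_univ_succ, mul_comm]
  have hcovX : ∀ q : Q, S.covL S.X q.1.1 q.1.2 = ev q ∘ dv dl fun i => P i 0 := fun q =>
    hS.covL_eq (fun q i => by rw [hR.tangent]; rfl) q
  have hcovF : ∀ (q : Q) a, S.covL (fun τ l => F τ l a) q.1.1 q.1.2 =
      ev q ∘ dv dl fun i => P i a.succ := fun q a =>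
    hS.covL_eq (fun q i => hR.normal q a i) q
  have hsum : ∀ (q : Q) b, ev q ((κ.map (algebraMap ℝ _)).mulVec w b) =
      ∑ c, κ b c * v q.1.1 q.1.2 c := fun q b => by
    simp [Matrix.mulVec, dotProduct, hR.curvature]
  constructor
  · intro h
    refine ⟨?_, ?_⟩
    · apply matrix_ext_succ
      · rw [hent, hX']; rfl
      · intro b
        rw [hent]
        refine ext_ev fun q => ?_
        rw [← hS.ip_eq, ← hcX, ← hcF, h.normal q q.2]; simp
      · intro a
        rw [hent, gdot_comm _ _ hG]
        refine ext_ev fun q => ?_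
        rw [← hS.ip_eq, ← hcX, ← hcF, h.normal q q.2]; simp
      · intro a b
        rw [hent]
        refine ext_ev fun q => ?_
        rw [← hS.ip_eq, ← hcF, ← hcF, h.gram q q.2]; simp
    · refine Matrix.ext fun i j => ext_ev fun q => ?_
      refine Fin.cases ?_ (fun b => ?_) j
      · rw [hconn0]
        have h1 := congrFun ((hcovX q).symm.trans (h.principal q q.2)) i
        refine h1.trans ?_
        simp [hR.normal, hR.curvature, mul_comm]
      · rw [hconn]
        have h1 := congrFun ((hcovF q b).symm.trans (h.parallel q q.2 b)) i
        refine h1.trans ?_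
        rw [map_mul, map_neg, hsum, hcX]; simp
  · intro h
    refine ⟨fun a i => ?_, fun a => ?_, fun q hq a => ?_, fun q hq a b => ?_, fun q hq => ?_,
      fun q hq a => ?_⟩
    · exact (contDiffOn_out (P i a.succ)).congr fun q hq =>
        (hR.normal ⟨q, hq⟩ a i).trans (out_eq _ ⟨q, hq⟩).symm
    · exact (contDiffOn_out (w a)).congr fun q hq =>
        (hR.curvature ⟨q, hq⟩ a).trans (out_eq _ ⟨q, hq⟩).symm
    · rw [hcX ⟨q, hq⟩, hcF ⟨q, hq⟩, hS.ip_eq ⟨q, hq⟩, ← hent, h.gram]; simp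
    · rw [hcF ⟨q, hq⟩, hcF ⟨q, hq⟩, hS.ip_eq ⟨q, hq⟩, ← hent, h.gram]; simp
    · rw [hcovX ⟨q, hq⟩]
      ext1 i
      have h1 := congrArg (ev ⟨q, hq⟩) ((congrFun (congrFun h.conn i) 0).trans (hconn0 i))
      refine h1.trans ?_
      simp [hR.normal ⟨q, hq⟩, hR.curvature ⟨q, hq⟩, mul_comm]
    · rw [hcovF ⟨q, hq⟩]
      ext1 i
      have h1 := congrArg (ev ⟨q, hq⟩) ((congrFun (congrFun h.conn i) a.succ).trans (hconn i a))
      refine h1.trans ?_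
      rw [map_mul, map_neg, hsum, hcX ⟨q, hq⟩]; simp

theorem IsParallelFrame.exists_represents (hS : S.IsFlat G Q) (h : S.IsParallelFrame Q κ F v) :
    ∃ P w, Represents hS F v P w :=
  ⟨Matrix.of fun i => Fin.cons (fieldX hS i) fun a =>
    smoothFun.mk Q (fun τ l => F τ l a i) (h.smooth_F a i),
    fun a => smoothFun.mk Q (fun τ l => v τ l a) (h.smooth_v a), fun _ => rfl, fun _ _ _ => rfl,
    fun _ _ => rfl⟩

theorem isHigherMap_iff (hR : Represents hS F v P w) (h : HierarchyData m) (k : ℕ) :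
    S.IsHigherMap Q h k F v ↔
      -fieldY hS = P.mulVec (Fin.cons (subst w (h.p k)) (subst w ∘ h.e k)) := by
  rw [eq_mulVec_cons_iff hR]
  have h1 : ∀ q : Q, ev q ∘ (-fieldY hS) = -S.Y q.1.1 q.1.2 := fun q => by
    ext1 i; simp [fieldY]
  constructor
  · intro H q
    rw [h1, H q q.2, evalJet_eq (fun a q => hR.curvature q a)]
    simp only [evalJet_eq (fun a q => hR.curvature q a), Function.comp_apply]
  · intro H q hq
    have h2 := H ⟨q, hq⟩
    rw [h1] at h2
    rw [h2, evalJet_eq (fun a q => hR.curvature q a) _ ⟨q, hq⟩]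
    simp only [evalJet_eq (fun a q => hR.curvature q a) _ ⟨q, hq⟩, Function.comp_apply]

theorem gdot_mulVec_cons {R : Type*} [CommRing R] [Algebra ℝ R]
    {P : Matrix (Fin (m + 1)) (Fin (m + 1)) R}
    (h : P.transpose * G.map (algebraMap ℝ R) * P = blockOne (κ.map (algebraMap ℝ R))) (r s : R)
    (x y : Fin m → R) : gdot G (P.mulVec (Fin.cons r x)) (P.mulVec (Fin.cons s y)) =
      r * s + gdot κ x y := by
  rw [gdot, ← Matrix.vecMul_transpose, ← Matrix.dotProduct_mulVec, Matrix.mulVec_mulVec,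
    Matrix.mulVec_mulVec, h]
  simp [dotProduct, Matrix.mulVec, Fin.sum_univ_succ, gdot]

/-- In a parallel frame D_X²X = v_l F - |v|² X, so adding (3/2)|v|² X leaves the tangential
coefficient |v|²/2, which is the first potential. -/
theorem isMKdVMap_iff (hR : Represents hS F v P w) (hP : IsAdaptedFrame dl G κ P w)
    (hκ : κ.IsSymm) : S.IsMKdVMap Q ↔
      -fieldY hS = P.mulVec (Fin.cons ((1 / 2 : ℝ) • gdot κ w w) (dv dl w)) := by
  have hX1 : dv dl (fieldX hS) = P.mulVec (Fin.cons 0 w) := by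
    rw [← funext hR.tangent]
    ext1 i
    refine (congrFun (congrFun hP.conn i) 0).trans ?_
    simp [Matrix.mul_apply, Matrix.mulVec, dotProduct, Fin.sum_univ_succ]
  have hX2 : dv dl (dv dl (fieldX hS)) = P.mulVec (Fin.cons (-gdot κ w w) (dv dl w)) := by
    rw [hX1, dv_mulVec, hP.conn, ← Matrix.mulVec_mulVec, ← Matrix.mulVec_add]
    congr 1
    ext i
    refine Fin.cases ?_ (fun a => ?_) i
    · simp [dv, Matrix.mulVec, dotProduct, Fin.sum_univ_succ]
      rw [gdot_comm w w hκ, gdot]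
      simp [dotProduct, Matrix.mulVec, mul_comm]
    · simp [dv, Matrix.mulVec, dotProduct, Fin.sum_univ_succ]
  have hX0 : fieldX hS = P.mulVec (Fin.cons 1 0) := by
    rw [← funext hR.tangent]
    ext1 i; simp [Matrix.mulVec, dotProduct, Fin.sum_univ_succ]
  have hg : gdot G (dv dl (fieldX hS)) (dv dl (fieldX hS)) = gdot κ w w := by
    rw [hX1, gdot_mulVec_cons hP.gram]; simp
  have key : P.mulVec (Fin.cons ((1 / 2 : ℝ) • gdot κ w w) (dv dl w)) =
      dv dl (dv dl (fieldX hS)) + ((3 / 2 : ℝ) • gdot κ w w) • fieldX hS := by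
    conv_rhs => rw [hX2, hX0, ← Matrix.mulVec_smul, ← Matrix.mulVec_add]
    congr 1
    ext i
    refine Fin.cases ?_ (fun a => ?_) i
    · simp only [Fin.cons_zero, Pi.add_apply, Pi.smul_apply, smul_eq_mul, mul_one]
      module
    · simp
  have hc1 : ∀ q : Q, S.covL S.X q.1.1 q.1.2 = ev q ∘ dv dl (fieldX hS) := fun q =>
    hS.covL_eq (fun _ _ => rfl) q
  have hc2 : ∀ q : Q, S.covL (S.covL S.X) q.1.1 q.1.2 = ev q ∘ dv dl (dv dl (fieldX hS)) := fun q =>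
    hS.covL_eq (fun q i => congrFun (hc1 q) i) q
  have hr : ∀ q : Q, S.covL (S.covL S.X) q.1.1 q.1.2 +
      ((3 / 2) * S.ip q.1.1 q.1.2 (S.covL S.X q.1.1 q.1.2) (S.covL S.X q.1.1 q.1.2)) •
        S.X q.1.1 q.1.2 =
      ev q ∘ P.mulVec (Fin.cons ((1 / 2 : ℝ) • gdot κ w w) (dv dl w)) := fun q => by
    rw [key, hc2, hc1, hS.ip_eq, hg]
    ext1 i
    simp [fieldX, mul_assoc]
  have h1 : ∀ q : Q, ev q ∘ (-fieldY hS) = -S.Y q.1.1 q.1.2 := fun q => by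
    ext1 i; simp [fieldY]
  constructor
  · intro H
    refine vec_ext_ev fun q => ?_
    rw [h1, ← hr]; exact H q q.2
  · intro H q hq
    rw [← h1 ⟨q, hq⟩, hr ⟨q, hq⟩, H]

end Frames

end FlowComponent

end

section

/-! ### Flat components realise the hierarchy -/

open smoothFun TopologicalSpace

namespace FlowComponent

section Realizes

variable {m : ℕ} {τ₀ τ₁ l₀ l₁ : ℝ} {S : FlowComponent (m + 1)}
  {G : Matrix (Fin (m + 1)) (Fin (m + 1)) ℝ} {κ : Matrix (Fin m) (Fin m) ℝ}
  {F : ℝ → ℝ → Fin m → Fin (m + 1) → ℝ} {v : ℝ → ℝ → Fin m → ℝ}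

theorem deriv_snd_out {Q : Opens (ℝ × ℝ)} (f : smoothFun Q) (q : Q) :
    deriv (fun s => out f q.1.1 s) q.1.2 = ev q (dl f) :=
  deriv_snd_congr (f := out f) f (out_eq f) q

theorem deriv_fst_out {Q : Opens (ℝ × ℝ)} (f : smoothFun Q) (q : Q) :
    deriv (fun s => out f s q.1.2) q.1.1 = ev q (dt f) :=
  deriv_fst_congr (f := out f) f (out_eq f) q

/-- The structure equations of the differential algebra, evaluated at points. The frame is
invertible, so the wave map equation is ϖ = 0, that is J(h⊥) = 0 with the potential h∥. -/
theorem IsFlat.exists_hamiltonianForm {Q : Opens (ℝ × ℝ)} (hS : S.IsFlat G Q) (hκ : κ.IsSymm)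
    (hdet : κ.det ≠ 0) (hT : S.TorsionFree Q)
    {P : Matrix (Fin (m + 1)) (Fin (m + 1)) (smoothFun Q)} {w : Fin m → smoothFun Q}
    (hR : Represents hS F v P w) (hP : IsAdaptedFrame dl G κ P w) :
    ∃ hpar hperp ϖ Θ, S.IsHamiltonianForm Q κ F v hpar hperp ϖ Θ ∧
      (S.IsWaveMap Q ↔
        ∀ q ∈ Q, ∀ a, deriv (fun s => hperp q.1 s a) q.2 + hpar q.1 q.2 * v q.1 q.2 a = 0) := by
  have hY := (torsionFree_iff hS).1 hT
  rw [← funext hR.tangent] at hY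
  obtain ⟨r, x, ϖ, Θ, hYx, hr, hX, hϖ, hΘ, hΘd, hv⟩ :=
    hP.structure_equations dl_dt hκ hdet hY
  have hcovT : ∀ q : Q, S.covT S.X q.1.1 q.1.2 = ev q ∘ dv dt fun i => P i 0 := fun q =>
    hS.covT_eq (fun q i => by rw [hR.tangent]; rfl) q
  have hϖ' : ∀ (q : Q) a, ev q (ϖ a) = ev q (dl (x a)) + ev q r * v q.1.1 q.1.2 a := fun q a => by
    rw [hR.curvature, ← map_mul, ← map_add]; exact congrArg (ev q) (congrFun hϖ a)
  refine ⟨out r, fun τ l a => out (x a) τ l, fun τ l a => out (ϖ a) τ l,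
    fun τ l => Matrix.of fun a b => out (Θ a b) τ l, ?_, ?_⟩
  · refine ⟨contDiffOn_out r, fun a => contDiffOn_out (x a), fun a => contDiffOn_out (ϖ a),
      fun a b => contDiffOn_out (Θ a b), fun q hq => ?_, fun q hq => ?_, fun q hq => ?_,
      fun q hq a => ?_, fun q hq => ?_, fun q hq a b => ?_, fun q hq b => ?_⟩
    · have := (eq_mulVec_cons_iff hR).1 hYx ⟨q, hq⟩
      simp only [out_eq _ ⟨q, hq⟩]
      exact this
    · rw [deriv_snd_out r ⟨q, hq⟩, hr]
      simp only [out_eq _ ⟨q, hq⟩, hR.curvature ⟨q, hq⟩]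
      simp only [gdot, dotProduct, Matrix.mulVec, map_sum, map_mul, Matrix.map_apply,
        AlgHom.commutes, Algebra.algebraMap_self, RingHom.id_apply, Finset.mul_sum]
      exact Finset.sum_congr rfl fun a _ => Finset.sum_congr rfl fun b _ => by ring
    · rw [hcovT ⟨q, hq⟩, hX, ev_comp_mulVec_cons hR]
      simp only [out_eq _ ⟨q, hq⟩]
      simp
    · rw [deriv_snd_out (x a) ⟨q, hq⟩, out_eq _ ⟨q, hq⟩, out_eq _ ⟨q, hq⟩]
      exact hϖ' ⟨q, hq⟩ a
    · refine Matrix.ext fun a b => ?_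
      have := congrArg (ev ⟨q, hq⟩) (congrFun (congrFun hΘ a) b)
      simp only [Matrix.transpose_apply, Matrix.of_apply, Matrix.neg_apply, out_eq _ ⟨q, hq⟩]
      rw [← map_neg]
      exact this
    · have := congrArg (ev ⟨q, hq⟩) (congrFun (congrFun hΘd a) b)
      simp only [Matrix.of_apply]
      rw [deriv_snd_out (Θ a b) ⟨q, hq⟩]
      simp only [out_eq _ ⟨q, hq⟩, hR.curvature ⟨q, hq⟩]
      refine this.trans ?_
      simp [gwedge, Matrix.vecMulVec_apply]
    · rw [deriv_snd_out (ϖ b) ⟨q, hq⟩,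
        deriv_fst_congr (f := fun τ l => v τ l b) (w b) (fun q => hR.curvature q b) ⟨q, hq⟩]
      have := congrArg (ev ⟨q, hq⟩) (congrFun hv b)
      refine this.trans ?_
      simp only [Matrix.of_apply, out_eq _ ⟨q, hq⟩, hR.curvature ⟨q, hq⟩]
      simp [gint, Matrix.vecMul, dotProduct, dv, Matrix.mul_apply, Finset.mul_sum, mul_assoc,
        mul_left_comm]
  · have h0 : S.IsWaveMap Q ↔ ϖ = 0 := by
      rw [isWaveMap_iff hS, ← funext hR.tangent, hX]
      constructor
      · intro h
        have h2 := hP.mulVec_injective hdet (h.trans (Matrix.mulVec_zero P).symm)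
        exact funext fun a => congrFun h2 a.succ
      · rintro rfl
        ext1 i
        simp [Matrix.mulVec, dotProduct, Fin.sum_univ_succ]
    rw [h0]
    constructor
    · intro h q hq a
      rw [deriv_snd_out (x a) ⟨q, hq⟩, out_eq _ ⟨q, hq⟩]
      refine (hϖ' ⟨q, hq⟩ a).symm.trans ?_
      rw [h]; simp
    · intro h
      refine vec_ext_ev fun q => funext fun a => ?_
      have := h q q.2 a
      rw [deriv_snd_out (x a) q, out_eq _ q] at this
      refine (hϖ' q a).trans (this.trans ?_)
      simp

/-- All constructions of frames start from initial values at one point c of the rectangle; the empty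
rectangle is treated separately. -/
theorem IsFlat.realizesHierarchy_of_nonempty (c : rectOpens τ₀ τ₁ l₀ l₁)
    (hS : S.IsFlat G (rectOpens τ₀ τ₁ l₀ l₁)) (hG : G.IsSymm) (hκ : κ.IsSymm) (hdet : κ.det ≠ 0)
    {P₀ : Matrix (Fin (m + 1)) (Fin (m + 1)) ℝ} (hP₀ : P₀.transpose * G * P₀ = blockOne κ)
    {h : HierarchyData m} (H : IsBiHamiltonianHierarchy κ h)
    (hX : S.NonStretching (rectOpens τ₀ τ₁ l₀ l₁)) (hT : S.TorsionFree (rectOpens τ₀ τ₁ l₀ l₁)) :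
    S.RealizesHierarchy (rectOpens τ₀ τ₁ l₀ l₁) κ h := by
  have hX' := (nonStretching_iff hS).1 hX
  have hT' := (torsionFree_iff hS).1 hT
  obtain ⟨P, w, hP, hPX⟩ := exists_adaptedFrame c hG hκ hdet hX' hP₀
  have hYP : dv dl (fieldY hS) = dv dt fun i => P i 0 := by rw [funext hPX]; exact hT'
  have lift : ∀ P' w', IsAdaptedFrame dl G κ P' w' → (∀ i, P' i 0 = fieldX hS i) →
      S.IsParallelFrame (rectOpens τ₀ τ₁ l₀ l₁) κ (fun τ l a i => out (P' i a.succ) τ l)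
        (fun τ l a => out (w' a) τ l) := fun P' w' h1 h2 =>
    (isParallelFrame_iff hG hX' (represents_out h2)).2 h1
  refine ⟨⟨_, _, lift P w hP hPX⟩, fun F v hF => ?_, fun hc => ?_, fun F v hF => ?_,
    fun k F v hF hk => ?_, fun hw => ?_⟩
  · obtain ⟨P', w', hR⟩ := hF.exists_represents hS
    exact hS.exists_hamiltonianForm hκ hdet hT hR ((isParallelFrame_iff hG hX' hR).1 hF)
  · have h1 : (dv dl fun i => P i 0) = dv dt fun i => P i 0 := by
      rw [← hYP, (isConvectiveMap_iff hS).1 hc, funext hPX]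
    obtain ⟨P', w', hP', h0, hw⟩ := exists_frame_of_convective c hκ hdet hP h1
    refine ⟨_, _, lift P' w' hP' fun i => (h0 i).trans (hPX i), fun q hq a => ?_⟩
    rw [deriv_snd_out _ ⟨q, hq⟩, deriv_fst_out _ ⟨q, hq⟩]
    exact congrArg (ev ⟨q, hq⟩) (congrFun hw a)
  · obtain ⟨P', w', hR⟩ := hF.exists_represents hS
    rw [isMKdVMap_iff hR ((isParallelFrame_iff hG hX' hR).1 hF) hκ, isHigherMap_iff hR]
    have h1 : subst w' (h.p 0) = (1 / 2 : ℝ) • gdot κ w' w' := by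
      rw [H.first_potential, map_smul, dot_eq_gdot, map_gdot, subst_comp_jet_zero]
    have h2 : subst w' ∘ h.e 0 = dv dl w' := by
      rw [H.first, ← subst_comp_jet_zero w', dv_subst, subst_comp_jet_zero]
      ext1 a; simp [dv, jet, totalD]
    rw [h1, h2]
  · obtain ⟨P', w', hR⟩ := hF.exists_represents hS
    have hP' := (isParallelFrame_iff hG hX' hR).1 hF
    obtain ⟨P₂, w₂, hP₂, h0, hk₂, hw⟩ := exists_frame_of_higher H c hκ hdet hP'
      (by rw [funext hR.tangent]; exact hT') k ((isHigherMap_iff hR h k).1 hk)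
    have h0' : ∀ i, P₂ i 0 = fieldX hS i := fun i => (h0 i).trans (hR.tangent i)
    refine ⟨_, _, lift P₂ w₂ hP₂ h0', (isHigherMap_iff (represents_out h0') h k).2 hk₂,
      fun q hq a => ?_⟩
    rw [deriv_fst_out _ ⟨q, hq⟩]
    refine (map_neg _ _).symm.trans ((congrArg (ev ⟨q, hq⟩) (congrFun hw a)).trans ?_)
    exact (evalJet_eq (fun a q => out_eq (w₂ a) q) (h.e (k + 1) a) ⟨q, hq⟩).symm
  · have h1 : (dv dt fun i => P i 0) = 0 := by
      rw [funext hPX]; exact (isWaveMap_iff hS).1 hw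
    obtain ⟨P', w', hP', h0, hw⟩ := exists_frame_of_wave c hκ hdet hP hYP h1
    refine ⟨_, _, lift P' w' hP' fun i => (h0 i).trans (hPX i), fun q hq a => ?_⟩
    rw [deriv_fst_out _ ⟨q, hq⟩]
    refine (congrArg (ev ⟨q, hq⟩) (congrFun hw a)).trans ?_
    simp

/-- Every statement along an empty surface holds. -/
theorem realizesHierarchy_empty {n : ℕ} (S : FlowComponent n) (κ : Matrix (Fin m) (Fin m) ℝ)
    (h : HierarchyData m) : S.RealizesHierarchy ∅ κ h := by
  have hF : S.IsParallelFrame (∅ : Set (ℝ × ℝ)) κ 0 0 := by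
    constructor <;> simp
  refine ⟨⟨_, _, hF⟩, fun F v _ => ⟨0, 0, 0, 0, ?_, ?_⟩, fun _ => ⟨_, _, hF, by simp⟩,
    fun F v _ => ?_, fun k F v _ _ => ⟨_, _, hF, ?_, by simp⟩, fun _ => ⟨_, _, hF, by simp⟩⟩
  · constructor <;> simp
  all_goals simp [IsWaveMap, IsMKdVMap, IsHigherMap]

theorem IsFlat.realizesHierarchy (hS : S.IsFlat G (rect τ₀ τ₁ l₀ l₁)) (hG : G.IsSymm)
    (hκ : κ.IsSymm) (hdet : κ.det ≠ 0) {P₀ : Matrix (Fin (m + 1)) (Fin (m + 1)) ℝ}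
    (hP₀ : P₀.transpose * G * P₀ = blockOne κ)
    {h : HierarchyData m} (H : IsBiHamiltonianHierarchy κ h)
    (hX : S.NonStretching (rect τ₀ τ₁ l₀ l₁)) (hT : S.TorsionFree (rect τ₀ τ₁ l₀ l₁)) :
    S.RealizesHierarchy (rect τ₀ τ₁ l₀ l₁) κ h := by
  obtain hQ | ⟨c, hc⟩ := (rect τ₀ τ₁ l₀ l₁).eq_empty_or_nonempty
  · rw [hQ]; exact realizesHierarchy_empty S κ h
  · exact IsFlat.realizesHierarchy_of_nonempty ⟨c, hc⟩ hS hG hκ hdet hP₀ H hX hT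

end Realizes

end FlowComponent

end

section

open smoothFun TopologicalSpace

/-! ### Reconstruction of a frame from a solution of the hierarchy -/

section Reconstruction

variable {m : ℕ} {τ₀ τ₁ l₀ l₁ : ℝ} {G : Matrix (Fin (m + 1)) (Fin (m + 1)) ℝ}
  {κ : Matrix (Fin m) (Fin m) ℝ}

theorem eq_zero_of_eq_frameConn {R : Type*} [CommRing R] [Algebra ℝ R] (κ : Matrix (Fin m) (Fin m) ℝ)
    {K : Matrix (Fin (m + 1)) (Fin (m + 1)) R}
    (hK : K = frameConn κ (fun a => K a.succ 0) (K.submatrix Fin.succ Fin.succ))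
    (h0 : ∀ a : Fin m, K a.succ 0 = 0) (h1 : ∀ a b : Fin m, K a.succ b.succ = 0) : K = 0 := by
  rw [hK]
  apply matrix_ext_succ
  · rfl
  · intro b; simp [h0, Matrix.mulVec, dotProduct]
  · exact h0
  · exact h1

/-- The zero curvature equation of a solution. -/
theorem zero_curvature {R : Type*} [CommRing R] [Algebra ℝ R] {d e : Derivation ℝ R R}
    (hκ : κ.IsSymm) {v ϖ : Fin m → R} {W : Matrix (Fin m) (Fin m) R} (hW : W.transpose = -W)
    (hWd : dmat d W = gwedge v ϖ) (hv : -dv e v = dv d ϖ + gint κ v W) :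
    dmat e (frameConn κ v 0) + frameConn κ (-ϖ) (-(W * κ.map (algebraMap ℝ R))) * frameConn κ v 0 =
      dmat d (frameConn κ (-ϖ) (-(W * κ.map (algebraMap ℝ R)))) +
        frameConn κ v 0 * frameConn κ (-ϖ) (-(W * κ.map (algebraMap ℝ R))) := by
  obtain ⟨K, hK⟩ : ∃ K, K = κ.map (algebraMap ℝ R) := ⟨_, rfl⟩
  have hKt : K.transpose = K := hK ▸ map_transpose_eq hκ
  obtain ⟨U, hU⟩ : ∃ U, U = frameConn κ v 0 := ⟨_, rfl⟩
  obtain ⟨T, hT⟩ : ∃ T, T = frameConn κ (-ϖ) (-(W * K)) := ⟨_, rfl⟩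
  have hUs : blockOne K * U + U.transpose * blockOne K = 0 := by
    rw [hU, hK]; exact blockOne_mul_frameConn v 0 hκ (by simp)
  have hTs : blockOne K * T + T.transpose * blockOne K = 0 := by
    rw [hT, hK]
    refine blockOne_mul_frameConn _ _ hκ ?_
    rw [← hK, Matrix.transpose_neg, Matrix.transpose_mul, hW, hKt]
    simp [Matrix.mul_assoc]
  have hdiff : ∀ (δ : Derivation ℝ R R) {A : Matrix (Fin (m + 1)) (Fin (m + 1)) R},
      blockOne K * A + A.transpose * blockOne K = 0 →
      blockOne K * dmat δ A + (dmat δ A).transpose * blockOne K = 0 := fun δ A h => by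
    have h1 := congrArg (dmat δ) h
    rw [dmat_add, dmat_mul, dmat_mul, hK, ← blockOne_map, dmat_algebraMap, dmat_transpose,
      dmat_zero] at h1
    rw [hK, ← blockOne_map]
    simpa using h1
  -- The curvature defect is skew for diag(1, κ) because U and T are, so only its first column and
  -- its normal block have to be checked. These are the evolution of v and D W = v∧ϖ.
  obtain ⟨Z, hZ⟩ : ∃ Z, Z = (dmat e U - dmat d T) + (T * U - U * T) := ⟨_, rfl⟩
  have hZs : blockOne K * Z + Z.transpose * blockOne K = 0 := by
    have h1 := hdiff e hUs
    have h2 := hdiff d hTs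
    have h3 := skew_commutator hTs hUs
    rw [hZ, Matrix.transpose_add, Matrix.transpose_sub, Matrix.mul_add, Matrix.add_mul,
      Matrix.mul_sub, Matrix.sub_mul]
    calc _ = (blockOne K * dmat e U + (dmat e U).transpose * blockOne K) -
          (blockOne K * dmat d T + (dmat d T).transpose * blockOne K) +
          (blockOne K * (T * U - U * T) + (T * U - U * T).transpose * blockOne K) := by abel
      _ = 0 := by rw [h1, h2, h3]; simp
  have hint : gint κ v W = -(W.mulVec (K.mulVec v)) := by
    rw [gint, ← hK, ← Matrix.mulVec_transpose, hW, ← Matrix.mulVec_transpose, hKt, Matrix.neg_mulVec]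
  have hZ0 : Z = 0 := by
    refine eq_zero_of_eq_frameConn κ (eq_frameConn_of_skew hκ (hK ▸ hZs)) (fun a => ?_) fun a b => ?_
    · have h1 := congrFun hv a
      rw [hint] at h1
      simp only [Pi.neg_apply, Pi.add_apply, dv] at h1
      have h2 : (T * U) a.succ 0 = -(W.mulVec (K.mulVec v)) a := by
        rw [Matrix.mulVec_mulVec]
        simp [hT, hU, Matrix.mul_apply, Fin.sum_univ_succ, Matrix.mulVec, dotProduct]
      have h3 : (U * T) a.succ 0 = 0 := by
        simp [hT, hU, Matrix.mul_apply, Fin.sum_univ_succ]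
      have h4 : dmat e U a.succ 0 = e (v a) := by simp [dmat, hU]
      have h5 : dmat d T a.succ 0 = -d (ϖ a) := by simp [dmat, hT]
      rw [hZ, Matrix.add_apply, Matrix.sub_apply, Matrix.sub_apply, h2, h3, h4, h5]
      linear_combination -h1
    · have h1 : dmat d (W * K) a b = v a * K.mulVec ϖ b - ϖ a * K.mulVec v b := by
        rw [hK, dmat_mul, dmat_algebraMap, Matrix.mul_zero, add_zero, hWd, gwedge, Matrix.sub_mul,
          ← hK, Matrix.vecMulVec_mul, Matrix.vecMulVec_mul, ← Matrix.mulVec_transpose,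
          ← Matrix.mulVec_transpose, hKt]
        rfl
      have h2 : (T * U) a.succ b.succ = ϖ a * K.mulVec v b := by
        simp [hT, hU, Matrix.mul_apply, Fin.sum_univ_succ, hK]
      have h3 : (U * T) a.succ b.succ = v a * K.mulVec ϖ b := by
        simp [hT, hU, Matrix.mul_apply, Fin.sum_univ_succ, hK, Matrix.mulVec_neg]
      have h4 : dmat e U a.succ b.succ = 0 := by simp [dmat, hU]
      have h5 : dmat d T a.succ b.succ = -dmat d (W * K) a b := by simp [dmat, hT]
      rw [hZ, Matrix.add_apply, Matrix.sub_apply, Matrix.sub_apply, h2, h3, h4, h5, h1]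
      ring
  rw [← hK, ← hU, ← hT]
  rw [hZ] at hZ0
  rw [← sub_eq_zero, ← hZ0]
  abel

/-- A frame with skew connection coefficients whose Gram matrix is right at one point. -/
theorem gram_of_gram_at (c : rectOpens τ₀ τ₁ l₀ l₁) (hdet : κ.det ≠ 0)
    {P U T : Matrix (Fin (m + 1)) (Fin (m + 1)) (smoothFun (rectOpens τ₀ τ₁ l₀ l₁))}
    {P₀ : Matrix (Fin (m + 1)) (Fin (m + 1)) ℝ} (hP₀ : P₀.transpose * G * P₀ = blockOne κ)
    (hU : blockOne (κ.map (algebraMap ℝ _)) * U + U.transpose * blockOne (κ.map (algebraMap ℝ _)) = 0)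
    (hT : blockOne (κ.map (algebraMap ℝ _)) * T + T.transpose * blockOne (κ.map (algebraMap ℝ _)) = 0)
    (hPl : dmat dl P = P * U) (hPt : dmat dt P = P * T) (hP : P.map (ev c) = P₀) :
    P.transpose * G.map (algebraMap ℝ _) * P = blockOne (κ.map (algebraMap ℝ _)) := by
  obtain ⟨K, hK⟩ : ∃ K : Matrix (Fin (m + 1)) (Fin (m + 1)) (smoothFun (rectOpens τ₀ τ₁ l₀ l₁)),
    K = blockOne (κ.map (algebraMap ℝ _)) := ⟨_, rfl⟩
  obtain ⟨J, hJ⟩ : ∃ J : Matrix (Fin (m + 1)) (Fin (m + 1)) (smoothFun (rectOpens τ₀ τ₁ l₀ l₁)),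
    J = (blockOne κ⁻¹).map (algebraMap ℝ _) := ⟨_, rfl⟩
  have hKJ : K * J = 1 := by rw [hK, hJ, blockOne_map, blockOne_mul, map_mul_map_inv hdet, blockOne_one]
  have hJK : J * K = 1 := mul_eq_one_comm.1 hKJ
  rw [← hK] at hU hT
  -- The inverse Gram expression PJPᵀ is preferred to PᵀGP: its derivative P(AJ + JAᵀ)Pᵀ vanishes
  -- identically by skewness, so no uniqueness theorem for a differential equation is needed.
  have hz : ∀ (δ : Derivation ℝ (smoothFun (rectOpens τ₀ τ₁ l₀ l₁)) _)
      {A : Matrix (Fin (m + 1)) (Fin (m + 1)) (smoothFun (rectOpens τ₀ τ₁ l₀ l₁))},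
      K * A + A.transpose * K = 0 → dmat δ P = P * A → dmat δ (P * J * P.transpose) = 0 := by
    intro δ A hA hPA
    have h1 : A * J + J * A.transpose = 0 := by
      have : J * (K * A + A.transpose * K) * J = A * J + J * A.transpose := by
        rw [Matrix.mul_add, Matrix.add_mul, ← Matrix.mul_assoc, hJK, Matrix.one_mul,
          Matrix.mul_assoc, Matrix.mul_assoc, hKJ, Matrix.mul_one]
      rw [← this, hA]; simp
    have h2 : dmat δ (P * J * P.transpose) = P * (A * J + J * A.transpose) * P.transpose := by
      rw [dmat_mul, dmat_mul, hJ, dmat_algebraMap, dmat_transpose, hPA, Matrix.transpose_mul]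
      simp only [Matrix.mul_add, Matrix.add_mul, Matrix.mul_assoc, Matrix.mul_zero, add_zero]
    rw [h2, h1]; simp
  have hPJ : P * J * P.transpose = (P₀ * blockOne κ⁻¹ * P₀.transpose).map (algebraMap ℝ _) := by
    refine Matrix.ext fun i j => ?_
    have h1 := eq_const c (congrFun (congrFun (hz dl hU hPl) i) j)
      (congrFun (congrFun (hz dt hT hPt) i) j)
    rw [h1, Matrix.map_apply]
    congr 1
    have h2 : (P * J * P.transpose).map (ev c) = P₀ * blockOne κ⁻¹ * P₀.transpose := by
      rw [Matrix.map_mul, Matrix.map_mul, Matrix.transpose_map, hP, hJ, map_map_algebraMap]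
      rfl
    exact congrFun (congrFun h2 i) j
  have hP₀G : P₀ * (blockOne κ⁻¹ * P₀.transpose * G) = 1 := by
    refine mul_eq_one_comm.1 ?_
    rw [Matrix.mul_assoc, Matrix.mul_assoc, ← Matrix.mul_assoc P₀.transpose, hP₀, blockOne_mul,
      Matrix.nonsing_inv_mul _ (isUnit_iff_ne_zero.2 hdet), blockOne_one]
  have h3 : P * (J * P.transpose * G.map (algebraMap ℝ _)) = 1 := by
    rw [← Matrix.mul_assoc, ← Matrix.mul_assoc, hPJ, ← Matrix.map_mul]
    rw [← Matrix.mul_assoc, ← Matrix.mul_assoc] at hP₀G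
    rw [hP₀G]; simp
  have h4 := mul_eq_one_comm.1 h3
  rw [← hK]
  calc _ = K * (J * P.transpose * G.map (algebraMap ℝ _) * P) := by
        simp only [← Matrix.mul_assoc, hKJ, Matrix.one_mul]
    _ = K := by rw [h4, Matrix.mul_one]

/-- Every solution of the hierarchy is carried by a frame and a position vector. -/
theorem exists_frame_of_solution (c : rectOpens τ₀ τ₁ l₀ l₁) (hκ : κ.IsSymm) (hdet : κ.det ≠ 0)
    {P₀ : Matrix (Fin (m + 1)) (Fin (m + 1)) ℝ} (hP₀ : P₀.transpose * G * P₀ = blockOne κ)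
    {h : HierarchyData m} (H : IsBiHamiltonianHierarchy κ h) (k : ℕ)
    {v : Fin m → smoothFun (rectOpens τ₀ τ₁ l₀ l₁)} (hv : -dv dt v = subst v ∘ h.e (k + 1))
    (x₀ : Fin (m + 1) → ℝ) :
    ∃ (P : Matrix (Fin (m + 1)) (Fin (m + 1)) (smoothFun (rectOpens τ₀ τ₁ l₀ l₁)))
      (x : Fin (m + 1) → smoothFun (rectOpens τ₀ τ₁ l₀ l₁)),
      IsAdaptedFrame dl G κ P v ∧ (∀ i, P i 0 = dl (x i)) ∧
      -dv dt x = P.mulVec (Fin.cons (subst v (h.p k)) (subst v ∘ h.e k)) ∧ ev c ∘ x = x₀ := by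
  have hI := H.hierarchy
  have hW : ((h.W (k + 1)).map (subst v)).transpose = -(h.W (k + 1)).map (subst v) := by
    rw [← Matrix.transpose_map, hI.W_skew, map_neg_algHom]
  obtain ⟨P, hPl, hPt, hPc⟩ := exists_compatible_solution c
    (zero_curvature hκ hW (dmat_subst_W hI v (k + 1)) (hv.trans (subst_e hI v (k + 1)))) P₀
  have hgram := gram_of_gram_at (G := G) c hdet hP₀ (blockOne_mul_frameConn _ _ hκ (by simp))
    (blockOne_mul_frameConn _ _ hκ (by
      rw [Matrix.transpose_neg, Matrix.transpose_mul, hW, map_transpose_eq hκ]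
      simp [Matrix.mul_assoc])) hPl hPt hPc
  have hP : IsAdaptedFrame dl G κ P v := ⟨hgram, hPl⟩
  obtain ⟨y, hy⟩ : ∃ y, y = P.mulVec (Fin.cons (subst v (h.p k)) (subst v ∘ h.e k)) := ⟨_, rfl⟩
  -- In the frame, the tangential part p_l - v·e of the derivative vanishes by the choice of the
  -- potential, and the normal part e_l + p v is ϖ^(k+1).
  have hyl : dv dl y = P.mulVec (Fin.cons 0 (subst v ∘ h.ϖ (k + 1))) := by
    rw [hy, dv_mulVec, hPl, ← Matrix.mulVec_mulVec, ← Matrix.mulVec_add]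
    congr 1
    ext1 i
    refine Fin.cases ?_ (fun a => ?_) i
    · have h1 := dl_subst_p hI v k
      rw [gdot_comm _ _ hκ, gdot] at h1
      simp only [Pi.add_apply, dv, Fin.cons_zero, h1]
      simp [Matrix.mulVec, dotProduct, Fin.sum_univ_succ, mul_comm]
    · have h1 := congrFun (subst_ϖ_succ hI v k) a
      simp only [Function.comp_apply, Pi.add_apply, Pi.smul_apply, smul_eq_mul, dv] at h1
      simp [dv, h1, Matrix.mulVec, dotProduct, Fin.sum_univ_succ]
      ring
  have hyt : (dv dt fun i => P i 0) = -dv dl y := by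
    ext1 i
    refine (congrFun (congrFun hPt i) 0).trans ?_
    rw [hyl]
    simp [Matrix.mul_apply, Matrix.mulVec, dotProduct, Fin.sum_univ_succ]
  -- The one-form X dl - y dτ is closed; its primitive with value x₀ at c is the position vector.
  have hpot : ∀ i, ∃ x, dl x = P i 0 ∧ dt x = -y i ∧ ev c x = x₀ i := fun i =>
    exists_potential c (by
      rw [map_neg]; exact congrFun hyt i) (x₀ i)
  choose x hxl hxt hxc using hpot
  refine ⟨P, x, hP, fun i => (hxl i).symm, ?_, funext hxc⟩
  rw [← hy]
  ext1 i
  simp [dv, hxt]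

end Reconstruction

end

section

open smoothFun TopologicalSpace

/-! ### Curve flows in the coordinate domain -/

section Curves

variable {n : ℕ} {Q : Opens (ℝ × ℝ)} {γ : ℝ → ℝ → E n × E n}

/-- A coordinate functional along a smooth surface. -/
def along (hγ : ContDiffOn ℝ ∞ (fun q : ℝ × ℝ => γ q.1 q.2) Q) (ℓ : E n × E n →L[ℝ] ℝ) :
    smoothFun Q :=
  smoothFun.mk Q (fun τ l => ℓ (γ τ l)) (ℓ.contDiff.comp_contDiffOn hγ)

theorem hasDerivAt_snd_of_contDiffOn (hγ : ContDiffOn ℝ ∞ (fun q : ℝ × ℝ => γ q.1 q.2) Q) (q : Q) :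
    HasDerivAt (fun s => γ q.1.1 s) (velL γ q.1.1 q.1.2) q.1.2 := by
  have h1 := ((hγ.contDiffAt (Q.isOpen.mem_nhds q.2)).differentiableAt (by simp)).hasFDerivAt
  have h2 : HasDerivAt (fun s : ℝ => (q.1.1, s)) (0, 1) q.1.2 :=
    (hasDerivAt_const _ _).prodMk (hasDerivAt_id _)
  exact (HasFDerivAt.comp_hasDerivAt (f := fun s : ℝ => (q.1.1, s)) q.1.2 h1
    h2).differentiableAt.hasDerivAt

theorem hasDerivAt_fst_of_contDiffOn (hγ : ContDiffOn ℝ ∞ (fun q : ℝ × ℝ => γ q.1 q.2) Q) (q : Q) :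
    HasDerivAt (fun s => γ s q.1.2) (velT γ q.1.1 q.1.2) q.1.1 := by
  have h1 := ((hγ.contDiffAt (Q.isOpen.mem_nhds q.2)).differentiableAt (by simp)).hasFDerivAt
  have h2 : HasDerivAt (fun s : ℝ => (s, q.1.2)) (1, 0) q.1.1 :=
    (hasDerivAt_id _).prodMk (hasDerivAt_const _ _)
  exact (HasFDerivAt.comp_hasDerivAt (f := fun s : ℝ => (s, q.1.2)) q.1.1 h1
    h2).differentiableAt.hasDerivAt

variable (ℓ : E n × E n →L[ℝ] ℝ) (q : Q)

theorem ev_dl_along (hγ : ContDiffOn ℝ ∞ (fun q : ℝ × ℝ => γ q.1 q.2) Q) :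
    ev q (dl (along hγ ℓ)) = ℓ (velL γ q.1.1 q.1.2) := by
  rw [← deriv_snd_congr (f := fun τ l => ℓ (γ τ l)) (along hγ ℓ) (fun _ => rfl) q]
  exact (ℓ.hasFDerivAt.comp_hasDerivAt q.1.2 (hasDerivAt_snd_of_contDiffOn hγ q)).deriv

theorem ev_dt_along (hγ : ContDiffOn ℝ ∞ (fun q : ℝ × ℝ => γ q.1 q.2) Q) :
    ev q (dt (along hγ ℓ)) = ℓ (velT γ q.1.1 q.1.2) := by
  rw [← deriv_fst_congr (f := fun τ l => ℓ (γ τ l)) (along hγ ℓ) (fun _ => rfl) q]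
  exact (ℓ.hasFDerivAt.comp_hasDerivAt q.1.1 (hasDerivAt_fst_of_contDiffOn hγ q)).deriv

/-- The coordinates `x` and `y`. -/
def coordX (i : Fin n) : E n × E n →L[ℝ] ℝ :=
  (EuclideanSpace.proj i).comp (ContinuousLinearMap.fst ℝ (E n) (E n))

def coordY (i : Fin n) : E n × E n →L[ℝ] ℝ :=
  (EuclideanSpace.proj i).comp (ContinuousLinearMap.snd ℝ (E n) (E n))

@[simp] theorem coordX_apply (i : Fin n) (u : E n × E n) : coordX i u = u.1 i := rfl
@[simp] theorem coordY_apply (i : Fin n) (u : E n × E n) : coordY i u = u.2 i := rfl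

theorem contDiffOn_snd_derivative
    (hγ : ContDiffOn ℝ ∞ (fun q : ℝ × ℝ => γ q.1 q.2) Q) :
    ContDiffOn ℝ ∞ (fun q : ℝ × ℝ => ℓ (velL γ q.1 q.2)) Q :=
  (contDiffOn_out (dl (along hγ ℓ))).congr fun q hq =>
    (ev_dl_along ℓ ⟨q, hq⟩ hγ).symm.trans (out_eq _ ⟨q, hq⟩).symm

theorem contDiffOn_fst_derivative
    (hγ : ContDiffOn ℝ ∞ (fun q : ℝ × ℝ => γ q.1 q.2) Q) :
    ContDiffOn ℝ ∞ (fun q : ℝ × ℝ => ℓ (velT γ q.1 q.2)) Q :=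
  (contDiffOn_out (dt (along hγ ℓ))).congr fun q hq =>
    (ev_dt_along ℓ ⟨q, hq⟩ hγ).symm.trans (out_eq _ ⟨q, hq⟩).symm

variable {N : Fin n → Fin n → E n × E n → ℝ} {g : E n × E n → Matrix (Fin n) (Fin n) ℝ}
  {G : Matrix (Fin n) (Fin n) ℝ} {V : Set (E n × E n)}

theorem isFlat_horizontal
    (hγ : ContDiffOn ℝ ∞ (fun q : ℝ × ℝ => γ q.1 q.2) Q)
    (hV : ∀ q ∈ Q, γ q.1 q.2 ∈ V) (hL : ∀ u ∈ V, ∀ i j k, connL N g i j k u = 0)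
    (hg : ∀ u ∈ V, g u = G) : (horizontal N g γ).IsFlat G Q where
  smooth_X i := contDiffOn_snd_derivative (coordX i) hγ
  smooth_Y i := contDiffOn_fst_derivative (coordX i) hγ
  A_eq q hq := Matrix.ext fun i j => by simp [horizontal, hL _ (hV q hq)]
  B_eq q hq := Matrix.ext fun i j => by simp [horizontal, hL _ (hV q hq)]
  G_eq q hq := hg _ (hV q hq)

theorem isFlat_vertical
    (hγ : ContDiffOn ℝ ∞ (fun q : ℝ × ℝ => γ q.1 q.2) Q)
    (hV : ∀ q ∈ Q, γ q.1 q.2 ∈ V) (hN : ∀ a i, ContDiffOn ℝ ∞ (N a i) V)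
    (hC : ∀ u ∈ V, ∀ i j k, connC g i j k u = 0)
    (hg : ∀ u ∈ V, g u = G) : (vertical N g γ).IsFlat G Q where
  smooth_X a := (contDiffOn_snd_derivative (coordY a) hγ).add <| ContDiffOn.sum fun i _ =>
    ((hN a i).comp hγ hV).mul (contDiffOn_snd_derivative (coordX i) hγ)
  smooth_Y a := (contDiffOn_fst_derivative (coordY a) hγ).add <| ContDiffOn.sum fun i _ =>
    ((hN a i).comp hγ hV).mul (contDiffOn_fst_derivative (coordX i) hγ)
  A_eq q hq := Matrix.ext fun i j => by simp [vertical, hC _ (hV q hq)]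
  B_eq q hq := Matrix.ext fun i j => by simp [vertical, hC _ (hV q hq)]
  G_eq q hq := hg _ (hV q hq)

open FlowComponent in
-- If the components of X and Y are derivatives of linear coordinates along γ, the torsion equation
-- is the equality of mixed partial derivatives.
theorem torsionFree_of_along
    (hγ : ContDiffOn ℝ ∞ (fun q : ℝ × ℝ => γ q.1 q.2) Q)
    {S : FlowComponent n} (hS : S.IsFlat G Q)
    (ℓ : Fin n → E n × E n →L[ℝ] ℝ) (hX : ∀ q ∈ Q, ∀ i, S.X q.1 q.2 i = ℓ i (velL γ q.1 q.2))
    (hY : ∀ q ∈ Q, ∀ i, S.Y q.1 q.2 i = ℓ i (velT γ q.1 q.2)) : S.TorsionFree Q := by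
  have h1 : fieldX hS = fun i => dl (along hγ (ℓ i)) := vec_ext_ev fun q => funext fun i =>
    (hX q q.2 i).trans (ev_dl_along (ℓ i) q hγ).symm
  have h2 : fieldY hS = fun i => dt (along hγ (ℓ i)) := vec_ext_ev fun q => funext fun i =>
    (hY q q.2 i).trans (ev_dt_along (ℓ i) q hγ).symm
  rw [torsionFree_iff hS, h1, h2]
  exact funext fun i => dl_dt _

theorem torsionFree_horizontal
    (hγ : ContDiffOn ℝ ∞ (fun q : ℝ × ℝ => γ q.1 q.2) Q)
    (hS : (horizontal N g γ).IsFlat G Q) :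
    (horizontal N g γ).TorsionFree Q :=
  torsionFree_of_along hγ hS coordX (fun _ _ _ => rfl) fun _ _ _ => rfl

/-- In a fibre the N-connection terms drop out, and the vertical components are the derivatives of
the y-coordinates. -/
theorem torsionFree_vertical
    (hγ : ContDiffOn ℝ ∞ (fun q : ℝ × ℝ => γ q.1 q.2) Q)
    (hS : (vertical N g γ).IsFlat G Q)
    (h : ∀ q ∈ Q, (velL γ q.1 q.2).1 = 0 ∧ (velT γ q.1 q.2).1 = 0) :
    (vertical N g γ).TorsionFree Q :=
  torsionFree_of_along hγ hS coordY (fun q hq i => by simp [vertical, vertPart, (h q hq).1])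
    fun q hq i => by simp [vertical, vertPart, (h q hq).2]

end Curves

end

section

open smoothFun TopologicalSpace

/-! ### Curve flows carrying a given solution -/

namespace FlowComponent

/-- The component with the same velocities in a flat space with the constant metric `G`. -/
def flatten {n : ℕ} (S : FlowComponent n) (G : Matrix (Fin n) (Fin n) ℝ) : FlowComponent n where
  X := S.X
  Y := S.Y
  A _ _ := 0
  B _ _ := 0
  G _ _ := G

variable {n m : ℕ} {S : FlowComponent n} {G : Matrix (Fin n) (Fin n) ℝ} {Q : Set (ℝ × ℝ)}

theorem covL_flatten {τ l : ℝ} (h : S.A τ l = 0) (Z : ℝ → ℝ → Fin n → ℝ) :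
    S.covL Z τ l = (S.flatten G).covL Z τ l := by
  ext1 i; simp [covL, flatten, h]

theorem covT_flatten {τ l : ℝ} (h : S.B τ l = 0) (Z : ℝ → ℝ → Fin n → ℝ) :
    S.covT Z τ l = (S.flatten G).covT Z τ l := by
  ext1 i; simp [covT, flatten, h]

theorem ip_flatten {τ l : ℝ} (h : S.G τ l = G) (z w : Fin n → ℝ) :
    S.ip τ l z w = (S.flatten G).ip τ l z w := by
  simp [ip, flatten, h]

theorem NonStretching.of_flatten (h : (S.flatten G).NonStretching Q)
    (hG : ∀ q ∈ Q, S.G q.1 q.2 = G) : S.NonStretching Q := fun q hq => by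
  rw [ip_flatten (hG q hq)]; exact h q hq

theorem TorsionFree.of_flatten (h : (S.flatten G).TorsionFree Q)
    (hA : ∀ q ∈ Q, S.A q.1 q.2 = 0) (hB : ∀ q ∈ Q, S.B q.1 q.2 = 0) : S.TorsionFree Q :=
  fun q hq => by
    rw [covL_flatten (G := G) (hA q hq), covT_flatten (G := G) (hB q hq)]; exact h q hq

theorem IsParallelFrame.of_flatten {κ : Matrix (Fin m) (Fin m) ℝ}
    {F : ℝ → ℝ → Fin m → Fin n → ℝ} {v : ℝ → ℝ → Fin m → ℝ}
    (h : (S.flatten G).IsParallelFrame Q κ F v)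
    (hA : ∀ q ∈ Q, S.A q.1 q.2 = 0) (hG : ∀ q ∈ Q, S.G q.1 q.2 = G) :
    S.IsParallelFrame Q κ F v where
  smooth_F := h.smooth_F
  smooth_v := h.smooth_v
  normal q hq a := by rw [ip_flatten (hG q hq)]; exact h.normal q hq a
  gram q hq a b := by rw [ip_flatten (hG q hq)]; exact h.gram q hq a b
  principal q hq := by rw [covL_flatten (G := G) (hA q hq)]; exact h.principal q hq
  parallel q hq a := by rw [covL_flatten (G := G) (hA q hq)]; exact h.parallel q hq a

theorem IsParallelFrame.mono {κ : Matrix (Fin m) (Fin m) ℝ} {Q' : Set (ℝ × ℝ)}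
    {F : ℝ → ℝ → Fin m → Fin n → ℝ} {v : ℝ → ℝ → Fin m → ℝ}
    (h : S.IsParallelFrame Q κ F v) (hQ : Q' ⊆ Q) : S.IsParallelFrame Q' κ F v where
  smooth_F a i := (h.smooth_F a i).mono hQ
  smooth_v a := (h.smooth_v a).mono hQ
  normal q hq a := h.normal q (hQ hq) a
  gram q hq a b := h.gram q (hQ hq) a b
  principal q hq := h.principal q (hQ hq)
  parallel q hq a := h.parallel q (hQ hq) a

end FlowComponent

theorem exists_rect_subset {U : Set (ℝ × ℝ)} {q : ℝ × ℝ} (hU : U ∈ nhds q) :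
    ∃ τ₂ τ₃ l₂ l₃, q ∈ rect τ₂ τ₃ l₂ l₃ ∧ rect τ₂ τ₃ l₂ l₃ ⊆ U := by
  obtain ⟨q₁, q₂⟩ := q
  obtain ⟨s, hs, t, ht, hst⟩ := mem_nhds_prod_iff.1 hU
  obtain ⟨a, b, hab, habs⟩ := mem_nhds_iff_exists_Ioo_subset.1 hs
  obtain ⟨a', b', hab', habt⟩ := mem_nhds_iff_exists_Ioo_subset.1 ht
  exact ⟨a, b, a', b', ⟨hab, hab'⟩, (Set.prod_mono habs habt).trans hst⟩

section Carried

variable {m : ℕ} {G : Matrix (Fin (m + 1)) (Fin (m + 1)) ℝ} {κ : Matrix (Fin m) (Fin m) ℝ}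
  {V : Set (E (m + 1) × E (m + 1))}

open FlowComponent in
/-- Solutions are carried by a component whose velocities are those of the position vector `x` of
the surfaces `place u x`. -/
theorem solutionsAreCarried {comp : (ℝ → ℝ → E (m + 1) × E (m + 1)) → FlowComponent (m + 1)}
    (place : E (m + 1) × E (m + 1) → (Fin (m + 1) → ℝ) → E (m + 1) × E (m + 1))
    (coord : E (m + 1) × E (m + 1) → Fin (m + 1) → ℝ)
    (hplace : ∀ u, ContDiff ℝ ∞ (place u)) (hcoord : ∀ u, place u (coord u) = u)
    (hvel : ∀ (Q : Opens (ℝ × ℝ)) (x : Fin (m + 1) → smoothFun Q) (u : E (m + 1) × E (m + 1))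
      (q : Q) (i : Fin (m + 1)),
      (comp fun τ l => place u fun i => out (x i) τ l).X q.1.1 q.1.2 i = ev q (dl (x i)) ∧
      (comp fun τ l => place u fun i => out (x i) τ l).Y q.1.1 q.1.2 i = ev q (dt (x i)))
    (hflat : ∀ γ τ l, γ τ l ∈ V →
      (comp γ).A τ l = 0 ∧ (comp γ).B τ l = 0 ∧ (comp γ).G τ l = G)
    (hV : IsOpen V) (hG : G.IsSymm) (hκ : κ.IsSymm) (hdet : κ.det ≠ 0)
    {P₀ : Matrix (Fin (m + 1)) (Fin (m + 1)) ℝ} (hP₀ : P₀.transpose * G * P₀ = blockOne κ)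
    {h : HierarchyData m} (H : IsBiHamiltonianHierarchy κ h) :
    SolutionsAreCarried comp V κ h := by
  intro k v τ₀ τ₁ l₀ l₁ hv hvt q₀ hq₀ u hu
  obtain ⟨Q, hQ⟩ : ∃ Q, Q = rectOpens τ₀ τ₁ l₀ l₁ := ⟨_, rfl⟩
  have hQr : (Q : Set (ℝ × ℝ)) = rect τ₀ τ₁ l₀ l₁ := by rw [hQ]; rfl
  subst hQ
  obtain ⟨w, hw⟩ : ∃ w : Fin m → smoothFun (rectOpens τ₀ τ₁ l₀ l₁), ∀ (a) (q : rectOpens τ₀ τ₁ l₀ l₁),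
      v q.1.1 q.1.2 a = ev q (w a) :=
    ⟨fun a => smoothFun.mk _ (fun τ l => v τ l a) (hv a), fun a q => rfl⟩
  have hwt : -dv dt w = subst w ∘ h.e (k + 1) := vec_ext_ev fun q => funext fun a => by
    have h1 := hvt q q.2 a
    rw [deriv_fst_congr (f := fun τ l => v τ l a) (w a) (hw a) q, evalJet_eq hw] at h1
    exact (map_neg (ev q) _).trans h1
  obtain ⟨P, x, hP, hPx, hflow, hxc⟩ := exists_frame_of_solution ⟨q₀, hq₀⟩ hκ hdet hP₀ H k hwt
    (coord u)
  obtain ⟨γ, hγ⟩ : ∃ γ : ℝ → ℝ → E (m + 1) × E (m + 1),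
    γ = fun τ l => place u fun i => out (x i) τ l := ⟨_, rfl⟩
  have hvel' := hvel _ x u
  rw [← hγ] at hvel'
  have hγs : ContDiffOn ℝ ∞ (fun q : ℝ × ℝ => γ q.1 q.2) (rect τ₀ τ₁ l₀ l₁) := by
    rw [hγ]
    exact (hplace u).comp_contDiffOn (contDiffOn_pi.2 fun i => contDiffOn_out (x i))
  have hγ₀ : γ q₀.1 q₀.2 = u := by
    refine Eq.trans ?_ (hcoord u)
    rw [hγ]
    exact congrArg (place u) (funext fun i =>
      (out_eq (x i) ⟨q₀, hq₀⟩).trans (congrFun hxc i))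
  -- The position vector is defined on the whole rectangle, but the surface is known to lie in V
  -- only near q₀; this is why the statement is local.
  obtain ⟨τ₂, τ₃, l₂, l₃, hq, hsub⟩ := exists_rect_subset
    ((hγs.continuousOn.isOpen_inter_preimage (rectOpens τ₀ τ₁ l₀ l₁).isOpen hV).mem_nhds
      ⟨hq₀, show γ q₀.1 q₀.2 ∈ V from hγ₀ ▸ hu⟩)
  have hsub₁ : rect τ₂ τ₃ l₂ l₃ ⊆ rect τ₀ τ₁ l₀ l₁ := fun q hq => (hsub hq).1
  have hsub₂ : ∀ q ∈ rect τ₂ τ₃ l₂ l₃, γ q.1 q.2 ∈ V := fun q hq => (hsub hq).2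
  have hA := fun q hq => (hflat γ q.1 q.2 (hsub₂ q hq)).1
  have hB := fun q hq => (hflat γ q.1 q.2 (hsub₂ q hq)).2.1
  have hGG := fun q hq => (hflat γ q.1 q.2 (hsub₂ q hq)).2.2
  -- The component of γ itself is flat only over V. The flat model with the same velocities is
  -- studied on the full rectangle and compared with it on the smaller one.
  have hS : ((comp γ).flatten G).IsFlat G (rectOpens τ₀ τ₁ l₀ l₁) :=
    ⟨fun i => (contDiffOn_out (dl (x i))).congr fun q hq =>
        (hvel' ⟨q, hq⟩ i).1.trans (out_eq _ ⟨q, hq⟩).symm,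
      fun i => (contDiffOn_out (dt (x i))).congr fun q hq =>
        (hvel' ⟨q, hq⟩ i).2.trans (out_eq _ ⟨q, hq⟩).symm,
      fun _ _ => rfl, fun _ _ => rfl, fun _ _ => rfl⟩
  have hX : fieldX hS = dv dl x := vec_ext_ev fun q => funext fun i => (hvel' q i).1
  have hY : fieldY hS = dv dt x := vec_ext_ev fun q => funext fun i => (hvel' q i).2
  have hX1 : gdot G (fieldX hS) (fieldX hS) = 1 := by
    have h1 := congrFun (congrFun hP.gram 0) 0
    rw [Matrix.mul_assoc] at h1
    have h2 : fieldX hS = fun i => P i 0 := hX.trans (funext fun i => (hPx i).symm)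
    rw [h2]
    exact h1
  have hR : Represents hS (fun τ l a i => out (P i a.succ) τ l) v P w :=
    ⟨fun i => by rw [hX]; exact hPx i, fun q a i => out_eq _ q, fun q a => hw a q⟩
  have hT : ((comp γ).flatten G).TorsionFree (rect τ₀ τ₁ l₀ l₁) := by
    refine (torsionFree_iff hS).2 ?_
    rw [hX, hY]
    exact funext fun i => dl_dt _
  have hN : ((comp γ).flatten G).NonStretching (rect τ₀ τ₁ l₀ l₁) := (nonStretching_iff hS).2 hX1
  have hF := (isParallelFrame_iff hG hX1 hR).2 hP
  have hH := (isHigherMap_iff hR h k).2 (by rw [hY]; exact hflow)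
  refine ⟨τ₂, τ₃, l₂, l₃, hq, hsub₁, γ, _, hγs.mono hsub₁, hsub₂, hγ₀,
    TorsionFree.of_flatten (G := G) (fun q hq => hT q (hsub₁ hq)) hA hB,
    NonStretching.of_flatten (G := G) (fun q hq => hN q (hsub₁ hq)) hGG,
    IsParallelFrame.of_flatten (hF.mono hsub₁) hA hGG, fun q hq => hH q (hsub₁ hq)⟩

variable {N : Fin (m + 1) → Fin (m + 1) → E (m + 1) × E (m + 1) → ℝ}
  {g : E (m + 1) × E (m + 1) → Matrix (Fin (m + 1)) (Fin (m + 1)) ℝ}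

theorem contDiff_toLp {n : ℕ} : ContDiff ℝ ∞ (fun x : Fin n → ℝ => (WithLp.toLp 2 x : E n)) :=
  (PiLp.continuousLinearEquiv 2 ℝ fun _ : Fin n => ℝ).symm.contDiff

/-- The position vector serves as the x-coordinates, with y frozen; horizontal components do not
involve N. -/
theorem solutionsAreCarried_horizontal (hL : ∀ u ∈ V, ∀ i j k, connL N g i j k u = 0)
    (hg : ∀ u ∈ V, g u = G)
    (hV : IsOpen V) (hG : G.IsSymm) (hκ : κ.IsSymm) (hdet : κ.det ≠ 0)
    {P₀ : Matrix (Fin (m + 1)) (Fin (m + 1)) ℝ} (hP₀ : P₀.transpose * G * P₀ = blockOne κ)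
    {h : HierarchyData m} (H : IsBiHamiltonianHierarchy κ h) :
    SolutionsAreCarried (horizontal N g) V κ h := by
  have hpl : ∀ u : E (m + 1) × E (m + 1), ContDiff ℝ ∞ fun z : Fin (m + 1) → ℝ =>
    ((WithLp.toLp 2 z : E (m + 1)), u.2) := fun u => contDiff_toLp.prodMk contDiff_const
  refine solutionsAreCarried (fun u z => (WithLp.toLp 2 z, u.2)) (fun u i => u.1 i) hpl
    (fun u => rfl) (fun Q x u q i => ?_) (fun γ τ l hγ => ⟨?_, ?_, hg _ hγ⟩) hV hG hκ hdet hP₀ H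
  · have hγ : ContDiffOn ℝ ∞ (fun q : ℝ × ℝ => ((WithLp.toLp 2 fun i => out (x i) q.1 q.2 :
      E (m + 1)), u.2)) Q :=
      (hpl u).comp_contDiffOn (contDiffOn_pi.2 fun i => contDiffOn_out (x i))
    have h1 : along (γ := fun τ l => ((WithLp.toLp 2 fun i => out (x i) τ l : E (m + 1)), u.2)) hγ
        (coordX i) = x i := ext_ev fun q => out_eq (x i) q
    rw [← h1, ev_dl_along, ev_dt_along]
    exact ⟨rfl, rfl⟩
  · exact Matrix.ext fun i j => by simp [horizontal, hL _ hγ]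
  · exact Matrix.ext fun i j => by simp [horizontal, hL _ hγ]

/-- The position vector serves as the y-coordinates in a fixed fibre, where vertical components are
plain derivatives. -/
theorem solutionsAreCarried_vertical (hC : ∀ u ∈ V, ∀ i j k, connC g i j k u = 0)
    (hg : ∀ u ∈ V, g u = G)
    (hV : IsOpen V) (hG : G.IsSymm) (hκ : κ.IsSymm) (hdet : κ.det ≠ 0)
    {P₀ : Matrix (Fin (m + 1)) (Fin (m + 1)) ℝ} (hP₀ : P₀.transpose * G * P₀ = blockOne κ)
    {h : HierarchyData m} (H : IsBiHamiltonianHierarchy κ h) :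
    SolutionsAreCarried (vertical N g) V κ h := by
  have hpl : ∀ u : E (m + 1) × E (m + 1), ContDiff ℝ ∞ fun z : Fin (m + 1) → ℝ =>
    (u.1, (WithLp.toLp 2 z : E (m + 1))) := fun u => contDiff_const.prodMk contDiff_toLp
  refine solutionsAreCarried (fun u z => (u.1, WithLp.toLp 2 z)) (fun u i => u.2 i) hpl
    (fun u => rfl) (fun Q x u q i => ?_) (fun γ τ l hγ => ⟨?_, ?_, hg _ hγ⟩) hV hG hκ hdet hP₀ H
  · obtain ⟨γ, hγd⟩ : ∃ γ : ℝ → ℝ → E (m + 1) × E (m + 1),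
      γ = fun τ l => (u.1, (WithLp.toLp 2 fun i => out (x i) τ l)) := ⟨_, rfl⟩
    have hγ : ContDiffOn ℝ ∞ (fun q : ℝ × ℝ => γ q.1 q.2) Q := by
      rw [hγd]
      exact (hpl u).comp_contDiffOn (contDiffOn_pi.2 fun i => contDiffOn_out (x i))
    have h1 : ∀ i, along hγ (coordY i) = x i := fun i => ext_ev fun q => by
      subst hγd; exact out_eq (x i) q
    have h2 : ∀ j, along hγ (coordX j) = algebraMap ℝ _ (u.1 j) := fun j => ext_ev fun q => by
      subst hγd; rfl
    have h3 : ∀ j, (velL γ q.1.1 q.1.2).1 j = 0 := fun j => by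
      rw [← coordX_apply, ← ev_dl_along (coordX j) q hγ, h2]; simp
    have h4 : ∀ j, (velT γ q.1.1 q.1.2).1 j = 0 := fun j => by
      rw [← coordX_apply, ← ev_dt_along (coordX j) q hγ, h2]; simp
    rw [← hγd, ← h1, ev_dl_along, ev_dt_along]
    simp [vertical, vertPart, h3, h4]
  · exact Matrix.ext fun i j => by simp [vertical, hC _ hγ]
  · exact Matrix.ext fun i j => by simp [vertical, hC _ hγ]

end Carried

end

section

/-! ### The canonical d-connection of a constant metric -/

section ConstantMetric

variable {n : ℕ} {V : Set (E n × E n)} {u : E n × E n}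

theorem fderiv_eq_zero_of_eq_const (hV : IsOpen V) {f : E n × E n → ℝ} {c : ℝ}
    (hf : ∀ w ∈ V, f w = c) (hu : u ∈ V) : fderiv ℝ f u = 0 := by
  have h1 : f =ᶠ[nhds u] fun _ => c := Filter.eventually_of_mem (hV.mem_nhds hu) hf
  rw [h1.fderiv_eq]
  exact fderiv_const_apply c

theorem dx_eq_zero (hV : IsOpen V) {f : E n × E n → ℝ} {c : ℝ} (hf : ∀ w ∈ V, f w = c)
    (hu : u ∈ V) (i : Fin n) : dx f i u = 0 := by
  rw [dx, fderiv_eq_zero_of_eq_const hV hf hu]; rfl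

theorem dy_eq_zero (hV : IsOpen V) {f : E n × E n → ℝ} {c : ℝ} (hf : ∀ w ∈ V, f w = c)
    (hu : u ∈ V) (i : Fin n) : dy f i u = 0 := by
  rw [dy, fderiv_eq_zero_of_eq_const hV hf hu]; rfl

theorem elong_eq_zero (N : Fin n → Fin n → E n × E n → ℝ) (hV : IsOpen V) {f : E n × E n → ℝ}
    {c : ℝ} (hf : ∀ w ∈ V, f w = c) (hu : u ∈ V) (i : Fin n) : elong N i f u = 0 := by
  simp [elong, dx_eq_zero hV hf hu, dy_eq_zero hV hf hu]

variable {g : E n × E n → Matrix (Fin n) (Fin n) ℝ} {G : Matrix (Fin n) (Fin n) ℝ}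

theorem connL_eq_zero (N : Fin n → Fin n → E n × E n → ℝ) (hV : IsOpen V)
    (hg : ∀ w ∈ V, g w = G) : ∀ u ∈ V, ∀ i j k, connL N g i j k u = 0 := by
  intro u hu i j k
  have h : ∀ k i j, elong N k (fun w => g w i j) u = 0 := fun k i j =>
    elong_eq_zero N hV (fun w hw => congrFun (congrFun (hg w hw) i) j) hu k
  simp [connL, h]

theorem connC_eq_zero (hV : IsOpen V) (hg : ∀ w ∈ V, g w = G) :
    ∀ u ∈ V, ∀ a b c, connC g a b c u = 0 := by
  intro u hu a b c
  have h : ∀ k i j, dy (fun w => g w i j) k u = 0 := fun k i j =>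
    dy_eq_zero hV (fun w hw => congrFun (congrFun (hg w hw) i) j) hu k
  simp [connC, h]

/-- The connection coefficients vanish on the open set V and not only at u, so their derivatives at
u vanish as well. -/
theorem curvature_eq_zero (N : Fin n → Fin n → E n × E n → ℝ) (hV : IsOpen V)
    (hg : ∀ w ∈ V, g w = G) (hu : u ∈ V) (i j k r : Fin n) :
    curvR N g i j k r u = 0 ∧ curvP N g i j k r u = 0 ∧ curvS g i j k r u = 0 := by
  have hL := connL_eq_zero N hV hg
  have hC := connC_eq_zero hV hg
  have hLe : ∀ a b c k, elong N k (connL N g a b c) u = 0 := fun a b c k =>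
    elong_eq_zero N hV (fun w hw => hL w hw a b c) hu k
  have hLy : ∀ a b c k, dy (connL N g a b c) k u = 0 := fun a b c k =>
    dy_eq_zero hV (fun w hw => hL w hw a b c) hu k
  have hCe : ∀ a b c k, elong N k (connC g a b c) u = 0 := fun a b c k =>
    elong_eq_zero N hV (fun w hw => hC w hw a b c) hu k
  have hCy : ∀ a b c k, dy (connC g a b c) k u = 0 := fun a b c k =>
    dy_eq_zero hV (fun w hw => hC w hw a b c) hu k
  refine ⟨?_, ?_, ?_⟩
  · simp [curvR, hLe, hL u hu, hC u hu]
  · simp [curvP, hLy, hCe, hL u hu, hC u hu]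
  · simp [curvS, hCy, hC u hu]

theorem IsConstantHessianFrame.deformedMetric_eq {L : E n × E n → ℝ} {s : ℝ}
    {e : E n × E n → Matrix (Fin n) (Fin n) ℝ} (h : IsConstantHessianFrame L s G V e) (hu : u ∈ V) :
    deformedMetric L s e u = G := by
  have h1 := isUnit_iff_ne_zero.2 (h.invertible u hu)
  rw [deformedMetric, h.hessian u hu, Matrix.mul_assoc, Matrix.mul_assoc,
    Matrix.mul_nonsing_inv _ h1, Matrix.mul_one, ← Matrix.mul_assoc, ← Matrix.transpose_mul,
    Matrix.mul_nonsing_inv _ h1, Matrix.transpose_one, Matrix.one_mul]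

end ConstantMetric

/-! ### Smoothness of the Lagrange geometry -/

section Smoothness

variable {n : ℕ} {V : Set (E n × E n)} {L : E n × E n → ℝ}

theorem contDiffOn_fderiv_apply (hV : IsOpen V) {f : E n × E n → ℝ} (hf : ContDiffOn ℝ ∞ f V)
    (w : E n × E n) : ContDiffOn ℝ ∞ (fun u => fderiv ℝ f u w) V :=
  (hf.fderiv_of_isOpen hV (by simp)).clm_apply contDiffOn_const

theorem contDiffOn_dx (hV : IsOpen V) {f : E n × E n → ℝ} (hf : ContDiffOn ℝ ∞ f V) (i : Fin n) :
    ContDiffOn ℝ ∞ (dx f i) V := contDiffOn_fderiv_apply hV hf _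

theorem contDiffOn_dy (hV : IsOpen V) {f : E n × E n → ℝ} (hf : ContDiffOn ℝ ∞ f V) (i : Fin n) :
    ContDiffOn ℝ ∞ (dy f i) V := contDiffOn_fderiv_apply hV hf _

theorem contDiffOn_lagrangeMetric (hV : IsOpen V) (hL : ContDiffOn ℝ ∞ L V) (i j : Fin n) :
    ContDiffOn ℝ ∞ (fun u => lagrangeMetric L u i j) V :=
  contDiffOn_const.mul (contDiffOn_dy hV (contDiffOn_dy hV hL j) i)

theorem lagrangeMetric_isSymm (hV : IsOpen V) (hL : ContDiffOn ℝ ∞ L V) {u : E n × E n}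
    (hu : u ∈ V) : (lagrangeMetric L u).IsSymm := by
  have h1 := hL.contDiffAt (hV.mem_nhds hu)
  have h2 : IsSymmSndFDerivAt ℝ L u := h1.isSymmSndFDerivAt (by
    rw [minSmoothness_of_isRCLikeNormedField]; exact WithTop.coe_le_coe.2 (le_top (a := (2 : ℕ∞))))
  have h3 : DifferentiableAt ℝ (fderiv ℝ L) u :=
    (h1.fderiv_right (m := 1) (by norm_cast)).differentiableAt (by simp)
  have h4 : ∀ w w', fderiv ℝ (fun z => fderiv ℝ L z w) u w' = fderiv ℝ (fderiv ℝ L) u w' w :=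
    fun w w' => by
      rw [fderiv_clm_apply h3 (differentiableAt_const w)]; simp
  refine Matrix.ext fun i j => ?_
  simp only [Matrix.transpose_apply, lagrangeMetric]
  congr 1
  exact (h4 _ _).trans ((h2.eq _ _).trans (h4 _ _).symm)

theorem contDiffOn_det {A : E n × E n → Matrix (Fin n) (Fin n) ℝ}
    (hA : ∀ i j, ContDiffOn ℝ ∞ (fun u => A u i j) V) : ContDiffOn ℝ ∞ (fun u => (A u).det) V := by
  simp only [Matrix.det_apply']
  exact ContDiffOn.sum fun σ _ => contDiffOn_const.mul (contDiffOn_prod fun i _ => hA _ _)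

/-- Cramer's rule: each entry of the inverse is a quotient of determinants. -/
theorem contDiffOn_inv {A : E n × E n → Matrix (Fin n) (Fin n) ℝ}
    (hA : ∀ i j, ContDiffOn ℝ ∞ (fun u => A u i j) V) (hdet : ∀ u ∈ V, (A u).det ≠ 0) (i j : Fin n) :
    ContDiffOn ℝ ∞ (fun u => (A u)⁻¹ i j) V := by
  have h1 : ∀ u, (A u)⁻¹ i j = (A u).det⁻¹ * ((A u).updateRow j (Pi.single i 1)).det := fun u => by
    rw [Matrix.inv_def, Matrix.smul_apply, Matrix.adjugate_apply, Ring.inverse_eq_inv', smul_eq_mul]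
  simp only [h1]
  refine ((contDiffOn_det hA).inv hdet).mul (contDiffOn_det fun r c => ?_)
  by_cases h : r = j
  · subst h; simp only [Matrix.updateRow_self]; exact contDiffOn_const
  · simp only [Matrix.updateRow_ne h]; exact hA r c

theorem contDiffOn_nConnection (hV : IsOpen V) (hL : ContDiffOn ℝ ∞ L V)
    (hdet : ∀ u ∈ V, (lagrangeMetric L u).det ≠ 0) (a i : Fin n) :
    ContDiffOn ℝ ∞ (nConnection L a i) V := by
  refine contDiffOn_dy hV ?_ i
  refine contDiffOn_const.mul (ContDiffOn.sum fun j _ => ?_)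
  refine (contDiffOn_inv (contDiffOn_lagrangeMetric hV hL) hdet a j).mul (ContDiffOn.sub ?_
    (contDiffOn_dx hV hL j))
  refine ContDiffOn.sum fun k _ => (contDiffOn_dx hV (contDiffOn_dy hV hL j) k).mul ?_
  exact ((EuclideanSpace.proj (𝕜 := ℝ) k).comp
    (ContinuousLinearMap.snd ℝ (E n) (E n))).contDiff.contDiffOn

end Smoothness

end

section

/-! ### Frames in which the Hessian is constant -/

/-- Elements near `1` have smooth square roots, which are fixed by an anti-endomorphism if the
element is. -/
theorem exists_smooth_sqrt {𝔸 : Type*} [NormedRing 𝔸] [NormedAlgebra ℝ 𝔸] [CompleteSpace 𝔸]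
    [FiniteDimensional ℝ 𝔸] {σ : 𝔸 → 𝔸} (hadd : ∀ x y, σ (x + y) = σ x + σ y)
    (hsmul : ∀ (c : ℝ) (x), σ (c • x) = c • σ x) (hσ₁ : σ 1 = 1) (hσ : ∀ x y, σ (x * y) = σ y * σ x) :
    ∃ (W : Set 𝔸) (R : 𝔸 → 𝔸), IsOpen W ∧ 1 ∈ W ∧ ContDiffOn ℝ ∞ R W ∧
      ∀ b ∈ W, R b * R b = b ∧ (σ b = b → σ (R b) = R b) := by
  have hσc : Continuous σ := LinearMap.continuous_of_finiteDimensional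
    ({ toFun := σ, map_add' := hadd, map_smul' := hsmul } : 𝔸 →ₗ[ℝ] 𝔸)
  obtain ⟨T, hT⟩ : ∃ T : 𝔸 ≃L[ℝ] 𝔸, ∀ x, T x = (2 : ℝ) • x :=
    ⟨ContinuousLinearEquiv.smulLeft (Units.mk0 (2 : ℝ) two_ne_zero), fun _ => rfl⟩
  -- Squaring has the invertible derivative 2 at 1, so the inverse function theorem applies. Class ω
  -- is used because analyticity at a point persists on a neighbourhood, whereas class ∞ at a point
  -- provides no common neighbourhood for all orders.
  have hc : ContDiffAt ℝ ω (fun x : 𝔸 => x * x) 1 := (contDiff_id.mul contDiff_id).contDiffAt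
  have hd : HasFDerivAt (fun x : 𝔸 => x * x)
      (T : 𝔸 →L[ℝ] 𝔸) 1 := by
    refine ((hasFDerivAt_id (𝕜 := ℝ) (1 : 𝔸)).mul' (hasFDerivAt_id (𝕜 := ℝ) (1 : 𝔸))).congr_fderiv ?_
    ext x
    simp [two_smul, hT]
  obtain ⟨ψ, hψ⟩ : ∃ ψ, ψ = hc.toOpenPartialHomeomorph _ hd (by simp) := ⟨_, rfl⟩
  have hψx : ∀ x, ψ x = x * x := fun x => by rw [hψ]; rfl
  have h1s : (1 : 𝔸) ∈ ψ.source := by rw [hψ]; exact hc.mem_toOpenPartialHomeomorph_source hd _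
  have h1 : ψ 1 = 1 := by rw [hψx, mul_one]
  have h1t : (1 : 𝔸) ∈ ψ.target := h1 ▸ ψ.map_source h1s
  have hR1 : ψ.symm 1 = 1 := by conv_lhs => rw [← h1, ψ.left_inv h1s]
  have hRc : ContDiffAt ℝ ω ψ.symm 1 := by
    refine ψ.contDiffAt_symm h1t (f₀' := T) ?_ ?_
    · rw [hR1, hψ]; exact hd
    · rw [hR1, hψ]; exact hc
  have h2 : ∀ᶠ b in nhds (1 : 𝔸), σ (ψ.symm b) ∈ ψ.source := by
    have : ContinuousAt (fun b => σ (ψ.symm b)) 1 := hσc.continuousAt.comp hRc.continuousAt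
    refine this.eventually_mem (ψ.open_source.mem_nhds ?_)
    rw [hR1, hσ₁]; exact h1s
  obtain ⟨W, hW, hWo, hW1⟩ := eventually_nhds_iff.1
    ((hRc.eventually (by simp)).and (h2.and (ψ.open_target.mem_nhds h1t)))
  refine ⟨W, ψ.symm, hWo, hW1, fun b hb => ((hW b hb).1.of_le (by simp)).contDiffWithinAt,
    fun b hb => ?_⟩
  have hb2 : ψ.symm b * ψ.symm b = b := by rw [← hψx]; exact ψ.right_inv (hW b hb).2.2
  -- Both R(b) and its image under σ lie in the domain where squaring is injective, and both have
  -- the square b.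
  refine ⟨hb2, fun hσb => ψ.injOn (hW b hb).2.1 (ψ.map_target (hW b hb).2.2) ?_⟩
  rw [hψx, hψx, ← hσ, hb2, hσb]

section Frames

variable {n : ℕ} {V : Set (E n × E n)}

open scoped Matrix.Norms.Operator in
theorem exists_smooth_matrix_sqrt (hV : IsOpen V) {B : E n × E n → Matrix (Fin n) (Fin n) ℝ}
    (hB : ∀ i j, ContDiffOn ℝ ∞ (fun w => B w i j) V) {u : E n × E n} (hu : u ∈ V) (hu₁ : B u = 1)
    {σ : Matrix (Fin n) (Fin n) ℝ → Matrix (Fin n) (Fin n) ℝ}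
    (hadd : ∀ x y, σ (x + y) = σ x + σ y) (hsmul : ∀ (c : ℝ) (x), σ (c • x) = c • σ x)
    (hσ₁ : σ 1 = 1) (hσ : ∀ x y, σ (x * y) = σ y * σ x) :
    ∃ (V' : Set (E n × E n)) (R : E n × E n → Matrix (Fin n) (Fin n) ℝ), IsOpen V' ∧ u ∈ V' ∧
      V' ⊆ V ∧ (∀ i j, ContDiffOn ℝ ∞ (fun w => R w i j) V') ∧
      ∀ w ∈ V', R w * R w = B w ∧ (σ (B w) = B w → σ (R w) = R w) := by
  obtain ⟨W, R, hWo, hW1, hR, hRW⟩ := exists_smooth_sqrt hadd hsmul hσ₁ hσ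
  have hB' : ContDiffOn ℝ ∞ B V := by
    have h1 : B = fun w => ∑ i, ∑ j, B w i j • Matrix.single i j (1 : ℝ) := funext fun w => by
      conv_lhs => rw [Matrix.matrix_eq_sum_single (B w)]
      simp
    rw [h1]
    exact ContDiffOn.sum fun i _ => ContDiffOn.sum fun j _ => (hB i j).smul contDiffOn_const
  refine ⟨V ∩ B ⁻¹' W, fun w => R (B w), hB'.continuousOn.isOpen_inter_preimage hV hWo,
    ⟨hu, show B u ∈ W by rw [hu₁]; exact hW1⟩, Set.inter_subset_left, fun i j => ?_, fun w hw => hRW _ hw.2⟩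
  have h1 : ContDiffOn ℝ ∞ (fun w => R (B w)) (V ∩ B ⁻¹' W) :=
    hR.comp (hB'.mono Set.inter_subset_left) fun w hw => hw.2
  exact (LinearMap.toContinuousLinearMap (Matrix.entryLinearMap ℝ ℝ i j)).contDiff.comp_contDiffOn h1

/-- The matrix S(u)⁻¹S(w) is 1 at w = u and self-adjoint for the form S(u). Its square root R near 1
is self-adjoint too, whence RᵀS(u)R = S(u)R² = S(w). No signature or diagonalisation enters. -/
theorem exists_congruence (hV : IsOpen V) {S : E n × E n → Matrix (Fin n) (Fin n) ℝ}
    (hS : ∀ i j, ContDiffOn ℝ ∞ (fun w => S w i j) V) (hsymm : ∀ w ∈ V, (S w).IsSymm)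
    {u : E n × E n} (hu : u ∈ V) (hdet : (S u).det ≠ 0) :
    ∃ (V' : Set (E n × E n)) (R : E n × E n → Matrix (Fin n) (Fin n) ℝ), IsOpen V' ∧ u ∈ V' ∧
      V' ⊆ V ∧ (∀ i j, ContDiffOn ℝ ∞ (fun w => R w i j) V') ∧
      ∀ w ∈ V', (R w).transpose * S u * R w = S w := by
  have hU : IsUnit (S u).det := isUnit_iff_ne_zero.2 hdet
  obtain ⟨V', R, hV', hu', hsub, hR, hRW⟩ := exists_smooth_matrix_sqrt hV
    (B := fun w => (S u)⁻¹ * S w) (σ := fun x => (S u)⁻¹ * x.transpose * S u)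
    (fun i j => by
      simp only [Matrix.mul_apply]
      exact ContDiffOn.sum fun k _ => contDiffOn_const.mul (hS k j))
    hu (Matrix.nonsing_inv_mul _ hU)
    (fun x y => by rw [Matrix.transpose_add, Matrix.mul_add, Matrix.add_mul])
    (fun c x => by simp)
    (by rw [Matrix.transpose_one, Matrix.mul_one, Matrix.nonsing_inv_mul _ hU])
    (fun x y => by
      rw [Matrix.transpose_mul]
      simp only [Matrix.mul_assoc]
      rw [Matrix.mul_nonsing_inv_cancel_left _ _ hU])
  refine ⟨V', R, hV', hu', hsub, hR, fun w hw => ?_⟩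
  obtain ⟨h1, h2⟩ := hRW w hw
  have h3 := h2 (by
    rw [Matrix.transpose_mul, Matrix.transpose_nonsing_inv, (hsymm u hu).eq,
      (hsymm w (hsub hw)).eq, Matrix.mul_assoc, Matrix.mul_assoc, Matrix.nonsing_inv_mul _ hU,
      Matrix.mul_one])
  have h4 := congrArg (S u * ·) h3
  simp only [Matrix.mul_assoc, Matrix.mul_nonsing_inv_cancel_left _ _ hU] at h4
  rw [h4, Matrix.mul_assoc, h1, Matrix.mul_nonsing_inv_cancel_left _ _ hU]

end Frames

/-- If R carries the Hessian at u to the Hessian nearby, then A R is the required frame. -/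
theorem exists_isConstantHessianFrame {n : ℕ} {V : Set (E n × E n)} {L : E n × E n → ℝ}
    (hV : IsOpen V) (hL : ContDiffOn ℝ ∞ L V) (hreg : ∀ u ∈ V, (lagrangeMetric L u).det ≠ 0)
    {u : E n × E n} (hu : u ∈ V) {s : ℝ} (hs : s = 1 ∨ s = -1) {g₀ A : Matrix (Fin n) (Fin n) ℝ}
    (hA : A.det ≠ 0) (h : s • lagrangeMetric L u = A.transpose * g₀ * A) :
    ∃ V' : Set (E n × E n), IsOpen V' ∧ u ∈ V' ∧ V' ⊆ V ∧ ∃ e, IsConstantHessianFrame L s g₀ V' e := by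
  have hs0 : s ≠ 0 := by rcases hs with rfl | rfl <;> norm_num
  have hdet : ∀ w ∈ V, (s • lagrangeMetric L w).det ≠ 0 := fun w hw => by
    rw [Matrix.det_smul]; exact mul_ne_zero (pow_ne_zero _ hs0) (hreg w hw)
  have hsymm : ∀ w ∈ V, (s • lagrangeMetric L w).IsSymm := fun w hw =>
    (lagrangeMetric_isSymm hV hL hw).smul s
  obtain ⟨V', R, hV', hu', hsub, hR, hRS⟩ := exists_congruence hV (S := fun w => s • lagrangeMetric L w)
    (fun i j => contDiffOn_const.mul (contDiffOn_lagrangeMetric hV hL i j)) hsymm hu (hdet u hu)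
  have hAu : IsUnit A.det := isUnit_iff_ne_zero.2 hA
  have hAt : IsUnit A.transpose.det := by rwa [Matrix.det_transpose]
  have hess : ∀ w ∈ V', s • lagrangeMetric L w = (A * R w).transpose * g₀ * (A * R w) :=
    fun w hw => by
      have h1 := hRS w hw
      simp only [h] at h1
      rw [← h1, Matrix.transpose_mul]
      simp only [Matrix.mul_assoc]
  refine ⟨V', hV', hu', hsub, fun w => A * R w, hs, ?_, fun h0 => ?_, fun a i => ?_,
    fun w hw h0 => ?_, hess⟩
  -- Symmetry of g₀ is inherited from the Hessian through the invertible A.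
  · have h1 := hsymm u hu
    rw [h] at h1
    have h2 : A.transpose * g₀.transpose * A = A.transpose * g₀ * A := by
      have := h1.eq
      rwa [Matrix.transpose_mul, Matrix.transpose_mul, Matrix.transpose_transpose,
        ← Matrix.mul_assoc] at this
    have h3 := congrArg (fun X => A.transpose⁻¹ * X * A⁻¹) h2
    change g₀.transpose = g₀
    simpa [Matrix.mul_assoc, Matrix.nonsing_inv_mul_cancel_left _ _ hAt,
      Matrix.mul_nonsing_inv _ hAu] using h3
  · refine hdet u hu ?_
    rw [h, Matrix.det_mul, Matrix.det_mul, h0]; simp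
  · simp only [Matrix.mul_apply]
    exact ContDiffOn.sum fun j _ => contDiffOn_const.mul (hR j i)
  · refine hdet w (hsub hw) ?_
    rw [hess w hw, Matrix.det_mul, h0, mul_zero]

end

section

/-! ### The coordinate expression of a regular Lagrangian -/

section Manifold

variable {n : ℕ} {M : Type*} [TopologicalSpace M] [ChartedSpace (E n) M]
  [IsManifold 𝓘(ℝ, E n) ∞ M] {L : TangentBundle 𝓘(ℝ, E n) M → ℝ}
  {φ : OpenPartialHomeomorph M (E n)}

theorem isOpen_slitDomain (φ : OpenPartialHomeomorph M (E n)) : IsOpen (slitDomain φ) :=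
  (φ.open_target.preimage continuous_fst).inter (isOpen_ne_fun continuous_snd continuous_const)

/-- The derivative of the chart is a left inverse. Injectivity keeps nonzero coordinates y off the
zero section, where alone L may fail to be smooth. -/
theorem mfderiv_symm_injective (hφ : φ ∈ IsManifold.maximalAtlas 𝓘(ℝ, E n) ∞ M) {x : E n}
    (hx : x ∈ φ.target) :
    Function.Injective (mfderiv 𝓘(ℝ, E n) 𝓘(ℝ, E n) φ.symm x) := by
  have h1 : MDifferentiableAt 𝓘(ℝ, E n) 𝓘(ℝ, E n) φ.symm x :=
    ((contMDiffOn_symm_of_mem_maximalAtlas hφ).contMDiffAt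
      (φ.open_target.mem_nhds hx)).mdifferentiableAt (by simp)
  have h2 : MDifferentiableAt 𝓘(ℝ, E n) 𝓘(ℝ, E n) φ (φ.symm x) :=
    (contMDiffAt_of_mem_maximalAtlas hφ (φ.map_target hx)).mdifferentiableAt (by simp)
  have h3 : φ ∘ φ.symm =ᶠ[nhds x] id :=
    Filter.eventually_of_mem (φ.open_target.mem_nhds hx) fun y hy => φ.right_inv hy
  have h4 := mfderiv_comp x h2 h1
  rw [h3.mfderiv_eq, mfderiv_id] at h4
  intro y z hyz
  have h5 := fun w => congrArg (fun f : E n →L[ℝ] E n => f w) h4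
  exact (h5 y).trans ((congrArg (mfderiv 𝓘(ℝ, E n) 𝓘(ℝ, E n) φ (φ.symm x)) hyz).trans (h5 z).symm)

/-- The local expression is L composed with the tangent map of the inverse chart, which is smooth
into the tangent bundle and avoids the zero section on the slit domain. -/
theorem contDiffOn_localLagrangian (hL : IsRegularLagrangian L)
    (hφ : φ ∈ IsManifold.maximalAtlas 𝓘(ℝ, E n) ∞ M) :
    ContDiffOn ℝ ∞ (localLagrangian L φ) (slitDomain φ) := by
  have hI : IsManifold 𝓘(ℝ, E n) 1 M := IsManifold.of_le (n := ∞) (by simp)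
  have h1 := (contMDiffOn_symm_of_mem_maximalAtlas hφ).contMDiffOn_tangentMapWithin (m := ∞)
    (by simp) φ.open_target.uniqueMDiffOn
  have h2 := contMDiff_tangentBundleModelSpaceHomeomorph_symm (I := 𝓘(ℝ, E n)) (n := ∞)
  have h3 : ContMDiffOn (𝓘(ℝ, E n).tangent) 𝓘(ℝ, ℝ) ∞ (fun u : ModelProd (E n) (E n) =>
      L (tangentMapWithin 𝓘(ℝ, E n) 𝓘(ℝ, E n) φ.symm φ.target
        ((tangentBundleModelSpaceHomeomorph 𝓘(ℝ, E n)).symm u))) (slitDomain φ) := by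
    refine hL.smooth.comp (h1.comp h2.contMDiffOn fun u hu => hu.1) fun u hu h0 => hu.2 ?_
    have h4 : mfderivWithin 𝓘(ℝ, E n) 𝓘(ℝ, E n) φ.symm φ.target u.1 u.2 = 0 := h0
    rw [mfderivWithin_of_isOpen φ.open_target hu.1] at h4
    exact mfderiv_symm_injective hφ hu.1 (h4.trans (map_zero _).symm)
  have h5 : ContDiffOn ℝ ∞ (fun u : E n × E n =>
      L (tangentMapWithin 𝓘(ℝ, E n) 𝓘(ℝ, E n) φ.symm φ.target
        ((tangentBundleModelSpaceHomeomorph 𝓘(ℝ, E n)).symm u))) (slitDomain φ) := by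
    rw [← contMDiffOn_iff_contDiffOn, modelWithCornersSelf_prod]
    exact h3
  refine h5.congr fun u hu => ?_
  change _ = L ⟨φ.symm u.1, mfderivWithin 𝓘(ℝ, E n) 𝓘(ℝ, E n) φ.symm φ.target u.1 u.2⟩
  rw [mfderivWithin_of_isOpen φ.open_target hu.1]
  rfl

end Manifold

end

end LagrangeFlow

end

theorem mainTheorem9 {m : ℕ} (hm : 1 ≤ m) {M : Type*} [TopologicalSpace M]
    [ChartedSpace (LagrangeFlow.E (m + 1)) M]
    [IsManifold 𝓘(ℝ, LagrangeFlow.E (m + 1)) ∞ M]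
    (L : TangentBundle 𝓘(ℝ, LagrangeFlow.E (m + 1)) M → ℝ)
    (hL : LagrangeFlow.IsRegularLagrangian L)
    (φ : OpenPartialHomeomorph M (LagrangeFlow.E (m + 1)))
    (hφ : φ ∈ IsManifold.maximalAtlas 𝓘(ℝ, LagrangeFlow.E (m + 1)) ∞ M) :
    -- frames with constant Hessian exist near every point
    (∀ u ∈ LagrangeFlow.slitDomain φ, ∀ s : ℝ, (s = 1 ∨ s = -1) →
      ∀ g₀ : Matrix (Fin (m + 1)) (Fin (m + 1)) ℝ,
      (∃ A : Matrix (Fin (m + 1)) (Fin (m + 1)) ℝ, A.det ≠ 0 ∧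
        s • LagrangeFlow.lagrangeMetric (LagrangeFlow.localLagrangian L φ) u =
          A.transpose * g₀ * A) →
      ∃ V : Set (LagrangeFlow.E (m + 1) × LagrangeFlow.E (m + 1)),
        IsOpen V ∧ u ∈ V ∧ V ⊆ LagrangeFlow.slitDomain φ ∧
        ∃ e, LagrangeFlow.IsConstantHessianFrame (LagrangeFlow.localLagrangian L φ) s g₀ V e) ∧
    -- every such frame induces the hierarchy
    (∀ (V : Set (LagrangeFlow.E (m + 1) × LagrangeFlow.E (m + 1))) (s : ℝ)
      (g₀ : Matrix (Fin (m + 1)) (Fin (m + 1)) ℝ)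
      (e : LagrangeFlow.E (m + 1) × LagrangeFlow.E (m + 1) →
        Matrix (Fin (m + 1)) (Fin (m + 1)) ℝ),
      IsOpen V → V ⊆ LagrangeFlow.slitDomain φ →
      LagrangeFlow.IsConstantHessianFrame (LagrangeFlow.localLagrangian L φ) s g₀ V e →
      ∀ (N : Fin (m + 1) → Fin (m + 1) → LagrangeFlow.E (m + 1) × LagrangeFlow.E (m + 1) → ℝ)
        (g : LagrangeFlow.E (m + 1) × LagrangeFlow.E (m + 1) →
          Matrix (Fin (m + 1)) (Fin (m + 1)) ℝ),
      N = LagrangeFlow.nConnection (LagrangeFlow.localLagrangian L φ) →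
      g = LagrangeFlow.deformedMetric (LagrangeFlow.localLagrangian L φ) s e →
      -- the deformed d-metric and the curvature of its canonical d-connection are constant
      (∀ u ∈ V, g u = g₀ ∧ ∀ i j k r, LagrangeFlow.curvR N g i j k r u = 0 ∧
        LagrangeFlow.curvP N g i j k r u = 0 ∧ LagrangeFlow.curvS g i j k r u = 0) ∧
      -- the hierarchies, for every Gram matrix of normal frames to a unit vector
      ∀ (κ : Matrix (Fin m) (Fin m) ℝ) (P : Fin (m + 1) → Fin (m + 1) → ℝ),
      P 0 ⬝ᵥ g₀.mulVec (P 0) = 1 →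
      (∀ a : Fin m, P 0 ⬝ᵥ g₀.mulVec (P a.succ) = 0) →
      (∀ a b : Fin m, P a.succ ⬝ᵥ g₀.mulVec (P b.succ) = κ a b) →
      κ.det ≠ 0 →
      ∃ h : LagrangeFlow.HierarchyData m, LagrangeFlow.IsBiHamiltonianHierarchy κ h ∧
        LagrangeFlow.SolutionsAreCarried (LagrangeFlow.horizontal N g) V κ h ∧
        LagrangeFlow.SolutionsAreCarried (LagrangeFlow.vertical N g) V κ h ∧
        ∀ (γ : ℝ → ℝ → LagrangeFlow.E (m + 1) × LagrangeFlow.E (m + 1)) (τ₀ τ₁ l₀ l₁ : ℝ)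
          (Q : Set (ℝ × ℝ)),
        Q = LagrangeFlow.rect τ₀ τ₁ l₀ l₁ →
        ContDiffOn ℝ ∞ (fun q : ℝ × ℝ => γ q.1 q.2) Q →
        (∀ q ∈ Q, γ q.1 q.2 ∈ V) →
        -- horizontal flows
        ((LagrangeFlow.horizontal N g γ).TorsionFree Q ∧
          ((LagrangeFlow.horizontal N g γ).NonStretching Q →
            (LagrangeFlow.horizontal N g γ).RealizesHierarchy Q κ h)) ∧
        -- vertical flows
        (((∀ q ∈ Q, (LagrangeFlow.velL γ q.1 q.2).1 = 0 ∧
            (LagrangeFlow.velT γ q.1 q.2).1 = 0) →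
          (LagrangeFlow.vertical N g γ).TorsionFree Q) ∧
          ((LagrangeFlow.vertical N g γ).TorsionFree Q →
            (LagrangeFlow.vertical N g γ).NonStretching Q →
            (LagrangeFlow.vertical N g γ).RealizesHierarchy Q κ h))) := by
  have hLs := LagrangeFlow.contDiffOn_localLagrangian hL hφ
  have hreg := hL.regular φ hφ
  have hopen := LagrangeFlow.isOpen_slitDomain φ
  refine ⟨fun u hu s hs g₀ ⟨A, hA, h⟩ =>
    LagrangeFlow.exists_isConstantHessianFrame hopen hLs hreg hu hs hA h, ?_⟩
  rintro V s g₀ e hV hVs he N g rfl rfl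
  have hg : ∀ u ∈ V, LagrangeFlow.deformedMetric (LagrangeFlow.localLagrangian L φ) s e u = g₀ :=
    fun u hu => he.deformedMetric_eq hu
  have hN : ∀ a i, ContDiffOn ℝ ∞
      (LagrangeFlow.nConnection (LagrangeFlow.localLagrangian L φ) a i) V := fun a i =>
    (LagrangeFlow.contDiffOn_nConnection hopen hLs hreg a i).mono hVs
  have hcL := LagrangeFlow.connL_eq_zero
    (LagrangeFlow.nConnection (LagrangeFlow.localLagrangian L φ)) hV hg
  have hcC := LagrangeFlow.connC_eq_zero hV hg
  refine ⟨fun u hu => ⟨hg u hu, fun i j k r =>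
    LagrangeFlow.curvature_eq_zero _ hV hg hu i j k r⟩, fun κ P h00 h01 h11 hdet => ?_⟩
  have hG := he.symm
  have hswap : ∀ x y, x ⬝ᵥ g₀.mulVec y = y ⬝ᵥ g₀.mulVec x := fun x y => by
    rw [Matrix.dotProduct_mulVec, ← Matrix.mulVec_transpose, hG.eq, dotProduct_comm]
  have hκ : κ.IsSymm := Matrix.ext fun a b => by
    rw [Matrix.transpose_apply, ← h11, ← h11, hswap]
  -- The vectors of the given basis are the rows of P, while frame matrices carry their vectors as
  -- columns.
  obtain ⟨P₀, hP₀⟩ : ∃ P₀ : Matrix (Fin (m + 1)) (Fin (m + 1)) ℝ, P₀ = (Matrix.of P).transpose :=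
    ⟨_, rfl⟩
  have hent : ∀ i j, (P₀.transpose * g₀ * P₀) i j = P i ⬝ᵥ g₀.mulVec (P j) := fun i j => by
    rw [Matrix.mul_assoc, hP₀]; rfl
  have hgram : P₀.transpose * g₀ * P₀ = LagrangeFlow.blockOne κ := by
    apply LagrangeFlow.matrix_ext_succ
    · rw [hent]; exact h00
    · intro b; rw [hent]; exact h01 b
    · intro a; rw [hent, hswap]; exact h01 a
    · intro a b; rw [hent]; exact h11 a b
  obtain ⟨Γ⟩ := LagrangeFlow.nonempty_generating hκ
  have H := Γ.isBiHamiltonianHierarchy hdet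
  refine ⟨Γ.data, H,
    LagrangeFlow.solutionsAreCarried_horizontal hcL hg hV hG hκ hdet hgram H,
    LagrangeFlow.solutionsAreCarried_vertical hcC hg hV hG hκ hdet hgram H, ?_⟩
  rintro γ τ₀ τ₁ l₀ l₁ Q rfl hγ hγV
  have hSh := LagrangeFlow.isFlat_horizontal (Q := LagrangeFlow.rectOpens τ₀ τ₁ l₀ l₁)
    hγ hγV hcL hg
  have hSv := LagrangeFlow.isFlat_vertical (Q := LagrangeFlow.rectOpens τ₀ τ₁ l₀ l₁)
    hγ hγV hN hcC hg
  have hT := LagrangeFlow.torsionFree_horizontal (Q := LagrangeFlow.rectOpens τ₀ τ₁ l₀ l₁) hγ hSh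
  exact ⟨⟨hT, fun hX => hSh.realizesHierarchy hG hκ hdet hgram H hX hT⟩,
    LagrangeFlow.torsionFree_vertical (Q := LagrangeFlow.rectOpens τ₀ τ₁ l₀ l₁) hγ hSv,
    fun hT hX => hSv.realizesHierarchy hG hκ hdet hgram H hX hT⟩
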